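/- Let $n\ge 2$, let $\mu>-\big(\tfrac{n-1}2\big)^2$ and set $\alpha:=\big[\big(\tfrac{n-1}2\big)^2+\mu\big]^{1/2}>0$. Let $g$ be a smooth Lorentzian metric on $\mathbb R\times(0,A)\times\mathbb S^{n-2}$ (coordinates $(t,x,\theta)$, $A>0$) that makes it an asymptotically AdS patch, that is, $$g_{tt}=-x^{-2}-1+\mathcal O(x^2),\quad g_{xx}=x^{-2}-1+\mathcal O(x),\quad g_{tx}=\mathcal O(x),$$ $$g_{\theta^i\theta^j}=x^{-2}(g_{\mathbb S^{n-2}})_{ij}+\mathcal O(x),\quad g_{t\theta^i}=\mathcal O(x),\quad g_{x\theta^i}=\mathcal O(x^2),$$ where $g_{\mathbb S^{n-2}}$ is the metric of the unit sphere and $Q=\mathcal O(x^m)$ means that for all $j,k,l$ there is a constant $C_{jkl}$ with $|\partial_t^j\partial_x^kD_\theta^lQ|\le C_{jkl}x^{m-k}$ for $x$ close to $0$, uniformly in $(t,\theta)$. Let $P_g$ be the operator defined by $$\square_g\phi-\mu\phi=(-g^{tt})\,x^{\frac{n-1}2}P_gv,\qquad \phi=x^{\frac{n-1}2}v,$$ so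 that the coefficient of $\partial_t^2$ in $P_g$ is $-1$. For $a\in(0,A]$ let $\mathbf L^2:=L^2((0,a)\times\mathbb S^{n-2},x\,dx\,d\theta)$, let $\mathbf D_xv:=\partial_xv+\frac\alpha xv$, let $\mathbf H^1_0$ be the completion of $C^\infty_c((0,a)\times\mathbb S^{n-2})$ in the norm given by the $\mathbf L^2$ norms of $v$, $\mathbf D_xv$ and $\nabla_\theta v$ (this encodes the Dirichlet conditions $x^\alpha v|_{x=0}=v|_{x=a}=0$), and let $$\|v\|_{\mathbf H^1_a}:=\frac{\|v\|_{\mathbf L^2}}a+\|\mathbf D_xv\|_{\mathbf L^2}+\|\nabla_\theta v\|_{\mathbf L^2}.$$ Then there are $a_0\in(0,A]$ and $c>0$, depending only on $n$, $\mu$ and $g$, such that for all $a\in(0,a_0]$, all $T>0$, all $v_0\in\mathbf H^1_0$, $v_1\in\mathbf L^2$ and $F\in L^1((-T,T),\mathbf L^2)$, the Cauchy problem $$P_gv=F\quad\text{in }(-T,T)\times(0,a)\times\mathbb S^{n-2},\qquad v(0)=v_0,\quad\partial_tv(0)=v_1$$ has a unique weak solution $v\in L^2((-T,T),\mathbf H^1_0)\cap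 H^1((-T,T),\mathbf L^2)$. Here a weak solution satisfies $$\int\big(-g^{ij}\partial_i\phi\,\partial_j\psi-\mu\phi\psi\big)\,d\mathrm{vol}_g=\int(-g^{tt})\,x^{\frac{n-1}2}F\psi\,d\mathrm{vol}_g\qquad\text{for all }\psi\in C^\infty_c((-T,T)\times(0,a)\times\mathbb S^{n-2})$$ with $\phi=x^{\frac{n-1}2}v$; $v(0)=v_0$ holds for the continuous representative of $v$ in $\mathbf L^2$, and $\partial_tv(0)=v_1$ means that $t\mapsto\int v(t)\chi\,x\,dx\,d\theta$ has derivative $\int v_1\chi\,x\,dx\,d\theta$ at $t=0$ for all $\chi\in C^\infty_c((0,a)\times\mathbb S^{n-2})$. Moreover, $$\|v\|_{L^\infty_t\mathbf H^1_a}+\|\partial_tv\|_{L^\infty_t\mathbf L^2}\le c\,e^{caT}\Big(\|v_0\|_{\mathbf H^1_a}+\|v_1\|_{\mathbf L^2}+\int_{-T}^T\|F(t)\|_{\mathbf L^2}\,dt\Big).$$ -/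

import Mathlib

open MeasureTheory Set Filter Topology Matrix
open scoped ENNReal ContDiff

noncomputable section

namespace AAdS

/-! ### The sphere `S^(n-2)` and functions on it

The sphere `S^(n-2)` is the unit sphere of `ℝ^(n-1)` with its round metric. A tangent vector (or,
through the round metric, a covector) at `θ` is a vector of `ℝ^(n-1)` that is orthogonal to `θ`. -/

/-- The Euclidean space `ℝ^(n-1)`. -/
abbrev Euc (n : ℕ) : Type := EuclideanSpace ℝ (Fin (n - 1))

/-- The unit sphere `S^(n-2)`. -/
abbrev Sph (n : ℕ) : Type := Metric.sphere (0 : Euc n) 1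

/-- The extension of a function on the sphere that is constant along rays: `y ↦ f (y / |y|)`. -/
def radialExt {n : ℕ} (f : Sph n → ℝ) (y : Euc n) : ℝ :=
  open Classical in
  if h : y = 0 then 0
  else f ⟨‖y‖⁻¹ • y, by
    rw [mem_sphere_zero_iff_norm, norm_smul, norm_inv, norm_norm,
      inv_mul_cancel₀ (norm_ne_zero_iff.mpr h)]⟩

/-- `Q` is smooth on `U × S^(n-2)`. -/
def SmoothOver {n : ℕ} {X : Type} [NormedAddCommGroup X] [NormedSpace ℝ X]
    (U : Set X) (Q : X × Sph n → ℝ) : Prop :=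
  ContDiffOn ℝ ∞ (fun p : X × Euc n => radialExt (fun θ => Q (p.1, θ)) p.2) (U ×ˢ {0}ᶜ)

/-- The gradient `∇_θ Q` on the unit sphere. The Euclidean gradient of an extension constant along
rays is tangent to the sphere, and is the gradient for the round metric. -/
def gradS {n : ℕ} {X : Type} (Q : X × Sph n → ℝ) (p : X × Sph n) : Euc n :=
  gradient (radialExt fun θ => Q (p.1, θ)) (p.2 : Euc n)

/-! ### Functions on the space-time `ℝ × (0, A) × S^(n-2)`, with points written `((t, x), θ)` -/

/-- Space-time points `((t, x), θ)`. -/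
abbrev Pt (n : ℕ) : Type := (ℝ × ℝ) × Sph n

/-- The time derivative `∂_t Q`. -/
def dT {n : ℕ} (Q : Pt n → ℝ) : Pt n → ℝ :=
  fun p => deriv (fun s => Q ((s, p.1.2), p.2)) p.1.1

/-- The derivative `∂_x Q`. -/
def dX {n : ℕ} (Q : Pt n → ℝ) : Pt n → ℝ :=
  fun p => deriv (fun s => Q ((p.1.1, s), p.2)) p.1.2

/-- The derivative of `Q` along the tangent vector field on the sphere which is the tangential
projection of the `i`-th basis vector of `ℝ^(n-1)`. These fields span every tangent space. -/
def dA {n : ℕ} (i : Fin (n - 1)) (Q : Pt n → ℝ) : Pt n → ℝ :=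
  fun p => gradS Q p i

/-- `Q = O(x^m)`: for all `j, k, l`, all derivatives `∂_t^j ∂_x^k D_θ^l Q` are bounded by a multiple
of `x^(m-k)` for `x` close to `0`, uniformly in `t` and `θ`. -/
def IsOx {n : ℕ} (m : ℕ) (Q : Pt n → ℝ) : Prop :=
  ∀ (j k : ℕ) (L : List (Fin (n - 1))), ∃ C : ℝ, ∀ᶠ x in 𝓝[>] (0 : ℝ), ∀ (t : ℝ) (θ : Sph n),
    |(dT^[j] (dX^[k] (L.foldr dA Q))) ((t, x), θ)| ≤ C * x ^ ((m : ℤ) - (k : ℤ))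

/-! ### Asymptotically AdS metrics

A symmetric covariant 2-tensor on `ℝ × (0, A) × S^(n-2)` is written as a symmetric matrix of size
`2 + (n - 1)`: its indices `0, 1` stand for `t, x` and the others for the coordinates of
`ℝ^(n-1)`, and it annihilates the radial vector `θ` of `ℝ^(n-1)`, so that it is just a bilinear
form on `ℝ × ℝ × T_θ S^(n-2)`. For example the round metric of the sphere has the matrix
`δ_ij - θ_i θ_j`. -/

/-- Indices of the components: `t`, `x`, and the coordinates of `ℝ^(n-1)`. -/
abbrev Idx (n : ℕ) : Type := Fin 2 ⊕ Fin (n - 1)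

/-- The index of the variable `t`. -/
abbrev iT (n : ℕ) : Idx n := Sum.inl 0

/-- The index of the variable `x`. -/
abbrev iX (n : ℕ) : Idx n := Sum.inl 1

/-- Fields of 2-tensors on space-time. -/
abbrev TensorField (n : ℕ) : Type := Pt n → Matrix (Idx n) (Idx n) ℝ

/-- The vector `w` of `ℝ × ℝ × ℝ^(n-1)` is tangent to `ℝ × ℝ × S^(n-2)` at a point over `θ`. -/
def IsTangent {n : ℕ} (θ : Sph n) (w : Idx n → ℝ) : Prop :=
  ∑ i, w (Sum.inr i) * (θ : Euc n) i = 0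

/-- `ℝ × (0, A) × S^(n-2)` with the metric `g` is an asymptotically AdS patch of width `A`. -/
structure IsAAdSPatch (n : ℕ) (A : ℝ) (g : TensorField n) : Prop where
  /-- The tensor is symmetric. -/
  symm : ∀ p : Pt n, p.1.2 ∈ Ioo 0 A → (g p).IsSymm
  /-- The tensor has no radial components. -/
  tangential : ∀ p : Pt n, p.1.2 ∈ Ioo 0 A → ∀ i : Idx n,
    ∑ j, g p i (Sum.inr j) * (p.2 : Euc n) j = 0
  /-- The coefficients are smooth. -/
  smooth : ∀ i j : Idx n, SmoothOver {y : ℝ × ℝ | y.2 ∈ Ioo 0 A} fun p => g p i j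
  /-- The metric is Lorentzian: at each point there is a timelike tangent vector, and the metric is
  positive definite on its orthogonal complement. -/
  lorentzian : ∀ p : Pt n, p.1.2 ∈ Ioo 0 A → ∃ e : Idx n → ℝ, IsTangent p.2 e ∧
    e ⬝ᵥ (g p *ᵥ e) < 0 ∧
    ∀ w : Idx n → ℝ, IsTangent p.2 w → e ⬝ᵥ (g p *ᵥ w) = 0 → w ≠ 0 → 0 < w ⬝ᵥ (g p *ᵥ w)
  /-- `g_tt = - x⁻² - 1 + O(x²)`. -/
  asymp_tt : IsOx 2 fun p => g p (iT n) (iT n) + (p.1.2 ^ 2)⁻¹ + 1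
  /-- `g_xx = x⁻² - 1 + O(x)`. -/
  asymp_xx : IsOx 1 fun p => g p (iX n) (iX n) - (p.1.2 ^ 2)⁻¹ + 1
  /-- `g_tx = O(x)`. -/
  asymp_tx : IsOx 1 fun p => g p (iT n) (iX n)
  /-- `g_θθ = x⁻² g_S + O(x)`, where `g_S` is the round metric. -/
  asymp_sphere : ∀ i j : Fin (n - 1), IsOx 1 fun p => g p (Sum.inr i) (Sum.inr j) -
    (p.1.2 ^ 2)⁻¹ * ((if i = j then 1 else 0) - (p.2 : Euc n) i * (p.2 : Euc n) j)
  /-- `g_tθ = O(x)`. -/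
  asymp_tsphere : ∀ i : Fin (n - 1), IsOx 1 fun p => g p (iT n) (Sum.inr i)
  /-- `g_xθ = O(x²)`. -/
  asymp_xsphere : ∀ i : Fin (n - 1), IsOx 2 fun p => g p (iX n) (Sum.inr i)

/-- The metric completed, by the form `(0, θ) ⊗ (0, θ)`, in the direction normal to the sphere, which
makes the matrix invertible and changes neither the determinant of the metric (in orthonormal bases
of `ℝ × ℝ × T_θ S^(n-2)`) nor the inverse metric on covectors tangent to the sphere. -/
def fullMetric {n : ℕ} (g : TensorField n) (p : Pt n) : Matrix (Idx n) (Idx n) ℝ :=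
  let ν : Idx n → ℝ := Sum.elim 0 fun i => (p.2 : Euc n) i
  g p + Matrix.of fun i j => ν i * ν j

/-- The density `√|det g|` of the volume of `g` with respect to `dt dx dθ`. -/
def volDensity {n : ℕ} (g : TensorField n) (p : Pt n) : ℝ :=
  Real.sqrt |(fullMetric g p).det|

/-- The inverse metric applied to two covectors, `g^(ij) ξ_i η_j`. -/
def invMetric {n : ℕ} (g : TensorField n) (p : Pt n) (ξ η : Idx n → ℝ) : ℝ :=
  ξ ⬝ᵥ ((fullMetric g p)⁻¹ *ᵥ η)

/-- The coefficient `g^(tt)` of the inverse metric. -/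
def invTT {n : ℕ} (g : TensorField n) (p : Pt n) : ℝ :=
  (fullMetric g p)⁻¹ (iT n) (iT n)

/-- The covector with components `a` along `dt`, `b` along `dx` and `v` along the sphere. -/
def covec {n : ℕ} (a b : ℝ) (v : Euc n) : Idx n → ℝ :=
  Sum.elim ![a, b] fun i => v i

/-! ### Twisted Sobolev spaces on the time slice `(0, a) × S^(n-2)`, with points `(x, θ)` -/

/-- The measure `x dx dθ` on `(0, a) × S^(n-2)`, where `dθ` is the standard measure of the unit
sphere. -/
def sliceMeasure (n : ℕ) (a : ℝ) : Measure (ℝ × Sph n) :=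
  ((volume.restrict (Ioo 0 a)).withDensity fun x => ENNReal.ofReal x).prod
    (volume : Measure (Euc n)).toSphere

/-- The space `𝐋² = L²((0, a) × S^(n-2), x dx dθ)`. -/
abbrev L2 (n : ℕ) (a : ℝ) : Type := Lp ℝ 2 (sliceMeasure n a)

/-- Square integrable `ℝ^(n-1)`-valued functions, for angular gradients. -/
abbrev L2vec (n : ℕ) (a : ℝ) : Type := Lp (Euc n) 2 (sliceMeasure n a)

/-- The Hilbert space of triples `(v, 𝐃_x v, ∇_θ v)`. -/
abbrev Triple (n : ℕ) (a : ℝ) : Type := WithLp 2 (L2 n a × WithLp 2 (L2 n a × L2vec n a))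

/-- Smooth functions with compact support in `(0, a) × S^(n-2)`. -/
structure IsSliceTest {n : ℕ} (a : ℝ) (χ : ℝ × Sph n → ℝ) : Prop where
  smooth : SmoothOver univ χ
  compact : HasCompactSupport χ
  support : tsupport χ ⊆ Ioo 0 a ×ˢ univ

/-- The twisted derivative `𝐃_x χ = ∂_x χ + (α / x) χ`. -/
def twisted {n : ℕ} (α : ℝ) (χ : ℝ × Sph n → ℝ) (z : ℝ × Sph n) : ℝ :=
  deriv (fun s => χ (s, z.2)) z.1 + α / z.1 * χ z

/-- The triples `(χ, 𝐃_x χ, ∇_θ χ)` with `χ` smooth and compactly supported in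
`(0, a) × S^(n-2)`. -/
def testTriples (n : ℕ) (α a : ℝ) : Set (Triple n a) :=
  {h | ∃ χ : ℝ × Sph n → ℝ, IsSliceTest a χ ∧ h.fst =ᵐ[sliceMeasure n a] χ ∧
    h.snd.fst =ᵐ[sliceMeasure n a] twisted α χ ∧ h.snd.snd =ᵐ[sliceMeasure n a] gradS χ}

/-- The space `𝐇¹₀`, the completion of the smooth functions with compact support in
`(0, a) × S^(n-2)` for the norm of `𝐇¹`. An element `v` is written as the triple
`(v, 𝐃_x v, ∇_θ v)`, so that the completion is a closure; the span of the set of triples of test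
functions is this set itself. -/
def H10 (n : ℕ) (α a : ℝ) : Submodule ℝ (Triple n a) :=
  (Submodule.span ℝ (testTriples n α a)).topologicalClosure

variable {n : ℕ} {α a : ℝ}

/-- The function `v` itself, as an element of `𝐋²`. -/
def fnOf (v : H10 n α a) : L2 n a := (v : Triple n a).fst

/-- The twisted derivative `𝐃_x v`. -/
def twistOf (v : H10 n α a) : L2 n a := (v : Triple n a).snd.fst

/-- The angular gradient `∇_θ v`. -/
def angularOf (v : H10 n α a) : L2vec n a := (v : Triple n a).snd.snd

/-- The norm `‖v‖ / a + ‖𝐃_ξ v‖ / a + ‖∇_θ v‖` of `𝐇¹_a`, where `ξ = x / a`, so that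
`𝐃_ξ = a 𝐃_x`. -/
def normA (v : H10 n α a) : ℝ :=
  ‖fnOf v‖ / a + ‖a • twistOf v‖ / a + ‖angularOf v‖

/-! ### The Cauchy problem -/

/-- The exponent `α = √(((n-1)/2)² + μ)`. -/
def alphaOf (n : ℕ) (μ : ℝ) : ℝ := Real.sqrt ((((n : ℝ) - 1) / 2) ^ 2 + μ)

/-- Smooth functions with compact support in `(-T, T) × (0, a) × S^(n-2)`. -/
structure IsSpacetimeTest (a T : ℝ) (ψ : Pt n → ℝ) : Prop where
  smooth : SmoothOver univ ψ
  compact : HasCompactSupport ψ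
  support : tsupport ψ ⊆ (Ioo (-T) T ×ˢ Ioo 0 a) ×ˢ univ

/-- For `v` with time derivative `w`, at the time `t` and the point `z = (x, θ)`, the differential
`dφ` of `φ = x^((n-1)/2) v`. Notice that `∂_x φ = x^((n-1)/2) (𝐃_x v + ((n-1)/2 - α) v / x)`. -/
def dPhi (v : H10 n α a) (w : L2 n a) (z : ℝ × Sph n) : Idx n → ℝ :=
  let β : ℝ := ((n : ℝ) - 1) / 2
  z.1 ^ β • covec (w z) (twistOf v z + (β - α) / z.1 * fnOf v z) (angularOf v z)

/-- The differential `dψ` of a function on space-time. -/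
def dPsi (ψ : Pt n → ℝ) (p : Pt n) : Idx n → ℝ := covec (dT ψ p) (dX ψ p) (gradS ψ p)

/-- `v`, with time derivative `w`, satisfies `P_g v = F` weakly in `(-T, T) × (0, a) × S^(n-2)`.

The operator `P_g` is obtained from `□_g - μ` by the change of unknown `φ = x^((n-1)/2) v` and by
division by the coefficient `-g^(tt)` (so that the coefficient of `∂_t²` in `P_g` is `-1`), that is
`□_g φ - μ φ = (-g^(tt)) x^((n-1)/2) P_g v`. Accordingly, `P_g v = F` means
`∫ (- g^(ij) ∂_i φ ∂_j ψ - μ φ ψ) dvol_g = ∫ (-g^(tt)) x^((n-1)/2) F ψ dvol_g` for all test functions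
`ψ`, where `dvol_g = √|det g| dt dx dθ`; the slice measure is `x dx dθ`, whence the factor `1/x`. -/
def SatisfiesWave (g : TensorField n) (μ T : ℝ) (v : ℝ → H10 n α a) (w F : ℝ → L2 n a) : Prop :=
  ∀ ψ : Pt n → ℝ, IsSpacetimeTest a T ψ →
    ∫ t in Ioo (-T) T, ∫ z, (- invMetric g ((t, z.1), z.2) (dPhi (v t) (w t) z)
          (dPsi ψ ((t, z.1), z.2))
        - μ * (z.1 ^ (((n : ℝ) - 1) / 2) * fnOf (v t) z) * ψ ((t, z.1), z.2))
        * (volDensity g ((t, z.1), z.2) / z.1) ∂(sliceMeasure n a)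
    = ∫ t in Ioo (-T) T, ∫ z, (- invTT g ((t, z.1), z.2))
        * z.1 ^ (((n : ℝ) - 1) / 2) * F t z * ψ ((t, z.1), z.2)
        * (volDensity g ((t, z.1), z.2) / z.1) ∂(sliceMeasure n a)

/-- `v` is a weak solution in `L²_t 𝐇¹₀ ∩ H¹_t 𝐋²`, with time derivative `w = ∂_t v`, of the Cauchy
problem `P_g v = F` in `(-T, T) × (0, a) × S^(n-2)`, `v(0) = v₀`, `∂_t v(0) = v₁`. -/
structure IsWeakSolution (g : TensorField n) (μ T : ℝ) (v₀ : H10 n α a) (v₁ : L2 n a)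
    (F : ℝ → L2 n a) (v : ℝ → H10 n α a) (w : ℝ → L2 n a) : Prop where
  /-- `v ∈ L²_t 𝐇¹₀`. -/
  memLp : MemLp v 2 (volume.restrict (Ioo (-T) T))
  /-- `∂_t v ∈ L²_t 𝐋²`. -/
  memLp_deriv : MemLp w 2 (volume.restrict (Ioo (-T) T))
  /-- `v` is in `H¹_t 𝐋²` with the weak derivative `w`, and the value at `0` of its continuous
  representative is `v₀`. -/
  initial : ∀ᵐ t ∂(volume.restrict (Ioo (-T) T)), fnOf (v t) = fnOf v₀ + ∫ s in (0 : ℝ)..t, w s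
  /-- `∂_t v(0) = v₁` weakly on the time slice: the pairing of (the continuous representative of) `v`
  with any test function is differentiable at `0` with the right derivative. -/
  initial_deriv : ∀ χ : ℝ × Sph n → ℝ, IsSliceTest a χ →
    HasDerivAt (fun t : ℝ => ∫ z, (fnOf v₀ + ∫ s in (0 : ℝ)..t, w s : L2 n a) z * χ z
        ∂(sliceMeasure n a))
      (∫ z, v₁ z * χ z ∂(sliceMeasure n a)) 0
  /-- The equation holds weakly. -/
  equation : SatisfiesWave g μ T v w F

end AAdS

end

noncomputable section

namespace AAdS

/-! ### Linear ordinary differential equations -/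

/-! The rescaled metric `k = x² g`, completed by the normal direction of the sphere, tends to the
flat form `diag(-1, 1, …, 1)` as `x → 0`. The error and its first two time derivatives are bounded
by `C x`. Put `β = (n-1)/2` and write both the unknown and the test function as `x^β` times
something. Then the powers of `x` from the volume, the inverse metric and the measure `x dx dθ`
cancel exactly (`wave_integrand_eq`). What remains is a form with the bounded coefficients `√|det k|
k^(ij)`, applied to the time derivative, `𝐃_x v + (β-α) v/x` and `∇_θ v`, together with the singular
mass term `μ √|det k| (v/x)²`.

The analytic core is the identity `⟨𝐃_x v, v/x⟩ = α ‖v/x‖²` (`inner_twistOf_divL`). It gives the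
Hardy inequality `‖v/x‖ ≤ α⁻¹ ‖𝐃_x v‖`. It also reduces the spatial energy of the flat coefficients
to exactly `‖𝐃_x v‖² + ‖∇_θ v‖²`, because `β² - α² + μ = 0` (`form_flatMetric`). So the flat energy
is coercive on `𝐇¹₀` for every `α > 0`, even when `μ < 0`. On `(0, a)` the true coefficients differ
from the flat ones by at most `C a`, so a small `a` keeps half of the coercivity
(`FormData.lower_form`). Their time derivatives are also at most `C a`, and this is why the energy
grows like `e^(c a T)`.

The equation thus becomes an abstract system `(M v' + B v)' = B† v' - A v - M F` in Hilbert spaces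
`V = 𝐇¹₀` and `H = 𝐋²`, all operators being bounded (`WaveSystem`). For existence, a small mass `δ`
on `V` makes it a bounded linear differential equation. The energy estimate (`IsRegularized.bounds`)
does not depend on `δ`, and weak limits as `δ → 0` solve the equation integrated in time
(`exists_isMildSolution`). For uniqueness `∂_t v` is too rough to be a test function, so
Ladyzhenskaya's choice is used, a weighted time primitive of `v`
(`IsMildSolution.integral_exp_smul_eq_zero`).

The weak formulation is linked to the integrated one by the du Bois-Reymond lemma in time. The
constant of integration is the initial momentum. It is identified with the initial velocity because,
against smooth test functions, the spatial derivatives in `B` can be moved to the test function.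
Hence only the continuity of `v` in `𝐋²` is needed (`hasDerivAt_inner_position`,
`exists_inner_gradL`). -/

lemma norm_integral_exp_abs_le {E : Type*} [NormedAddCommGroup E] [NormedSpace ℝ E]
    {l C : ℝ} (hl : 0 < l) (hC : 0 ≤ C) {f : ℝ → E}
    (hf : ∀ s, ‖f s‖ ≤ C * Real.exp (l * |s|)) (t : ℝ) :
    ‖∫ s in (0 : ℝ)..t, f s‖ ≤ C / l * Real.exp (l * |t|) := by
  have key : ∀ (f : ℝ → E) (t : ℝ), 0 ≤ t → (∀ s, ‖f s‖ ≤ C * Real.exp (l * |s|)) →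
      ‖∫ s in (0 : ℝ)..t, f s‖ ≤ C / l * Real.exp (l * t) := by
    intro f t ht hf
    have hd : ∀ x : ℝ, HasDerivAt (fun s => C / l * Real.exp (l * s)) (C * Real.exp (l * x)) x := by
      intro x
      have h := (((hasDerivAt_id x).const_mul l).exp.const_mul (C / l))
      have e : C / l * (Real.exp (l * id x) * (l * 1)) = C * Real.exp (l * x) := by
        simp only [id]; field_simp
      rwa [e] at h
    have h1 : ∫ s in (0 : ℝ)..t, C * Real.exp (l * s) =
        C / l * Real.exp (l * t) - C / l * Real.exp (l * 0) :=
      intervalIntegral.integral_eq_sub_of_hasDerivAt (fun x _ => hd x)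
        (Continuous.intervalIntegrable (by fun_prop) _ _)
    have h2 : ‖∫ s in (0 : ℝ)..t, f s‖ ≤ ∫ s in (0 : ℝ)..t, C * Real.exp (l * s) := by
      refine intervalIntegral.norm_integral_le_of_norm_le ht ?_
        (Continuous.intervalIntegrable (by fun_prop) _ _)
      refine ae_of_all _ fun s hs => ?_
      have := hf s
      rwa [abs_of_pos hs.1] at this
    have : 0 ≤ C / l * Real.exp (l * 0) := by positivity
    linarith
  rcases le_total 0 t with ht | ht
  · rw [abs_of_nonneg ht]
    exact key f t ht hf
  · rw [abs_of_nonpos ht]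
    have := key (fun s => f (-s)) (-t) (by linarith) (fun s => by simpa using hf (-s))
    rwa [intervalIntegral.integral_comp_neg, neg_neg, neg_zero, intervalIntegral.integral_symm,
      norm_neg] at this

/-- The integral operator is a contraction on the whole interval once the sup norm carries the
weight `e^(-l |t|)`, so no continuation of local solutions is needed. The fixed point `u` is the
weighted solution. -/
theorem exists_integral_eq_linear {E : Type*} [NormedAddCommGroup E] [NormedSpace ℝ E]
    [CompleteSpace E] {G : ℝ → E →L[ℝ] E} {f : ℝ → E} (hG : Continuous G) (hf : Continuous f)
    (x₀ : E) {T : ℝ} (hT : 0 < T) :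
    ∃ y : ℝ → E, Continuous y ∧
      ∀ t ∈ Icc (-T) T, y t = x₀ + ∫ s in (0 : ℝ)..t, (G s (y s) + f s) := by
  have hTT : -T ≤ T := by linarith
  -- Freezing the time at the ends of the interval makes the bound `K` valid for all times.
  let pr : ℝ → ℝ := fun t => (projIcc (-T) T hTT t : ℝ)
  have hpr : Continuous pr := continuous_subtype_val.comp continuous_projIcc
  have hpr' : ∀ t ∈ Icc (-T) T, pr t = t := fun t ht => by
    simp only [pr, projIcc_of_mem hTT ht]
  obtain ⟨K, hK⟩ := isCompact_Icc.exists_bound_of_continuousOn (s := Icc (-T) T) hG.continuousOn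
  have hKpr : ∀ t, ‖G (pr t)‖ ≤ K := fun t => hK _ (projIcc (-T) T hTT t).2
  have hK0 : 0 ≤ K := (norm_nonneg _).trans (hKpr 0)
  -- The contraction factor is `K / l`, which is below `1/2`.
  let l : ℝ := 2 * K + 1
  have hl : 0 < l := by positivity
  let ex : C(Icc (-T) T, E) → ℝ → E := fun u t => u (projIcc (-T) T hTT t)
  have hex : ∀ u, Continuous (ex u) := fun u => u.continuous.comp continuous_projIcc
  let integrand : C(Icc (-T) T, E) → ℝ → E := fun u s =>
    G (pr s) (Real.exp (l * |s|) • ex u s) + f s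
  have hint : ∀ u, Continuous (integrand u) := fun u => by
    refine ((hG.comp hpr).clm_apply ?_).add hf
    exact (by fun_prop : Continuous fun s : ℝ => Real.exp (l * |s|)).smul (hex u)
  let Ψ : C(Icc (-T) T, E) → C(Icc (-T) T, E) := fun u =>
    ⟨fun t => Real.exp (-(l * |(t : ℝ)|)) • (x₀ + ∫ s in (0 : ℝ)..t, integrand u s), by
      have h1 : Continuous fun t : ℝ => ∫ s in (0 : ℝ)..t, integrand u s :=
        intervalIntegral.continuous_primitive (fun a b => (hint u).intervalIntegrable a b) 0
      have h2 : Continuous fun t : ℝ => Real.exp (-(l * |t|)) := by fun_prop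
      exact (h2.smul (continuous_const.add h1)).comp continuous_subtype_val⟩
  have hΨ : ∀ u v, dist (Ψ u) (Ψ v) ≤ (1 / 2 : ℝ) * dist u v := by
    intro u v
    rw [dist_eq_norm, dist_eq_norm, ContinuousMap.norm_le _ (by positivity)]
    intro t
    have e1 : (Ψ u - Ψ v) t = Real.exp (-(l * |(t : ℝ)|)) •
        ∫ s in (0 : ℝ)..t, G (pr s) (Real.exp (l * |s|) • (ex u s - ex v s)) := by
      have : ∫ s in (0 : ℝ)..t, G (pr s) (Real.exp (l * |s|) • (ex u s - ex v s)) =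
          (∫ s in (0 : ℝ)..t, integrand u s) - ∫ s in (0 : ℝ)..t, integrand v s := by
        rw [← intervalIntegral.integral_sub ((hint u).intervalIntegrable _ _)
          ((hint v).intervalIntegrable _ _)]
        congr 1
        ext s
        simp [integrand, smul_sub]
      rw [this]
      simp only [ContinuousMap.sub_apply, Ψ, ContinuousMap.coe_mk, ← smul_sub]
      congr 1
      abel
    rw [e1, norm_smul, Real.norm_eq_abs, Real.abs_exp]
    have e2 := norm_integral_exp_abs_le hl (C := K * ‖u - v‖) (by positivity)
      (f := fun s => G (pr s) (Real.exp (l * |s|) • (ex u s - ex v s))) (fun s => by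
        refine ((G (pr s)).le_opNorm _).trans ?_
        rw [norm_smul, Real.norm_eq_abs, Real.abs_exp]
        have h3 : ‖ex u s - ex v s‖ ≤ ‖u - v‖ := by
          simpa [ex] using (u - v).norm_coe_le_norm (projIcc (-T) T hTT s)
        calc ‖G (pr s)‖ * (Real.exp (l * |s|) * ‖ex u s - ex v s‖)
            ≤ K * (Real.exp (l * |s|) * ‖u - v‖) := by
              gcongr; exact hKpr s
          _ = _ := by ring) t
    calc Real.exp (-(l * |(t : ℝ)|)) * _
        ≤ Real.exp (-(l * |(t : ℝ)|)) * (K * ‖u - v‖ / l * Real.exp (l * |(t : ℝ)|)) := by gcongr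
      _ = K / l * ‖u - v‖ := by rw [Real.exp_neg]; field_simp
      _ ≤ 1 / 2 * ‖u - v‖ := by
        refine mul_le_mul_of_nonneg_right ?_ (norm_nonneg _)
        rw [div_le_div_iff₀ hl two_pos]
        simp only [l]; linarith
  have hc : ContractingWith (1 / 2) Ψ := by
    refine ⟨by rw [← NNReal.coe_lt_coe]; norm_num, LipschitzWith.of_dist_le_mul fun u v => ?_⟩
    simpa using hΨ u v
  have : Nonempty C(Icc (-T) T, E) := ⟨0⟩
  let u := hc.fixedPoint
  have hu : Ψ u = u := hc.fixedPoint_isFixedPt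
  refine ⟨fun t => Real.exp (l * |t|) • ex u t, 
    (by fun_prop : Continuous fun s : ℝ => Real.exp (l * |s|)).smul (hex u), fun t ht => ?_⟩
  have h1 : ex u t = Real.exp (-(l * |t|)) • (x₀ + ∫ s in (0 : ℝ)..t, integrand u s) := by
    have : ex u t = Ψ u ⟨t, ht⟩ := by rw [hu]; simp only [ex, projIcc_of_mem hTT ht]
    rw [this]; rfl
  have h2 : ∫ s in (0 : ℝ)..t, integrand u s =
      ∫ s in (0 : ℝ)..t, (G s (Real.exp (l * |s|) • ex u s) + f s) := by
    refine intervalIntegral.integral_congr fun s hs => ?_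
    have hs' : s ∈ Icc (-T) T := by
      refine (uIcc_subset_Icc ?_ ht) hs
      constructor <;> linarith
    simp only [integrand, hpr' s hs']
  simp only [h1, h2, smul_smul, ← Real.exp_add]
  rw [add_neg_cancel, Real.exp_zero, one_smul]
  
/-- The integral equation is solved on a larger interval so that the derivative at `±T` is
two-sided. -/
theorem exists_hasDerivAt_linear {E : Type*} [NormedAddCommGroup E] [NormedSpace ℝ E]
    [CompleteSpace E] {G : ℝ → E →L[ℝ] E} {f : ℝ → E} (hG : Continuous G) (hf : Continuous f)
    (x₀ : E) {T : ℝ} (hT : 0 < T) :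
    ∃ y : ℝ → E, Continuous y ∧ y 0 = x₀ ∧
      ∀ t ∈ Icc (-T) T, HasDerivAt y (G t (y t) + f t) t := by
  obtain ⟨y, hy, h⟩ := exists_integral_eq_linear hG hf x₀ (T := T + 1) (by linarith)
  refine ⟨y, hy, by simpa using h 0 (by constructor <;> linarith), fun t ht => ?_⟩
  have h1 : HasDerivAt (fun t => x₀ + ∫ s in (0 : ℝ)..t, (G s (y s) + f s)) (G t (y t) + f t) t :=
    (((hG.clm_apply hy).add hf).integral_hasStrictDerivAt 0 t).hasDerivAt.const_add x₀
  refine h1.congr_of_eventuallyEq ?_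
  filter_upwards [Ioo_mem_nhds (show -(T + 1) < t by linarith [ht.1])
    (show t < T + 1 by linarith [ht.2])] with s hs
  exact h s (Ioo_subset_Icc_self hs)

/-! ### Product rule for absolutely continuous functions -/

section Product

variable {E F G : Type*} [NormedAddCommGroup E] [NormedSpace ℝ E] [NormedAddCommGroup F]
  [NormedSpace ℝ F] [NormedAddCommGroup G] [NormedSpace ℝ G]

/-- The increments are dominated by those of the scalar primitive of `‖f‖`, for which absolute
continuity is known. -/
lemma absolutelyContinuous_integral {f : ℝ → E} {a b c : ℝ}
    (hf : IntervalIntegrable f volume a b) (hc : c ∈ uIcc a b) (x₀ : E) :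
    AbsolutelyContinuousOnInterval (fun t => x₀ + ∫ s in c..t, f s) a b := by
  have h1 := hf.norm.absolutelyContinuousOnInterval_intervalIntegral hc
  rw [absolutelyContinuousOnInterval_iff] at h1 ⊢
  intro ε hε
  obtain ⟨δ, hδ, h⟩ := h1 ε hε
  refine ⟨δ, hδ, fun I hI hI' => lt_of_le_of_lt (Finset.sum_le_sum fun i hi => ?_) (h I hI hI')⟩
  have hmem := hI.1 i hi
  have hi1 : ∀ x ∈ uIcc a b, ∀ y ∈ uIcc a b, IntervalIntegrable f volume x y := fun x hx y hy =>
    hf.mono_set (uIcc_subset_uIcc hx hy)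
  rw [dist_add_left, dist_comm, dist_comm (∫ v in c..(I.2 i).1, ‖f v‖), dist_eq_norm, dist_eq_norm,
    intervalIntegral.integral_interval_sub_left (hi1 _ hc _ hmem.2) (hi1 _ hc _ hmem.1),
    intervalIntegral.integral_interval_sub_left (hi1 _ hc _ hmem.2).norm (hi1 _ hc _ hmem.1).norm]
  exact intervalIntegral.norm_integral_le_abs_integral_norm

lemma absolutelyContinuous_clm_apply {u : ℝ → E →L[ℝ] F} {f : ℝ → E} {a b : ℝ}
    (hu : AbsolutelyContinuousOnInterval u a b) (hf : AbsolutelyContinuousOnInterval f a b) :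
    AbsolutelyContinuousOnInterval (fun t => u t (f t)) a b := by
  obtain ⟨C, hC⟩ := hu.exists_bound
  obtain ⟨D, hD⟩ := hf.exists_bound
  have hC0 : 0 ≤ C := (norm_nonneg _).trans (hC a left_mem_uIcc)
  have hD0 : 0 ≤ D := (norm_nonneg _).trans (hD a left_mem_uIcc)
  rw [absolutelyContinuousOnInterval_iff] at hu hf ⊢
  intro ε hε
  obtain ⟨δ, hδ, h⟩ := hu (ε / (2 * (D + 1))) (by positivity)
  obtain ⟨δ', hδ', h'⟩ := hf (ε / (2 * (C + 1))) (by positivity)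
  refine ⟨min δ δ', lt_min hδ hδ', fun I hI hI' => ?_⟩
  have h1 := h I hI (hI'.trans_le (min_le_left _ _))
  have h2 := h' I hI (hI'.trans_le (min_le_right _ _))
  have h3 : ∀ i ∈ Finset.range I.1, dist (u (I.2 i).1 (f (I.2 i).1)) (u (I.2 i).2 (f (I.2 i).2)) ≤
      (D + 1) * dist (u (I.2 i).1) (u (I.2 i).2) + (C + 1) * dist (f (I.2 i).1) (f (I.2 i).2) := by
    intro i hi
    have hmem := hI.1 i hi
    rw [dist_eq_norm, dist_eq_norm, dist_eq_norm]
    have e : u (I.2 i).1 (f (I.2 i).1) - u (I.2 i).2 (f (I.2 i).2) =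
        (u (I.2 i).1 - u (I.2 i).2) (f (I.2 i).1) + u (I.2 i).2 (f (I.2 i).1 - f (I.2 i).2) := by
      simp
    rw [e]
    refine (norm_add_le _ _).trans (add_le_add ?_ ?_)
    · refine (ContinuousLinearMap.le_opNorm _ _).trans ?_
      rw [mul_comm]
      gcongr
      linarith [hD _ hmem.1]
    · refine (ContinuousLinearMap.le_opNorm _ _).trans ?_
      gcongr
      linarith [hC _ hmem.2]
  refine lt_of_le_of_lt (Finset.sum_le_sum h3) ?_
  rw [Finset.sum_add_distrib, ← Finset.mul_sum, ← Finset.mul_sum]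
  rw [lt_div_iff₀ (by positivity)] at h1 h2
  nlinarith

lemma contDiff_one_of_hasDerivAt {f f' : ℝ → E} (h : ∀ t, HasDerivAt f (f' t) t)
    (hf' : Continuous f') : ContDiff ℝ 1 f := by
  rw [contDiff_one_iff_deriv]
  refine ⟨fun t => (h t).differentiableAt, ?_⟩
  rwa [show deriv f = f' from funext fun t => (h t).deriv]

/-- The product is scalar and absolutely continuous, so the fundamental theorem of calculus applies
to it. The almost everywhere derivatives of the two vector valued factors come from Lebesgue
differentiation. Since `f` and `g` are known to be primitives only on the interval, they are first
replaced by the primitives themselves. -/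
lemma deriv_bilin_integral [CompleteSpace E] [CompleteSpace F]
    {β β' : ℝ → E →L[ℝ] F →L[ℝ] ℝ} (hβ : ∀ t, HasDerivAt β (β' t) t) (hβ' : Continuous β')
    {f' : ℝ → E} {g' : ℝ → F} {f : ℝ → E} {g : ℝ → F} {a b : ℝ}
    (hf' : IntervalIntegrable f' volume a b) (hg' : IntervalIntegrable g' volume a b)
    (hf : ∀ t ∈ uIcc a b, f t = f a + ∫ s in a..t, f' s)
    (hg : ∀ t ∈ uIcc a b, g t = g a + ∫ s in a..t, g' s) :
    IntervalIntegrable (fun t => β' t (f t) (g t) + β t (f' t) (g t) + β t (f t) (g' t)) volume a b ∧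
    ∫ t in a..b, (β' t (f t) (g t) + β t (f' t) (g t) + β t (f t) (g' t)) =
      β b (f b) (g b) - β a (f a) (g a) := by
  have ha : a ∈ uIcc a b := left_mem_uIcc
  set f₁ : ℝ → E := fun t => f a + ∫ s in a..t, f' s with hf₁
  set g₁ : ℝ → F := fun t => g a + ∫ s in a..t, g' s with hg₁
  have hβ1 : ContDiff ℝ 1 β := contDiff_one_of_hasDerivAt hβ hβ'
  have hac : AbsolutelyContinuousOnInterval (fun t => β t (f₁ t) (g₁ t)) a b :=
    absolutelyContinuous_clm_apply (absolutelyContinuous_clm_apply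
      hβ1.contDiffOn.absolutelyContinuousOnInterval (absolutelyContinuous_integral hf' ha _))
      (absolutelyContinuous_integral hg' ha _)
  have h := hac.integral_deriv_eq_sub
  have e1 : f₁ b = f b := (hf b right_mem_uIcc).symm
  have e2 : g₁ b = g b := (hg b right_mem_uIcc).symm
  have e3 : f₁ a = f a := by simp [hf₁]
  have e4 : g₁ a = g a := by simp [hg₁]
  rw [e1, e2, e3, e4] at h
  have key : ∀ᵐ t, t ∈ uIoc a b → deriv (fun t => β t (f₁ t) (g₁ t)) t =
      β' t (f t) (g t) + β t (f' t) (g t) + β t (f t) (g' t) := by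
    filter_upwards [hf'.ae_hasDerivAt_integral, hg'.ae_hasDerivAt_integral] with t h1 h2 ht
    have ht' : t ∈ uIcc a b := uIoc_subset_uIcc ht
    have h3 := (h1 ht' a ha).const_add (f a)
    have h4 := (h2 ht' a ha).const_add (g a)
    have h5 := (((hβ t).clm_apply h3).clm_apply h4).deriv
    rw [h5, ← hf t ht', ← hg t ht']
    simp
  rw [← h]
  refine ⟨hac.intervalIntegrable_deriv.congr_ae ((ae_restrict_iff' measurableSet_uIoc).2 key), ?_⟩
  refine intervalIntegral.integral_congr_ae ?_
  filter_upwards [key] with t ht hmem using (ht hmem).symm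

end Product

end AAdS

namespace AAdS

open scoped InnerProduct

/-! ### Weak limits along ultrafilters -/

section Weak

variable {X Y : Type*} [NormedAddCommGroup X] [InnerProductSpace ℝ X]
  [NormedAddCommGroup Y] [InnerProductSpace ℝ Y]

/-- Weak convergence in a Hilbert space. -/
def WeakTendsto (u : ℕ → X) (l : Filter ℕ) (x : X) : Prop :=
  ∀ y, Tendsto (fun k => inner ℝ (u k) y) l (𝓝 (inner ℝ x y))

/-- Banach–Alaoglu through the Riesz isomorphism. Convergence along an ultrafilter replaces the
extraction of subsequences and needs no separability. -/
lemma exists_weakTendsto [CompleteSpace X] (u : ℕ → X) {C : ℝ} (hu : ∀ k, ‖u k‖ ≤ C)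
    (l : Ultrafilter ℕ) : ∃ x, WeakTendsto u l x := by
  let φ : ℕ → WeakDual ℝ X := fun k => StrongDual.toWeakDual (InnerProductSpace.toDual ℝ X (u k))
  have hK := WeakDual.isCompact_closedBall (𝕜 := ℝ) (E := X) 0 C
  obtain ⟨f, -, hf⟩ := isCompact_iff_ultrafilter_le_nhds.1 hK (l.map φ) (by
    rw [Ultrafilter.coe_map, le_principal_iff, mem_map]
    refine univ_mem' fun k => ?_
    simpa [φ] using hu k)
  refine ⟨(InnerProductSpace.toDual ℝ X).symm (WeakDual.toStrongDual f), fun y => ?_⟩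
  have h1 : Tendsto φ l (𝓝 f) := hf
  have h2 := ((WeakBilin.eval_continuous (topDualPairing ℝ X) y).tendsto f).comp h1
  simp only [InnerProductSpace.toDual_symm_apply]
  exact h2

lemma WeakTendsto.clm [CompleteSpace X] [CompleteSpace Y] {u : ℕ → X} {l : Filter ℕ} {x : X}
    (h : WeakTendsto u l x) (L : X →L[ℝ] Y) : WeakTendsto (fun k => L (u k)) l (L x) := by
  intro y
  simp only [← ContinuousLinearMap.adjoint_inner_right]
  exact h _

lemma WeakTendsto.add {u v : ℕ → X} {l : Filter ℕ} {x y : X}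
    (h : WeakTendsto u l x) (h' : WeakTendsto v l y) :
    WeakTendsto (fun k => u k + v k) l (x + y) := by
  intro z
  simp only [inner_add_left]
  exact (h z).add (h' z)

lemma weakTendsto_of_tendsto {u : ℕ → X} {l : Filter ℕ} {x : X} (h : Tendsto u l (𝓝 x)) :
    WeakTendsto u l x := fun _ => h.inner tendsto_const_nhds

lemma WeakTendsto.unique {u : ℕ → X} {l : Filter ℕ} [l.NeBot] {x y : X}
    (h : WeakTendsto u l x) (h' : WeakTendsto u l y) : x = y :=
  ext_inner_right ℝ fun z => tendsto_nhds_unique (h z) (h' z)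

/-- Pairing with the limit itself, cut off to the set where its norm exceeds `K₀`, gives `∫ (‖x‖ -
K₀) ‖x‖ ≤ 0` over that set, whose integrand is nonnegative. -/
lemma ae_norm_le_of_weakTendsto {α : Type*} [MeasurableSpace α] {ν : Measure α} [IsFiniteMeasure ν]
    {u : ℕ → Lp X 2 ν} {l : Filter ℕ} [l.NeBot] {x : Lp X 2 ν}
    (h : WeakTendsto u l x) {K : ℕ → ℝ} {K₀ : ℝ} (hK : Tendsto K l (𝓝 K₀))
    (hu : ∀ k, ∀ᵐ t ∂ν, ‖u k t‖ ≤ K k) : ∀ᵐ t ∂ν, ‖x t‖ ≤ K₀ := by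
  have hxm : StronglyMeasurable x := Lp.stronglyMeasurable x
  set S : Set α := {t | K₀ < ‖x t‖} with hS
  have hSm : MeasurableSet S := measurableSet_lt measurable_const hxm.norm.measurable
  have hyL : MemLp (S.indicator x) 2 ν := (Lp.memLp x).indicator hSm
  set y : Lp X 2 ν := hyL.toLp
  have hy : y =ᵐ[ν] S.indicator x := hyL.coeFn_toLp
  have hint : Integrable (fun t => ‖S.indicator x t‖) ν :=
    (hyL.integrable (by norm_num)).norm
  have h1 : inner ℝ x y ≤ K₀ * ∫ t, ‖S.indicator x t‖ ∂ν := by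
    refine le_of_tendsto_of_tendsto' (h y) (hK.mul_const _) fun k => ?_
    rw [L2.inner_def, ← integral_const_mul]
    refine integral_mono_ae (L2.integrable_inner _ _) (hint.const_mul _) ?_
    filter_upwards [hy, hu k] with t h1 h2
    rw [h1]
    refine (real_inner_le_norm _ _).trans ?_
    gcongr
  have h2 : inner ℝ x y = ∫ t, ‖x t‖ * ‖S.indicator x t‖ ∂ν := by
    rw [L2.inner_def]
    refine integral_congr_ae ?_
    filter_upwards [hy] with t h1
    rw [h1]
    by_cases ht : t ∈ S
    · simp [ht, pow_two]
    · simp [ht]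
  have hint2 : Integrable (fun t => ‖x t‖ * ‖S.indicator x t‖) ν := by
    refine (L2.integrable_inner (𝕜 := ℝ) x y).congr ?_
    filter_upwards [hy] with t h1
    rw [h1]
    by_cases ht : t ∈ S
    · simp [ht, pow_two]
    · simp [ht]
  have h3 : ∫ t, (‖x t‖ - K₀) * ‖S.indicator x t‖ ∂ν ≤ 0 := by
    simp only [sub_mul]
    rw [integral_sub hint2 (hint.const_mul _), integral_const_mul]
    linarith
  have hnn : ∀ t, 0 ≤ (‖x t‖ - K₀) * ‖S.indicator x t‖ := by
    intro t
    by_cases ht : t ∈ S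
    · exact mul_nonneg (sub_nonneg.2 (le_of_lt ht)) (norm_nonneg _)
    · simp [ht]
  have hintd : Integrable (fun t => (‖x t‖ - K₀) * ‖S.indicator x t‖) ν := by
    simp only [sub_mul]
    exact hint2.sub (hint.const_mul _)
  have h4 := (integral_eq_zero_iff_of_nonneg hnn hintd).1
    (le_antisymm h3 (integral_nonneg hnn))
  filter_upwards [h4, (ae_all_iff.2 hu)] with t ht htu
  by_contra hlt
  push Not at hlt
  have htS : t ∈ S := hlt
  have h5 : (‖x t‖ - K₀) * ‖S.indicator x t‖ = 0 := ht
  rw [indicator_of_mem htS] at h5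
  rcases mul_eq_zero.1 h5 with h6 | h6
  · linarith [show K₀ < ‖x t‖ from hlt]
  -- The integrand also vanishes where `‖x t‖ = 0`; this case is excluded by `K₀ ≥ 0`, the limit of
  -- bounds for norms.
  · have hK0 : 0 ≤ K₀ := ge_of_tendsto' hK fun k => (norm_nonneg _).trans (htu k)
    linarith [show K₀ < ‖x t‖ from hlt]

end Weak

/-! ### Operators on square integrable functions of time -/

section Time

variable {E F : Type*} [NormedAddCommGroup E] [NormedSpace ℝ E] [NormedAddCommGroup F]
  [NormedSpace ℝ F]

/-- Lebesgue measure on the time interval `(-T, T)`. -/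
abbrev timeMeasure (T : ℝ) : Measure ℝ := volume.restrict (Ioo (-T) T)

lemma intervalIntegrable_of_integrable_time {f : ℝ → E} {T t : ℝ}
    (hf : Integrable f (timeMeasure T)) (ht : t ∈ Icc (-T) T) {s : ℝ} (hs : s ∈ Icc (-T) T) :
    IntervalIntegrable f volume s t := by
  have h1 : IntegrableOn f (Icc (-T) T) := (integrableOn_Icc_iff_integrableOn_Ioo (by simp) (by simp)).2 hf
  exact (h1.mono_set (uIcc_subset_Icc hs ht)).intervalIntegrable

lemma intervalIntegral_congr_time {f g : ℝ → E} {T s t : ℝ} (h : f =ᵐ[timeMeasure T] g)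
    (hs : s ∈ Icc (-T) T) (ht : t ∈ Icc (-T) T) : ∫ r in s..t, f r = ∫ r in s..t, g r := by
  refine intervalIntegral.integral_congr_ae ?_
  have := (ae_restrict_iff' measurableSet_Ioo).1 h
  have hT1 : ∀ᵐ x : ℝ, x ≠ T := by simp [ae_iff, measure_singleton]
  have hT2 : ∀ᵐ x : ℝ, x ≠ -T := by simp [ae_iff, measure_singleton]
  filter_upwards [this, hT1, hT2] with x hx h1 h2 hx'
  have hx2 := uIcc_subset_Icc hs ht (uIoc_subset_uIcc hx')
  exact hx ⟨lt_of_le_of_ne hx2.1 (Ne.symm h2), lt_of_le_of_ne hx2.2 h1⟩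

lemma norm_intervalIntegral_le_time {f : ℝ → E} {T t : ℝ} 
    (hf : Integrable f (timeMeasure T)) (ht : t ∈ Icc (-T) T) {s : ℝ} (hs : s ∈ Icc (-T) T) :
    ‖∫ r in s..t, f r‖ ≤ ∫ r, ‖f r‖ ∂(timeMeasure T) := by
  refine intervalIntegral.norm_integral_le_integral_norm_uIoc.trans ?_
  have h1 : IntegrableOn f (Icc (-T) T) := (integrableOn_Icc_iff_integrableOn_Ioo (by simp) (by simp)).2 hf
  rw [← integral_Icc_eq_integral_Ioo]
  exact setIntegral_mono_set h1.norm (ae_of_all _ fun _ => norm_nonneg _)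
    (uIoc_subset_uIcc.trans (uIcc_subset_Icc hs ht)).eventuallyLE

lemma aestronglyMeasurable_primitive {f : ℝ → E} {T : ℝ} (hT : 0 < T)
    (hf : Integrable f (timeMeasure T)) :
    AEStronglyMeasurable (fun t => ∫ s in (0 : ℝ)..t, f s) (timeMeasure T) := by
  have h0 : (0 : ℝ) ∈ uIcc (-T) T := by rw [uIcc_of_le (by linarith)]; constructor <;> linarith
  have h := intervalIntegral.continuousOn_primitive_interval' (μ := volume)
    (intervalIntegrable_of_integrable_time hf (s := -T) (t := T)
      (by constructor <;> linarith) (by constructor <;> linarith)) h0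
  rw [uIcc_of_le (by linarith)] at h
  exact (h.mono Ioo_subset_Icc_self).aestronglyMeasurable measurableSet_Ioo

lemma memLp_primitive {f : ℝ → E} {T : ℝ} (hT : 0 < T)
    (hf : Integrable f (timeMeasure T)) (p : ℝ≥0∞) :
    MemLp (fun t => ∫ s in (0 : ℝ)..t, f s) p (timeMeasure T) := by
  refine MemLp.of_bound (aestronglyMeasurable_primitive hT hf) (∫ r, ‖f r‖ ∂(timeMeasure T)) ?_
  filter_upwards [ae_restrict_mem measurableSet_Ioo] with t ht
  exact norm_intervalIntegral_le_time hf (Ioo_subset_Icc_self ht) (by constructor <;> linarith)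

lemma memLp_time_of_continuous {f : ℝ → E} (hf : Continuous f) (T : ℝ) (p : ℝ≥0∞) :
    MemLp f p (timeMeasure T) := by
  obtain ⟨C, hC⟩ := isCompact_Icc.exists_bound_of_continuousOn (s := Icc (-T) T) hf.continuousOn
  refine MemLp.of_bound (hf.continuousOn.aestronglyMeasurable measurableSet_Ioo) C ?_
  filter_upwards [ae_restrict_mem measurableSet_Ioo] with t ht
  exact hC t (Ioo_subset_Icc_self ht)

lemma integrable_coe_time {T : ℝ} (f : Lp E 2 (timeMeasure T)) :
    Integrable f (timeMeasure T) := (Lp.memLp f).integrable (by norm_num)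

lemma integral_norm_le_lp (T : ℝ) : ∃ C : ℝ, 0 ≤ C ∧ ∀ f : Lp E 2 (timeMeasure T),
    ∫ r, ‖f r‖ ∂(timeMeasure T) ≤ C * ‖f‖ := by
  refine ⟨(timeMeasure T univ ^ (1 / (1 : ℝ≥0∞).toReal - 1 / (2 : ℝ≥0∞).toReal)).toReal,
    ENNReal.toReal_nonneg, fun f => ?_⟩
  have h := eLpNorm_le_eLpNorm_mul_rpow_measure_univ (μ := timeMeasure T) (p := 1) (q := 2)
    (by norm_num) (Lp.aestronglyMeasurable f)
  rw [integral_norm_eq_lintegral_enorm (Lp.aestronglyMeasurable f), ← eLpNorm_one_eq_lintegral_enorm,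
    Lp.norm_def, ← ENNReal.toReal_mul, mul_comm]
  refine ENNReal.toReal_mono (ENNReal.mul_ne_top (Lp.eLpNorm_ne_top f) ?_) h
  refine ENNReal.rpow_ne_top_of_nonneg (by norm_num) (measure_ne_top _ _)

/-- Being a bounded operator on square integrable functions, time integration commutes with weak
limits. The same purpose is served by `exists_pointwise_clm` for time dependent operators. -/
lemma exists_primitive_clm {T : ℝ} (hT : 0 < T) :
    ∃ L : Lp E 2 (timeMeasure T) →L[ℝ] Lp E 2 (timeMeasure T),
      ∀ f, L f =ᵐ[timeMeasure T] fun t => ∫ s in (0 : ℝ)..t, f s := by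
  obtain ⟨C, hC, h⟩ := integral_norm_le_lp (E := E) T
  have h0 : (0 : ℝ) ∈ Icc (-T) T := by constructor <;> linarith
  let L : Lp E 2 (timeMeasure T) →ₗ[ℝ] Lp E 2 (timeMeasure T) :=
    { toFun := fun f => (memLp_primitive hT (integrable_coe_time f) 2).toLp
      map_add' := fun f g => by
        rw [← MemLp.toLp_add]
        refine MemLp.toLp_congr _ _ ?_
        filter_upwards [ae_restrict_mem measurableSet_Ioo] with t ht
        have ht' := Ioo_subset_Icc_self ht
        rw [Pi.add_apply, ← intervalIntegral.integral_add
          (intervalIntegrable_of_integrable_time (integrable_coe_time f) ht' h0)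
          (intervalIntegrable_of_integrable_time (integrable_coe_time g) ht' h0)]
        exact intervalIntegral_congr_time (Lp.coeFn_add f g) h0 ht'
      map_smul' := fun c f => by
        rw [RingHom.id_apply, ← MemLp.toLp_const_smul]
        refine MemLp.toLp_congr _ _ ?_
        filter_upwards [ae_restrict_mem measurableSet_Ioo] with t ht
        have ht' := Ioo_subset_Icc_self ht
        rw [Pi.smul_apply, ← intervalIntegral.integral_smul]
        exact intervalIntegral_congr_time (Lp.coeFn_smul c f) h0 ht' }
  refine ⟨L.mkContinuous (((measureUnivNNReal (timeMeasure T) : ℝ) ^ (2 : ℝ≥0∞).toReal⁻¹) * C)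
    fun f => ?_, fun f => ?_⟩
  · rw [mul_assoc]
    refine Lp.norm_le_of_ae_bound (by positivity) ?_
    filter_upwards [(memLp_primitive hT (integrable_coe_time f) 2).coeFn_toLp,
      ae_restrict_mem measurableSet_Ioo] with t h1 ht
    simp only [L, LinearMap.coe_mk, AddHom.coe_mk]
    rw [h1]
    exact (norm_intervalIntegral_le_time (integrable_coe_time f) (Ioo_subset_Icc_self ht) h0).trans
      (h f)
  · exact (memLp_primitive hT (integrable_coe_time f) 2).coeFn_toLp

lemma exists_pointwise_clm (T : ℝ) {U : ℝ → E →L[ℝ] F} (hU : Continuous U) :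
    ∃ L : Lp E 2 (timeMeasure T) →L[ℝ] Lp F 2 (timeMeasure T),
      ∀ f, L f =ᵐ[timeMeasure T] fun t => U t (f t) := by
  have hm := memLp_time_of_continuous hU T ∞
  refine ⟨(ContinuousLinearMap.id ℝ (E →L[ℝ] F)).holderL (timeMeasure T) ∞ 2 2 hm.toLp,
    fun f => ?_⟩
  rw [ContinuousLinearMap.holderL_apply_apply]
  filter_upwards [(ContinuousLinearMap.id ℝ (E →L[ℝ] F)).coeFn_holder (r := 2) hm.toLp f,
    hm.coeFn_toLp] with t h1 h2
  rw [h1, h2]; rfl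

end Time

end AAdS

namespace AAdS

open scoped InnerProduct

/-! ### Abstract second order evolution equations -/

/-- The operators of an abstract second order equation `(M v' + B v)' = B† v' - A v - M F` for
functions of time with values in a Hilbert space `V` that is mapped to a Hilbert space `H`. -/
structure WaveSystem (V H : Type*) [NormedAddCommGroup V] [InnerProductSpace ℝ V]
    [NormedAddCommGroup H] [InnerProductSpace ℝ H] where
  /-- The map from `V` to `H`. -/
  ι : V →L[ℝ] H
  /-- The mass operator. -/
  M : ℝ → H →L[ℝ] H
  /-- Its time derivative. -/
  M' : ℝ → H →L[ℝ] H
  /-- The operator that couples time and space derivatives. -/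
  B : ℝ → V →L[ℝ] H
  /-- Its time derivative. -/
  B' : ℝ → V →L[ℝ] H
  /-- The stiffness operator. -/
  A : ℝ → V →L[ℝ] V
  /-- Its time derivative. -/
  A' : ℝ → V →L[ℝ] V
  /-- The lower bound for the mass and the stiffness. -/
  lower : ℝ
  /-- The upper bound for the mass and the stiffness. -/
  upper : ℝ
  /-- The bound for the time derivatives. -/
  rate : ℝ
  dense : DenseRange ι
  hasDerivAt_M : ∀ t, HasDerivAt M (M' t) t
  hasDerivAt_B : ∀ t, HasDerivAt B (B' t) t
  hasDerivAt_A : ∀ t, HasDerivAt A (A' t) t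
  continuous_M' : Continuous M'
  continuous_B' : Continuous B'
  continuous_A' : Continuous A'
  symm_M : ∀ t x y, inner ℝ (M t x) y = inner ℝ x (M t y)
  symm_A : ∀ t x y, inner ℝ (A t x) y = inner ℝ x (A t y)
  lower_pos : 0 < lower
  upper_nonneg : 0 ≤ upper
  rate_nonneg : 0 ≤ rate
  lower_M : ∀ t x, lower * ‖x‖ ^ 2 ≤ inner ℝ (M t x) x
  lower_A : ∀ t x, lower * ‖x‖ ^ 2 ≤ inner ℝ (A t x) x
  upper_M : ∀ t, ‖M t‖ ≤ upper
  upper_A : ∀ t, ‖A t‖ ≤ upper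
  rate_M : ∀ t, ‖M' t‖ ≤ rate
  rate_B : ∀ t, ‖B' t‖ ≤ rate
  rate_A : ∀ t, ‖A' t‖ ≤ rate

lemma abs_inner_clm_le {E F : Type*} [NormedAddCommGroup E] [NormedSpace ℝ E]
    [NormedAddCommGroup F] [InnerProductSpace ℝ F] (L : E →L[ℝ] F) {C : ℝ} (hL : ‖L‖ ≤ C) (x : E)
    (y : F) : |inner ℝ (L x) y| ≤ C * ‖x‖ * ‖y‖ := by
  refine (abs_real_inner_le_norm _ _).trans ?_
  gcongr
  exact (L.le_opNorm x).trans (by gcongr)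

/-- Growth of a nonnegative function whose derivative is controlled by itself and its root. -/
lemma sqrt_le_of_deriv_le {e e' φ : ℝ → ℝ} {k c T : ℝ} (hk : 0 ≤ k) (hc : 0 ≤ c)
    (he : ∀ t ∈ Icc 0 T, 0 ≤ e t) (hφ : Continuous φ) (hφ0 : ∀ t, 0 ≤ φ t)
    (hd : ∀ t ∈ Icc 0 T, HasDerivAt e (e' t) t)
    (hb : ∀ t ∈ Icc 0 T, e' t ≤ 2 * k * e t + 2 * c * φ t * √(e t)) {t : ℝ} (ht : t ∈ Icc 0 T) :
    √(e t) ≤ Real.exp (k * T) * (√(e 0) + c * ∫ s in (0 : ℝ)..T, φ s) := by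
  have h0T : 0 ≤ T := ht.1.trans ht.2
  -- The square root is differentiable only away from zero, hence the shift by `ε`, which is removed
  -- by a limit at the end.
  have key : ∀ ε : ℝ, 0 < ε →
      √(e t) ≤ Real.exp (k * T) * (√(e 0 + ε) + c * ∫ s in (0 : ℝ)..T, φ s) := by
    intro ε hε
    have hpos : ∀ s ∈ Icc 0 T, 0 < e s + ε := fun s hs => by linarith [he s hs]
    -- Variation of constants: the differential inequality says that this function decreases.
    let Z : ℝ → ℝ := fun s => Real.exp (-(k * s)) * √(e s + ε) - c * ∫ r in (0 : ℝ)..s, φ r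
    have hZ : ∀ s ∈ Icc 0 T, HasDerivAt Z
        (Real.exp (-(k * s)) * (-(k * 1)) * √(e s + ε) +
          Real.exp (-(k * s)) * (e' s / (2 * √(e s + ε))) - c * φ s) s := by
      intro s hs
      have h1 : HasDerivAt (fun s => Real.exp (-(k * s))) (Real.exp (-(k * s)) * (-(k * 1))) s :=
        (((hasDerivAt_id s).const_mul k).neg).exp
      have h2 := ((hd s hs).add_const ε).sqrt (hpos s hs).ne'
      exact (h1.mul h2).sub (((hφ.integral_hasStrictDerivAt 0 s).hasDerivAt).const_mul c)
    have hanti : AntitoneOn Z (Icc 0 T) := by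
      refine antitoneOn_of_hasDerivWithinAt_nonpos (convex_Icc 0 T)
        (fun s hs => (hZ s hs).continuousAt.continuousWithinAt)
        (fun s hs => (hZ s (interior_subset hs)).hasDerivWithinAt) fun s hs => ?_
      have hs' : s ∈ Icc 0 T := interior_subset hs
      set y := √(e s + ε) with hy
      have hy0 : 0 < y := Real.sqrt_pos.2 (hpos s hs')
      have hy2 : y ^ 2 = e s + ε := Real.sq_sqrt (hpos s hs').le
      have hey : √(e s) ≤ y := Real.sqrt_le_sqrt (by linarith)
      have h3 : e' s / (2 * y) ≤ k * y + c * φ s := by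
        rw [div_le_iff₀ (by positivity)]
        have h4 := hb s hs'
        have h5 : 2 * c * φ s * √(e s) ≤ 2 * c * φ s * y := by
          have := hφ0 s
          gcongr
        have h6 : 2 * k * e s ≤ 2 * k * y ^ 2 := by
          rw [hy2]
          gcongr
          linarith
        nlinarith
      have hexp : Real.exp (-(k * s)) ≤ 1 := by
        rw [Real.exp_le_one_iff]
        have := mul_nonneg hk hs'.1
        linarith
      have hexp0 := Real.exp_pos (-(k * s))
      have h7 : Real.exp (-(k * s)) * (e' s / (2 * y)) ≤ Real.exp (-(k * s)) * (k * y + c * φ s) :=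
        mul_le_mul_of_nonneg_left h3 hexp0.le
      have h8 : Real.exp (-(k * s)) * (c * φ s) ≤ 1 * (c * φ s) :=
        mul_le_mul_of_nonneg_right hexp (mul_nonneg hc (hφ0 s))
      nlinarith
    have h9 := hanti (left_mem_Icc.2 h0T) ht ht.1
    simp only [Z, mul_zero, neg_zero, Real.exp_zero, one_mul, intervalIntegral.integral_same,
      sub_zero] at h9
    have h10 : √(e t + ε) ≤ Real.exp (k * t) * (√(e 0 + ε) + c * ∫ s in (0 : ℝ)..t, φ s) := by
      have h11 : √(e t + ε) = Real.exp (k * t) * (Real.exp (-(k * t)) * √(e t + ε)) := by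
        rw [← mul_assoc, ← Real.exp_add]; simp
      rw [h11]
      gcongr
      linarith
    have h12 : ∫ s in (0 : ℝ)..t, φ s ≤ ∫ s in (0 : ℝ)..T, φ s :=
      intervalIntegral.integral_mono_interval le_rfl ht.1 ht.2 (ae_of_all _ fun s => hφ0 s)
        (hφ.intervalIntegrable _ _)
    have h13 : 0 ≤ ∫ s in (0 : ℝ)..t, φ s :=
      intervalIntegral.integral_nonneg ht.1 fun s _ => hφ0 s
    calc √(e t) ≤ √(e t + ε) := Real.sqrt_le_sqrt (by linarith)
      _ ≤ _ := h10
      _ ≤ _ := by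
        gcongr
        exact ht.2
  have hlim : Tendsto (fun ε : ℝ => Real.exp (k * T) * (√(e 0 + ε) + c * ∫ s in (0 : ℝ)..T, φ s))
      (𝓝[>] 0) (𝓝 (Real.exp (k * T) * (√(e 0 + 0) + c * ∫ s in (0 : ℝ)..T, φ s))) := by
    refine Tendsto.mono_left (Continuous.tendsto ?_ 0) nhdsWithin_le_nhds
    fun_prop
  rw [add_zero] at hlim
  exact ge_of_tendsto hlim (eventually_nhdsWithin_of_forall fun ε hε => key ε hε)

/-- A two-sided bound for the derivative allows the forward estimate to be applied to the reversed
time as well. -/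
lemma sqrt_le_of_abs_deriv_le {e e' φ : ℝ → ℝ} {k c T : ℝ} (hk : 0 ≤ k) (hc : 0 ≤ c)
    (he : ∀ t ∈ Icc (-T) T, 0 ≤ e t) (hφ : Continuous φ) (hφ0 : ∀ t, 0 ≤ φ t)
    (hd : ∀ t ∈ Icc (-T) T, HasDerivAt e (e' t) t)
    (hb : ∀ t ∈ Icc (-T) T, |e' t| ≤ 2 * k * e t + 2 * c * φ t * √(e t)) {t : ℝ}
    (ht : t ∈ Icc (-T) T) :
    √(e t) ≤ Real.exp (k * T) * (√(e 0) + c * ∫ s in (-T)..T, φ s) := by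
  have hT : 0 ≤ T := by linarith [ht.1.trans ht.2]
  rcases le_total 0 t with h | h
  · refine (sqrt_le_of_deriv_le (T := T) hk hc (fun s hs => he s ⟨by linarith [hs.1], hs.2⟩) hφ hφ0
      (fun s hs => hd s ⟨by linarith [hs.1], hs.2⟩)
      (fun s hs => (le_abs_self _).trans (hb s ⟨by linarith [hs.1], hs.2⟩)) ⟨h, ht.2⟩).trans ?_
    gcongr
    exact intervalIntegral.integral_mono_interval (by linarith) hT le_rfl
      (ae_of_all _ fun s => hφ0 s) (hφ.intervalIntegrable _ _)
  · have h1 := sqrt_le_of_deriv_le (e := fun s => e (-s)) (e' := fun s => -e' (-s))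
      (φ := fun s => φ (-s)) (T := T) (t := -t) hk hc
      (fun s hs => he _ ⟨by linarith [hs.2], by linarith [hs.1]⟩) (hφ.comp continuous_neg)
      (fun s => hφ0 _)
      (fun s hs => by
        have := (hd (-s) ⟨by linarith [hs.2], by linarith [hs.1]⟩).comp s (hasDerivAt_neg s)
        simpa using! this)
      (fun s hs => (neg_le_abs _).trans (hb _ ⟨by linarith [hs.2], by linarith [hs.1]⟩))
      ⟨by linarith, by linarith [ht.1]⟩
    simp only [neg_neg, neg_zero, intervalIntegral.integral_comp_neg] at h1
    refine h1.trans ?_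
    gcongr
    exact intervalIntegral.integral_mono_interval le_rfl (by linarith) hT
      (ae_of_all _ fun s => hφ0 s) (hφ.intervalIntegrable _ _)

/-! ### The equation with an additional mass on `V`: solvability and energy estimate -/

namespace WaveSystem

variable {V H : Type*} [NormedAddCommGroup V] [InnerProductSpace ℝ V]
    [NormedAddCommGroup H] [InnerProductSpace ℝ H] (S : WaveSystem V H)

lemma continuous_M : Continuous S.M :=
  continuous_iff_continuousAt.2 fun t => (S.hasDerivAt_M t).continuousAt

lemma continuous_B : Continuous S.B :=
  continuous_iff_continuousAt.2 fun t => (S.hasDerivAt_B t).continuousAt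

lemma continuous_A : Continuous S.A :=
  continuous_iff_continuousAt.2 fun t => (S.hasDerivAt_A t).continuousAt

variable [CompleteSpace V] [CompleteSpace H]

/-- `(v, w)` with `v' = w` solves the equation with the additional mass `δ` on `V`. -/
structure IsRegularized (δ T : ℝ) (F : ℝ → H) (v w w' : ℝ → V) : Prop where
  continuous_v : Continuous v
  continuous_w : Continuous w
  hasDerivAt_v : ∀ t ∈ Icc (-T) T, HasDerivAt v (w t) t
  hasDerivAt_w : ∀ t ∈ Icc (-T) T, HasDerivAt w (w' t) t
  equation : ∀ t ∈ Icc (-T) T, (S.ι†) (S.M t (S.ι (w' t))) + δ • w' t +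
    (S.ι†) (S.M' t (S.ι (w t)) + S.B' t (v t) + S.B t (w t)) =
      ((S.B t)†) (S.ι (w t)) - S.A t (v t) - (S.ι†) (S.M t (F t))

/-- The mass `δ` makes `ι† M ι + δ` coercive on `V`, hence invertible, with an inverse that is
continuous in time. The stiffness `A` is represented in `V` itself and so is bounded. Solving for
`w'` therefore yields a linear differential equation with bounded operators on `V × V`. -/
lemma exists_regularized {δ : ℝ} (hδ : 0 < δ) {F : ℝ → H} (hF : Continuous F) (v₀ w₀ : V) {T : ℝ}
    (hT : 0 < T) : ∃ v w w' : ℝ → V, v 0 = v₀ ∧ w 0 = w₀ ∧ S.IsRegularized δ T F v w w' := by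
  have hM := S.continuous_M
  have hB := S.continuous_B
  have hA := S.continuous_A
  have hM' := S.continuous_M'
  have hB' := S.continuous_B'
  let N : ℝ → V →L[ℝ] V := fun t =>
    (S.ι†).comp ((S.M t).comp S.ι) + δ • ContinuousLinearMap.id ℝ V
  have hN : Continuous N := by
    have : Continuous fun t => (S.ι†).comp ((S.M t).comp S.ι) := by fun_prop
    exact this.add continuous_const
  have hunit : ∀ t, IsUnit (N t) := fun t => by
    refine ContinuousLinearMap.isUnit_of_forall_le_norm_inner_map (𝕜 := ℝ) (N t) (c := δ.toNNReal)
      (Real.toNNReal_pos.2 hδ) fun x => ?_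
    have h1 : inner ℝ (N t x) x = inner ℝ (S.M t (S.ι x)) (S.ι x) + δ * ‖x‖ ^ 2 := by
      simp only [N, _root_.add_apply, ContinuousLinearMap.comp_apply,
        _root_.smul_apply, inner_add_left, ContinuousLinearMap.adjoint_inner_left,
        ContinuousLinearMap.id_apply, inner_smul_left, real_inner_self_eq_norm_sq]
      rfl
    have h2 : 0 ≤ inner ℝ (S.M t (S.ι x)) (S.ι x) :=
      le_trans (mul_nonneg S.lower_pos.le (sq_nonneg _)) (S.lower_M t _)
    rw [h1, Real.norm_eq_abs]
    refine le_trans ?_ (le_abs_self _)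
    rw [Real.coe_toNNReal _ hδ.le]
    linarith
  let R : ℝ → V →L[ℝ] V := fun t => Ring.inverse (N t)
  have hR : Continuous R := by
    refine continuous_iff_continuousAt.2 fun t => ?_
    have h1 := NormedRing.inverse_continuousAt (hunit t).unit
    rw [IsUnit.unit_spec] at h1
    exact h1.comp hN.continuousAt
  have hNR : ∀ t x, N t (R t x) = x := fun t x => by
    have := Ring.mul_inverse_cancel _ (hunit t)
    exact congrArg (fun L : V →L[ℝ] V => L x) this
  let Dw : ℝ → V →L[ℝ] V := fun t =>
    ((S.B t)†).comp S.ι - (S.ι†).comp ((S.M' t).comp S.ι + S.B t)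
  let Dv : ℝ → V →L[ℝ] V := fun t => - S.A t - (S.ι†).comp (S.B' t)
  have hadj : Continuous fun t => (S.B t)† :=
    (ContinuousLinearMap.adjoint (𝕜 := ℝ) (E := V) (F := H)).continuous.comp hB
  have hDw : Continuous Dw := by fun_prop
  have hDv : Continuous Dv := by fun_prop
  let G : ℝ → (V × V) →L[ℝ] (V × V) := fun t =>
    (ContinuousLinearMap.inl ℝ V V).comp (ContinuousLinearMap.snd ℝ V V) +
    (ContinuousLinearMap.inr ℝ V V).comp ((R t).comp
      ((Dv t).comp (ContinuousLinearMap.fst ℝ V V) + (Dw t).comp (ContinuousLinearMap.snd ℝ V V)))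
  have hG : Continuous G := by fun_prop
  let f : ℝ → V × V := fun t => (0, - R t ((S.ι†) (S.M t (F t))))
  have hf : Continuous f := by
    refine continuous_const.prodMk (hR.clm_apply ?_).neg
    exact (S.ι†).continuous.comp (hM.clm_apply hF)
  obtain ⟨y, hy, hy0, hyd⟩ := exists_hasDerivAt_linear hG hf (v₀, w₀) hT
  refine ⟨fun t => (y t).1, fun t => (y t).2,
    fun t => R t (Dv t (y t).1 + Dw t (y t).2 - (S.ι†) (S.M t (F t))), by simp [hy0], by simp [hy0],
    hy.fst, hy.snd, fun t ht => ?_, fun t ht => ?_, fun t ht => ?_⟩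
  · have := (ContinuousLinearMap.fst ℝ V V).hasFDerivAt.comp_hasDerivAt t (hyd t ht)
    simpa [G, f] using! this
  · have := (ContinuousLinearMap.snd ℝ V V).hasFDerivAt.comp_hasDerivAt t (hyd t ht)
    simp only [G, f] at this
    convert! this using 1
    simp [sub_eq_add_neg]
  · have h1 := hNR t (Dv t (y t).1 + Dw t (y t).2 - (S.ι†) (S.M t (F t)))
    have h2 : ∀ x, N t x = (S.ι†) (S.M t (S.ι x)) + δ • x := fun x => rfl
    rw [h2] at h1
    rw [h1]
    simp only [Dv, Dw, _root_.sub_apply, _root_.neg_apply,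
      ContinuousLinearMap.comp_apply, _root_.add_apply, map_add]
    abel

/-- A constant for the energy estimate. -/
def energyConst (m N : ℝ) : ℝ :=
  (√(2 / m) + √2) * (√(N + 1) + N * √(2 / m))

variable {S}

/-- This is the energy estimate. The energy controls `m ‖v‖²`, `m ‖ι w‖²` and `δ ‖w‖²`, and its
derivative involves only `M'`, `A'`, `B'` and the source. The growth rate is therefore `rate /
lower`, and the constants do not depend on `δ`. -/
lemma IsRegularized.bounds {δ T : ℝ} (hδ : 0 < δ) {F : ℝ → H} (hF : Continuous F)
    {v w w' : ℝ → V} (h : S.IsRegularized δ T F v w w') {t : ℝ} (ht : t ∈ Icc (-T) T) {K : ℝ}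
    (hK : energyConst S.lower S.upper * Real.exp (S.rate / S.lower * T) *
      (‖v 0‖ + ‖S.ι (w 0)‖ + √δ * ‖w 0‖ + ∫ s in (-T)..T, ‖F s‖) ≤ K) :
    ‖v t‖ ≤ K ∧ ‖S.ι (w t)‖ ≤ K ∧ √δ * ‖w t‖ ≤ K := by
  have hT : 0 ≤ T := by linarith [ht.1.trans ht.2]
  set m := S.lower with hm
  have hm0 : 0 < m := S.lower_pos
  have hN0 := S.upper_nonneg
  have hk0 := S.rate_nonneg
  let e : ℝ → ℝ := fun s => (inner ℝ (S.M s (S.ι (w s))) (S.ι (w s)) + δ * ‖w s‖ ^ 2 +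
    inner ℝ (S.A s (v s)) (v s)) / 2
  have he_lower : ∀ s, m * ‖S.ι (w s)‖ ^ 2 + δ * ‖w s‖ ^ 2 + m * ‖v s‖ ^ 2 ≤ 2 * e s := by
    intro s
    have h1 := S.lower_M s (S.ι (w s))
    have h2 := S.lower_A s (v s)
    simp only [e]
    linarith
  have he0 : ∀ s, 0 ≤ e s := fun s => by
    have := he_lower s
    have h1 : 0 ≤ m * ‖S.ι (w s)‖ ^ 2 + δ * ‖w s‖ ^ 2 + m * ‖v s‖ ^ 2 := by positivity
    linarith
  have hv : ∀ s, ‖v s‖ ≤ √(2 / m) * √(e s) := fun s => by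
    rw [← Real.sqrt_mul (by positivity)]
    refine Real.le_sqrt_of_sq_le ?_
    rw [div_mul_eq_mul_div, le_div_iff₀ hm0]
    have h1 : 0 ≤ m * ‖S.ι (w s)‖ ^ 2 + δ * ‖w s‖ ^ 2 := by positivity
    linarith [he_lower s]
  have hw : ∀ s, ‖S.ι (w s)‖ ≤ √(2 / m) * √(e s) := fun s => by
    rw [← Real.sqrt_mul (by positivity)]
    refine Real.le_sqrt_of_sq_le ?_
    rw [div_mul_eq_mul_div, le_div_iff₀ hm0]
    have h1 : 0 ≤ m * ‖v s‖ ^ 2 + δ * ‖w s‖ ^ 2 := by positivity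
    linarith [he_lower s]
  have hw' : ∀ s, √δ * ‖w s‖ ≤ √2 * √(e s) := fun s => by
    rw [← Real.sqrt_mul (by positivity)]
    refine Real.le_sqrt_of_sq_le ?_
    rw [mul_pow, Real.sq_sqrt hδ.le]
    have h1 : 0 ≤ m * ‖S.ι (w s)‖ ^ 2 + m * ‖v s‖ ^ 2 := by positivity
    linarith [he_lower s]
  -- Obtained by pairing the equation with `w`. The term `⟨B w, ι w⟩` occurs on both sides and
  -- cancels, and the symmetry of `M` and `A` takes care of the products with `w'` and `w`.
  let e' : ℝ → ℝ := fun s => - inner ℝ (S.M' s (S.ι (w s))) (S.ι (w s)) / 2 -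
    inner ℝ (S.B' s (v s)) (S.ι (w s)) + inner ℝ (S.A' s (v s)) (v s) / 2 -
    inner ℝ (S.M s (F s)) (S.ι (w s))
  have hd : ∀ s ∈ Icc (-T) T, HasDerivAt e (e' s) s := by
    intro s hs
    have hws := h.hasDerivAt_w s hs
    have hvs := h.hasDerivAt_v s hs
    have hιw : HasDerivAt (fun s => S.ι (w s)) (S.ι (w' s)) s :=
      S.ι.hasFDerivAt.comp_hasDerivAt s hws
    have h1 := ((S.hasDerivAt_M s).clm_apply hιw).inner ℝ hιw
    have h2 := (hws.inner ℝ hws).const_mul δ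
    have h3 := ((S.hasDerivAt_A s).clm_apply hvs).inner ℝ hvs
    have h4 := ((h1.add h2).add h3).div_const 2
    have h5 : e = fun s => (inner ℝ (S.M s (S.ι (w s))) (S.ι (w s)) + δ * inner ℝ (w s) (w s) +
        inner ℝ (S.A s (v s)) (v s)) / 2 := by
      ext s; simp only [e, real_inner_self_eq_norm_sq]
    rw [h5]
    refine h4.congr_deriv ?_
    have h6 := congrArg (fun x => inner ℝ x (w s)) (h.equation s hs)
    simp only [inner_add_left, inner_sub_left, ContinuousLinearMap.adjoint_inner_left,
      inner_smul_left, RCLike.conj_to_real] at h6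
    have h7 := S.symm_M s (S.ι (w s)) (S.ι (w' s))
    have h8 := S.symm_A s (v s) (w s)
    simp only [inner_add_left, e']
    have h9 := real_inner_comm (w s) (w' s)
    have h10 := real_inner_comm (v s) (S.A s (w s))
    have h11 := real_inner_comm (S.B s (w s)) (S.ι (w s))
    have h12 := real_inner_comm (S.ι (w s)) (S.M s (S.ι (w' s)))
    rw [h9] at h6 ⊢
    linarith
  have hb : ∀ s ∈ Icc (-T) T, |e' s| ≤ 2 * (S.rate / m) * e s +
      2 * (S.upper * √(2 / m)) * ‖F s‖ * √(e s) := by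
    intro s hs
    have h1 := abs_inner_clm_le _ (S.rate_M s) (S.ι (w s)) (S.ι (w s))
    have h2 := abs_inner_clm_le _ (S.rate_B s) (v s) (S.ι (w s))
    have h3 := abs_inner_clm_le _ (S.rate_A s) (v s) (v s)
    have h4 := abs_inner_clm_le _ (S.upper_M s) (F s) (S.ι (w s))
    have h5 : S.upper * ‖F s‖ * ‖S.ι (w s)‖ ≤ S.upper * ‖F s‖ * (√(2 / m) * √(e s)) := by
      gcongr; exact hw s
    have h6 : S.rate * (‖S.ι (w s)‖ ^ 2 + ‖v s‖ ^ 2) ≤ 2 * (S.rate / m) * e s := by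
      have : ‖S.ι (w s)‖ ^ 2 + ‖v s‖ ^ 2 ≤ 2 * e s / m := by
        rw [le_div_iff₀ hm0]
        have h1 : 0 ≤ δ * ‖w s‖ ^ 2 := by positivity
        linarith [he_lower s]
      calc S.rate * (‖S.ι (w s)‖ ^ 2 + ‖v s‖ ^ 2) ≤ S.rate * (2 * e s / m) := by gcongr
        _ = _ := by ring
    have h7 : 0 ≤ S.upper * √(2 / m) * ‖F s‖ * √(e s) := by positivity
    have h8 : S.rate * ‖v s‖ * ‖S.ι (w s)‖ ≤ S.rate * ((‖S.ι (w s)‖ ^ 2 + ‖v s‖ ^ 2) / 2) := by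
      rw [mul_assoc]
      gcongr
      nlinarith [sq_nonneg (‖v s‖ - ‖S.ι (w s)‖)]
    rw [abs_le] at h1 h2 h3 h4 ⊢
    simp only [e']
    constructor <;> nlinarith
  have hE := sqrt_le_of_abs_deriv_le (k := S.rate / m) (c := S.upper * √(2 / m)) (φ := fun s => ‖F s‖)
    (by positivity) (by positivity) (fun s _ => he0 s) hF.norm (fun s => norm_nonneg _) hd hb ht
  have hI : 0 ≤ ∫ s in (-T)..T, ‖F s‖ :=
    intervalIntegral.integral_nonneg (by linarith) fun s _ => norm_nonneg _
  have hE0 : √(e 0) ≤ √(S.upper + 1) * (‖v 0‖ + ‖S.ι (w 0)‖ + √δ * ‖w 0‖) := by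
    rw [Real.sqrt_le_left (by positivity), mul_pow, Real.sq_sqrt (by positivity)]
    have h1 := (le_abs_self _).trans (abs_inner_clm_le _ (S.upper_M 0) (S.ι (w 0)) (S.ι (w 0)))
    have h2 := (le_abs_self _).trans (abs_inner_clm_le _ (S.upper_A 0) (v 0) (v 0))
    have h3 : (√δ * ‖w 0‖) ^ 2 = δ * ‖w 0‖ ^ 2 := by rw [mul_pow, Real.sq_sqrt hδ.le]
    set p := ‖v 0‖
    set q := ‖S.ι (w 0)‖
    set r := √δ * ‖w 0‖
    have hp : 0 ≤ p := norm_nonneg _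
    have hq : 0 ≤ q := norm_nonneg _
    have hr : 0 ≤ r := by positivity
    have h4 : e 0 ≤ (S.upper + 1) * (p ^ 2 + q ^ 2 + r ^ 2) := by
      simp only [e]
      rw [← h3]
      nlinarith [sq_nonneg p, sq_nonneg q, sq_nonneg r, mul_nonneg hN0 (sq_nonneg r),
        mul_nonneg hN0 (sq_nonneg p), mul_nonneg hN0 (sq_nonneg q)]
    refine h4.trans ?_
    gcongr
    nlinarith [mul_nonneg hp hq, mul_nonneg hp hr, mul_nonneg hq hr]
  set X := ‖v 0‖ + ‖S.ι (w 0)‖ + √δ * ‖w 0‖ + ∫ s in (-T)..T, ‖F s‖ with hX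
  have hX0 : 0 ≤ X := by positivity
  have hsum : √(e 0) + S.upper * √(2 / m) * ∫ s in (-T)..T, ‖F s‖ ≤
      (√(S.upper + 1) + S.upper * √(2 / m)) * X := by
    have h1 : √(S.upper + 1) * (‖v 0‖ + ‖S.ι (w 0)‖ + √δ * ‖w 0‖) ≤ √(S.upper + 1) * X := by
      gcongr; linarith
    have h2 : S.upper * √(2 / m) * ∫ s in (-T)..T, ‖F s‖ ≤ S.upper * √(2 / m) * X := by
      gcongr
      have : 0 ≤ ‖v 0‖ + ‖S.ι (w 0)‖ + √δ * ‖w 0‖ := by positivity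
      linarith
    linarith
  have hfin : (√(2 / m) + √2) * √(e t) ≤ K := by
    refine le_trans ?_ hK
    calc (√(2 / m) + √2) * √(e t) ≤ (√(2 / m) + √2) * (Real.exp (S.rate / m * T) *
          ((√(S.upper + 1) + S.upper * √(2 / m)) * X)) := by
          gcongr
          refine hE.trans ?_
          gcongr
      _ = _ := by rw [energyConst]; ring
  have h1 : 0 ≤ √2 * √(e t) := by positivity
  have h2 : 0 ≤ √(2 / m) * √(e t) := by positivity
  rw [add_mul] at hfin
  exact ⟨(hv t).trans (by linarith), (hw t).trans (by linarith), (hw' t).trans (by linarith)⟩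

end WaveSystem

end AAdS

namespace AAdS

open scoped InnerProduct

/-! ### Existence of mild solutions -/

lemma eq_add_integral_of_hasDerivAt {E : Type*} [NormedAddCommGroup E] [NormedSpace ℝ E]
    [CompleteSpace E] {f f' : ℝ → E} {T : ℝ} (hd : ∀ t ∈ Icc (-T) T, HasDerivAt f (f' t) t)
    (hf' : Continuous f') {t : ℝ} (ht : t ∈ Icc (-T) T) :
    f t = f 0 + ∫ s in (0 : ℝ)..t, f' s := by
  have h0 : (0 : ℝ) ∈ Icc (-T) T := by constructor <;> linarith [ht.1.trans ht.2]
  rw [intervalIntegral.integral_eq_sub_of_hasDerivAt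
    (fun s hs => hd s (uIcc_subset_Icc h0 ht hs)) (hf'.intervalIntegrable _ _)]
  abel

namespace WaveSystem

variable {V H : Type*} [NormedAddCommGroup V] [InnerProductSpace ℝ V] [CompleteSpace V]
    [NormedAddCommGroup H] [InnerProductSpace ℝ H] [CompleteSpace H] (S : WaveSystem V H)

/-- The momentum `M w + B v`, represented in `V`. -/
def momentum (t : ℝ) (v : V) (w : H) : V := (S.ι†) (S.M t w + S.B t v)

/-- The time derivative of the momentum. -/
def force (t : ℝ) (v : V) (w f : H) : V :=
  ((S.B t)†) w - S.A t v - (S.ι†) (S.M t f)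

/-- Solutions of the integrated equations. -/
structure IsMildSolution (T : ℝ) (v₀ : V) (v₁ : H) (F : ℝ → H) (v : ℝ → V) (w : ℝ → H) :
    Prop where
  memLp : MemLp v 2 (timeMeasure T)
  memLp_deriv : MemLp w 2 (timeMeasure T)
  position : ∀ᵐ t ∂(timeMeasure T), S.ι (v t) = S.ι v₀ + ∫ s in (0 : ℝ)..t, w s
  momentum : ∀ᵐ t ∂(timeMeasure T), S.momentum t (v t) (w t) = S.momentum 0 v₀ v₁ +
    ∫ s in (0 : ℝ)..t, S.force s (v s) (w s) (F s)

lemma continuous_adjoint_B : Continuous fun t => (S.B t)† :=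
  (ContinuousLinearMap.adjoint (𝕜 := ℝ) (E := V) (F := H)).continuous.comp S.continuous_B

lemma IsRegularized.momentum_eq {S : WaveSystem V H} {δ T : ℝ} {F : ℝ → H} (hF : Continuous F)
    {v w w' : ℝ → V} (h : S.IsRegularized δ T F v w w') {t : ℝ} (ht : t ∈ Icc (-T) T) :
    S.momentum t (v t) (S.ι (w t)) + δ • w t = S.momentum 0 (v 0) (S.ι (w 0)) + δ • w 0 +
      ∫ s in (0 : ℝ)..t, S.force s (v s) (S.ι (w s)) (F s) := by
  have hv := h.continuous_v
  have hw := h.continuous_w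
  have hM := S.continuous_M
  have hA := S.continuous_A
  have hB := S.continuous_adjoint_B
  refine eq_add_integral_of_hasDerivAt (f := fun t => S.momentum t (v t) (S.ι (w t)) + δ • w t)
    (fun s hs => ?_) ?_ ht
  · have h1 := h.hasDerivAt_v s hs
    have h2 := h.hasDerivAt_w s hs
    have h3 : HasDerivAt (fun s => S.ι (w s)) (S.ι (w' s)) s :=
      S.ι.hasFDerivAt.comp_hasDerivAt s h2
    have h4 := ((S.hasDerivAt_M s).clm_apply h3).add ((S.hasDerivAt_B s).clm_apply h1)
    have h5 := ((S.ι†).hasFDerivAt.comp_hasDerivAt s h4).add (h2.const_smul δ)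
    refine h5.congr_deriv ?_
    rw [force, ← h.equation s hs]
    simp only [map_add]
    abel
  · unfold force
    fun_prop

lemma integrable_clm {E G : Type*} [NormedAddCommGroup E] [NormedSpace ℝ E]
    [NormedAddCommGroup G] [NormedSpace ℝ G] {T : ℝ} {f : ℝ → E}
    (hf : Integrable f (timeMeasure T)) {U : ℝ → E →L[ℝ] G} (hU : Continuous U) :
    Integrable (fun t => U t (f t)) (timeMeasure T) := by
  have h1 := memLp_one_iff_integrable.2 hf
  have := (ContinuousLinearMap.id ℝ (E →L[ℝ] G)).memLp_of_bilin (r := 1)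
    (memLp_time_of_continuous hU T ∞) h1
  exact memLp_one_iff_integrable.1 this

lemma integrable_force {T : ℝ} {v : ℝ → V} {w F : ℝ → H} (hv : Integrable v (timeMeasure T))
    (hw : Integrable w (timeMeasure T)) (hF : Integrable F (timeMeasure T)) :
    Integrable (fun t => S.force t (v t) (w t) (F t)) (timeMeasure T) := by
  have hM : Continuous fun t => (S.ι†).comp (S.M t) := continuous_const.clm_comp S.continuous_M
  exact ((integrable_clm hw S.continuous_adjoint_B).sub (integrable_clm hv S.continuous_A)).sub
    (integrable_clm hF hM)

/-- Regularised solutions with a continuous source and an initial velocity in `V` converge weakly,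
with the mass tending to zero. Every term of the integrated equations is either the image of the
unknowns under a fixed bounded operator or converges in norm, so the equations pass to the limit.
The pointwise bounds pass to the limit by `ae_norm_le_of_weakTendsto`. -/
theorem exists_isMildSolution {T : ℝ} (hT : 0 < T) (v₀ : V) (v₁ : H) {F : ℝ → H}
    (hF : Integrable F (timeMeasure T)) {K : ℝ}
    (hK : K = energyConst S.lower S.upper * Real.exp (S.rate / S.lower * T) *
      (‖v₀‖ + ‖v₁‖ + ∫ t, ‖F t‖ ∂(timeMeasure T))) :
    ∃ v w, S.IsMildSolution T v₀ v₁ F v w ∧ (∀ᵐ t ∂(timeMeasure T), ‖v t‖ ≤ K) ∧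
      ∀ᵐ t ∂(timeMeasure T), ‖w t‖ ≤ K := by
  have hεpos : ∀ k : ℕ, (0 : ℝ) < 1 / ((k : ℝ) + 1) := fun k => Nat.one_div_pos_of_nat
  have hε := tendsto_one_div_add_atTop_nhds_zero_nat (𝕜 := ℝ)
  have hFk : ∀ k : ℕ, ∃ G : ℝ → H, Continuous G ∧ Integrable G (timeMeasure T) ∧
      ∫ t, ‖F t - G t‖ ∂(timeMeasure T) ≤ 1 / ((k : ℝ) + 1) := fun k => by
    obtain ⟨G, -, h1, h2, h3⟩ := hF.exists_hasCompactSupport_integral_sub_le (hεpos k)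
    exact ⟨G, h2, h3, h1⟩
  choose G hGc hGi hG using hFk
  have hwk : ∀ k : ℕ, ∃ x : V, ‖S.ι x - v₁‖ < 1 / ((k : ℝ) + 1) := fun k => by
    obtain ⟨x, hx⟩ := S.dense.exists_dist_lt v₁ (hεpos k)
    exact ⟨x, by rwa [← dist_eq_norm, dist_comm]⟩
  choose w₀ hw₀ using hwk
  -- The approximations `w₀ k` of `v₁` converge only in `H` and may be unbounded in `V`. This choice
  -- forces both `r k` and `r k * ‖w₀ k‖` to zero; the mass is `r k ^ 2`, so the initial energy of
  -- the added mass disappears.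
  let r : ℕ → ℝ := fun k => 1 / ((k : ℝ) + 1) / (1 + ‖w₀ k‖)
  have hr : ∀ k, 0 < r k := fun k => by have := hεpos k; positivity
  have hr1 : ∀ k, r k ≤ 1 / ((k : ℝ) + 1) := fun k =>
    div_le_self (hεpos k).le (by linarith [norm_nonneg (w₀ k)])
  have hr2 : ∀ k, r k * ‖w₀ k‖ ≤ 1 / ((k : ℝ) + 1) := fun k => by
    have h1 := norm_nonneg (w₀ k)
    simp only [r]
    rw [div_mul_eq_mul_div, div_le_iff₀ (by linarith)]
    exact mul_le_mul_of_nonneg_left (by linarith) (hεpos k).le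
  have hr0 : Tendsto r atTop (𝓝 0) :=
    squeeze_zero (fun k => (hr k).le) hr1 hε
  choose v w w' hv0 hw0 hreg using fun k => S.exists_regularized (δ := r k ^ 2)
    (by have := hr k; positivity) (hGc k) v₀ (w₀ k) hT
  let Kk : ℕ → ℝ := fun k => energyConst S.lower S.upper * Real.exp (S.rate / S.lower * T) *
      (‖v₀‖ + ‖S.ι (w₀ k)‖ + r k * ‖w₀ k‖ + ∫ t, ‖G k t‖ ∂(timeMeasure T))
  have hbound : ∀ k, ∀ t ∈ Icc (-T) T,
      ‖v k t‖ ≤ Kk k ∧ ‖S.ι (w k t)‖ ≤ Kk k ∧ r k * ‖w k t‖ ≤ Kk k := by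
    intro k t ht
    have h1 : √(r k ^ 2) = r k := Real.sqrt_sq (hr k).le
    have := (hreg k).bounds (by have := hr k; positivity) (hGc k) ht (K := Kk k) (by
      rw [hv0, hw0, h1, intervalIntegral.integral_of_le (by linarith),
        integral_Ioc_eq_integral_Ioo])
    rwa [h1] at this
  have hw₀lim : Tendsto (fun k => S.ι (w₀ k)) atTop (𝓝 v₁) := by
    rw [tendsto_iff_norm_sub_tendsto_zero]
    exact squeeze_zero (fun k => norm_nonneg _) (fun k => (hw₀ k).le) hε
  have hGlim : Tendsto (fun k => ∫ t, ‖G k t‖ ∂(timeMeasure T)) atTop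
      (𝓝 (∫ t, ‖F t‖ ∂(timeMeasure T))) := by
    rw [tendsto_iff_norm_sub_tendsto_zero]
    refine squeeze_zero (fun k => norm_nonneg _) (fun k => ?_) hε
    rw [← integral_sub (hGi k).norm hF.norm]
    refine (norm_integral_le_integral_norm _).trans (le_trans ?_ (hG k))
    refine integral_mono ((hGi k).norm.sub hF.norm).norm (hF.sub (hGi k)).norm fun t => ?_
    rw [norm_sub_rev (F t)]
    exact abs_norm_sub_norm_le _ _
  have hKlim : Tendsto Kk atTop (𝓝 K) := by
    have h1 : Tendsto (fun k => r k * ‖w₀ k‖) atTop (𝓝 0) :=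
      squeeze_zero (fun k => mul_nonneg (hr k).le (norm_nonneg _)) hr2 hε
    have := (((tendsto_const_nhds (x := ‖v₀‖)).add hw₀lim.norm).add h1).add hGlim
    rw [hK]
    convert this.const_mul (energyConst S.lower S.upper * Real.exp (S.rate / S.lower * T)) using 2
    ring
  obtain ⟨C, hC⟩ : ∃ C, ∀ k, Kk k ≤ C := by
    obtain ⟨C, hC⟩ := hKlim.bddAbove_range
    exact ⟨C, fun k => hC ⟨k, rfl⟩⟩
  have hmem : ∀ᵐ t ∂(timeMeasure T), t ∈ Icc (-T) T := by
    filter_upwards [ae_restrict_mem measurableSet_Ioo] with t ht using Ioo_subset_Icc_self ht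
  have h0 : (0 : ℝ) ∈ Icc (-T) T := by constructor <;> linarith
  have hC0 : 0 ≤ C := (norm_nonneg _).trans ((hbound 0 0 h0).1.trans (hC 0))
  have hwc : ∀ k, Continuous fun t => S.ι (w k t) := fun k =>
    S.ι.continuous.comp (hreg k).continuous_w
  have hvL := fun k => memLp_time_of_continuous (hreg k).continuous_v T 2
  have hwL := fun k => memLp_time_of_continuous (hwc k) T 2
  let x : ℕ → Lp V 2 (timeMeasure T) := fun k => (hvL k).toLp
  let y : ℕ → Lp H 2 (timeMeasure T) := fun k => (hwL k).toLp
  have hx : ∀ k, x k =ᵐ[timeMeasure T] v k := fun k => (hvL k).coeFn_toLp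
  have hy : ∀ k, y k =ᵐ[timeMeasure T] fun t => S.ι (w k t) := fun k => (hwL k).coeFn_toLp
  have hxb : ∀ k, ∀ᵐ t ∂(timeMeasure T), ‖x k t‖ ≤ Kk k := fun k => by
    filter_upwards [hx k, hmem] with t h1 h2
    rw [h1]; exact (hbound k t h2).1
  have hyb : ∀ k, ∀ᵐ t ∂(timeMeasure T), ‖y k t‖ ≤ Kk k := fun k => by
    filter_upwards [hy k, hmem] with t h1 h2
    rw [h1]; exact (hbound k t h2).2.1
  -- One ultrafilter gives simultaneous weak limits of positions and velocities, and it is finer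
  -- than the convergence of the data.
  let l : Ultrafilter ℕ := hyperfilter ℕ
  have hl : (l : Filter ℕ) ≤ atTop := Nat.hyperfilter_le_atTop
  obtain ⟨x₀, hx₀⟩ := exists_weakTendsto x
    (C := (measureUnivNNReal (timeMeasure T) : ℝ) ^ (2 : ℝ≥0∞).toReal⁻¹ * C)
    (fun k => Lp.norm_le_of_ae_bound hC0 ((hxb k).mono fun t h => h.trans (hC k))) l
  obtain ⟨y₀, hy₀⟩ := exists_weakTendsto y
    (C := (measureUnivNNReal (timeMeasure T) : ℝ) ^ (2 : ℝ≥0∞).toReal⁻¹ * C)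
    (fun k => Lp.norm_le_of_ae_bound hC0 ((hyb k).mono fun t h => h.trans (hC k))) l
  obtain ⟨PH, hPH⟩ := exists_primitive_clm (E := H) hT
  obtain ⟨PV, hPV⟩ := exists_primitive_clm (E := V) hT
  obtain ⟨Li, hLi⟩ := exists_pointwise_clm T (U := fun _ => S.ι) continuous_const
  have hMc : Continuous fun t => (S.ι†).comp (S.M t) := continuous_const.clm_comp S.continuous_M
  have hBc : Continuous fun t => (S.ι†).comp (S.B t) := continuous_const.clm_comp S.continuous_B
  obtain ⟨LM, hLM⟩ := exists_pointwise_clm T hMc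
  obtain ⟨LB, hLB⟩ := exists_pointwise_clm T hBc
  obtain ⟨LBt, hLBt⟩ := exists_pointwise_clm T S.continuous_adjoint_B
  obtain ⟨LA, hLA⟩ := exists_pointwise_clm T S.continuous_A
  have hpos : Li x₀ = (memLp_const (S.ι v₀)).toLp + PH y₀ := by
    have h1 : WeakTendsto (fun k => Li (x k)) l (Li x₀) := hx₀.clm Li
    have h2 : WeakTendsto (fun k => (memLp_const (S.ι v₀)).toLp + PH (y k)) l
        ((memLp_const (S.ι v₀)).toLp + PH y₀) :=
      (weakTendsto_of_tendsto tendsto_const_nhds).add (hy₀.clm PH)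
    refine h1.unique ?_
    convert! h2 using 2 with k
    refine Lp.ext ?_
    filter_upwards [hLi (x k), hx k, Lp.coeFn_add ((memLp_const (S.ι v₀)).toLp) (PH (y k)),
      (memLp_const (p := 2) (μ := timeMeasure T) (S.ι v₀)).coeFn_toLp, hPH (y k), hmem]
      with t h1 h2 h3 h4 h5 h6
    rw [h1, h2, h3, Pi.add_apply, h4, h5, intervalIntegral_congr_time (hy k) h0 h6]
    have := eq_add_integral_of_hasDerivAt (f := fun t => S.ι (v k t))
      (fun s hs => S.ι.hasFDerivAt.comp_hasDerivAt s ((hreg k).hasDerivAt_v s hs)) (hwc k) h6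
    simpa only [hv0] using this
  have hMF : Integrable (fun t => (S.ι†) (S.M t (F t))) (timeMeasure T) := integrable_clm hF hMc
  have hMG : ∀ k, Integrable (fun t => (S.ι†) (S.M t (G k t))) (timeMeasure T) := fun k =>
    integrable_clm (hGi k) hMc
  -- The source is only integrable in time, so it cannot be passed through the integration operator
  -- on square integrable functions. Its primitive is bounded and is kept with the known terms.
  have hcL : MemLp (fun t => S.momentum 0 v₀ v₁ - ∫ s in (0 : ℝ)..t, (S.ι†) (S.M s (F s))) 2
      (timeMeasure T) := (memLp_const _).sub (memLp_primitive hT hMF 2)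
  have hckL : ∀ k, MemLp (fun t => (S.momentum 0 v₀ (S.ι (w₀ k)) + r k ^ 2 • w₀ k -
      ∫ s in (0 : ℝ)..t, (S.ι†) (S.M s (G k s))) - r k ^ 2 • w k t) 2 (timeMeasure T) := fun k =>
    ((memLp_const _).sub (memLp_primitive hT (hMG k) 2)).sub
      (memLp_time_of_continuous (continuous_const.smul (hreg k).continuous_w) T 2)
  -- The known terms converge uniformly in time. The remainder of the regularisation satisfies `‖r²
  -- w‖ = r (r ‖w‖) ≤ r K`, by the third bound of the energy estimate.
  have hclim : Tendsto (fun k => (hckL k).toLp) l (𝓝 hcL.toLp) := by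
    refine Tendsto.mono_left ?_ hl
    rw [tendsto_iff_norm_sub_tendsto_zero]
    let D : ℕ → ℝ := fun k => ‖S.ι†‖ * S.upper * ‖S.ι (w₀ k) - v₁‖ + r k * (1 / ((k : ℝ) + 1)) +
      ‖S.ι†‖ * S.upper * (1 / ((k : ℝ) + 1)) + r k * Kk k
    have hup := S.upper_nonneg
    have hD0 : ∀ k, 0 ≤ D k := fun k => by
      have h1 := hεpos k
      have h2 := (hr k).le
      have h3 : 0 ≤ Kk k := (norm_nonneg _).trans (hbound k 0 h0).1
      positivity
    have hD : Tendsto D atTop (𝓝 0) := by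
      have h1 := (tendsto_iff_norm_sub_tendsto_zero.1 hw₀lim).const_mul (‖S.ι†‖ * S.upper)
      have h2 := hr0.mul hε
      have h3 := hε.const_mul (‖S.ι†‖ * S.upper)
      have h4 := hr0.mul hKlim
      have h5 := ((h1.add h2).add h3).add h4
      simp only [mul_zero, zero_mul, add_zero] at h5
      exact h5
    refine squeeze_zero (fun k => norm_nonneg _) (fun k => Lp.norm_le_of_ae_bound (hD0 k) ?_)
      (by
        have h5 := hD.const_mul ((measureUnivNNReal (timeMeasure T) : ℝ) ^ (2 : ℝ≥0∞).toReal⁻¹)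
        rwa [mul_zero] at h5)
    filter_upwards [Lp.coeFn_sub ((hckL k).toLp) (hcL.toLp), (hckL k).coeFn_toLp, hcL.coeFn_toLp,
      hmem] with t h1 h2 h3 h4
    rw [h1, Pi.sub_apply, h2, h3]
    have e1 : (S.momentum 0 v₀ (S.ι (w₀ k)) + r k ^ 2 • w₀ k -
        ∫ s in (0 : ℝ)..t, (S.ι†) (S.M s (G k s))) - r k ^ 2 • w k t -
        (S.momentum 0 v₀ v₁ - ∫ s in (0 : ℝ)..t, (S.ι†) (S.M s (F s))) =
        (S.ι†) (S.M 0 (S.ι (w₀ k) - v₁)) + r k ^ 2 • w₀ k +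
        (∫ s in (0 : ℝ)..t, (S.ι†) (S.M s (F s - G k s))) - r k ^ 2 • w k t := by
      have e2 : ∫ s in (0 : ℝ)..t, (S.ι†) (S.M s (F s - G k s)) =
          (∫ s in (0 : ℝ)..t, (S.ι†) (S.M s (F s))) -
          ∫ s in (0 : ℝ)..t, (S.ι†) (S.M s (G k s)) := by
        rw [← intervalIntegral.integral_sub (intervalIntegrable_of_integrable_time hMF h4 h0)
          (intervalIntegrable_of_integrable_time (hMG k) h4 h0)]
        simp only [map_sub]
      rw [e2]
      simp only [WaveSystem.momentum, map_add, map_sub]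
      abel
    rw [e1]
    have b0 : ∀ s z, ‖(S.ι†) (S.M s z)‖ ≤ ‖S.ι†‖ * S.upper * ‖z‖ := fun s z => by
      rw [mul_assoc]
      refine ((S.ι†).le_opNorm _).trans ?_
      gcongr
      exact ((S.M s).le_opNorm _).trans (by gcongr; exact S.upper_M s)
    have b1 : ‖∫ s in (0 : ℝ)..t, (S.ι†) (S.M s (F s - G k s))‖ ≤
        ‖S.ι†‖ * S.upper * (1 / ((k : ℝ) + 1)) := by
      refine (norm_intervalIntegral_le_time (integrable_clm (hF.sub (hGi k)) hMc) h4 h0).trans ?_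
      calc _ ≤ ∫ s, ‖S.ι†‖ * S.upper * ‖F s - G k s‖ ∂(timeMeasure T) := by
            refine integral_mono (integrable_clm (hF.sub (hGi k)) hMc).norm
              ((hF.sub (hGi k)).norm.const_mul _) fun s => b0 s _
        _ ≤ _ := by
          rw [integral_const_mul]
          gcongr
          exact hG k
    have b2 : ‖r k ^ 2 • w₀ k‖ ≤ r k * (1 / ((k : ℝ) + 1)) := by
      rw [norm_smul, Real.norm_eq_abs, abs_of_nonneg (sq_nonneg _), pow_two, mul_assoc]
      exact mul_le_mul_of_nonneg_left (hr2 k) (hr k).le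
    have b3 : ‖r k ^ 2 • w k t‖ ≤ r k * Kk k := by
      rw [norm_smul, Real.norm_eq_abs, abs_of_nonneg (sq_nonneg _), pow_two, mul_assoc]
      exact mul_le_mul_of_nonneg_left (hbound k t h4).2.2 (hr k).le
    exact (norm_sub_le _ _).trans (add_le_add ((norm_add_le _ _).trans (add_le_add
      ((norm_add_le _ _).trans (add_le_add (b0 0 _) b2)) b1)) b3)
  have hmom : LM y₀ + LB x₀ = hcL.toLp + PV (LBt y₀ + (-LA) x₀) := by
    have h1 : WeakTendsto (fun k => LM (y k) + LB (x k)) l (LM y₀ + LB x₀) :=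
      (hy₀.clm LM).add (hx₀.clm LB)
    have h2 : WeakTendsto (fun k => (hckL k).toLp + PV (LBt (y k) + (-LA) (x k))) l
        (hcL.toLp + PV (LBt y₀ + (-LA) x₀)) :=
      (weakTendsto_of_tendsto hclim).add (((hy₀.clm LBt).add (hx₀.clm (-LA))).clm PV)
    refine h1.unique ?_
    convert! h2 using 2 with k
    refine Lp.ext ?_
    have e0 : (LBt (y k) + (-LA) (x k) : Lp V 2 (timeMeasure T)) =ᵐ[timeMeasure T]
        fun t => ((S.B t)†) (S.ι (w k t)) - S.A t (v k t) := by
      filter_upwards [Lp.coeFn_add (LBt (y k)) ((-LA) (x k)), Lp.coeFn_neg (LA (x k)), hLBt (y k),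
        hLA (x k), hx k, hy k] with t h1 h2 h3 h4 h5 h6
      rw [h1, Pi.add_apply, _root_.neg_apply, h2, Pi.neg_apply, h3, h4, h5, h6, sub_eq_add_neg]
    filter_upwards [Lp.coeFn_add (LM (y k)) (LB (x k)), hLM (y k), hLB (x k), hx k, hy k,
      Lp.coeFn_add ((hckL k).toLp) (PV (LBt (y k) + (-LA) (x k))), (hckL k).coeFn_toLp,
      hPV (LBt (y k) + (-LA) (x k)), hmem] with t h1 h2 h3 h4 h5 h6 h7 h8 h9
    rw [h1, Pi.add_apply, h2, h3, h4, h5, h6, Pi.add_apply, h7, h8,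
      intervalIntegral_congr_time e0 h0 h9]
    have e1 := (hreg k).momentum_eq (hGc k) h9
    rw [hv0, hw0] at e1
    have e2 : ∫ s in (0 : ℝ)..t, S.force s (v k s) (S.ι (w k s)) (G k s) =
        (∫ s in (0 : ℝ)..t, (((S.B s)†) (S.ι (w k s)) - S.A s (v k s))) -
          ∫ s in (0 : ℝ)..t, (S.ι†) (S.M s (G k s)) := by
      have hv := (hreg k).continuous_v
      have hA := S.continuous_A
      have hB := S.continuous_adjoint_B
      have hw := hwc k
      rw [← intervalIntegral.integral_sub (Continuous.intervalIntegrable (by fun_prop) _ _)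
          (intervalIntegrable_of_integrable_time (hMG k) h9 h0)]
      rfl
    rw [e2] at e1
    have e3 : ((S.ι†).comp (S.M t)) (S.ι (w k t)) + ((S.ι†).comp (S.B t)) (v k t) =
        S.momentum t (v k t) (S.ι (w k t)) := by
      simp [WaveSystem.momentum]
    rw [e3, eq_sub_of_add_eq e1]
    abel
  have hxi := integrable_coe_time x₀
  have hyi := integrable_coe_time y₀
  refine ⟨x₀, y₀, ⟨Lp.memLp x₀, Lp.memLp y₀, ?_, ?_⟩,
    ae_norm_le_of_weakTendsto hx₀ (hKlim.mono_left hl) hxb,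
    ae_norm_le_of_weakTendsto hy₀ (hKlim.mono_left hl) hyb⟩
  · have e0 : (Li x₀ : Lp H 2 (timeMeasure T)) =ᵐ[timeMeasure T]
      ((memLp_const (S.ι v₀)).toLp + PH y₀ : Lp H 2 (timeMeasure T)) := by rw [hpos]
    filter_upwards [e0, hLi x₀, Lp.coeFn_add ((memLp_const (S.ι v₀)).toLp) (PH y₀),
      (memLp_const (p := 2) (μ := timeMeasure T) (S.ι v₀)).coeFn_toLp, hPH y₀]
      with t h1 h2 h3 h4 h5
    rw [← h2, h1, h3, Pi.add_apply, h4, h5]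
  · have e0 : (LM y₀ + LB x₀ : Lp V 2 (timeMeasure T)) =ᵐ[timeMeasure T]
      (hcL.toLp + PV (LBt y₀ + (-LA) x₀) : Lp V 2 (timeMeasure T)) := by rw [hmom]
    have e1 : (LBt y₀ + (-LA) x₀ : Lp V 2 (timeMeasure T)) =ᵐ[timeMeasure T]
        fun t => ((S.B t)†) (y₀ t) - S.A t (x₀ t) := by
      filter_upwards [Lp.coeFn_add (LBt y₀) ((-LA) x₀), Lp.coeFn_neg (LA x₀), hLBt y₀,
        hLA x₀] with t h1 h2 h3 h4
      rw [h1, Pi.add_apply, _root_.neg_apply, h2, Pi.neg_apply, h3, h4, sub_eq_add_neg]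
    filter_upwards [e0, Lp.coeFn_add (LM y₀) (LB x₀), hLM y₀, hLB x₀,
      Lp.coeFn_add (hcL.toLp) (PV (LBt y₀ + (-LA) x₀)), hcL.coeFn_toLp,
      hPV (LBt y₀ + (-LA) x₀), hmem] with t h1 h2 h3 h4 h5 h6 h7 h8
    have e3 : S.momentum t (x₀ t) (y₀ t) =
        ((S.ι†).comp (S.M t)) (y₀ t) + ((S.ι†).comp (S.B t)) (x₀ t) := by
      simp [WaveSystem.momentum]
    rw [e3, ← h3, ← h4, ← Pi.add_apply, ← h2, h1, h5, Pi.add_apply, h6, h7,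
      intervalIntegral_congr_time e1 h0 h8]
    have e2 : ∫ s in (0 : ℝ)..t, S.force s (x₀ s) (y₀ s) (F s) =
        (∫ s in (0 : ℝ)..t, (((S.B s)†) (y₀ s) - S.A s (x₀ s))) -
          ∫ s in (0 : ℝ)..t, (S.ι†) (S.M s (F s)) := by
      have hi : Integrable (fun s => ((S.B s)†) (y₀ s) - S.A s (x₀ s)) (timeMeasure T) :=
        (integrable_clm hyi S.continuous_adjoint_B).sub (integrable_clm hxi S.continuous_A)
      rw [← intervalIntegral.integral_sub (intervalIntegrable_of_integrable_time hi h8 h0)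
          (intervalIntegrable_of_integrable_time hMF h8 h0)]
      rfl
    rw [e2]
    abel

end WaveSystem

end AAdS

namespace AAdS

open scoped InnerProduct

/-! ### Uniqueness of mild solutions -/

/-- The real inner product as a continuous bilinear map. -/
def innerBilin (F : Type*) [NormedAddCommGroup F] [InnerProductSpace ℝ F] : F →L[ℝ] F →L[ℝ] ℝ :=
  LinearMap.mkContinuous₂ (innerₗ F) 1 fun x y => by
    simpa using abs_real_inner_le_norm x y

@[simp]
lemma innerBilin_apply {F : Type*} [NormedAddCommGroup F] [InnerProductSpace ℝ F] (x y : F) :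
    innerBilin F x y = inner ℝ x y := rfl

lemma hasDerivAt_smul_clm_comp_const {E F G : Type*} [NormedAddCommGroup E] [NormedSpace ℝ E]
    [NormedAddCommGroup F] [NormedSpace ℝ F] [NormedAddCommGroup G] [NormedSpace ℝ G]
    (K : F →L[ℝ] G) {L : ℝ → E →L[ℝ] F} {L' : E →L[ℝ] F} {c : ℝ → ℝ} {c' t : ℝ}
    (hc : HasDerivAt c c' t) (hL : HasDerivAt L L' t) :
    HasDerivAt (fun t => c t • K.comp (L t)) (c t • K.comp L' + c' • K.comp (L t)) t :=
  hc.smul (((ContinuousLinearMap.compL ℝ E F G) K).hasFDerivAt.comp_hasDerivAt t hL)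

lemma continuous_clm_comp_const {E F G : Type*} [NormedAddCommGroup E] [NormedSpace ℝ E]
    [NormedAddCommGroup F] [NormedSpace ℝ F] [NormedAddCommGroup G] [NormedSpace ℝ G]
    (K : F →L[ℝ] G) {L : ℝ → E →L[ℝ] F} (hL : Continuous L) :
    Continuous fun t => K.comp (L t) :=
  ((ContinuousLinearMap.compL ℝ E F G) K).continuous.comp hL

lemma integral_deriv_weighted_inner {E F : Type*} [NormedAddCommGroup E] [NormedSpace ℝ E]
    [NormedAddCommGroup F] [InnerProductSpace ℝ F] [CompleteSpace E] [CompleteSpace F]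
    {L L' : ℝ → E →L[ℝ] F} (hL : ∀ t, HasDerivAt L (L' t) t) (hL' : Continuous L') (k : ℝ)
    {f' : ℝ → E} {g' : ℝ → F} {f : ℝ → E} {g : ℝ → F} {a b : ℝ}
    (hf' : IntervalIntegrable f' volume a b) (hg' : IntervalIntegrable g' volume a b)
    (hf : ∀ t ∈ uIcc a b, f t = f a + ∫ s in a..t, f' s)
    (hg : ∀ t ∈ uIcc a b, g t = g a + ∫ s in a..t, g' s) :
    IntervalIntegrable (fun t => Real.exp (k * t) * (k * inner ℝ (L t (f t)) (g t) +
      inner ℝ (L' t (f t)) (g t) + inner ℝ (L t (f' t)) (g t) + inner ℝ (L t (f t)) (g' t)))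
      volume a b ∧
    ∫ t in a..b, Real.exp (k * t) * (k * inner ℝ (L t (f t)) (g t) +
      inner ℝ (L' t (f t)) (g t) + inner ℝ (L t (f' t)) (g t) + inner ℝ (L t (f t)) (g' t)) =
      Real.exp (k * b) * inner ℝ (L b (f b)) (g b) -
        Real.exp (k * a) * inner ℝ (L a (f a)) (g a) := by
  have hLc : Continuous L := continuous_iff_continuousAt.2 fun t => (hL t).continuousAt
  have hd : ∀ t, HasDerivAt (fun t => Real.exp (k * t) • (innerBilin F).comp (L t))
      (Real.exp (k * t) • (innerBilin F).comp (L' t) +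
        (Real.exp (k * t) * (k * 1)) • (innerBilin F).comp (L t)) t := fun t => by
    have h1 : HasDerivAt (fun t => Real.exp (k * t)) (Real.exp (k * t) * (k * 1)) t :=
      ((hasDerivAt_id t).const_mul k).exp
    exact hasDerivAt_smul_clm_comp_const (innerBilin F) h1 (hL t)
  have hc : Continuous fun t => Real.exp (k * t) • (innerBilin F).comp (L' t) +
        (Real.exp (k * t) * (k * 1)) • (innerBilin F).comp (L t) :=
    ((by fun_prop : Continuous fun t : ℝ => Real.exp (k * t)).smul
      (continuous_clm_comp_const (innerBilin F) hL')).add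
    ((by fun_prop : Continuous fun t : ℝ => Real.exp (k * t) * (k * 1)).smul
      (continuous_clm_comp_const (innerBilin F) hLc))
  have h := deriv_bilin_integral hd hc hf' hg' hf hg
  have e : (fun t => (Real.exp (k * t) • (innerBilin F).comp (L' t) +
        (Real.exp (k * t) * (k * 1)) • (innerBilin F).comp (L t)) (f t) (g t) +
      (Real.exp (k * t) • (innerBilin F).comp (L t)) (f' t) (g t) +
      (Real.exp (k * t) • (innerBilin F).comp (L t)) (f t) (g' t)) = fun t =>
      Real.exp (k * t) * (k * inner ℝ (L t (f t)) (g t) +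
      inner ℝ (L' t (f t)) (g t) + inner ℝ (L t (f' t)) (g t) + inner ℝ (L t (f t)) (g' t)) := by
    ext t
    simp
    ring
  rw [e] at h
  simpa using h

/-- Lebesgue differentiation of a primitive that vanishes identically. -/
lemma ae_eq_zero_of_forall_integral_eq_zero {E : Type*} [NormedAddCommGroup E] [NormedSpace ℝ E]
    [CompleteSpace E] {f : ℝ → E} {T : ℝ} (hf : Integrable f (timeMeasure T)) {a b : ℝ}
    (hab : Ioo a b ⊆ Ioo (-T) T) (hT : 0 < T)
    (h : ∀ t ∈ Ioo a b, ∫ s in (0 : ℝ)..t, f s = 0) : ∀ᵐ t, t ∈ Ioo a b → f t = 0 := by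
  have h0 : (0 : ℝ) ∈ uIcc (-T) T := by rw [uIcc_of_le (by linarith)]; constructor <;> linarith
  have hI := intervalIntegrable_of_integrable_time hf (s := -T) (t := T)
    (by constructor <;> linarith) (by constructor <;> linarith)
  filter_upwards [hI.ae_hasDerivAt_integral] with t ht hmem
  have h1 := ht (by rw [uIcc_of_le (by linarith)]; exact Ioo_subset_Icc_self (hab hmem)) 0 h0
  have h2 : HasDerivAt (fun x => ∫ s in (0 : ℝ)..x, f s) 0 t := by
    refine (hasDerivAt_const t (0 : E)).congr_of_eventuallyEq ?_
    filter_upwards [Ioo_mem_nhds hmem.1 hmem.2] with s hs using h s hs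
  exact h1.unique h2

namespace WaveSystem

variable {V H : Type*} [NormedAddCommGroup V] [InnerProductSpace ℝ V] [CompleteSpace V]
    [NormedAddCommGroup H] [InnerProductSpace ℝ H] [CompleteSpace H] {S : WaveSystem V H}

/-- The two weights have product one. So the mixed term, which carries no weight, is bounded by half
the sum of the weighted squares. -/
lemma abs_rate_terms_le (k t : ℝ) (x : V) (y : H) :
    |-(Real.exp (-k * t) * inner ℝ (S.M' t y) y) / 2 + Real.exp (k * t) * inner ℝ (S.A' t x) x / 2 -
      inner ℝ (S.B' t x) y| ≤
    S.rate * (Real.exp (-k * t) * ‖y‖ ^ 2 + Real.exp (k * t) * ‖x‖ ^ 2) := by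
  have h1 := abs_inner_clm_le _ (S.rate_M t) y y
  have h2 := abs_inner_clm_le _ (S.rate_A t) x x
  have h3 := abs_inner_clm_le _ (S.rate_B t) x y
  have hr := S.rate_nonneg
  set p := Real.exp (-k * t)
  set q := Real.exp (k * t)
  have hp : 0 < p := Real.exp_pos _
  have hq : 0 < q := Real.exp_pos _
  have hpq : p * q = 1 := by simp only [p, q, ← Real.exp_add]; simp
  have h4 : ‖x‖ * ‖y‖ ≤ (p * ‖y‖ ^ 2 + q * ‖x‖ ^ 2) / 2 := by
    have hs : (√p * √q) = 1 := by rw [← Real.sqrt_mul hp.le, hpq, Real.sqrt_one]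
    have h5 := sq_nonneg (√p * ‖y‖ - √q * ‖x‖)
    have h6 : (√p * ‖y‖ - √q * ‖x‖) ^ 2 = p * ‖y‖ ^ 2 + q * ‖x‖ ^ 2 - 2 * (√p * √q) * (‖x‖ * ‖y‖) := by
      rw [sub_sq, mul_pow, mul_pow, Real.sq_sqrt hp.le, Real.sq_sqrt hq.le]; ring
    rw [h6, hs] at h5
    linarith
  have h7 : S.rate * (‖x‖ * ‖y‖) ≤ S.rate * ((p * ‖y‖ ^ 2 + q * ‖x‖ ^ 2) / 2) := by gcongr
  have h8 : |p * inner ℝ (S.M' t y) y| ≤ p * (S.rate * ‖y‖ * ‖y‖) := by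
    rw [abs_mul, abs_of_pos hp]; gcongr
  have h9 : |q * inner ℝ (S.A' t x) x| ≤ q * (S.rate * ‖x‖ * ‖x‖) := by
    rw [abs_mul, abs_of_pos hq]; gcongr
  rw [abs_le] at h3 h8 h9 ⊢
  constructor <;> nlinarith

/-- Ladyzhenskaya's argument. The momentum equation is tested with `ψ(t) = -∫_t^s e^(-k r) v(r) dr`,
which lies in `V`, vanishes at `s` and has the derivative `e^(-k t) v`. Up to zeroth order terms
everything becomes an exact derivative. The boundary terms are `-e^(-k s) ⟨M u, u⟩ / 2` at `s` and
`-⟨A ψ, ψ⟩ / 2` at `0`, both nonpositive. If `|k|` is large, with the sign of `s`, the zeroth order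
terms contribute a nonnegative integral, and hence `ψ(0) = 0`. -/
lemma IsMildSolution.integral_exp_smul_eq_zero {T : ℝ} {v : ℝ → V} {w : ℝ → H}
    (h : S.IsMildSolution T 0 0 (fun _ => 0) v w) {s k : ℝ} (hs : s ∈ Icc (-T) T)
    (hk : (0 ≤ s ∧ S.rate * 2 ≤ k * S.lower) ∨ (s ≤ 0 ∧ S.rate * 2 ≤ -k * S.lower)) :
    ∫ t in (0 : ℝ)..s, Real.exp (-k * t) • v t = 0 := by
  have hvi : Integrable v (timeMeasure T) := h.memLp.integrable (by norm_num)
  have hwi : Integrable w (timeMeasure T) := h.memLp_deriv.integrable (by norm_num)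
  have hRi : Integrable (fun t => S.force t (v t) (w t) 0) (timeMeasure T) :=
    S.integrable_force hvi hwi (integrable_zero ℝ H (timeMeasure T))
  have h0 : (0 : ℝ) ∈ Icc (-T) T := by constructor <;> linarith [hs.1.trans hs.2]
  let hh : ℝ → V := fun t => Real.exp (-k * t) • v t
  have hhi : Integrable hh (timeMeasure T) := by
    have hc : Continuous fun t : ℝ => Real.exp (-k * t) • ContinuousLinearMap.id ℝ V := by fun_prop
    exact integrable_clm hvi hc
  have hw2 := intervalIntegrable_of_integrable_time hwi hs h0
  have hR2 := intervalIntegrable_of_integrable_time hRi hs h0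
  have hh2 := intervalIntegrable_of_integrable_time hhi hs h0
  let u : ℝ → H := fun t => ∫ r in (0 : ℝ)..t, w r
  let P : ℝ → V := fun t => ∫ r in (0 : ℝ)..t, S.force r (v r) (w r) 0
  let ψ₀ : V := - ∫ r in (0 : ℝ)..s, hh r
  let ψ : ℝ → V := fun t => ψ₀ + ∫ r in (0 : ℝ)..t, hh r
  have hψs : ψ s = 0 := by simp [ψ, ψ₀]
  have hψ0 : ψ 0 = ψ₀ := by simp [ψ]
  have hu0 : u 0 = 0 := by simp [u]
  have hP0 : P 0 = 0 := by simp [P]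
  have hu : ∀ t ∈ uIcc 0 s, u t = u 0 + ∫ r in (0 : ℝ)..t, w r := fun t _ => by simp [u]
  have hP : ∀ t ∈ uIcc 0 s, P t = P 0 + ∫ r in (0 : ℝ)..t, S.force r (v r) (w r) 0 :=
    fun t _ => by simp [P]
  have hψ : ∀ t ∈ uIcc 0 s, ψ t = ψ 0 + ∫ r in (0 : ℝ)..t, hh r := fun t _ => by
    rw [hψ0]
  obtain ⟨i1, I1⟩ := integral_deriv_weighted_inner (L := fun _ => ContinuousLinearMap.id ℝ V)
    (L' := fun _ => 0) (fun t => hasDerivAt_const t _) continuous_const 0 hR2 hh2 hP hψ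
  obtain ⟨i2, I2⟩ := integral_deriv_weighted_inner S.hasDerivAt_M S.continuous_M' (-k) hw2 hw2 hu hu
  obtain ⟨i3, I3⟩ := integral_deriv_weighted_inner S.hasDerivAt_A S.continuous_A' k hh2 hh2 hψ hψ
  obtain ⟨i4, I4⟩ := integral_deriv_weighted_inner S.hasDerivAt_B S.continuous_B' 0 hh2 hw2 hψ hu
  -- The zeroth order terms: the derivatives of the weights produce the factor `k / 2`, and the rest
  -- comes from the time derivatives of the operators.
  let g : ℝ → ℝ := fun t => k / 2 * (Real.exp (-k * t) * inner ℝ (S.M t (u t)) (u t) +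
    Real.exp (k * t) * inner ℝ (S.A t (ψ t)) (ψ t)) +
    (-(Real.exp (-k * t) * inner ℝ (S.M' t (u t)) (u t)) / 2 +
      Real.exp (k * t) * inner ℝ (S.A' t (ψ t)) (ψ t) / 2 - inner ℝ (S.B' t (ψ t)) (u t))
  have hmem : ∀ᵐ t, t ∈ uIoc 0 s → S.ι (v t) = u t ∧ S.momentum t (v t) (w t) = P t := by
    have h1 := (ae_restrict_iff' measurableSet_Ioo).1 h.position
    have h2 := (ae_restrict_iff' measurableSet_Ioo).1 h.momentum
    have hT1 : ∀ᵐ x : ℝ, x ≠ T := by simp [ae_iff, measure_singleton]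
    have hT2 : ∀ᵐ x : ℝ, x ≠ -T := by simp [ae_iff, measure_singleton]
    filter_upwards [h1, h2, hT1, hT2] with t h1 h2 h3 h4 ht
    have ht' := uIcc_subset_Icc h0 hs (uIoc_subset_uIcc ht)
    have ht2 : t ∈ Ioo (-T) T := ⟨lt_of_le_of_ne ht'.1 (Ne.symm h4), lt_of_le_of_ne ht'.2 h3⟩
    refine ⟨by simpa using h1 ht2, ?_⟩
    have := h2 ht2
    simpa [WaveSystem.momentum] using this
  have hg : ∫ t in (0 : ℝ)..s, g t = -(Real.exp (-k * s) * inner ℝ (S.M s (u s)) (u s)) / 2 -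
      inner ℝ (S.A 0 ψ₀) ψ₀ / 2 := by
    -- The opposite weights are what makes this work: in terms of `hh = e^(-k t) v` the term `⟨A v,
    -- ψ⟩` equals `e^(k t) ⟨A hh, ψ⟩`, half of the derivative of a weighted quadratic form up to
    -- zeroth order terms.
    have e1 : ∀ᵐ t, t ∈ uIoc 0 s → g t =
        Real.exp (0 * t) * (0 * inner ℝ ((ContinuousLinearMap.id ℝ V) (P t)) (ψ t) +
          inner ℝ ((0 : V →L[ℝ] V) (P t)) (ψ t) +
          inner ℝ ((ContinuousLinearMap.id ℝ V) (S.force t (v t) (w t) 0)) (ψ t) +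
          inner ℝ ((ContinuousLinearMap.id ℝ V) (P t)) (hh t)) -
        Real.exp (0 * t) * (0 * inner ℝ (S.B t (ψ t)) (u t) + inner ℝ (S.B' t (ψ t)) (u t) +
          inner ℝ (S.B t (hh t)) (u t) + inner ℝ (S.B t (ψ t)) (w t)) -
        (1 / 2) * (Real.exp (-k * t) * (-k * inner ℝ (S.M t (u t)) (u t) +
          inner ℝ (S.M' t (u t)) (u t) + inner ℝ (S.M t (w t)) (u t) +
          inner ℝ (S.M t (u t)) (w t))) +
        (1 / 2) * (Real.exp (k * t) * (k * inner ℝ (S.A t (ψ t)) (ψ t) +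
          inner ℝ (S.A' t (ψ t)) (ψ t) + inner ℝ (S.A t (hh t)) (ψ t) +
          inner ℝ (S.A t (ψ t)) (hh t))) := by
      filter_upwards [hmem] with t ht hts
      obtain ⟨h1, h2⟩ := ht hts
      have hp : Real.exp (k * t) * Real.exp (-k * t) = 1 := by rw [← Real.exp_add]; simp
      rw [← h2]
      have a1 : inner ℝ (S.M t (u t)) (w t) = inner ℝ (S.M t (w t)) (u t) := by
        rw [S.symm_M, real_inner_comm]
      have a2 : inner ℝ (S.A t (ψ t)) (v t) = inner ℝ (S.A t (v t)) (ψ t) := by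
        rw [S.symm_A, real_inner_comm]
      have a3 : inner ℝ (S.B t (ψ t)) (w t) = inner ℝ (w t) (S.B t (ψ t)) := real_inner_comm _ _
      simp only [g, hh, WaveSystem.momentum, force, ContinuousLinearMap.id_apply, inner_add_left,
        inner_sub_left, ContinuousLinearMap.adjoint_inner_left, h1, inner_smul_right, map_zero,
        map_smul, inner_smul_left, RCLike.conj_to_real, zero_mul, Real.exp_zero, a1, a2, a3,
        _root_.zero_apply, inner_zero_left]
      have a4 : Real.exp (k * t) * (k * inner ℝ (S.A t (ψ t)) (ψ t) +
          inner ℝ (S.A' t (ψ t)) (ψ t) + Real.exp (-k * t) * inner ℝ (S.A t (v t)) (ψ t) +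
          Real.exp (-k * t) * inner ℝ (S.A t (v t)) (ψ t)) =
          Real.exp (k * t) * (k * inner ℝ (S.A t (ψ t)) (ψ t) +
          inner ℝ (S.A' t (ψ t)) (ψ t)) + (Real.exp (k * t) * Real.exp (-k * t)) *
          (2 * inner ℝ (S.A t (v t)) (ψ t)) := by ring
      rw [a4, hp]
      ring
    rw [intervalIntegral.integral_congr_ae e1, intervalIntegral.integral_add
      ((i1.sub i4).sub (i2.const_mul _)) (i3.const_mul _), intervalIntegral.integral_sub
      (i1.sub i4) (i2.const_mul _), intervalIntegral.integral_sub i1 i4,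
      intervalIntegral.integral_const_mul, intervalIntegral.integral_const_mul, I1, I2, I3, I4]
    simp only [hψs, hψ0, hu0, hP0, map_zero, inner_zero_left, inner_zero_right, mul_zero,
      Real.exp_zero, one_mul, sub_zero, zero_sub]
    ring
  have hA0 : S.lower * ‖ψ₀‖ ^ 2 ≤ inner ℝ (S.A 0 ψ₀) ψ₀ := S.lower_A 0 ψ₀
  have hMs : 0 ≤ Real.exp (-k * s) * inner ℝ (S.M s (u s)) (u s) :=
    mul_nonneg (Real.exp_pos _).le (le_trans (mul_nonneg S.lower_pos.le (sq_nonneg _))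
      (S.lower_M s (u s)))
  have hnn : 0 ≤ ∫ t in (0 : ℝ)..s, g t := by
    have hform : ∀ t, S.lower * (Real.exp (-k * t) * ‖u t‖ ^ 2 + Real.exp (k * t) * ‖ψ t‖ ^ 2) ≤
        Real.exp (-k * t) * inner ℝ (S.M t (u t)) (u t) +
          Real.exp (k * t) * inner ℝ (S.A t (ψ t)) (ψ t) := by
      intro t
      have h1 := mul_le_mul_of_nonneg_left (S.lower_M t (u t)) (Real.exp_pos (-k * t)).le
      have h2 := mul_le_mul_of_nonneg_left (S.lower_A t (ψ t)) (Real.exp_pos (k * t)).le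
      linarith
    have hX : ∀ t, 0 ≤ Real.exp (-k * t) * ‖u t‖ ^ 2 + Real.exp (k * t) * ‖ψ t‖ ^ 2 :=
      fun t => by positivity
    have hlow := S.lower_pos
    have hrate := S.rate_nonneg
    rcases hk with ⟨hs0, hk⟩ | ⟨hs0, hk⟩
    · refine intervalIntegral.integral_nonneg hs0 fun t _ => ?_
      have h1 := (abs_le.1 (abs_rate_terms_le (S := S) k t (ψ t) (u t))).1
      have hk0 : 0 ≤ k := by
        by_contra hneg
        have : k * S.lower < 0 := mul_neg_of_neg_of_pos (not_le.1 hneg) hlow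
        linarith
      have h2 := mul_le_mul_of_nonneg_left (hform t) (by linarith : 0 ≤ k / 2)
      have h3 := mul_le_mul_of_nonneg_right hk (hX t)
      simp only [g]
      linarith
    · rw [intervalIntegral.integral_symm, ← intervalIntegral.integral_neg]
      refine intervalIntegral.integral_nonneg hs0 fun t _ => ?_
      have h1 := (abs_le.1 (abs_rate_terms_le (S := S) k t (ψ t) (u t))).2
      have hk0 : k ≤ 0 := by
        by_contra hneg
        have : 0 < k * S.lower := mul_pos (not_le.1 hneg) hlow
        linarith
      have h2 := mul_le_mul_of_nonneg_left (hform t) (by linarith : 0 ≤ -k / 2)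
      have h3 := mul_le_mul_of_nonneg_right hk (hX t)
      simp only [g]
      linarith
  rw [hg] at hnn
  have hz : ‖ψ₀‖ ^ 2 ≤ 0 := by
    by_contra hneg
    have := mul_pos S.lower_pos (not_le.1 hneg)
    linarith
  have hz' : ψ₀ = 0 := by
    rw [← norm_eq_zero]
    exact pow_eq_zero_iff (two_ne_zero) |>.1 (le_antisymm hz (sq_nonneg _))
  exact neg_eq_zero.1 hz'

/-- All weighted primitives of `v` vanish, with opposite signs of `k` for positive and negative
times, so `v` vanishes. Then the primitive of `w` vanishes by the position equation, first almost
everywhere and then everywhere by continuity. -/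
lemma IsMildSolution.ae_eq_zero {T : ℝ} (hT : 0 < T) {v : ℝ → V} {w : ℝ → H}
    (h : S.IsMildSolution T 0 0 (fun _ => 0) v w) :
    (∀ᵐ t ∂(timeMeasure T), v t = 0) ∧ ∀ᵐ t ∂(timeMeasure T), w t = 0 := by
  have hvi : Integrable v (timeMeasure T) := h.memLp.integrable (by norm_num)
  have hwi : Integrable w (timeMeasure T) := h.memLp_deriv.integrable (by norm_num)
  set k : ℝ := S.rate * 2 / S.lower
  have hk : S.rate * 2 ≤ k * S.lower := by
    simp only [k]; rw [div_mul_cancel₀ _ S.lower_pos.ne']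
  have hexp : ∀ k : ℝ, Integrable (fun t => Real.exp (-k * t) • v t) (timeMeasure T) := fun k => by
    have hc : Continuous fun t : ℝ => Real.exp (-k * t) • ContinuousLinearMap.id ℝ V := by fun_prop
    exact integrable_clm hvi hc
  have h1 := ae_eq_zero_of_forall_integral_eq_zero (hexp k) (a := 0) (b := T)
    (Ioo_subset_Ioo_left (by linarith)) hT fun t ht =>
      h.integral_exp_smul_eq_zero ⟨by linarith [ht.1], ht.2.le⟩ (Or.inl ⟨ht.1.le, hk⟩)
  have h2 := ae_eq_zero_of_forall_integral_eq_zero (hexp (-k)) (a := -T) (b := 0)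
    (Ioo_subset_Ioo_right (by linarith)) hT fun t ht =>
      h.integral_exp_smul_eq_zero ⟨ht.1.le, by linarith [ht.2]⟩
        (Or.inr ⟨ht.2.le, by rwa [neg_neg]⟩)
  have h0 : ∀ᵐ x : ℝ, x ≠ 0 := by simp [ae_iff, measure_singleton]
  have hv : ∀ᵐ t ∂(timeMeasure T), v t = 0 := by
    rw [ae_restrict_iff' measurableSet_Ioo]
    filter_upwards [h1, h2, h0] with t h1 h2 h0 ht
    rcases lt_or_gt_of_ne h0 with h3 | h3
    · exact (smul_eq_zero.1 (h2 ⟨ht.1, h3⟩)).resolve_left (Real.exp_pos _).ne'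
    · exact (smul_eq_zero.1 (h1 ⟨h3, ht.2⟩)).resolve_left (Real.exp_pos _).ne'
  refine ⟨hv, ?_⟩
  rw [ae_restrict_iff' measurableSet_Ioo]
  refine ae_eq_zero_of_forall_integral_eq_zero hwi Subset.rfl hT ?_
  have hz : ∀ᵐ t ∂(timeMeasure T), ∫ s in (0 : ℝ)..t, w s = 0 := by
    filter_upwards [hv, h.position] with t h1 h2
    rw [h1, map_zero, zero_add] at h2
    exact h2.symm
  have hc : ContinuousOn (fun t => ∫ s in (0 : ℝ)..t, w s) (Ioo (-T) T) := by
    have h0 : (0 : ℝ) ∈ uIcc (-T) T := by rw [uIcc_of_le (by linarith)]; constructor <;> linarith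
    have h := intervalIntegral.continuousOn_primitive_interval' (μ := volume)
      (intervalIntegrable_of_integrable_time hwi (s := -T) (t := T)
        (by constructor <;> linarith) (by constructor <;> linarith)) h0
    rw [uIcc_of_le (by linarith)] at h
    exact h.mono Ioo_subset_Icc_self
  exact fun t ht => MeasureTheory.Measure.eqOn_open_of_ae_eq hz isOpen_Ioo hc
    continuousOn_const ht

lemma IsMildSolution.sub {T : ℝ} (hT : 0 < T) {v₀ : V} {v₁ : H} {F : ℝ → H}
    (hF : Integrable F (timeMeasure T)) {v v' : ℝ → V}
    {w w' : ℝ → H} (h : S.IsMildSolution T v₀ v₁ F v w) (h' : S.IsMildSolution T v₀ v₁ F v' w') :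
    S.IsMildSolution T 0 0 (fun _ => 0) (v - v') (w - w') := by
  have hvi : Integrable v (timeMeasure T) := h.memLp.integrable (by norm_num)
  have hwi : Integrable w (timeMeasure T) := h.memLp_deriv.integrable (by norm_num)
  have hvi' : Integrable v' (timeMeasure T) := h'.memLp.integrable (by norm_num)
  have hwi' : Integrable w' (timeMeasure T) := h'.memLp_deriv.integrable (by norm_num)
  have h0 : (0 : ℝ) ∈ Icc (-T) T := by constructor <;> linarith
  refine ⟨h.memLp.sub h'.memLp, h.memLp_deriv.sub h'.memLp_deriv, ?_, ?_⟩
  · filter_upwards [h.position, h'.position, ae_restrict_mem measurableSet_Ioo] with t h1 h2 ht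
    have ht' := Ioo_subset_Icc_self ht
    simp only [Pi.sub_apply]
    rw [map_sub, h1, h2, intervalIntegral.integral_sub
      (intervalIntegrable_of_integrable_time hwi ht' h0)
      (intervalIntegrable_of_integrable_time hwi' ht' h0), map_zero]
    abel
  · filter_upwards [h.momentum, h'.momentum, ae_restrict_mem measurableSet_Ioo] with t h1 h2 ht
    have ht' := Ioo_subset_Icc_self ht
    have e1 : S.momentum t ((v - v') t) ((w - w') t) =
        S.momentum t (v t) (w t) - S.momentum t (v' t) (w' t) := by
      simp only [WaveSystem.momentum, Pi.sub_apply, map_sub, map_add]; abel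
    have e2 : ∀ s, S.force s ((v - v') s) ((w - w') s) 0 =
        S.force s (v s) (w s) (F s) - S.force s (v' s) (w' s) (F s) := fun s => by
      simp only [force, Pi.sub_apply, map_sub, map_zero]; abel
    have e3 : S.momentum 0 0 0 = 0 := by simp [WaveSystem.momentum]
    simp only [e1, e2, e3]
    rw [h1, h2, intervalIntegral.integral_sub
      (intervalIntegrable_of_integrable_time (S.integrable_force hvi hwi hF) ht' h0)
      (intervalIntegrable_of_integrable_time (S.integrable_force hvi' hwi' hF) ht' h0)]
    abel

theorem IsMildSolution.unique {T : ℝ} (hT : 0 < T) {v₀ : V} {v₁ : H} {F : ℝ → H}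
    (hF : Integrable F (timeMeasure T)) {v v' : ℝ → V}
    {w w' : ℝ → H} (h : S.IsMildSolution T v₀ v₁ F v w) (h' : S.IsMildSolution T v₀ v₁ F v' w') :
    v =ᵐ[timeMeasure T] v' ∧ w =ᵐ[timeMeasure T] w' := by
  obtain ⟨h1, h2⟩ := (h.sub hT hF h').ae_eq_zero hT
  exact ⟨h1.mono fun t ht => sub_eq_zero.1 ht, h2.mono fun t ht => sub_eq_zero.1 ht⟩

end WaveSystem

end AAdS

namespace AAdS

open scoped InnerProduct

/-! ### Weak and mild solutions of the abstract equation -/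

lemma integral_deriv_smul_primitive {E : Type*} [NormedAddCommGroup E] [InnerProductSpace ℝ E]
    [CompleteSpace E] {R : ℝ → E} {T : ℝ} (hT : 0 < T) (hR : Integrable R (timeMeasure T))
    {η : ℝ → ℝ} (hη : ContDiff ℝ ∞ η) (hs : tsupport η ⊆ Ioo (-T) T) :
    ∫ t in Ioo (-T) T, (deriv η t • (∫ s in (0 : ℝ)..t, R s) + η t • R t) = 0 := by
  have h0 : (0 : ℝ) ∈ Icc (-T) T := by constructor <;> linarith
  have hTT : (T : ℝ) ∈ Icc (-T) T := by constructor <;> linarith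
  have hmT : (-T : ℝ) ∈ Icc (-T) T := by constructor <;> linarith
  have hηc : Continuous η := hη.continuous
  have hηd : Continuous (deriv η) := hη.continuous_deriv (by simp)
  have hdη : ∀ t, HasDerivAt η (deriv η t) t := fun t =>
    (hη.differentiable (by simp)).differentiableAt.hasDerivAt
  have hη0 : ∀ t, t ∉ Ioo (-T) T → η t = 0 := fun t ht => image_eq_zero_of_notMem_tsupport
    fun h => ht (hs h)
  set I : ℝ → E := fun t => ∫ s in (0 : ℝ)..t, R s with hI
  have hint : Integrable (fun t => deriv η t • I t + η t • R t) (timeMeasure T) := by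
    have c1 : Continuous fun t : ℝ => deriv η t • ContinuousLinearMap.id ℝ E :=
      hηd.smul continuous_const
    have c2 : Continuous fun t : ℝ => η t • ContinuousLinearMap.id ℝ E :=
      hηc.smul continuous_const
    exact (WaveSystem.integrable_clm ((memLp_primitive hT hR 1).integrable le_rfl) c1).add
      (WaveSystem.integrable_clm hR c2)
  refine ext_inner_right ℝ fun y => ?_
  rw [inner_zero_left, real_inner_comm, ← integral_inner hint]
  have hβ : ∀ t, HasDerivAt (fun t => η t • ContinuousLinearMap.id ℝ E)
      (deriv η t • ContinuousLinearMap.id ℝ E) t := fun t =>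
    (hdη t).smul_const (ContinuousLinearMap.id ℝ E)
  have hRi := intervalIntegrable_of_integrable_time hR hTT hmT
  have hf : ∀ t ∈ uIcc (-T) T, I t = I (-T) + ∫ s in (-T)..t, R s := fun t ht => by
    rw [uIcc_of_le (by linarith)] at ht
    exact (intervalIntegral.integral_add_adjacent_intervals
      (intervalIntegrable_of_integrable_time hR hmT h0)
      (intervalIntegrable_of_integrable_time hR ht hmT)).symm
  obtain ⟨-, h⟩ := integral_deriv_weighted_inner (f := I) (g := fun _ => y) (g' := fun _ => 0) hβ
    (hηd.smul continuous_const) 0 hRi (by simp) hf (by simp)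
  rw [← integral_Ioc_eq_integral_Ioo, ← intervalIntegral.integral_of_le (by linarith)]
  rw [hη0 T (by simp), hη0 (-T) (by simp)] at h
  simp only [zero_smul, _root_.zero_apply, inner_zero_left, mul_zero, sub_zero] at h
  rw [← h]
  refine intervalIntegral.integral_congr fun t _ => ?_
  simp [inner_add_right, inner_smul_right, inner_smul_left, real_inner_comm]

/-- The du Bois-Reymond lemma. -/
theorem exists_ae_eq_add_integral {E : Type*} [NormedAddCommGroup E] [InnerProductSpace ℝ E]
    [CompleteSpace E] {P R : ℝ → E} {T : ℝ} (hT : 0 < T) (hP : Integrable P (timeMeasure T))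
    (hR : Integrable R (timeMeasure T))
    (h : ∀ η : ℝ → ℝ, ContDiff ℝ ∞ η → HasCompactSupport η → tsupport η ⊆ Ioo (-T) T →
      ∫ t in Ioo (-T) T, (deriv η t • P t + η t • R t) = 0) :
    ∃ c, ∀ᵐ t ∂(timeMeasure T), P t = c + ∫ s in (0 : ℝ)..t, R s := by
  set I : ℝ → E := fun t => ∫ s in (0 : ℝ)..t, R s with hI
  have hII : Integrable I (timeMeasure T) := (memLp_primitive hT hR 1).integrable le_rfl
  have hsm : ∀ {η : ℝ → ℝ} {f : ℝ → E}, Continuous η → Integrable f (timeMeasure T) →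
      Integrable (fun t => η t • f t) (timeMeasure T) := fun {η f} hη hf =>
    WaveSystem.integrable_clm hf
      (U := fun t => η t • ContinuousLinearMap.id ℝ E) (hη.smul continuous_const)
  -- Subtracting the primitive of `R` reduces the claim to a function with vanishing weak
  -- derivative, which has to be constant.
  have hQ : ∀ η : ℝ → ℝ, ContDiff ℝ ∞ η → HasCompactSupport η → tsupport η ⊆ Ioo (-T) T →
      ∫ t in Ioo (-T) T, deriv η t • (P t - I t) = 0 := by
    intro η h1 h2 h3
    have hηd : Continuous (deriv η) := h1.continuous_deriv (by simp)
    have e : ∀ t, deriv η t • (P t - I t) = (deriv η t • P t + η t • R t) -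
        (deriv η t • I t + η t • R t) := fun t => by rw [smul_sub]; abel
    simp only [e]
    have i1 : Integrable (fun t => deriv η t • P t + η t • R t) (volume.restrict (Ioo (-T) T)) :=
      (hsm hηd hP).add (hsm h1.continuous hR)
    have i2 : Integrable (fun t => deriv η t • I t + η t • R t) (volume.restrict (Ioo (-T) T)) :=
      (hsm hηd hII).add (hsm h1.continuous hR)
    rw [integral_sub i1 i2, h η h1 h2 h3,
      integral_deriv_smul_primitive hT hR h1 h3, sub_zero]
  obtain ⟨b, hb, -⟩ : ∃ b : ContDiffBump (0 : ℝ), b.rOut < T ∧ True :=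
    ⟨⟨T / 4, T / 2, by linarith, by linarith⟩, by simp only; linarith, trivial⟩
  set φ₀ : ℝ → ℝ := b.normed volume with hφ₀
  have hφ₀1 : ContDiff ℝ ∞ φ₀ := b.contDiff_normed
  have hφ₀2 : HasCompactSupport φ₀ := b.hasCompactSupport_normed
  have hφ₀3 : tsupport φ₀ ⊆ Ioo (-T) T := by
    rw [hφ₀, b.tsupport_normed_eq, Real.closedBall_eq_Icc]
    intro x hx
    constructor <;> linarith [hx.1, hx.2]
  have hφ₀4 : ∫ t, φ₀ t = 1 := b.integral_normed
  refine ⟨∫ t in Ioo (-T) T, φ₀ t • (P t - I t), ?_⟩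
  set q := ∫ t in Ioo (-T) T, φ₀ t • (P t - I t) with hq
  have hfull : ∀ {φ : ℝ → ℝ} (f : ℝ → E), tsupport φ ⊆ Ioo (-T) T →
      ∫ t in Ioo (-T) T, φ t • f t = ∫ t, φ t • f t := fun f hφ =>
    setIntegral_eq_integral_of_forall_compl_eq_zero fun t ht => by
      rw [image_eq_zero_of_notMem_tsupport fun h => ht (hφ h), zero_smul]
  have hfull' : ∀ {φ : ℝ → ℝ}, tsupport φ ⊆ Ioo (-T) T →
      ∫ t in Ioo (-T) T, φ t = ∫ t, φ t := fun hφ =>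
    setIntegral_eq_integral_of_forall_compl_eq_zero fun t ht =>
      image_eq_zero_of_notMem_tsupport fun h => ht (hφ h)
  have key : ∀ φ : ℝ → ℝ, ContDiff ℝ ∞ φ → HasCompactSupport φ → tsupport φ ⊆ Ioo (-T) T →
      ∫ t, φ t • (P t - I t - q) = 0 := by
    intro φ h1 h2 h3
    set m := ∫ t, φ t with hm
    -- Subtracting a multiple of the fixed bump `φ₀` gives mean zero, so the primitive of `f` again
    -- has compact support in the interval and is admissible in `hQ`.
    set f : ℝ → ℝ := fun t => φ t - m * φ₀ t with hf
    have hfc : Continuous f := h1.continuous.sub (continuous_const.mul hφ₀1.continuous)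
    obtain ⟨p, r, hp, hr, hpr⟩ : ∃ p r : ℝ, -T < p ∧ r < T ∧ ∀ t, t ∉ Icc p r → f t = 0 := by
      have hK : IsCompact (tsupport φ ∪ tsupport φ₀) := h2.isCompact.union hφ₀2.isCompact
      have hne : (tsupport φ ∪ tsupport φ₀).Nonempty := by
        by_contra hne
        rw [not_nonempty_iff_eq_empty, union_empty_iff, tsupport_eq_empty_iff,
          tsupport_eq_empty_iff] at hne
        rw [hne.2] at hφ₀4
        simp at hφ₀4
      obtain ⟨p, hp, hp'⟩ := hK.exists_isLeast hne
      obtain ⟨r, hr, hr'⟩ := hK.exists_isGreatest hne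
      refine ⟨p, r, (union_subset h3 hφ₀3 hp).1, (union_subset h3 hφ₀3 hr).2, fun t ht => ?_⟩
      have ht' : t ∉ tsupport φ ∪ tsupport φ₀ := fun h => ht ⟨hp' h, hr' h⟩
      rw [mem_union, not_or] at ht'
      simp [f, image_eq_zero_of_notMem_tsupport ht'.1, image_eq_zero_of_notMem_tsupport ht'.2]
    have hfi : ∫ t in (-T)..T, f t = 0 := by
      rw [intervalIntegral.integral_of_le (by linarith), integral_Ioc_eq_integral_Ioo,
        integral_sub, integral_const_mul, hfull' h3, hfull' hφ₀3, hφ₀4, mul_one, sub_self]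
      · exact (h1.continuous.integrable_of_hasCompactSupport h2).integrableOn
      · exact ((hφ₀1.continuous.integrable_of_hasCompactSupport hφ₀2).const_mul m).integrableOn
    set η : ℝ → ℝ := fun t => ∫ s in (-T)..t, f s with hη
    have hηd : ∀ t, HasDerivAt η (f t) t := fun t =>
      intervalIntegral.integral_hasDerivAt_right (hfc.intervalIntegrable _ _)
        hfc.aestronglyMeasurable.stronglyMeasurableAtFilter hfc.continuousAt
    have hηd' : deriv η = f := funext fun t => (hηd t).deriv
    have hη1 : ContDiff ℝ ∞ η := by
      rw [contDiff_infty_iff_deriv, hηd']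
      exact ⟨fun t => (hηd t).differentiableAt, h1.sub (contDiff_const.mul hφ₀1)⟩
    have hη0 : ∀ t, t ∉ Icc p r → η t = 0 := by
      intro t ht
      rw [mem_Icc, not_and_or, not_le, not_le] at ht
      rcases ht with ht | ht
      · refine (intervalIntegral.integral_congr (g := fun _ => 0) fun s hs => ?_).trans (by simp)
        refine hpr s fun hs' => ?_
        rcases mem_uIcc.1 hs with h | h <;> linarith [hs'.1, h.2]
      · have h5 : ∫ s in t..T, f s = 0 := by
          refine (intervalIntegral.integral_congr (g := fun _ => 0) fun s hs => ?_).trans (by simp)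
          refine hpr s fun hs' => ?_
          rcases mem_uIcc.1 hs with h | h <;> linarith [hs'.2, h.1]
        have := intervalIntegral.integral_add_adjacent_intervals
          (hfc.intervalIntegrable (μ := volume) (-T) t) (hfc.intervalIntegrable t T)
        rw [h5, add_zero, hfi] at this
        exact this
    have hηs : tsupport η ⊆ Icc p r := closure_minimal (fun t ht => by
      by_contra hc; exact ht (hη0 t hc)) isClosed_Icc
    have h6 := hQ η hη1 (HasCompactSupport.intro isCompact_Icc hη0)
      (hηs.trans fun t ht => ⟨by linarith [ht.1], by linarith [ht.2]⟩)
    rw [hηd'] at h6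
    have e1 : ∀ t, f t • (P t - I t) = φ t • (P t - I t) - m • φ₀ t • (P t - I t) := fun t => by
      simp only [f, sub_smul, mul_smul]
    simp only [e1] at h6
    have i1 : Integrable (fun t => φ t • (P t - I t)) (volume.restrict (Ioo (-T) T)) :=
      hsm h1.continuous (hP.sub hII)
    have i2 : Integrable (fun t => m • φ₀ t • (P t - I t)) (volume.restrict (Ioo (-T) T)) :=
      (hsm hφ₀1.continuous (hP.sub hII)).smul m
    rw [integral_sub i1 i2, integral_smul] at h6
    rw [← hfull _ h3]
    have i3 : Integrable (fun t => φ t • q) (volume.restrict (Ioo (-T) T)) :=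
      ((h1.continuous.integrable_of_hasCompactSupport h2).smul_const q).integrableOn
    simp only [smul_sub _ (P _ - I _) q]
    rw [integral_sub i1 i3, integral_smul_const, hfull' h3]
    exact h6
  have hint : IntegrableOn (fun t => P t - I t - q) (Ioo (-T) T) :=
    (hP.sub hII).sub (integrable_const q : Integrable (fun _ => q) (timeMeasure T))
  have hloc : LocallyIntegrableOn (fun t => P t - I t - q) (Ioo (-T) T) :=
    hint.locallyIntegrableOn
  have := isOpen_Ioo.ae_eq_zero_of_integral_contDiff_smul_eq_zero hloc key
  rw [timeMeasure, ae_restrict_iff' measurableSet_Ioo]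
  filter_upwards [this] with t ht hmem
  have h7 := sub_eq_zero.1 (ht hmem)
  rw [← h7]; simp [I]

lemma continuousAt_primitive_time {E : Type*} [NormedAddCommGroup E] [NormedSpace ℝ E]
    {f : ℝ → E} {T : ℝ} (hT : 0 < T) (hf : Integrable f (timeMeasure T)) :
    ContinuousAt (fun t => ∫ s in (0 : ℝ)..t, f s) 0 := by
  have h0 : (0 : ℝ) ∈ uIcc (-T) T := by rw [uIcc_of_le (by linarith)]; constructor <;> linarith
  have h := intervalIntegral.continuousOn_primitive_interval' (μ := volume)
    (intervalIntegrable_of_integrable_time hf (s := -T) (t := T)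
      (by constructor <;> linarith) (by constructor <;> linarith)) h0
  rw [uIcc_of_le (by linarith)] at h
  exact h.continuousAt (Icc_mem_nhds (by linarith) hT)

namespace WaveSystem

variable {V H : Type*} [NormedAddCommGroup V] [InnerProductSpace ℝ V] [CompleteSpace V]
    [NormedAddCommGroup H] [InnerProductSpace ℝ H] [CompleteSpace H] {S : WaveSystem V H}

lemma norm_sub_zero_le_of_hasDerivAt {E : Type*} [NormedAddCommGroup E] [NormedSpace ℝ E]
    {f f' : ℝ → E} (hf : ∀ t, HasDerivAt f (f' t) t) {C : ℝ} (hC : ∀ t, ‖f' t‖ ≤ C) (t : ℝ) :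
    ‖f t - f 0‖ ≤ C * |t| := by
  simpa using! Convex.norm_image_sub_le_of_norm_hasDerivWithin_le (s := univ)
    (fun x _ => (hf x).hasDerivWithinAt) (fun x _ => hC x) convex_univ (mem_univ 0) (mem_univ t)

/-- The initial velocity is determined by the initial momentum. -/
lemma hasDerivAt_inner_position {T : ℝ} (hT : 0 < T) {v : ℝ → V} {w : ℝ → H} {R : ℝ → V}
    {v₀ c χ : V} (hv : Integrable v (timeMeasure T)) (hw : Integrable w (timeMeasure T))
    (hR : Integrable R (timeMeasure T))
    (hpos : ∀ᵐ t ∂(timeMeasure T), S.ι (v t) = S.ι v₀ + ∫ s in (0 : ℝ)..t, w s)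
    (hmom : ∀ᵐ t ∂(timeMeasure T), S.momentum t (v t) (w t) = c + ∫ s in (0 : ℝ)..t, R s)
    {C : ℝ} (hC : ∀ x, |inner ℝ (S.B 0 x) (S.ι χ)| ≤ C * ‖S.ι x‖) :
    HasDerivAt (fun t => inner ℝ (S.ι v₀ + ∫ s in (0 : ℝ)..t, w s) (S.M 0 (S.ι χ)))
      (inner ℝ c χ - inner ℝ (S.B 0 v₀) (S.ι χ)) 0 := by
  set d := inner ℝ c χ - inner ℝ (S.B 0 v₀) (S.ι χ) with hd
  have h0 : (0 : ℝ) ∈ Icc (-T) T := by constructor <;> linarith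
  have h0' : (0 : ℝ) ∈ Ioo (-T) T := by constructor <;> linarith
  set b : ℝ → ℝ := fun s => S.rate * ‖S.ι χ‖ * (‖w s‖ + ‖v s‖) with hb
  have hbi : Integrable b (timeMeasure T) := (hw.norm.add hv.norm).const_mul _
  set a : ℝ → ℝ := fun s => ‖χ‖ * ‖∫ r in (0 : ℝ)..s, R r‖ + C * ‖∫ r in (0 : ℝ)..s, w r‖ with ha
  have ha0 : Tendsto a (𝓝 0) (𝓝 0) := by
    have h1 : ContinuousAt a 0 := ((continuousAt_primitive_time hT hR).norm.const_mul _).add ((continuousAt_primitive_time hT hw).norm.const_mul _)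
    have : a 0 = 0 := by simp [a]
    rw [ContinuousAt, this] at h1; exact h1
  have hb0 : Tendsto (fun h => ∫ s in (0 : ℝ)..h, b s) (𝓝 0) (𝓝 0) := by
    have h1 := continuousAt_primitive_time hT hbi
    rw [ContinuousAt, intervalIntegral.integral_same] at h1
    exact h1
  -- The error has two parts of different nature. The function `a` is continuous and vanishes at
  -- `0`. The function `b` is merely integrable, but it is multiplied by `|s|`, and its primitive is
  -- small near `0`. The hypothesis `hC` is needed because `v` is continuous at `0` only after
  -- mapping to `H`.
  have herr : ∀ᵐ s ∂(timeMeasure T), |inner ℝ (w s) (S.M 0 (S.ι χ)) - d| ≤ a s + |s| * b s := by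
    filter_upwards [hpos, hmom] with s h1 h2
    have h3 : inner ℝ (S.momentum s (v s) (w s)) χ = inner ℝ (S.M s (w s)) (S.ι χ) +
        inner ℝ (S.B s (v s)) (S.ι χ) := by
      rw [WaveSystem.momentum, ContinuousLinearMap.adjoint_inner_left, inner_add_left]
    rw [h2, inner_add_left] at h3
    have h4 : S.ι (v s - v₀) = ∫ r in (0 : ℝ)..s, w r := by rw [map_sub, h1]; abel
    have h5 := hC (v s - v₀)
    rw [h4, map_sub, inner_sub_left] at h5
    have h6 : ‖S.M s - S.M 0‖ ≤ S.rate * |s| :=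
      norm_sub_zero_le_of_hasDerivAt S.hasDerivAt_M S.rate_M s
    have h7 : ‖S.B s - S.B 0‖ ≤ S.rate * |s| :=
      norm_sub_zero_le_of_hasDerivAt S.hasDerivAt_B S.rate_B s
    have h8 := abs_inner_clm_le _ h6 (w s) (S.ι χ)
    have h9 := abs_inner_clm_le _ h7 (v s) (S.ι χ)
    have h10 := abs_real_inner_le_norm (∫ r in (0 : ℝ)..s, R r) χ
    rw [_root_.sub_apply, inner_sub_left] at h8 h9
    have h11 : inner ℝ (w s) (S.M 0 (S.ι χ)) = inner ℝ (S.M 0 (w s)) (S.ι χ) :=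
      (S.symm_M _ _ _).symm
    rw [h11, hd]
    have e : inner ℝ (S.M 0 (w s)) (S.ι χ) - (inner ℝ c χ - inner ℝ (S.B 0 v₀) (S.ι χ)) =
        inner ℝ (∫ r in (0 : ℝ)..s, R r) χ -
        (inner ℝ (S.B 0 (v s)) (S.ι χ) - inner ℝ (S.B 0 v₀) (S.ι χ)) -
        (inner ℝ (S.M s (w s)) (S.ι χ) - inner ℝ (S.M 0 (w s)) (S.ι χ)) -
        (inner ℝ (S.B s (v s)) (S.ι χ) - inner ℝ (S.B 0 (v s)) (S.ι χ)) := by linarith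
    rw [e]
    have e2 : a s + |s| * b s = ‖∫ r in (0 : ℝ)..s, R r‖ * ‖χ‖ + C * ‖∫ r in (0 : ℝ)..s, w r‖ +
      S.rate * |s| * ‖w s‖ * ‖S.ι χ‖ + S.rate * |s| * ‖v s‖ * ‖S.ι χ‖ := by
      simp only [a, b]; ring
    rw [e2]
    exact (abs_sub _ _).trans (add_le_add ((abs_sub _ _).trans (add_le_add ((abs_sub _ _).trans
      (add_le_add h10 h5)) h8)) h9)
  have hprim : ∀ᶠ h in 𝓝 (0 : ℝ), inner ℝ (S.ι v₀ + ∫ s in (0 : ℝ)..h, w s) (S.M 0 (S.ι χ)) -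
      inner ℝ (S.ι v₀ + ∫ s in (0 : ℝ)..(0 : ℝ), w s) (S.M 0 (S.ι χ)) - (h - 0) • d =
      ∫ s in (0 : ℝ)..h, (inner ℝ (w s) (S.M 0 (S.ι χ)) - d) := by
    filter_upwards [Icc_mem_nhds h0'.1 h0'.2] with h hh
    have hwI := intervalIntegrable_of_integrable_time hw hh h0
    have hwI2 : IntervalIntegrable (fun s => inner ℝ (w s) (S.M 0 (S.ι χ))) volume 0 h :=
      intervalIntegrable_of_integrable_time (hw.inner_const (𝕜 := ℝ) _) hh h0
    rw [intervalIntegral.integral_sub hwI2 (by simp), intervalIntegral.integral_const,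
      intervalIntegral.integral_same, add_zero, inner_add_left, add_sub_cancel_left]
    congr 1
    have := (innerSL ℝ (S.M 0 (S.ι χ))).intervalIntegral_comp_comm hwI
    simp only [innerSL_apply_apply] at this
    simp only [real_inner_comm _ (S.M 0 (S.ι χ))] at this
    exact this.symm
  rw [hasDerivAt_iff_isLittleO]
  refine Asymptotics.IsLittleO.of_bound fun ε hε => ?_
  obtain ⟨δ, hδ, hδa⟩ := Metric.eventually_nhds_iff.1
    (ha0.eventually (gt_mem_nhds (half_pos hε)))
  have hbε := (hb0.norm).eventually (gt_mem_nhds (by simpa using half_pos hε : ‖(0:ℝ)‖ < ε / 2))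
  filter_upwards [hprim, hbε, Icc_mem_nhds h0'.1 h0'.2, Metric.ball_mem_nhds 0 hδ] with h h1 h2 h3 h4
  rw [h1]
  have hbI := intervalIntegrable_of_integrable_time hbi h3 h0
  have h5 : ‖∫ s in (0 : ℝ)..h, (inner ℝ (w s) (S.M 0 (S.ι χ)) - d)‖ ≤
      |∫ s in (0 : ℝ)..h, (ε / 2 + |h| * b s)| := by
    refine intervalIntegral.norm_integral_le_abs_of_norm_le ?_
      ((intervalIntegrable_const).add (hbI.const_mul _))
    have h6 := (ae_restrict_iff' measurableSet_Ioo).1 herr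
    have hT1 : ∀ᵐ x : ℝ, x ≠ T := by simp [ae_iff, measure_singleton]
    have hT2 : ∀ᵐ x : ℝ, x ≠ -T := by simp [ae_iff, measure_singleton]
    rw [ae_restrict_iff' measurableSet_uIoc]
    filter_upwards [h6, hT1, hT2] with s h6 h7 h8 hs
    have hs' := uIoc_subset_uIcc hs
    have hs2 := uIcc_subset_Icc h0 h3 hs'
    have hs3 : |s| ≤ |h| := by
      rcases mem_uIcc.1 hs' with h9 | h9
      · rw [abs_of_nonneg h9.1, abs_of_nonneg (h9.1.trans h9.2)]; exact h9.2
      · rw [abs_of_nonpos h9.2, abs_of_nonpos (h9.1.trans h9.2)]; linarith [h9.1]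
    refine (h6 ⟨lt_of_le_of_ne hs2.1 (Ne.symm h8), lt_of_le_of_ne hs2.2 h7⟩).trans ?_
    have hbn : 0 ≤ b s := by have := S.rate_nonneg; simp only [b]; positivity
    refine add_le_add (hδa ?_).le (by gcongr)
    rw [Real.dist_eq, sub_zero]
    rw [mem_ball_zero_iff, Real.norm_eq_abs] at h4
    linarith
  refine h5.trans ?_
  rw [intervalIntegral.integral_add intervalIntegrable_const (hbI.const_mul _),
    intervalIntegral.integral_const, intervalIntegral.integral_const_mul]
  refine (abs_add_le _ _).trans ?_
  rw [abs_mul, abs_abs, smul_eq_mul, abs_mul, sub_zero, abs_of_pos (half_pos hε), Real.norm_eq_abs]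
  rw [Real.norm_eq_abs] at h2
  nlinarith [abs_nonneg h]

/-- Weak solutions are mild solutions. -/
theorem isMildSolution_of_weak {T : ℝ} (hT : 0 < T) {v₀ : V} {v₁ : H} {F : ℝ → H}
    (hF : Integrable F (timeMeasure T)) {v : ℝ → V} {w : ℝ → H}
    (hv : MemLp v 2 (timeMeasure T)) (hw : MemLp w 2 (timeMeasure T))
    (hpos : ∀ᵐ t ∂(timeMeasure T), S.ι (v t) = S.ι v₀ + ∫ s in (0 : ℝ)..t, w s)
    {D : Set V} (hD : Dense D)
    (hweak : ∀ η : ℝ → ℝ, ContDiff ℝ ∞ η → HasCompactSupport η → tsupport η ⊆ Ioo (-T) T →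
      ∀ χ ∈ D, ∫ t in Ioo (-T) T, (deriv η t * inner ℝ (S.momentum t (v t) (w t)) χ +
        η t * inner ℝ (S.force t (v t) (w t) (F t)) χ) = 0)
    (hB : ∀ χ ∈ D, ∃ C, ∀ x, |inner ℝ (S.B 0 x) (S.ι χ)| ≤ C * ‖S.ι x‖)
    (hder : ∀ χ ∈ D, HasDerivAt
      (fun t => inner ℝ (S.ι v₀ + ∫ s in (0 : ℝ)..t, w s) (S.M 0 (S.ι χ)))
      (inner ℝ v₁ (S.M 0 (S.ι χ))) 0) :
    S.IsMildSolution T v₀ v₁ F v w := by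
  have hvi : Integrable v (timeMeasure T) := hv.integrable (by norm_num)
  have hwi : Integrable w (timeMeasure T) := hw.integrable (by norm_num)
  have hRi := S.integrable_force hvi hwi hF
  have hPi : Integrable (fun t => S.momentum t (v t) (w t)) (timeMeasure T) := by
    have h1 : Continuous fun t => (S.ι†).comp (S.M t) := continuous_const.clm_comp S.continuous_M
    have h2 : Continuous fun t => (S.ι†).comp (S.B t) := continuous_const.clm_comp S.continuous_B
    refine ((integrable_clm hwi h1).add (integrable_clm hvi h2)).congr (.of_forall fun t => ?_)
    simp [WaveSystem.momentum]
  obtain ⟨c, hc⟩ := exists_ae_eq_add_integral hT hPi hRi fun η h1 h2 h3 => by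
    have hηd : Continuous (deriv η) := h1.continuous_deriv (by simp)
    have i1 : Integrable (fun t => deriv η t • S.momentum t (v t) (w t)) (timeMeasure T) :=
      integrable_clm hPi (U := fun t => deriv η t • ContinuousLinearMap.id ℝ V)
        (hηd.smul continuous_const)
    have i2 : Integrable (fun t => η t • S.force t (v t) (w t) (F t)) (timeMeasure T) :=
      integrable_clm hRi (U := fun t => η t • ContinuousLinearMap.id ℝ V)
        (h1.continuous.smul continuous_const)
    refine hD.eq_zero_of_inner_left (𝕜 := ℝ) fun χ hχ => ?_
    have i3 : Integrable (fun t => deriv η t • S.momentum t (v t) (w t) +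
      η t • S.force t (v t) (w t) (F t)) (volume.restrict (Ioo (-T) T)) := i1.add i2
    rw [real_inner_comm, ← integral_inner i3]
    refine (integral_congr_ae (.of_forall fun t => ?_)).trans (hweak η h1 h2 h3 χ hχ)
    simp only [inner_add_right, inner_smul_right, real_inner_comm]
  refine ⟨hv, hw, hpos, ?_⟩
  -- The same pairing is differentiated at `0` twice: once from the momentum with the unknown
  -- constant `c`, once from the prescribed initial velocity.
  have hc' : c = S.momentum 0 v₀ v₁ := by
    refine hD.eq_of_inner_left (𝕜 := ℝ) fun χ hχ => ?_
    obtain ⟨C, hC⟩ := hB χ hχ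
    have h1 := (hasDerivAt_inner_position hT hvi hwi hRi hpos hc hC).unique (hder χ hχ)
    rw [WaveSystem.momentum, ContinuousLinearMap.adjoint_inner_left, inner_add_left, S.symm_M]
    exact (sub_eq_iff_eq_add.1 h1)
  rw [← hc']
  exact hc

/-- Mild solutions are weak solutions. -/
theorem IsMildSolution.integral_eq_zero {T : ℝ} (hT : 0 < T) {v₀ : V} {v₁ : H} {F : ℝ → H}
    (hF : Integrable F (timeMeasure T)) {v : ℝ → V} {w : ℝ → H}
    (h : S.IsMildSolution T v₀ v₁ F v w) {ψ ψ' : ℝ → V} (hψ : ∀ t, HasDerivAt ψ (ψ' t) t)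
    (hψ' : Continuous ψ') (h1 : ψ (-T) = 0) (h2 : ψ T = 0) :
    ∫ t in Ioo (-T) T, (inner ℝ (S.momentum t (v t) (w t)) (ψ' t) +
        inner ℝ (S.force t (v t) (w t) (F t)) (ψ t)) = 0 := by
  have hvi : Integrable v (timeMeasure T) := h.memLp.integrable (by norm_num)
  have hwi : Integrable w (timeMeasure T) := h.memLp_deriv.integrable (by norm_num)
  have hRi := S.integrable_force hvi hwi hF
  have h0 : (0 : ℝ) ∈ Icc (-T) T := by constructor <;> linarith
  have hTT : (T : ℝ) ∈ Icc (-T) T := by constructor <;> linarith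
  have hmT : (-T : ℝ) ∈ Icc (-T) T := by constructor <;> linarith
  set R : ℝ → V := fun t => S.force t (v t) (w t) (F t) with hR
  set P : ℝ → V := fun t => S.momentum 0 v₀ v₁ + ∫ s in (0 : ℝ)..t, R s with hP
  have hf : ∀ t ∈ uIcc (-T) T, P t = P (-T) + ∫ s in (-T)..t, R s := fun t ht => by
    rw [uIcc_of_le (by linarith)] at ht
    simp only [P]
    rw [add_assoc, intervalIntegral.integral_add_adjacent_intervals
      (intervalIntegrable_of_integrable_time hRi hmT h0)
      (intervalIntegrable_of_integrable_time hRi ht hmT)]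
  have hψi := hψ'.intervalIntegrable (μ := volume) (-T) T
  have hg : ∀ t ∈ uIcc (-T) T, ψ t = ψ (-T) + ∫ s in (-T)..t, ψ' s := fun t ht => by
    rw [intervalIntegral.integral_eq_sub_of_hasDerivAt (fun s _ => hψ s)
      (hψ'.intervalIntegrable _ _)]
    abel
  obtain ⟨-, hh⟩ := integral_deriv_weighted_inner
    (L := fun _ => ContinuousLinearMap.id ℝ V) (L' := fun _ => 0)
    (fun t => hasDerivAt_const t _) continuous_const 0
    (intervalIntegrable_of_integrable_time hRi hTT hmT) hψi hf hg
  rw [h1, h2, inner_zero_right, inner_zero_right, mul_zero, mul_zero, sub_zero, intervalIntegral.integral_of_le (by linarith),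
    integral_Ioc_eq_integral_Ioo] at hh
  rw [← hh]
  refine integral_congr_ae ?_
  filter_upwards [h.momentum] with t ht
  rw [ht]
  simp only [_root_.zero_apply, zero_add, zero_mul, inner_zero_left, Real.exp_zero, one_mul,
    ContinuousLinearMap.id_apply]
  rw [add_comm]

/-- The initial velocity of mild solutions with bounded velocity is attained weakly. -/
theorem IsMildSolution.hasDerivAt_inner {T : ℝ} (hT : 0 < T) {v₀ : V} {v₁ : H} {F : ℝ → H}
    (hF : Integrable F (timeMeasure T)) {v : ℝ → V} {w : ℝ → H}
    (h : S.IsMildSolution T v₀ v₁ F v w) {K : ℝ} (hK : ∀ᵐ t ∂(timeMeasure T), ‖w t‖ ≤ K)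
    {D : Set V} (hD : Dense D)
    (hB : ∀ χ ∈ D, ∃ C, ∀ x, |inner ℝ (S.B 0 x) (S.ι χ)| ≤ C * ‖S.ι x‖) (f : H) :
    HasDerivAt (fun t => inner ℝ (S.ι v₀ + ∫ s in (0 : ℝ)..t, w s) f) (inner ℝ v₁ f) 0 := by
  have hvi : Integrable v (timeMeasure T) := h.memLp.integrable (by norm_num)
  have hwi : Integrable w (timeMeasure T) := h.memLp_deriv.integrable (by norm_num)
  have hRi := S.integrable_force hvi hwi hF
  have h0' : (0 : ℝ) ∈ Ioo (-T) T := by constructor <;> linarith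
  -- By coercivity, a vector orthogonal to the range is zero.
  have hMd : DenseRange (S.M 0) := by
    have : ((S.M 0).range.topologicalClosure) = ⊤ := by
      rw [Submodule.topologicalClosure_eq_top_iff, Submodule.eq_bot_iff]
      intro y hy
      have h1 : inner ℝ (S.M 0 y) y = 0 := hy _ ⟨y, rfl⟩
      have h2 := S.lower_M 0 y
      rw [h1] at h2
      by_contra hne
      have := mul_pos S.lower_pos (pow_pos (norm_pos_iff.2 hne) 2)
      linarith
    have h3 : closure (range (S.M 0)) = univ := by
      have := congrArg (fun W : Submodule ℝ H => (W : Set H)) this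
      simpa using! this
    exact dense_iff_closure_eq.2 h3
  have hdense : DenseRange fun χ : D => S.M 0 (S.ι χ) :=
    hMd.comp (S.dense.comp hD.denseRange_val S.ι.continuous) (S.M 0).continuous
  have hD1 : ∀ χ ∈ D, HasDerivAt
      (fun t => inner ℝ (S.ι v₀ + ∫ s in (0 : ℝ)..t, w s) (S.M 0 (S.ι χ)))
      (inner ℝ v₁ (S.M 0 (S.ι χ))) 0 := fun χ hχ => by
    obtain ⟨C, hC⟩ := hB χ hχ
    have := hasDerivAt_inner_position hT hvi hwi hRi h.position h.momentum hC
    convert! this using 1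
    rw [WaveSystem.momentum, ContinuousLinearMap.adjoint_inner_left, inner_add_left, S.symm_M]
    ring
  -- The bounded velocity makes the difference quotients uniformly bounded, so differentiability at
  -- `0` passes from a dense set of functionals to all of them.
  have hlip : ∀ᶠ t in 𝓝 (0 : ℝ), ‖∫ s in (0 : ℝ)..t, w s‖ ≤ K * |t| := by
    filter_upwards [Icc_mem_nhds h0'.1 h0'.2] with t ht
    have h6 := (ae_restrict_iff' measurableSet_Ioo).1 hK
    have hT1 : ∀ᵐ x : ℝ, x ≠ T := by simp [ae_iff, measure_singleton]
    have hT2 : ∀ᵐ x : ℝ, x ≠ -T := by simp [ae_iff, measure_singleton]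
    have := intervalIntegral.norm_integral_le_of_norm_le_const_ae (f := w) (a := 0) (b := t)
      (C := K) (by
        filter_upwards [h6, hT1, hT2] with s h6 h7 h8 hs
        have hs2 := uIcc_subset_Icc ⟨h0'.1.le, h0'.2.le⟩ ht (uIoc_subset_uIcc hs)
        exact h6 ⟨lt_of_le_of_ne hs2.1 (Ne.symm h8), lt_of_le_of_ne hs2.2 h7⟩)
    simpa using this
  have hK0 : 0 ≤ K := by
    have : (timeMeasure T) ≠ 0 := by
      rw [timeMeasure, Ne, Measure.restrict_eq_zero, Real.volume_Ioo]; simp [hT]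
    have : (ae (timeMeasure T)).NeBot := ae_neBot.2 this
    obtain ⟨t, ht⟩ := hK.exists
    exact (norm_nonneg _).trans ht
  rw [hasDerivAt_iff_isLittleO]
  refine Asymptotics.IsLittleO.of_bound fun ε hε => ?_
  obtain ⟨χ, hχ⟩ := hdense.exists_dist_lt f (ε := ε / (2 * (K + ‖v₁‖ + 1))) (by positivity)
  have h1 := (hasDerivAt_iff_isLittleO.1 (hD1 χ χ.2)).bound (half_pos hε)
  filter_upwards [h1, hlip] with t h1 h2
  set g := S.M 0 (S.ι (χ : V))
  have hfg : ‖f - g‖ * (K + ‖v₁‖) ≤ ε / 2 := by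
    rw [dist_eq_norm, lt_div_iff₀ (by positivity)] at hχ
    nlinarith [norm_nonneg (f - g), norm_nonneg v₁]
  have e : inner ℝ (S.ι v₀ + ∫ s in (0 : ℝ)..t, w s) f -
      inner ℝ (S.ι v₀ + ∫ s in (0 : ℝ)..(0 : ℝ), w s) f - (t - 0) • inner ℝ v₁ f =
      (inner ℝ (S.ι v₀ + ∫ s in (0 : ℝ)..t, w s) g -
      inner ℝ (S.ι v₀ + ∫ s in (0 : ℝ)..(0 : ℝ), w s) g - (t - 0) • inner ℝ v₁ g) +
      (inner ℝ (∫ s in (0 : ℝ)..t, w s) (f - g) - t * inner ℝ v₁ (f - g)) := by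
    simp only [inner_add_left, inner_sub_right, intervalIntegral.integral_same, inner_zero_left,
      smul_eq_mul]
    ring
  rw [e]
  refine (norm_add_le _ _).trans ?_
  have h3 : ‖inner ℝ (∫ s in (0 : ℝ)..t, w s) (f - g) - t * inner ℝ v₁ (f - g)‖ ≤
      |t| * (‖f - g‖ * (K + ‖v₁‖)) := by
    refine (norm_sub_le _ _).trans ?_
    rw [norm_mul, Real.norm_eq_abs, Real.norm_eq_abs, Real.norm_eq_abs]
    have h4 := abs_real_inner_le_norm (∫ s in (0 : ℝ)..t, w s) (f - g)
    have h5 := abs_real_inner_le_norm v₁ (f - g)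
    have h6 := mul_le_mul_of_nonneg_right h2 (norm_nonneg (f - g))
    have h7 := mul_le_mul_of_nonneg_left h5 (abs_nonneg t)
    linarith
  rw [sub_zero, Real.norm_eq_abs t] at h1 ⊢
  have h8 := mul_le_mul_of_nonneg_left hfg (abs_nonneg t)
  linarith

end WaveSystem

end AAdS

namespace AAdS

open scoped InnerProduct

/-! ### Smooth functions on products with the sphere -/

/-- The radial projection to the unit sphere. -/
def unitPt {n : ℕ} (y : Euc n) (h : y ≠ 0) : Sph n :=
  ⟨‖y‖⁻¹ • y, by
    rw [mem_sphere_zero_iff_norm, norm_smul, norm_inv, norm_norm,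
      inv_mul_cancel₀ (norm_ne_zero_iff.mpr h)]⟩

lemma sph_ne_zero {n : ℕ} (θ : Sph n) : (θ : Euc n) ≠ 0 := by
  intro h
  have := norm_eq_of_mem_sphere θ
  rw [h, norm_zero] at this
  exact zero_ne_one this

lemma radialExt_eq {n : ℕ} (f : Sph n → ℝ) {y : Euc n} (h : y ≠ 0) :
    radialExt f y = f (unitPt y h) := by
  simp [radialExt, h, unitPt]

lemma unitPt_coe {n : ℕ} (θ : Sph n) : unitPt (θ : Euc n) (sph_ne_zero θ) = θ := by
  ext1
  simp [unitPt]

lemma unitPt_smul {n : ℕ} {y : Euc n} (hy : y ≠ 0) {r : ℝ} (hr : 0 < r) (h : r • y ≠ 0) :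
    unitPt (r • y) h = unitPt y hy := by
  ext1
  simp only [unitPt, norm_smul, Real.norm_eq_abs, abs_of_pos hr, smul_smul]
  congr 1
  field_simp

@[simp]
lemma radialExt_coe {n : ℕ} (f : Sph n → ℝ) (θ : Sph n) : radialExt f (θ : Euc n) = f θ := by
  rw [radialExt_eq f (sph_ne_zero θ), unitPt_coe]

variable {n : ℕ} {X : Type} [NormedAddCommGroup X] [NormedSpace ℝ X]

/-- The extension of a function that is constant along rays in the second variable. -/
def jointExt (Q : X × Sph n → ℝ) (p : X × Euc n) : ℝ := radialExt (fun θ => Q (p.1, θ)) p.2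

@[simp]
lemma jointExt_coe (Q : X × Sph n → ℝ) (x : X) (θ : Sph n) :
    jointExt Q (x, (θ : Euc n)) = Q (x, θ) := radialExt_coe _ θ

lemma jointExt_eq (Q : X × Sph n → ℝ) (x : X) {y : Euc n} (h : y ≠ 0) :
    jointExt Q (x, y) = Q (x, unitPt y h) := radialExt_eq _ h

lemma SmoothOver.contDiffOn {U : Set X} {Q : X × Sph n → ℝ} (h : SmoothOver U Q) :
    ContDiffOn ℝ ∞ (jointExt Q) (U ×ˢ {0}ᶜ) := h

lemma contDiffOn_normalize :
    ContDiffOn ℝ ∞ (fun y : Euc n => ‖y‖⁻¹ • y) ({0}ᶜ) := fun y hy => by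
  have hy : y ≠ 0 := hy
  exact (((contDiffAt_norm ℝ hy).inv (norm_ne_zero_iff.2 hy)).smul contDiffAt_id).contDiffWithinAt

/-- Composition with `y ↦ y / |y|` produces the extension that is constant along rays, so `G` need
not be homogeneous itself. -/
lemma smoothOver_of_contDiffOn {U : Set X} {G : X × Euc n → ℝ}
    (h : ContDiffOn ℝ ∞ G (U ×ˢ {0}ᶜ)) :
    SmoothOver U fun p : X × Sph n => G (p.1, (p.2 : Euc n)) := by
  have h1 : ContDiffOn ℝ ∞ (fun p : X × Euc n => (p.1, ‖p.2‖⁻¹ • p.2)) (U ×ˢ {0}ᶜ) :=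
    contDiffOn_fst.prodMk (contDiffOn_normalize.comp contDiffOn_snd fun p hp => hp.2)
  refine (h.comp h1 fun p hp => ⟨hp.1, ?_⟩).congr fun p hp => ?_
  · have := sph_ne_zero (unitPt p.2 hp.2)
    exact this
  · exact radialExt_eq _ hp.2

lemma SmoothOver.congr {U : Set X} {Q Q' : X × Sph n → ℝ} (h : SmoothOver U Q)
    (he : ∀ p : X × Sph n, p.1 ∈ U → Q' p = Q p) : SmoothOver U Q' :=
  ContDiffOn.congr h fun p hp => by
    rw [radialExt_eq _ hp.2, radialExt_eq _ hp.2, he _ hp.1]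

lemma SmoothOver.mono {U U' : Set X} {Q : X × Sph n → ℝ} (h : SmoothOver U Q) (hU : U' ⊆ U) :
    SmoothOver U' Q :=
  ContDiffOn.mono h (prod_mono_left hU)

lemma smoothOver_fst {U : Set X} {f : X → ℝ} (h : ContDiffOn ℝ ∞ f U) :
    SmoothOver U fun p : X × Sph n => f p.1 :=
  smoothOver_of_contDiffOn (h.comp contDiffOn_fst fun _ hp => hp.1)

lemma smoothOver_coord (U : Set X) (i : Fin (n - 1)) :
    SmoothOver U fun p : X × Sph n => (p.2 : Euc n) i :=
  smoothOver_of_contDiffOn (G := fun p => p.2 i)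
    (ContDiff.contDiffOn (by fun_prop))

lemma SmoothOver.comp_pi {ι : Type*} [Fintype ι] {U : Set X} {Q : ι → X × Sph n → ℝ}
    (hQ : ∀ i, SmoothOver U (Q i)) {Φ : (ι → ℝ) → ℝ}
    (hΦ : ∀ p : X × Sph n, p.1 ∈ U → ContDiffAt ℝ ∞ Φ fun i => Q i p) :
    SmoothOver U fun p => Φ fun i => Q i p := by
  intro p hp
  have h1 : ContDiffWithinAt ℝ ∞ (fun q i => jointExt (Q i) q) (U ×ˢ {0}ᶜ) p :=
    contDiffWithinAt_pi.2 fun i => hQ i p hp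
  have h2 := hΦ (p.1, unitPt p.2 hp.2) hp.1
  have e : (fun i => Q i (p.1, unitPt p.2 hp.2)) = fun i => jointExt (Q i) p :=
    funext fun i => (jointExt_eq _ _ hp.2).symm
  rw [e] at h2
  refine (h2.comp_contDiffWithinAt p h1).congr (fun q hq => ?_) ?_
  · rw [radialExt_eq _ hq.2]
    simp only [Function.comp, jointExt, radialExt_eq _ hq.2]
  · rw [radialExt_eq _ hp.2]
    simp only [Function.comp, jointExt, radialExt_eq _ hp.2]

lemma SmoothOver.add {U : Set X} {Q Q' : X × Sph n → ℝ} (h : SmoothOver U Q)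
    (h' : SmoothOver U Q') : SmoothOver U fun p => Q p + Q' p :=
  (ContDiffOn.add h h').congr fun p hp => by simp only [radialExt_eq _ hp.2]

lemma SmoothOver.mul {U : Set X} {Q Q' : X × Sph n → ℝ} (h : SmoothOver U Q)
    (h' : SmoothOver U Q') : SmoothOver U fun p => Q p * Q' p :=
  (ContDiffOn.mul h h').congr fun p hp => by simp only [radialExt_eq _ hp.2]

lemma SmoothOver.comp_fst {X' : Type} [NormedAddCommGroup X'] [NormedSpace ℝ X'] {U : Set X}
    {U' : Set X'} {Q : X × Sph n → ℝ} (h : SmoothOver U Q) {f : X' → X}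
    (hf : ContDiffOn ℝ ∞ f U') (hm : MapsTo f U' U) :
    SmoothOver U' fun p : X' × Sph n => Q (f p.1, p.2) := by
  have h1 : ContDiffOn ℝ ∞ (fun p : X' × Euc n => (f p.1, p.2)) (U' ×ˢ {0}ᶜ) :=
    (hf.comp contDiffOn_fst fun p hp => hp.1).prodMk contDiffOn_snd
  exact ContDiffOn.comp h h1 fun p hp => ⟨hm hp.1, hp.2⟩

lemma SmoothOver.continuousOn {U : Set X} {Q : X × Sph n → ℝ} (h : SmoothOver U Q) :
    ContinuousOn Q (U ×ˢ univ) := by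
  have h1 : ContinuousOn (fun p : X × Sph n => (p.1, (p.2 : Euc n))) (U ×ˢ univ) := by fun_prop
  refine (h.contDiffOn.continuousOn.comp h1 fun p hp => ⟨hp.1, sph_ne_zero p.2⟩).congr
    fun p _ => ?_
  exact (jointExt_coe Q p.1 p.2).symm

lemma SmoothOver.continuous {Q : X × Sph n → ℝ} (h : SmoothOver univ Q) : Continuous Q := by
  have := h.continuousOn
  rwa [univ_prod_univ, continuousOn_univ] at this

lemma isOpen_prod_compl_zero {U : Set X} (hU : IsOpen U) :
    IsOpen (U ×ˢ ({0}ᶜ : Set (Euc n))) := hU.prod isOpen_compl_singleton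

lemma SmoothOver.contDiffAt {U : Set X} (hU : IsOpen U) {Q : X × Sph n → ℝ} (h : SmoothOver U Q)
    {x : X} (hx : x ∈ U) {y : Euc n} (hy : y ≠ 0) : ContDiffAt ℝ ∞ (jointExt Q) (x, y) :=
  h.contDiffOn.contDiffAt ((isOpen_prod_compl_zero hU).mem_nhds ⟨hx, hy⟩)

lemma SmoothOver.hasFDerivAt {U : Set X} (hU : IsOpen U) {Q : X × Sph n → ℝ} (h : SmoothOver U Q)
    {x : X} (hx : x ∈ U) {y : Euc n} (hy : y ≠ 0) :
    HasFDerivAt (jointExt Q) (fderiv ℝ (jointExt Q) (x, y)) (x, y) :=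
  ((h.contDiffAt hU hx hy).differentiableAt (by simp)).hasFDerivAt

/-- The derivative of a function on `X × S^(n-2)` in a direction of `X × ℝ^(n-1)`. -/
def dirDeriv (v : X × Euc n) (Q : X × Sph n → ℝ) (p : X × Sph n) : ℝ :=
  fderiv ℝ (jointExt Q) (p.1, (p.2 : Euc n)) v

lemma SmoothOver.dirDeriv {U : Set X} (hU : IsOpen U) {Q : X × Sph n → ℝ} (h : SmoothOver U Q)
    (v : X × Euc n) : SmoothOver U (dirDeriv v Q) := by
  have h1 := h.contDiffOn.fderiv_of_isOpen (m := ∞) (isOpen_prod_compl_zero hU) (by simp)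
  exact smoothOver_of_contDiffOn (h1.clm_apply contDiffOn_const)

lemma SmoothOver.hasDerivAt_comp {U : Set X} (hU : IsOpen U) {Q : X × Sph n → ℝ}
    (h : SmoothOver U Q) {c : ℝ → X} {c' : X} {s : ℝ} (hc : HasDerivAt c c' s) (hs : c s ∈ U)
    (θ : Sph n) : HasDerivAt (fun r => Q (c r, θ)) (AAdS.dirDeriv (c', 0) Q (c s, θ)) s := by
  have h1 : HasDerivAt (fun r => (c r, (θ : Euc n))) (c', 0) s := hc.prodMk (hasDerivAt_const _ _)
  have h2 := (h.hasFDerivAt hU hs (sph_ne_zero θ)).comp_hasDerivAt s h1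
  exact h2.congr_of_eventuallyEq (.of_forall fun r => (jointExt_coe Q _ θ).symm)

lemma SmoothOver.gradS_apply {U : Set X} (hU : IsOpen U) {Q : X × Sph n → ℝ}
    (h : SmoothOver U Q) {p : X × Sph n} (hp : p.1 ∈ U) (i : Fin (n - 1)) :
    gradS Q p i = AAdS.dirDeriv (0, EuclideanSpace.single i 1) Q p := by
  have h1 : HasFDerivAt (fun y : Euc n => (p.1, y)) (ContinuousLinearMap.inr ℝ X (Euc n))
      (p.2 : Euc n) := hasFDerivAt_prodMk_right _ _
  have h2 := (h.hasFDerivAt hU hp (sph_ne_zero p.2)).comp (p.2 : Euc n) h1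
  have h3 : HasFDerivAt (radialExt fun θ => Q (p.1, θ)) _ (p.2 : Euc n) := h2
  have h4 : inner ℝ (gradS Q p) (EuclideanSpace.single i (1 : ℝ)) = gradS Q p i := by
    simp [EuclideanSpace.inner_single_right]
  rw [← h4, gradS, gradient, InnerProductSpace.toDual_symm_apply, h3.fderiv]
  simp [AAdS.dirDeriv]

lemma SmoothOver.differentiableAt_radialExt {U : Set X} (hU : IsOpen U) {Q : X × Sph n → ℝ}
    (h : SmoothOver U Q) {x : X} (hx : x ∈ U) {y : Euc n} (hy : y ≠ 0) :
    DifferentiableAt ℝ (radialExt fun θ => Q (x, θ)) y := by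
  have h1 : HasFDerivAt (fun y : Euc n => (x, y)) (ContinuousLinearMap.inr ℝ X (Euc n)) y :=
    hasFDerivAt_prodMk_right _ _
  exact ((h.hasFDerivAt hU hx hy).comp y h1).differentiableAt

/-- The gradient is tangent to the sphere. -/
lemma inner_gradS {Q : X × Sph n → ℝ} (p : X × Sph n)
    (hd : DifferentiableAt ℝ (radialExt fun θ => Q (p.1, θ)) (p.2 : Euc n)) :
    inner ℝ (gradS Q p) (p.2 : Euc n) = 0 := by
  rw [gradS, gradient, InnerProductSpace.toDual_symm_apply]
  have h1 : HasDerivAt (fun r : ℝ => r • (p.2 : Euc n)) (p.2 : Euc n) 1 := by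
    simpa using (hasDerivAt_id (1 : ℝ)).smul_const (p.2 : Euc n)
  have h2 : HasFDerivAt (radialExt fun θ => Q (p.1, θ)) (fderiv ℝ (radialExt fun θ => Q (p.1, θ))
      (p.2 : Euc n)) ((1 : ℝ) • (p.2 : Euc n)) := by simpa using hd.hasFDerivAt
  have h3 := h2.comp_hasDerivAt (1 : ℝ) h1
  have h4 : HasDerivAt ((radialExt fun θ => Q (p.1, θ)) ∘ fun r : ℝ => r • (p.2 : Euc n)) 0 1 := by
    refine (hasDerivAt_const (1 : ℝ) (Q p)).congr_of_eventuallyEq ?_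
    filter_upwards [lt_mem_nhds (zero_lt_one' ℝ)] with r hr
    have hne : r • (p.2 : Euc n) ≠ 0 := smul_ne_zero hr.ne' (sph_ne_zero _)
    simp only [Function.comp]
    rw [radialExt_eq _ hne, unitPt_smul (sph_ne_zero p.2) hr hne, unitPt_coe]
  exact h3.unique h4

/-- Symmetry of the second derivative of the extension. One of the directions must be tangent to
`X`: only then is the derivative again constant along rays, so that extending it from the sphere
gives the derivative of the extension. Derivatives along the sphere scale like `1 / |y|` instead. -/
lemma dirDeriv_comm {U : Set X} (hU : IsOpen U) {Q : X × Sph n → ℝ} (h : SmoothOver U Q)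
    (u : X) (v : X × Euc n) {p : X × Sph n} (hp : p.1 ∈ U) :
    dirDeriv (u, 0) (dirDeriv v Q) p = dirDeriv v (dirDeriv (u, 0) Q) p := by
  obtain ⟨x, θ⟩ := p
  have hx : x ∈ U := hp
  have hθ := sph_ne_zero θ
  have hG := h.contDiffAt hU hx hθ
  have hsymm : IsSymmSndFDerivAt ℝ (jointExt Q) (x, (θ : Euc n)) :=
    hG.isSymmSndFDerivAt (by
      rw [minSmoothness_of_isRCLikeNormedField]; 
      exact WithTop.coe_le_coe.2 (by exact_mod_cast le_top))
  have hd2 : DifferentiableAt ℝ (fderiv ℝ (jointExt Q)) (x, (θ : Euc n)) :=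
    (hG.fderiv_right (m := ∞) (by simp)).differentiableAt (by simp)
  have hap : ∀ w : X × Euc n, HasFDerivAt (fun q => fderiv ℝ (jointExt Q) q w)
      ((fderiv ℝ (fderiv ℝ (jointExt Q)) (x, (θ : Euc n))).flip w) (x, (θ : Euc n)) := fun w => by
    have := hd2.hasFDerivAt.clm_apply (hasFDerivAt_const w _)
    simpa using this
  have hline : HasDerivAt (fun s : ℝ => x + s • u) u 0 := by
    simpa using ((hasDerivAt_id (0 : ℝ)).smul_const u).const_add x
  have h1 : dirDeriv (u, 0) (dirDeriv v Q) (x, θ) =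
      fderiv ℝ (fderiv ℝ (jointExt Q)) (x, (θ : Euc n)) (u, 0) v := by
    have e1 := (h.dirDeriv hU v).hasDerivAt_comp hU hline (by simpa using hx) θ
    have e2 : HasDerivAt (fun s : ℝ => (x + s • u, (θ : Euc n))) (u, 0) 0 :=
      hline.prodMk (hasDerivAt_const _ _)
    have e3 : HasFDerivAt (fun q => fderiv ℝ (jointExt Q) q v)
      ((fderiv ℝ (fderiv ℝ (jointExt Q)) (x, (θ : Euc n))).flip v)
      ((fun s : ℝ => (x + s • u, (θ : Euc n))) 0) := by simpa using hap v
    have e4 := e3.comp_hasDerivAt (0 : ℝ) e2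
    have e5 := e1.unique e4
    simpa using e5
  have h2 : jointExt (dirDeriv (u, 0) Q) =ᶠ[𝓝 (x, (θ : Euc n))]
      fun q => fderiv ℝ (jointExt Q) q (u, 0) := by
    filter_upwards [(isOpen_prod_compl_zero hU).mem_nhds ⟨hx, hθ⟩] with q hq
    obtain ⟨x', y⟩ := q
    have hx' : x' ∈ U := hq.1
    have hy : y ≠ 0 := hq.2
    have hl : HasDerivAt (fun s : ℝ => x' + s • u) u 0 := by
      simpa using ((hasDerivAt_id (0 : ℝ)).smul_const u).const_add x'
    rw [jointExt_eq _ _ hy]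
    have e1 := h.hasDerivAt_comp hU hl (by simpa using hx') (unitPt y hy)
    have e2 : HasDerivAt (fun s : ℝ => (x' + s • u, y)) (u, 0) 0 :=
      hl.prodMk (hasDerivAt_const _ _)
    have e3 : HasFDerivAt (jointExt Q) (fderiv ℝ (jointExt Q) (x', y))
      ((fun s : ℝ => (x' + s • u, y)) 0) := by simpa using h.hasFDerivAt hU hx' hy
    have e4 := (e3.comp_hasDerivAt (0 : ℝ) e2).congr_of_eventuallyEq
      (.of_forall fun s => (jointExt_eq Q (x' + s • u) hy).symm)
    simpa using e1.unique e4
  rw [h1, hsymm.eq]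
  have h3 : dirDeriv v (dirDeriv (u, 0) Q) (x, θ) =
      fderiv ℝ (fun q => fderiv ℝ (jointExt Q) q (u, 0)) (x, (θ : Euc n)) v := by
    rw [dirDeriv, h2.fderiv_eq]
  rw [h3, (hap (u, 0)).fderiv]
  rfl

end AAdS

namespace AAdS

open scoped InnerProduct

/-! ### Test functions -/

section Support

variable {n : ℕ} {X : Type} [NormedAddCommGroup X] [NormedSpace ℝ X]

lemma eventually_snd_ne_zero (x : X) {y : Euc n} (hy : y ≠ 0) :
    ∀ᶠ p : X × Euc n in 𝓝 (x, y), p.2 ≠ 0 :=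
  continuousAt_snd.eventually_ne hy

lemma dirDeriv_eq_zero {K : Set X} (hK : IsClosed K) {Q : X × Sph n → ℝ}
    (h : ∀ x, x ∉ K → ∀ θ, Q (x, θ) = 0) (v : X × Euc n) :
    ∀ x, x ∉ K → ∀ θ, dirDeriv v Q (x, θ) = 0 := by
  intro x hx θ
  have h1 : jointExt Q =ᶠ[𝓝 (x, (θ : Euc n))] fun _ => 0 := by
    have h2 : ∀ᶠ p : X × Euc n in 𝓝 (x, (θ : Euc n)), p.1 ∈ Kᶜ :=
      continuousAt_fst.eventually (hK.isOpen_compl.mem_nhds hx)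
    have h3 : ∀ᶠ p : X × Euc n in 𝓝 (x, (θ : Euc n)), p.2 ≠ 0 :=
      eventually_snd_ne_zero _ (sph_ne_zero θ)
    filter_upwards [h2, h3] with p h2 h3
    rw [← Prod.mk.eta (p := p), jointExt_eq _ _ h3, h _ h2]
  rw [dirDeriv, h1.fderiv_eq]
  simp

lemma smoothOver_univ_of_supported {U K : Set X} (hU : IsOpen U) (hK : IsClosed K) (hKU : K ⊆ U)
    {Q : X × Sph n → ℝ} (h : SmoothOver U Q) (h0 : ∀ x, x ∉ K → ∀ θ, Q (x, θ) = 0) :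
    SmoothOver univ Q := by
  rintro ⟨x, y⟩ hp
  have hy : y ≠ 0 := hp.2
  by_cases hx : x ∈ U
  · exact (h.contDiffAt hU hx hy).contDiffWithinAt
  · have h1 : jointExt Q =ᶠ[𝓝 (x, y)] fun _ => 0 := by
      have h2 : ∀ᶠ p : X × Euc n in 𝓝 (x, y), p.1 ∈ Kᶜ :=
        continuousAt_fst.eventually (hK.isOpen_compl.mem_nhds fun hxK => hx (hKU hxK))
      have h3 : ∀ᶠ p : X × Euc n in 𝓝 (x, y), p.2 ≠ 0 :=
        eventually_snd_ne_zero _ (hy)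
      filter_upwards [h2, h3] with p h2 h3
      rw [← Prod.mk.eta (p := p), jointExt_eq _ _ h3, h0 _ h2]
    exact (contDiffAt_const.congr_of_eventuallyEq h1).contDiffWithinAt

lemma exists_Icc_of_isCompact {K : Set ℝ} (hK : IsCompact K) {c d : ℝ} (hcd : c < d)
    (h : K ⊆ Ioo c d) : ∃ p q, c < p ∧ q < d ∧ K ⊆ Icc p q := by
  rcases K.eq_empty_or_nonempty with rfl | hne
  · exact ⟨(c + d) / 2, (c + d) / 2, by linarith, by linarith, empty_subset _⟩
  · obtain ⟨p, hp, hp'⟩ := hK.exists_isLeast hne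
    obtain ⟨q, hq, hq'⟩ := hK.exists_isGreatest hne
    exact ⟨p, q, (h hp).1, (h hq).2, fun x hx => ⟨hp' hx, hq' hx⟩⟩

lemma dirDeriv_add {U : Set X} (hU : IsOpen U) {Q Q' : X × Sph n → ℝ} (h : SmoothOver U Q)
    (h' : SmoothOver U Q') (v : X × Euc n) {p : X × Sph n} (hp : p.1 ∈ U) :
    dirDeriv v (Q + Q') p = dirDeriv v Q p + dirDeriv v Q' p := by
  have h1 : jointExt (Q + Q') =ᶠ[𝓝 (p.1, (p.2 : Euc n))] jointExt Q + jointExt Q' := by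
    have h3 : ∀ᶠ q : X × Euc n in 𝓝 (p.1, (p.2 : Euc n)), q.2 ≠ 0 :=
      eventually_snd_ne_zero _ (sph_ne_zero p.2)
    filter_upwards [h3] with q h3
    simp only [jointExt, radialExt_eq _ h3, Pi.add_apply]
  have h2 := (h.hasFDerivAt hU hp (sph_ne_zero p.2)).add (h'.hasFDerivAt hU hp (sph_ne_zero p.2))
  simp only [dirDeriv, h1.fderiv_eq, h2.fderiv, _root_.add_apply]

lemma dirDeriv_mul {U : Set X} (hU : IsOpen U) {Q Q' : X × Sph n → ℝ} (h : SmoothOver U Q)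
    (h' : SmoothOver U Q') (v : X × Euc n) {p : X × Sph n} (hp : p.1 ∈ U) :
    dirDeriv v (fun q => Q q * Q' q) p = Q p * dirDeriv v Q' p + Q' p * dirDeriv v Q p := by
  have h1 : jointExt (fun q => Q q * Q' q) =ᶠ[𝓝 (p.1, (p.2 : Euc n))]
      fun q => jointExt Q q * jointExt Q' q := by
    have h3 : ∀ᶠ q : X × Euc n in 𝓝 (p.1, (p.2 : Euc n)), q.2 ≠ 0 :=
      eventually_snd_ne_zero _ (sph_ne_zero p.2)
    filter_upwards [h3] with q h3
    simp only [jointExt, radialExt_eq _ h3]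
  have h2 := (h.hasFDerivAt hU hp (sph_ne_zero p.2)).fun_mul
    (h'.hasFDerivAt hU hp (sph_ne_zero p.2))
  simp only [dirDeriv, h1.fderiv_eq, h2.fderiv]
  simp

lemma dirDeriv_const_smul (c : ℝ) {U : Set X} (hU : IsOpen U) {Q : X × Sph n → ℝ}
    (h : SmoothOver U Q) (v : X × Euc n) {p : X × Sph n} (hp : p.1 ∈ U) :
    dirDeriv v (c • Q) p = c * dirDeriv v Q p := by
  have h1 : jointExt (c • Q) =ᶠ[𝓝 (p.1, (p.2 : Euc n))] c • jointExt Q := by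
    have h3 : ∀ᶠ q : X × Euc n in 𝓝 (p.1, (p.2 : Euc n)), q.2 ≠ 0 :=
      eventually_snd_ne_zero _ (sph_ne_zero p.2)
    filter_upwards [h3] with q h3
    simp only [jointExt, radialExt_eq _ h3, Pi.smul_apply]
  have h2 := (h.hasFDerivAt hU hp (sph_ne_zero p.2)).const_smul c
  simp only [dirDeriv, h1.fderiv_eq, h2.fderiv]
  simp

end Support

variable {n : ℕ} {a : ℝ}

/-- Vanishing outside a compact interval in `x`, uniformly over the sphere, is easier to carry
through products and derivatives than a condition on the topological support. -/
lemma isSliceTest_iff (ha : 0 < a) {χ : ℝ × Sph n → ℝ} :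
    IsSliceTest a χ ↔ SmoothOver univ χ ∧ ∃ p q, 0 < p ∧ q < a ∧
      ∀ x, x ∉ Icc p q → ∀ θ, χ (x, θ) = 0 := by
  constructor
  · rintro ⟨h1, h2, h3⟩
    have hK : IsCompact (Prod.fst '' tsupport χ) := h2.isCompact.image continuous_fst
    obtain ⟨p, q, hp, hq, hpq⟩ := exists_Icc_of_isCompact hK ha (by
      rintro _ ⟨z, hz, rfl⟩; exact (h3 hz).1)
    refine ⟨h1, p, q, hp, hq, fun x hx θ => image_eq_zero_of_notMem_tsupport fun h => hx ?_⟩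
    exact hpq ⟨_, h, rfl⟩
  · rintro ⟨h1, p, q, hp, hq, h⟩
    have h0 : ∀ z : ℝ × Sph n, z ∉ Icc p q ×ˢ (univ : Set (Sph n)) → χ z = 0 := fun z hz =>
      h z.1 (fun hz' => hz ⟨hz', mem_univ _⟩) z.2
    have hc : IsCompact (Icc p q ×ˢ (univ : Set (Sph n))) := isCompact_Icc.prod isCompact_univ
    refine ⟨h1, HasCompactSupport.intro hc h0, ?_⟩
    refine (closure_minimal (fun z hz => ?_) hc.isClosed : tsupport χ ⊆ _).trans
      (prod_mono_left fun x hx => ⟨hp.trans_le hx.1, hx.2.trans_lt hq⟩)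
    by_contra hz'
    exact hz (h0 z hz')

lemma IsSliceTest.dirDeriv (ha : 0 < a) {χ : ℝ × Sph n → ℝ} (h : IsSliceTest a χ)
    (v : ℝ × Euc n) : IsSliceTest a (dirDeriv v χ) := by
  rw [isSliceTest_iff ha] at h ⊢
  obtain ⟨h1, p, q, hp, hq, h2⟩ := h
  exact ⟨h1.dirDeriv isOpen_univ v, p, q, hp, hq, dirDeriv_eq_zero isClosed_Icc h2 v⟩

lemma IsSliceTest.mul_left (ha : 0 < a) {χ Q : ℝ × Sph n → ℝ} (h : IsSliceTest a χ)
    (hQ : SmoothOver (Ioo 0 a) Q) : IsSliceTest a fun z => Q z * χ z := by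
  rw [isSliceTest_iff ha] at h ⊢
  obtain ⟨h1, p, q, hp, hq, h2⟩ := h
  have h0 : ∀ x, x ∉ Icc p q → ∀ θ, Q (x, θ) * χ (x, θ) = 0 := fun x hx θ => by
    rw [h2 x hx θ, mul_zero]
  refine ⟨smoothOver_univ_of_supported isOpen_Ioo isClosed_Icc (fun x hx => ?_)
    (hQ.mul (h1.mono (subset_univ _))) h0, p, q, hp, hq, h0⟩
  exact ⟨hp.trans_le hx.1, hx.2.trans_lt hq⟩

lemma IsSliceTest.add {χ χ' : ℝ × Sph n → ℝ} (h : IsSliceTest a χ)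
    (h' : IsSliceTest a χ') : IsSliceTest a (χ + χ') :=
  ⟨h.smooth.add h'.smooth, h.compact.add h'.compact,
    (tsupport_add χ χ').trans (union_subset h.support h'.support)⟩

lemma IsSliceTest.const_smul (ha : 0 < a) {χ : ℝ × Sph n → ℝ} (h : IsSliceTest a χ) (c : ℝ) :
    IsSliceTest a (c • χ) :=
  h.mul_left ha (smoothOver_fst contDiffOn_const)

lemma smoothOver_div_fst (c a : ℝ) : SmoothOver (Ioo 0 a) fun z : ℝ × Sph n => c / z.1 :=
  smoothOver_fst (contDiffOn_const.div contDiffOn_id fun _ hx => hx.1.ne')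

lemma twisted_eq (α : ℝ) {χ : ℝ × Sph n → ℝ} (h : SmoothOver univ χ) :
    twisted α χ = fun z => dirDeriv ((1 : ℝ), 0) χ z + α / z.1 * χ z := by
  ext z
  have h1 : HasDerivAt (fun s => χ (s, z.2)) (dirDeriv ((1 : ℝ), 0) χ z) z.1 :=
    h.hasDerivAt_comp isOpen_univ (hasDerivAt_id z.1) (mem_univ _) z.2
  rw [twisted, h1.deriv]

lemma gradS_apply_eq {χ : ℝ × Sph n → ℝ} (h : SmoothOver univ χ) (i : Fin (n - 1)) :
    (fun z => gradS χ z i) = dirDeriv (0, EuclideanSpace.single i 1) χ :=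
  funext fun _ => h.gradS_apply isOpen_univ (mem_univ _) i

lemma IsSliceTest.twisted (ha : 0 < a) {χ : ℝ × Sph n → ℝ} (h : IsSliceTest a χ) (α : ℝ) :
    IsSliceTest a (twisted α χ) := by
  rw [twisted_eq α h.smooth]
  exact (h.dirDeriv ha _).add (h.mul_left ha (smoothOver_div_fst α a))

instance : IsFiniteMeasure (sliceMeasure n a) := by
  have : IsFiniteMeasure ((volume.restrict (Ioo 0 a)).withDensity fun x => ENNReal.ofReal x) := by
    refine isFiniteMeasure_withDensity_ofReal ?_
    have h : IntegrableOn (fun x : ℝ => x) (Icc 0 a) := continuous_id.continuousOn.integrableOn_Icc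
    exact (h.mono_set Ioo_subset_Icc_self).2
  rw [sliceMeasure]
  infer_instance

lemma ae_slice_mem : ∀ᵐ z ∂(sliceMeasure n a), z.1 ∈ Ioo 0 a := by
  have h1 : ∀ᵐ x ∂((volume.restrict (Ioo 0 a)).withDensity fun x => ENNReal.ofReal x),
      x ∈ Ioo 0 a :=
    (withDensity_absolutelyContinuous _ _).ae_le (ae_restrict_mem measurableSet_Ioo)
  exact Measure.quasiMeasurePreserving_fst.ae h1

lemma IsSliceTest.memLp {χ : ℝ × Sph n → ℝ} (h : IsSliceTest a χ) (p : ℝ≥0∞) :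
    MemLp χ p (sliceMeasure n a) :=
  h.smooth.continuous.memLp_of_hasCompactSupport h.compact

lemma continuous_gradS {χ : ℝ × Sph n → ℝ} (h : SmoothOver univ χ) : Continuous (gradS χ) := by
  have h1 : Continuous fun z => WithLp.ofLp (gradS χ z) := continuous_pi fun i => by
    rw [gradS_apply_eq h i]
    exact (h.dirDeriv isOpen_univ _).continuous
  exact (PiLp.continuous_toLp 2 (fun _ : Fin (n - 1) => ℝ)).comp h1

lemma IsSliceTest.memLp_gradS (ha : 0 < a) {χ : ℝ × Sph n → ℝ} (h : IsSliceTest a χ) (p : ℝ≥0∞) :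
    MemLp (gradS χ) p (sliceMeasure n a) := by
  refine (continuous_gradS h.smooth).memLp_of_hasCompactSupport ?_
  obtain ⟨-, r, s, -, -, h2⟩ := (isSliceTest_iff ha).1 h
  refine HasCompactSupport.intro (K := Icc r s ×ˢ univ) (isCompact_Icc.prod isCompact_univ)
    fun z hz => ?_
  ext i
  rw [h.smooth.gradS_apply isOpen_univ (mem_univ _)]
  exact dirDeriv_eq_zero isClosed_Icc h2 _ z.1 (fun hz' => hz ⟨hz', mem_univ _⟩) z.2

/-- The space of test functions on a time slice. -/
def sliceTests (n : ℕ) {a : ℝ} (ha : 0 < a) : Submodule ℝ (ℝ × Sph n → ℝ) where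
  carrier := {χ | IsSliceTest a χ}
  add_mem' h h' := h.add h'
  zero_mem' := (isSliceTest_iff ha).2 ⟨smoothOver_fst contDiffOn_const, a / 2, a / 2,
    by linarith, by linarith, fun _ _ _ => rfl⟩
  smul_mem' c _ h := h.const_smul ha c

lemma isSliceTest_coe {ha : 0 < a} (χ : sliceTests n ha) :
    IsSliceTest a (χ : ℝ × Sph n → ℝ) := χ.2

lemma twisted_add (α : ℝ) {χ χ' : ℝ × Sph n → ℝ} (h : SmoothOver univ χ)
    (h' : SmoothOver univ χ') : twisted α (χ + χ') = twisted α χ + twisted α χ' := by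
  have h2 : SmoothOver univ (χ + χ') := h.add h'
  rw [twisted_eq α h, twisted_eq α h', twisted_eq α h2]
  ext z
  have := dirDeriv_add isOpen_univ h h' ((1 : ℝ), 0) (mem_univ z.1)
  simp only [Pi.add_apply]
  rw [this]
  ring

lemma twisted_const_smul (α c : ℝ) {χ : ℝ × Sph n → ℝ} (h : SmoothOver univ χ) :
    twisted α (c • χ) = c • twisted α χ := by
  have h' : SmoothOver univ (c • χ) := (smoothOver_fst (contDiffOn_const (c := c))).mul h
  rw [twisted_eq α h, twisted_eq α h']
  ext z
  have := dirDeriv_const_smul c isOpen_univ h ((1 : ℝ), 0) (mem_univ z.1)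
  simp only [Pi.smul_apply, smul_eq_mul]
  rw [this]
  ring

lemma gradS_add {χ χ' : ℝ × Sph n → ℝ} (h : SmoothOver univ χ)
    (h' : SmoothOver univ χ') : gradS (χ + χ') = gradS χ + gradS χ' := by
  have h2 : SmoothOver univ (χ + χ') := h.add h'
  ext z i
  rw [h2.gradS_apply isOpen_univ (mem_univ _)]
  have := dirDeriv_add isOpen_univ h h' (0, EuclideanSpace.single i 1) (mem_univ z.1)
  simp only [Pi.add_apply, PiLp.add_apply, h.gradS_apply isOpen_univ (mem_univ _),
    h'.gradS_apply isOpen_univ (mem_univ _)]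
  exact this

lemma gradS_const_smul (c : ℝ) {χ : ℝ × Sph n → ℝ} (h : SmoothOver univ χ) :
    gradS (c • χ) = c • gradS χ := by
  have h' : SmoothOver univ (c • χ) := (smoothOver_fst (contDiffOn_const (c := c))).mul h
  ext z i
  rw [h'.gradS_apply isOpen_univ (mem_univ _)]
  have := dirDeriv_const_smul c isOpen_univ h (0, EuclideanSpace.single i 1) (mem_univ z.1)
  simp only [Pi.smul_apply, PiLp.smul_apply, h.gradS_apply isOpen_univ (mem_univ _), smul_eq_mul]
  exact this

lemma toLp_eq_add {Ω E : Type*} [MeasurableSpace Ω] {ν : Measure Ω} [NormedAddCommGroup E]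
    {p : ℝ≥0∞} {f g h : Ω → E} (hf : MemLp f p ν) (hg : MemLp g p ν) (hh : MemLp h p ν)
    (e : f = g + h) : hf.toLp f = hg.toLp g + hh.toLp h := by
  subst e
  exact MemLp.toLp_add hg hh

lemma toLp_eq_const_smul {Ω E : Type*} [MeasurableSpace Ω] {ν : Measure Ω}
    [NormedAddCommGroup E] [NormedSpace ℝ E] {p : ℝ≥0∞} {c : ℝ} {f g : Ω → E} (hf : MemLp f p ν)
    (hg : MemLp g p ν) (e : f = c • g) : hf.toLp f = c • hg.toLp g := by
  subst e
  exact MemLp.toLp_const_smul c hg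

lemma memLp_test {ha : 0 < a} (χ : sliceTests n ha) :
    MemLp (χ : ℝ × Sph n → ℝ) 2 (sliceMeasure n a) := (isSliceTest_coe χ).memLp 2

lemma memLp_twisted (α : ℝ) {ha : 0 < a} (χ : sliceTests n ha) :
    MemLp (twisted α (χ : ℝ × Sph n → ℝ)) 2 (sliceMeasure n a) :=
  ((isSliceTest_coe χ).twisted ha α).memLp 2

lemma memLp_gradS {ha : 0 < a} (χ : sliceTests n ha) :
    MemLp (gradS (χ : ℝ × Sph n → ℝ)) 2 (sliceMeasure n a) := (isSliceTest_coe χ).memLp_gradS ha 2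

/-- The triple of a test function. -/
def testTriple (n : ℕ) (α : ℝ) {a : ℝ} (ha : 0 < a) : sliceTests n ha →ₗ[ℝ] Triple n a where
  toFun χ := WithLp.toLp 2 ((memLp_test χ).toLp _,
    WithLp.toLp 2 ((memLp_twisted α χ).toLp _, (memLp_gradS χ).toLp _))
  map_add' χ χ' := by
    have e1 := twisted_add α (isSliceTest_coe χ).smooth (isSliceTest_coe χ').smooth
    have e2 := gradS_add (isSliceTest_coe χ).smooth (isSliceTest_coe χ').smooth
    exact WithLp.ofLp_injective 2 (Prod.ext
      (toLp_eq_add (memLp_test (χ + χ')) (memLp_test χ) (memLp_test χ') rfl)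
      (WithLp.ofLp_injective 2 (Prod.ext
        (toLp_eq_add (memLp_twisted α (χ + χ')) (memLp_twisted α χ) (memLp_twisted α χ') e1)
        (toLp_eq_add (memLp_gradS (χ + χ')) (memLp_gradS χ) (memLp_gradS χ') e2))))
  map_smul' c χ := by
    have e1 := twisted_const_smul α c (isSliceTest_coe χ).smooth
    have e2 := gradS_const_smul c (isSliceTest_coe χ).smooth
    exact WithLp.ofLp_injective 2 (Prod.ext
      (toLp_eq_const_smul (memLp_test (c • χ)) (memLp_test χ) rfl)
      (WithLp.ofLp_injective 2 (Prod.ext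
        (toLp_eq_const_smul (memLp_twisted α (c • χ)) (memLp_twisted α χ) e1)
        (toLp_eq_const_smul (memLp_gradS (c • χ)) (memLp_gradS χ) e2))))

lemma testTriple_mem (n : ℕ) (α : ℝ) {a : ℝ} (ha : 0 < a) (χ : sliceTests n ha) :
    testTriple n α ha χ ∈ testTriples n α a :=
  ⟨χ, χ.2, (memLp_test χ).coeFn_toLp, (memLp_twisted α χ).coeFn_toLp, (memLp_gradS χ).coeFn_toLp⟩

lemma span_testTriples (n : ℕ) (α : ℝ) {a : ℝ} (ha : 0 < a) :
    Submodule.span ℝ (testTriples n α a) = LinearMap.range (testTriple n α ha) := by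
  refine le_antisymm (Submodule.span_le.2 ?_) ?_
  · rintro h ⟨χ, hχ, h1, h2, h3⟩
    let χ' : sliceTests n ha := ⟨χ, hχ⟩
    refine ⟨χ', WithLp.ofLp_injective 2 (Prod.ext ?_
      (WithLp.ofLp_injective 2 (Prod.ext ?_ ?_)))⟩
    · exact Lp.ext ((memLp_test χ').coeFn_toLp.trans h1.symm)
    · exact Lp.ext ((memLp_twisted α χ').coeFn_toLp.trans h2.symm)
    · exact Lp.ext ((memLp_gradS χ').coeFn_toLp.trans h3.symm)
  · rintro _ ⟨χ, rfl⟩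
    exact Submodule.subset_span (testTriple_mem n α ha χ)

/-- Test functions as elements of `𝐇¹₀`. -/
def testH10 (n : ℕ) (α : ℝ) {a : ℝ} (ha : 0 < a) : sliceTests n ha →ₗ[ℝ] H10 n α a :=
  (testTriple n α ha).codRestrict _ fun χ =>
    Submodule.le_topologicalClosure _ (Submodule.subset_span (testTriple_mem n α ha χ))

/-- Identities and estimates that are continuous in `v ∈ 𝐇¹₀` need to be verified on test functions
only. -/
lemma denseRange_testH10 (n : ℕ) (α : ℝ) {a : ℝ} (ha : 0 < a) :
    DenseRange (testH10 n α ha) := by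
  intro v
  have hv : (v : Triple n a) ∈ closure (range (testTriple n α ha)) := by
    have h : (v : Triple n a) ∈ (Submodule.span ℝ (testTriples n α a)).topologicalClosure := v.2
    rw [span_testTriples n α ha] at h
    exact h
  rw [closure_subtype]
  convert hv using 2
  ext h
  constructor
  · rintro ⟨_, ⟨χ, rfl⟩, rfl⟩
    exact ⟨χ, rfl⟩
  · rintro ⟨χ, rfl⟩
    exact ⟨_, ⟨χ, rfl⟩, rfl⟩

/-- A test function as an element of `𝐋²`. -/
def testL2 {ha : 0 < a} (χ : sliceTests n ha) : L2 n a := (memLp_test χ).toLp _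

lemma testL2_ae {ha : 0 < a} (χ : sliceTests n ha) : testL2 χ =ᵐ[sliceMeasure n a] χ :=
  (memLp_test χ).coeFn_toLp

variable {α : ℝ}

lemma fnOf_testH10 {ha : 0 < a} (χ : sliceTests n ha) : fnOf (testH10 n α ha χ) = testL2 χ := rfl

lemma twistOf_testH10_ae {ha : 0 < a} (χ : sliceTests n ha) :
    twistOf (testH10 n α ha χ) =ᵐ[sliceMeasure n a] twisted α χ :=
  (memLp_twisted α χ).coeFn_toLp

lemma angularOf_testH10_ae {ha : 0 < a} (χ : sliceTests n ha) :
    angularOf (testH10 n α ha χ) =ᵐ[sliceMeasure n a] gradS (χ : ℝ × Sph n → ℝ) :=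
  (memLp_gradS χ).coeFn_toLp

end AAdS

namespace AAdS

open scoped InnerProduct

/-! ### The divergence theorem on the sphere -/

/-- Polar coordinates for a product of a radial and an angular function, which turn integrals over
the whole space into integrals over the sphere. -/
lemma integral_polar {E : Type*} [NormedAddCommGroup E] [NormedSpace ℝ E] [MeasurableSpace E]
    [FiniteDimensional ℝ E] [Nontrivial E] [BorelSpace E] (ν : Measure E) [ν.IsAddHaarMeasure]
    {F : E → ℝ} {p : ℝ → ℝ} {q : Metric.sphere (0 : E) 1 → ℝ}
    (h : ∀ (r : ℝ) (θ : Metric.sphere (0 : E) 1), 0 < r → F (r • (θ : E)) = p r * q θ) :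
    ∫ y, F y ∂ν = (∫ r : Ioi (0 : ℝ), p r ∂(Measure.volumeIoiPow (Module.finrank ℝ E - 1))) *
      ∫ θ, q θ ∂ν.toSphere := by
  have h1 : ∫ y, F y ∂ν = ∫ y : ({0}ᶜ : Set E), F y ∂(ν.comap (↑)) := by
    rw [integral_subtype_comap (measurableSet_singleton _).compl F,
      Measure.restrict_eq_self_of_ae_mem]
    simp [ae_iff, measure_singleton]
  have hmp := ν.measurePreserving_homeomorphUnitSphereProd
  have h2 := hmp.integral_comp (homeomorphUnitSphereProd E).measurableEmbedding
    fun z => p z.2 * q z.1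
  rw [h1, mul_comm, ← integral_prod_mul]
  simp only [mul_comm (q _)]
  rw [← h2]
  refine integral_congr_ae (.of_forall fun y => ?_)
  have h3 := h (homeomorphUnitSphereProd E y).2 (homeomorphUnitSphereProd E y).1
    (homeomorphUnitSphereProd E y).2.2
  simp only
  rw [← h3, ← homeomorphUnitSphereProd_symm_apply_coe, Homeomorph.symm_apply_apply]

lemma contDiff_mul_of_eventually_eq_zero {E : Type*} [NormedAddCommGroup E] [NormedSpace ℝ E]
    {m : WithTop ℕ∞} {ρ U : E → ℝ} (hρ : ContDiff ℝ m ρ) (h0 : ∀ᶠ y in 𝓝 0, ρ y = 0)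
    (hU : ContDiffOn ℝ m U {0}ᶜ) : ContDiff ℝ m fun y => ρ y * U y := by
  rw [contDiff_iff_contDiffAt]
  intro y
  by_cases hy : y = 0
  · subst hy
    refine (contDiffAt_const (c := (0 : ℝ))).congr_of_eventuallyEq ?_
    filter_upwards [h0] with y hy
    rw [hy, zero_mul]
  · exact hρ.contDiffAt.mul (hU.contDiffAt (isOpen_compl_singleton.mem_nhds hy))

/-- The divergence theorem on the sphere, for functions that are constant along rays. -/
theorem exists_integral_sphere_fderiv {E : Type*} [NormedAddCommGroup E] [InnerProductSpace ℝ E]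
    [MeasurableSpace E] [FiniteDimensional ℝ E] [Nontrivial E] [BorelSpace E] (ν : Measure E)
    [ν.IsAddHaarMeasure] (e : E) :
    ∃ k : ℝ, ∀ U : E → ℝ, ContDiffOn ℝ ∞ U {0}ᶜ → (∀ (r : ℝ) y, 0 < r → y ≠ 0 → U (r • y) = U y) →
      ∫ θ : Metric.sphere (0 : E) 1, fderiv ℝ U θ e ∂ν.toSphere =
        k * ∫ θ : Metric.sphere (0 : E) 1, U θ * inner ℝ (θ : E) e ∂ν.toSphere := by
  -- The cutoff `ρ(y) = b(|y|²)` is supported in `1 ≤ |y|² ≤ 3`, away from the singularity of `U` at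
  -- the origin, and equals one at `|y|² = 2`.
  let b : ContDiffBump (2 : ℝ) := ⟨1 / 2, 1, by norm_num, by norm_num⟩
  let ρ : E → ℝ := fun y => b (‖y‖ ^ 2)
  have hb : ContDiff ℝ ∞ b := b.contDiff
  have hb0 : ∀ s, 1 ≤ |s - 2| → b s = 0 := fun s hs => b.zero_of_le_dist (by
    rw [Real.dist_eq]; exact hs)
  have hρ : ContDiff ℝ ∞ ρ := hb.comp (contDiff_norm_sq ℝ)
  have hρ0 : ∀ y, ‖y‖ < 1 → ρ y = 0 := fun y hy => hb0 _ (by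
    have : ‖y‖ ^ 2 ≤ 1 := by nlinarith [norm_nonneg y]
    rw [abs_sub_comm, le_abs]; left; linarith)
  have hρ1 : ∀ y, y ∉ Metric.closedBall (0 : E) 2 → ρ y = 0 := fun y hy => hb0 _ (by
    rw [mem_closedBall_zero_iff, not_le] at hy
    rw [le_abs]; left; nlinarith)
  have hρn : ∀ᶠ y in 𝓝 (0 : E), ρ y = 0 := by
    filter_upwards [Metric.ball_mem_nhds (0 : E) one_pos] with y hy
    exact hρ0 y (by simpa using hy)
  let c : (ℝ → ℝ) → ℝ := fun p =>
    ∫ r : Ioi (0 : ℝ), p r ∂(Measure.volumeIoiPow (Module.finrank ℝ E - 1))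
  have hsph : ∀ θ : Metric.sphere (0 : E) 1, ‖(θ : E)‖ = 1 := norm_eq_of_mem_sphere
  have hnorm : ∀ (r : ℝ) (θ : Metric.sphere (0 : E) 1), 0 < r → ‖r • (θ : E)‖ = r := fun r θ hr => by
    rw [norm_smul, hsph, mul_one, Real.norm_eq_abs, abs_of_pos hr]
  have hinv : ContDiffOn ℝ ∞ (fun y : E => ‖y‖⁻¹) {0}ᶜ := fun y hy =>
    ((contDiffAt_norm ℝ hy).inv (norm_ne_zero_iff.2 hy)).contDiffWithinAt
  have hc1 : c (fun r => b (r ^ 2) * r⁻¹) ≠ 0 := by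
    have h1 : ∫ y, ρ y * ‖y‖⁻¹ ∂ν = c (fun r => b (r ^ 2) * r⁻¹) *
        ∫ _θ : Metric.sphere (0 : E) 1, (1 : ℝ) ∂ν.toSphere :=
      integral_polar ν (p := fun r => b (r ^ 2) * r⁻¹) (q := fun _ => 1) fun r θ hr => by
        simp only [ρ, hnorm r θ hr, mul_one]
    have h2 : 0 < ∫ y, ρ y * ‖y‖⁻¹ ∂ν := by
      obtain ⟨y, hy⟩ := exists_norm_eq E (Real.sqrt_nonneg 2)
      refine (contDiff_mul_of_eventually_eq_zero hρ hρn
        hinv).continuous.integral_pos_of_hasCompactSupport_nonneg_nonzero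
        (HasCompactSupport.intro (isCompact_closedBall 0 2) fun y hy => by rw [hρ1 y hy, zero_mul])
        (fun y => mul_nonneg b.nonneg (by positivity)) (x := y) ?_
      have : ρ y = 1 := b.one_of_mem_closedBall (by
        rw [hy, Real.sq_sqrt (by norm_num)]; simp [b])
      rw [this, hy]
      positivity
    intro h
    rw [h1, h, zero_mul] at h2
    exact lt_irrefl _ h2
  refine ⟨-c (fun r => deriv b (r ^ 2) * (2 * r)) / c (fun r => b (r ^ 2) * r⁻¹), fun U hU hUh => ?_⟩
  have hθ0 : ∀ θ : Metric.sphere (0 : E) 1, (θ : E) ≠ 0 := fun θ h => by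
    have := hsph θ; rw [h, norm_zero] at this; exact zero_ne_one this
  have hUd : ∀ y, y ≠ 0 → HasFDerivAt U (fderiv ℝ U y) y := fun y hy =>
    ((hU.contDiffAt (isOpen_compl_singleton.mem_nhds hy)).differentiableAt (by simp)).hasFDerivAt
  -- The derivative of a function constant along rays is homogeneous of degree `-1`, whence the
  -- factor `r⁻¹` in the radial integral.
  have hUsc : ∀ (r : ℝ) (y : E), 0 < r → y ≠ 0 → r * fderiv ℝ U (r • y) e = fderiv ℝ U y e :=
    fun r y hr hy => by
      have h1 : HasFDerivAt (fun y : E => r • y) (r • ContinuousLinearMap.id ℝ E) y :=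
        (hasFDerivAt_id y).const_smul r
      have h2 := (hUd (r • y) (smul_ne_zero hr.ne' hy)).comp y h1
      have h3 : HasFDerivAt (U ∘ fun y : E => r • y) (fderiv ℝ U y) y :=
        (hUd y hy).congr_of_eventuallyEq (by
          filter_upwards [isOpen_compl_singleton.mem_nhds hy] with z hz using hUh r z hr hz)
      have h4 := congrArg (fun L : E →L[ℝ] ℝ => L e) (h2.unique h3)
      simpa using h4
  have hρd : ∀ y, HasFDerivAt ρ ((2 * deriv b (‖y‖ ^ 2)) • innerSL ℝ y) y := fun y => by
    have h1 : HasDerivAt b (deriv b (‖y‖ ^ 2)) (‖y‖ ^ 2) :=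
      (hb.differentiable (by simp)).differentiableAt.hasDerivAt
    have h2 := h1.comp_hasFDerivAt y (hasStrictFDerivAt_norm_sq y).hasFDerivAt
    refine h2.congr_fderiv ?_
    ext z
    simp
    ring
  let ρ₁ : E → ℝ := fun y => 2 * deriv b (‖y‖ ^ 2) * inner ℝ y e
  have hdb : ContDiff ℝ ∞ (deriv b) := (contDiff_infty_iff_deriv.1 hb).2
  have hρ₁ : ContDiff ℝ ∞ ρ₁ :=
    (contDiff_const.mul (hdb.comp (contDiff_norm_sq ℝ))).mul (contDiff_id.inner ℝ contDiff_const)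
  have hρ₁e : ∀ y, ρ₁ y = fderiv ℝ ρ y e := fun y => by
    rw [(hρd y).fderiv]; simp [ρ₁]
  have hρ₁n : ∀ᶠ y in 𝓝 (0 : E), ρ₁ y = 0 := by
    filter_upwards [hρn.eventually_nhds] with y hy
    have : ρ =ᶠ[𝓝 y] fun _ => 0 := hy
    rw [hρ₁e, this.fderiv_eq]; simp
  have hρ₁1 : ∀ y, y ∉ Metric.closedBall (0 : E) 2 → ρ₁ y = 0 := fun y hy => by
    have : ρ =ᶠ[𝓝 y] fun _ => 0 := by
      filter_upwards [Metric.isClosed_closedBall.isOpen_compl.mem_nhds hy] with z hz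
      exact hρ1 z hz
    rw [hρ₁e, this.fderiv_eq]; simp
  have hdU : ContDiffOn ℝ ∞ (fun y => fderiv ℝ U y e) {0}ᶜ :=
    (hU.fderiv_of_isOpen (m := ∞) isOpen_compl_singleton (by simp)).clm_apply contDiffOn_const
  have f0 := contDiff_mul_of_eventually_eq_zero hρ hρn hU
  have f1 := contDiff_mul_of_eventually_eq_zero hρ hρn hdU
  have f2 := contDiff_mul_of_eventually_eq_zero hρ₁ hρ₁n hU
  have hsupp : ∀ {f g : E → ℝ}, (∀ y, y ∉ Metric.closedBall (0 : E) 2 → f y = 0) →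
      Continuous (fun y => f y * g y) → Integrable (fun y => f y * g y) ν := fun {f g} hf hc =>
    hc.integrable_of_hasCompactSupport (HasCompactSupport.intro (isCompact_closedBall 0 2)
      fun y hy => by rw [hf y hy, zero_mul])
  have i0 := hsupp hρ1 f0.continuous
  have i1 := hsupp hρ1 f1.continuous
  have i2 := hsupp hρ₁1 f2.continuous
  have hfd : ∀ y, HasFDerivAt (fun y => ρ y * U y) (fderiv ℝ (fun y => ρ y * U y) y) y := fun y =>
    ((f0.differentiable (by simp)) y).hasFDerivAt
  have hfe : ∀ y, fderiv ℝ (fun y => ρ y * U y) y e = ρ y * fderiv ℝ U y e + ρ₁ y * U y := by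
    intro y
    by_cases hy : y = 0
    · subst hy
      have : (fun y => ρ y * U y) =ᶠ[𝓝 0] fun _ => 0 := by
        filter_upwards [hρn] with y hy
        rw [hy, zero_mul]
      rw [this.fderiv_eq, hρn.self_of_nhds, hρ₁n.self_of_nhds]
      simp
    · rw [((hρd y).fun_mul (hUd y hy)).fderiv]
      simp [ρ₁]
      ring
  -- The integral of the derivative of `ρ U` vanishes. In polar coordinates its two terms become the
  -- two sides of the claim, multiplied by radial constants, the first of which is nonzero by `hc1`.
  have hzero : ∫ y, (ρ y * fderiv ℝ U y e + ρ₁ y * U y) ∂ν = 0 := by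
    have i3 : Integrable (fun y => fderiv ℝ (fun y => ρ y * U y) y e) ν := by
      simp only [hfe]; exact i1.add i2
    have := integral_bilinear_hasFDerivAt_right_eq_neg_left_of_integrable (μ := ν) (v := e)
      (f := fun _ => (1 : ℝ)) (f' := fun _ => 0) (g := fun y => ρ y * U y)
      (B := ContinuousLinearMap.mul ℝ ℝ) (by simp) (by simpa using i3) (by simpa using i0)
      (fun x _ => hasFDerivAt_const _ _) (fun x _ => hfd x)
    simpa [hfe] using this
  have p1 := integral_polar ν (F := fun y => ρ y * fderiv ℝ U y e)
    (p := fun r => b (r ^ 2) * r⁻¹) (q := fun θ => fderiv ℝ U θ e) fun r θ hr => by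
      rw [← hUsc r θ hr (hθ0 θ)]
      simp only [ρ, hnorm r θ hr]
      field_simp
  have p2 := integral_polar ν (F := fun y => ρ₁ y * U y)
    (p := fun r => deriv b (r ^ 2) * (2 * r)) (q := fun θ => U θ * inner ℝ (θ : E) e)
    fun r θ hr => by
      simp only [ρ₁, hnorm r θ hr, hUh r θ hr (hθ0 θ), inner_smul_left, RCLike.conj_to_real]
      ring
  rw [integral_add i1 i2, p1, p2] at hzero
  rw [div_mul_eq_mul_div, eq_div_iff hc1]
  simp only [c]
  linarith

end AAdS

namespace AAdS

open scoped InnerProduct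

/-! ### Multiplication operators -/

section Mul

variable {Ω : Type*} [MeasurableSpace Ω] {ν : Measure Ω}

lemma inner_eq_integral {u w : Lp ℝ 2 ν} {f g : Ω → ℝ} (hu : u =ᵐ[ν] f) (hw : w =ᵐ[ν] g) :
    inner ℝ u w = ∫ z, f z * g z ∂ν := by
  rw [L2.inner_def]
  refine integral_congr_ae ?_
  filter_upwards [hu, hw] with z h1 h2
  rw [h1, h2]
  simp [mul_comm]

open Classical in
/-- The operator of multiplication by an essentially bounded function. -/
def mulOp (ν : Measure Ω) (k : Ω → ℝ) : Lp ℝ 2 ν →L[ℝ] Lp ℝ 2 ν :=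
  if h : MemLp k ∞ ν then (ContinuousLinearMap.mul ℝ ℝ).holderL ν ∞ 2 2 h.toLp else 0

lemma mulOp_ae {k : Ω → ℝ} (hk : MemLp k ∞ ν) (f : Lp ℝ 2 ν) :
    mulOp ν k f =ᵐ[ν] fun z => k z * f z := by
  rw [mulOp, dif_pos hk, ContinuousLinearMap.holderL_apply_apply]
  filter_upwards [(ContinuousLinearMap.mul ℝ ℝ).coeFn_holder (r := 2) hk.toLp f,
    hk.coeFn_toLp] with z h1 h2
  rw [h1, h2]; rfl

lemma inner_mulOp {k : Ω → ℝ} (hk : MemLp k ∞ ν) {u w : Lp ℝ 2 ν} {f g : Ω → ℝ}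
    (hu : u =ᵐ[ν] f) (hw : w =ᵐ[ν] g) :
    inner ℝ (mulOp ν k u) w = ∫ z, k z * f z * g z ∂ν :=
  inner_eq_integral ((mulOp_ae hk u).trans (hu.mono fun z hz => by simp only [hz])) hw

lemma inner_mulOp_comm {k : Ω → ℝ} (hk : MemLp k ∞ ν) (u w : Lp ℝ 2 ν) :
    inner ℝ (mulOp ν k u) w = inner ℝ u (mulOp ν k w) := by
  rw [inner_mulOp hk (.refl _ _) (.refl _ _), inner_eq_integral (.refl _ _) (mulOp_ae hk w)]
  congr 1; ext z; ring

lemma norm_mulOp_le {k : Ω → ℝ} {C : ℝ} (hC : 0 ≤ C) (h : ∀ᵐ z ∂ν, |k z| ≤ C) :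
    ‖mulOp ν k‖ ≤ C := by
  by_cases hk : MemLp k ∞ ν
  · refine ContinuousLinearMap.opNorm_le_bound _ hC fun f => ?_
    refine Lp.norm_le_mul_norm_of_ae_le_mul ?_
    filter_upwards [mulOp_ae hk f, h] with z h1 h2
    rw [h1, norm_mul]
    exact mul_le_mul_of_nonneg_right h2 (norm_nonneg _)
  · rw [mulOp, dif_neg hk, norm_zero]; exact hC

lemma mulOp_sub {k l : Ω → ℝ} (hk : MemLp k ∞ ν) (hl : MemLp l ∞ ν) :
    mulOp ν (fun z => k z - l z) = mulOp ν k - mulOp ν l := by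
  ext1 f
  refine Lp.ext ?_
  rw [_root_.sub_apply]
  filter_upwards [mulOp_ae (hk.sub hl) f, mulOp_ae hk f, mulOp_ae hl f,
    Lp.coeFn_sub (mulOp ν k f) (mulOp ν l f)] with z h1 h2 h3 h4
  rw [h4, Pi.sub_apply, h2, h3]
  refine h1.trans ?_
  simp only [Pi.sub_apply]
  ring

lemma mulOp_const_mul {k : Ω → ℝ} (hk : MemLp k ∞ ν) (c : ℝ) :
    mulOp ν (fun z => c * k z) = c • mulOp ν k := by
  ext1 f
  refine Lp.ext ?_
  rw [_root_.smul_apply]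
  filter_upwards [mulOp_ae (hk.const_mul c) f, mulOp_ae hk f,
    Lp.coeFn_smul c (mulOp ν k f)] with z h1 h2 h3
  rw [h3, Pi.smul_apply, h2, smul_eq_mul, ← mul_assoc]
  exact h1

/-- Differentiability of curves of multiplication operators. -/
lemma hasDerivAt_mulOp {k k' : ℝ → Ω → ℝ} {s : Set Ω} (hs : ∀ᵐ z ∂ν, z ∈ s)
    (hk : ∀ t, MemLp (k t) ∞ ν) (hk' : ∀ t, MemLp (k' t) ∞ ν)
    (hd : ∀ z ∈ s, ∀ t, HasDerivAt (fun t => k t z) (k' t z) t) {C : ℝ} (hC : 0 ≤ C)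
    (hlip : ∀ z ∈ s, ∀ t r, |k' t z - k' r z| ≤ C * |t - r|) (t : ℝ) :
    HasDerivAt (fun t => mulOp ν (k t)) (mulOp ν (k' t)) t := by
  -- The Lipschitz constant of `k'` is uniform in the point, so the Taylor remainder is quadratic in
  -- the sup norm and hence in operator norm.
  have key : ∀ r, ‖mulOp ν (k r) - mulOp ν (k t) - (r - t) • mulOp ν (k' t)‖ ≤
      C * |r - t| ^ 2 := fun r => by
    have h0 : MemLp (fun z => k r z - k t z) ∞ ν := (hk r).sub (hk t)
    rw [← mulOp_sub (hk r) (hk t), ← mulOp_const_mul (hk' t), ← mulOp_sub h0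
      ((hk' t).const_mul _)]
    refine norm_mulOp_le (by positivity) (hs.mono fun z hz => ?_)
    have h1 : ∀ q ∈ uIcc t r, HasDerivWithinAt (fun q => k q z - q * k' t z)
        (k' q z - k' t z) (uIcc t r) q := fun q _ => by
      have := ((hd z hz q).sub ((hasDerivAt_id q).mul_const (k' t z)))
      simpa using! this.hasDerivWithinAt
    have h2 := (convex_uIcc t r).norm_image_sub_le_of_norm_hasDerivWithin_le (C := C * |r - t|) h1
      (fun q hq => by
        exact (hlip z hz q t).trans
          (mul_le_mul_of_nonneg_left (abs_sub_left_of_mem_uIcc hq) hC)) left_mem_uIcc right_mem_uIcc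
    rw [Real.norm_eq_abs, Real.norm_eq_abs] at h2
    calc _ = |k r z - r * k' t z - (k t z - t * k' t z)| := by congr 1; ring
      _ ≤ _ := h2
      _ = _ := by ring
  rw [hasDerivAt_iff_isLittleO]
  refine Asymptotics.IsLittleO.of_bound fun ε hε => ?_
  filter_upwards [Metric.ball_mem_nhds t (ε := ε / (C + 1)) (by positivity)] with r hr
  rw [Metric.mem_ball, Real.dist_eq, lt_div_iff₀ (by positivity)] at hr
  refine (key r).trans ?_
  rw [Real.norm_eq_abs]
  nlinarith [abs_nonneg (r - t)]

lemma continuous_mulOp {k : ℝ → Ω → ℝ} {s : Set Ω} (hs : ∀ᵐ z ∂ν, z ∈ s)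
    (hk : ∀ t, MemLp (k t) ∞ ν) {C : ℝ} (hC : 0 ≤ C)
    (hlip : ∀ z ∈ s, ∀ t r, |k t z - k r z| ≤ C * |t - r|) :
    Continuous fun t => mulOp ν (k t) := by
  refine (LipschitzWith.of_dist_le_mul (K := ⟨C, hC⟩) fun t r => ?_).continuous
  rw [dist_eq_norm, ← mulOp_sub (hk t) (hk r), Real.dist_eq]
  exact norm_mulOp_le (by positivity) (hs.mono fun z hz => hlip z hz t r)

end Mul

/-! ### Integration by parts on time slices -/

variable {n : ℕ} {a : ℝ}

lemma integral_slice_factor (f : ℝ → ℝ) :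
    ∫ x, f x ∂((volume.restrict (Ioo 0 a)).withDensity fun x => ENNReal.ofReal x) =
      ∫ x in Ioo 0 a, x * f x := by
  have h := integral_withDensity_eq_integral_smul (μ := volume.restrict (Ioo 0 a))
    (f := Real.toNNReal) measurable_real_toNNReal f
  refine Eq.trans h (setIntegral_congr_fun measurableSet_Ioo fun x hx => ?_)
  simp only [NNReal.smul_def, Real.coe_toNNReal x hx.1.le, smul_eq_mul]

lemma integral_slice_sphere {f : ℝ × Sph n → ℝ} (hf : Integrable f (sliceMeasure n a)) :
    ∫ z, f z ∂(sliceMeasure n a) = ∫ θ, (∫ x in Ioo 0 a, x * f (x, θ))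
      ∂(volume : Measure (Euc n)).toSphere := by
  rw [sliceMeasure] at hf ⊢
  rw [integral_prod_symm _ hf]
  simp only [integral_slice_factor]

lemma IsSliceTest.integrable {χ : ℝ × Sph n → ℝ} (h : IsSliceTest a χ) :
    Integrable χ (sliceMeasure n a) := memLp_one_iff_integrable.1 (h.memLp 1)

/-- The factor `1 / x` cancels the density `x`, which leaves the integral of a derivative with
compact support. -/
lemma IsSliceTest.integral_dirDeriv_div (ha : 0 < a) {χ : ℝ × Sph n → ℝ} (h : IsSliceTest a χ) :
    ∫ z, 1 / z.1 * AAdS.dirDeriv ((1 : ℝ), 0) χ z ∂(sliceMeasure n a) = 0 := by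
  have h1 := (h.dirDeriv ha ((1 : ℝ), 0)).mul_left ha (smoothOver_div_fst 1 a)
  rw [integral_slice_sphere h1.integrable]
  obtain ⟨hs, p, q, hp, hq, h0⟩ := (isSliceTest_iff ha).1 h
  have hθ : ∀ θ, ∫ x in Ioo 0 a, x * (1 / x * AAdS.dirDeriv ((1 : ℝ), 0) χ (x, θ)) = 0 := by
    intro θ
    have hd : ∀ x, HasDerivAt (fun s => χ (s, θ)) (AAdS.dirDeriv ((1 : ℝ), 0) χ (x, θ)) x :=
      fun x => hs.hasDerivAt_comp isOpen_univ (hasDerivAt_id x) (mem_univ _) θ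
    have hd0 := dirDeriv_eq_zero isClosed_Icc h0 ((1 : ℝ), 0)
    have hI : ∀ {f : ℝ × Sph n → ℝ}, SmoothOver univ f → (∀ x, x ∉ Icc p q → ∀ θ, f (x, θ) = 0) →
        Integrable fun x => f (x, θ) := fun {f} hf hf0 =>
      (hf.continuous.comp (by fun_prop)).integrable_of_hasCompactSupport
        (HasCompactSupport.intro isCompact_Icc fun x hx => hf0 x hx θ)
    refine Eq.trans ?_ (integral_eq_zero_of_hasDerivAt_of_integrable hd
      (hI (hs.dirDeriv isOpen_univ _) hd0) (hI hs h0))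
    have hd1 : ∀ x, x ∉ Ioo 0 a → AAdS.dirDeriv ((1 : ℝ), 0) χ (x, θ) = 0 := fun x hx =>
      hd0 x (fun hx' : x ∈ Icc p q => hx ⟨hp.trans_le hx'.1, hx'.2.trans_lt hq⟩) θ
    rw [← setIntegral_eq_integral_of_forall_compl_eq_zero hd1]
    refine setIntegral_congr_fun measurableSet_Ioo fun x hx => ?_
    have := hx.1.ne'
    beta_reduce
    field_simp
  simp only [hθ, integral_zero]

/-- The sphere formula on each fibre. The right-hand side contains no derivative, so it does no harm
in integrations by parts, and the value of `k` does not matter. -/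
lemma exists_integral_dirDeriv_sphere (ha : 0 < a) (i : Fin (n - 1)) :
    ∃ k : ℝ, ∀ χ : ℝ × Sph n → ℝ, IsSliceTest a χ →
      ∫ z, dirDeriv (0, EuclideanSpace.single i 1) χ z ∂(sliceMeasure n a) =
        k * ∫ z, χ z * (z.2 : Euc n) i ∂(sliceMeasure n a) := by
  have : Nontrivial (Euc n) := by
    have : Nonempty (Fin (n - 1)) := ⟨i⟩
    infer_instance
  obtain ⟨k, hk⟩ := exists_integral_sphere_fderiv (volume : Measure (Euc n))
    (EuclideanSpace.single i (1 : ℝ))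
  refine ⟨k, fun χ h => ?_⟩
  have h1 := (h.dirDeriv ha (0, EuclideanSpace.single i 1)).integrable
  have h2 := (h.mul_left ha (smoothOver_coord (Ioo 0 a) i)).integrable
  have e : ∀ x, ∫ θ : Sph n, dirDeriv (0, EuclideanSpace.single i 1) χ (x, θ)
      ∂(volume : Measure (Euc n)).toSphere =
      k * ∫ θ : Sph n, (θ : Euc n) i * χ (x, θ) ∂(volume : Measure (Euc n)).toSphere := by
    intro x
    have hU : ContDiffOn ℝ ∞ (radialExt fun θ => χ (x, θ)) {0}ᶜ :=
      h.smooth.contDiffOn.comp (contDiffOn_const.prodMk contDiffOn_id) fun y hy => ⟨mem_univ x, hy⟩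
    have h3 := hk _ hU fun r y hr hy => by
      rw [radialExt_eq _ (smul_ne_zero hr.ne' hy), radialExt_eq _ hy, unitPt_smul hy hr]
    convert h3 using 2
    · ext θ
      have h4 : HasFDerivAt (fun y : Euc n => (x, y)) (ContinuousLinearMap.inr ℝ ℝ (Euc n))
        (θ : Euc n) := hasFDerivAt_prodMk_right _ _
      have h5 : HasFDerivAt (radialExt fun θ => χ (x, θ)) _ (θ : Euc n) :=
        (h.smooth.hasFDerivAt isOpen_univ (mem_univ x) (sph_ne_zero θ)).comp (θ : Euc n) h4
      rw [h5.fderiv]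
      simp [dirDeriv]
    · congr 1
      ext θ
      simp [EuclideanSpace.inner_single_right]
      ring
  simp only [mul_comm (χ _)]
  rw [sliceMeasure, integral_prod _ h1, integral_prod _ h2, ← integral_const_mul]
  simp only [e]

variable {α : ℝ}

/-- A test function that is given with its properties. -/
def mkTest (ha : 0 < a) {f : ℝ × Sph n → ℝ} (hf : IsSliceTest a f) : sliceTests n ha := ⟨f, hf⟩

lemma inner_testL2 {ha : 0 < a} (χ χ' : sliceTests n ha) :
    inner ℝ (testL2 χ) (testL2 χ') = ∫ z, (χ : ℝ × Sph n → ℝ) z * (χ' : ℝ × Sph n → ℝ) z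
      ∂(sliceMeasure n a) :=
  inner_eq_integral (testL2_ae χ) (testL2_ae χ')

/-- Integration by parts in the radial direction. -/
lemma integral_mul_dirDeriv_radial (ha : 0 < a) {χ f : ℝ × Sph n → ℝ} (h : IsSliceTest a χ)
    (hf : IsSliceTest a f) :
    ∫ z, dirDeriv ((1 : ℝ), 0) χ z * f z ∂(sliceMeasure n a) =
      -∫ z, χ z * (1 / z.1 * dirDeriv ((1 : ℝ), 0) (fun z => z.1 * f z) z)
        ∂(sliceMeasure n a) := by
  have hxf : IsSliceTest a fun z => z.1 * f z :=
    hf.mul_left ha (smoothOver_fst (f := fun x : ℝ => x) contDiffOn_id)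
  have h1 := (hxf.mul_left ha (h.smooth.mono (subset_univ _))).integral_dirDeriv_div ha
  have i1 : Integrable (fun z => dirDeriv ((1 : ℝ), 0) χ z * f z) (sliceMeasure n a) :=
    (hf.mul_left ha ((h.dirDeriv ha _).smooth.mono (subset_univ _))).integrable
  have i2 : Integrable (fun z => χ z * (1 / z.1 * dirDeriv ((1 : ℝ), 0) (fun z => z.1 * f z) z))
      (sliceMeasure n a) :=
    (((hxf.dirDeriv ha _).mul_left ha (smoothOver_div_fst 1 a)).mul_left ha
      (h.smooth.mono (subset_univ _))).integrable
  rw [eq_neg_iff_add_eq_zero, ← integral_add i1 i2, ← h1]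
  refine integral_congr_ae ?_
  filter_upwards [ae_slice_mem] with z hz
  have hz' := hz.1.ne'
  rw [dirDeriv_mul isOpen_univ h.smooth hxf.smooth _ (mem_univ z.1)]
  field_simp
  ring

/-- The formal adjoint of the twisted derivative. -/
lemma exists_inner_twistOf (ha : 0 < a) (f : sliceTests n ha) :
    ∃ f' : sliceTests n ha, ∀ v : H10 n α a,
      inner ℝ (twistOf v) (testL2 f) = inner ℝ (fnOf v) (testL2 f') := by
  have hf := isSliceTest_coe f
  have hxf : IsSliceTest a fun z => z.1 * (f : ℝ × Sph n → ℝ) z :=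
    hf.mul_left ha (smoothOver_fst (f := fun x : ℝ => x) contDiffOn_id)
  have h1 := (hxf.dirDeriv ha ((1 : ℝ), 0)).mul_left ha (smoothOver_div_fst (-1) a)
  have h2 := hf.mul_left ha (smoothOver_div_fst α a)
  refine ⟨mkTest ha (h1.add h2), fun v => ?_⟩
  refine (denseRange_testH10 n α ha).induction_on v ?_ fun χ => ?_
  · exact isClosed_eq (Continuous.inner (by unfold twistOf; fun_prop) continuous_const)
      (Continuous.inner (by unfold fnOf; fun_prop) continuous_const)
  · have hχ := isSliceTest_coe χ
    rw [fnOf_testH10, inner_testL2, inner_eq_integral (twistOf_testH10_ae χ) (testL2_ae f),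
      twisted_eq α hχ.smooth]
    have h3 := integral_mul_dirDeriv_radial ha hχ hf
    have i1 : Integrable (fun z => dirDeriv ((1 : ℝ), 0) (χ : ℝ × Sph n → ℝ) z *
        (f : ℝ × Sph n → ℝ) z) (sliceMeasure n a) :=
      (hf.mul_left ha ((hχ.dirDeriv ha _).smooth.mono (subset_univ _))).integrable
    have i2 : Integrable (fun z => (χ : ℝ × Sph n → ℝ) z * (α / z.1 * (f : ℝ × Sph n → ℝ) z))
      (sliceMeasure n a) := (h2.mul_left ha (hχ.smooth.mono (subset_univ _))).integrable
    have i3 : Integrable (fun z => (χ : ℝ × Sph n → ℝ) z * (-1 / z.1 *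
        dirDeriv ((1 : ℝ), 0) (fun z => z.1 * (f : ℝ × Sph n → ℝ) z) z)) (sliceMeasure n a) :=
      (h1.mul_left ha (hχ.smooth.mono (subset_univ _))).integrable
    calc _ = ∫ z, (dirDeriv ((1 : ℝ), 0) (χ : ℝ × Sph n → ℝ) z * (f : ℝ × Sph n → ℝ) z +
          (χ : ℝ × Sph n → ℝ) z * (α / z.1 * (f : ℝ × Sph n → ℝ) z)) ∂(sliceMeasure n a) := by
          congr 1; ext z; ring
      _ = ∫ z, ((χ : ℝ × Sph n → ℝ) z * (-1 / z.1 *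
          dirDeriv ((1 : ℝ), 0) (fun z => z.1 * (f : ℝ × Sph n → ℝ) z) z) +
          (χ : ℝ × Sph n → ℝ) z * (α / z.1 * (f : ℝ × Sph n → ℝ) z)) ∂(sliceMeasure n a) := by
          rw [integral_add i1 i2, integral_add i3 i2, h3, ← integral_neg]
          congr 2; ext z; ring
      _ = _ := by
          congr 1; ext z
          simp only [mkTest, Pi.add_apply]
          ring

/-- The components of the angular gradient. -/
def angComp (i : Fin (n - 1)) : H10 n α a →L[ℝ] L2 n a :=
  ((EuclideanSpace.proj i : Euc n →L[ℝ] ℝ).compLpL 2 (sliceMeasure n a)).comp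
    ((WithLp.sndL 2 ℝ (L2 n a) (L2vec n a)).comp
      ((WithLp.sndL 2 ℝ (L2 n a) (WithLp 2 (L2 n a × L2vec n a))).comp (H10 n α a).subtypeL))

lemma angComp_ae (i : Fin (n - 1)) (v : H10 n α a) :
    angComp i v =ᵐ[sliceMeasure n a] fun z => angularOf v z i :=
  ContinuousLinearMap.coeFn_compLpL _ _

/-- The formal adjoint of the angular derivatives. -/
lemma exists_inner_angComp (ha : 0 < a) (i : Fin (n - 1)) (f : sliceTests n ha) :
    ∃ f' : sliceTests n ha, ∀ v : H10 n α a,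
      inner ℝ (angComp i v) (testL2 f) = inner ℝ (fnOf v) (testL2 f') := by
  have hf := isSliceTest_coe f
  obtain ⟨k, hk⟩ := exists_integral_dirDeriv_sphere (n := n) ha i
  have h1 := (hf.mul_left ha (smoothOver_coord (Ioo 0 a) i)).const_smul ha k
  have h2 := (hf.dirDeriv ha (0, EuclideanSpace.single i 1)).const_smul ha (-1)
  refine ⟨mkTest ha (h1.add h2), fun v => ?_⟩
  refine (denseRange_testH10 n α ha).induction_on v ?_ fun χ => ?_
  · exact isClosed_eq ((angComp i).continuous.inner continuous_const)
      (Continuous.inner (by unfold fnOf; fun_prop) continuous_const)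
  · have hχ := isSliceTest_coe χ
    have e1 : angComp i (testH10 n α ha χ) =ᵐ[sliceMeasure n a]
        dirDeriv (0, EuclideanSpace.single i 1) (χ : ℝ × Sph n → ℝ) := by
      filter_upwards [angComp_ae i (testH10 n α ha χ), angularOf_testH10_ae (α := α) χ] with z h3 h4
      rw [h3, h4, ← gradS_apply_eq hχ.smooth i]
    rw [fnOf_testH10, inner_testL2, inner_eq_integral e1 (testL2_ae f)]
    have h3 := hk _ (hf.mul_left ha (hχ.smooth.mono (subset_univ _)))
    have i1 : Integrable (fun z => dirDeriv (0, EuclideanSpace.single i 1) (χ : ℝ × Sph n → ℝ) z *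
        (f : ℝ × Sph n → ℝ) z) (sliceMeasure n a) :=
      (hf.mul_left ha ((hχ.dirDeriv ha _).smooth.mono (subset_univ _))).integrable
    have i2 : Integrable (fun z => (χ : ℝ × Sph n → ℝ) z *
        dirDeriv (0, EuclideanSpace.single i 1) (f : ℝ × Sph n → ℝ) z) (sliceMeasure n a) :=
      ((hf.dirDeriv ha _).mul_left ha (hχ.smooth.mono (subset_univ _))).integrable
    have i3 : Integrable (fun z => (χ : ℝ × Sph n → ℝ) z * (f : ℝ × Sph n → ℝ) z *
        (z.2 : Euc n) i) (sliceMeasure n a) := by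
      have := ((hf.mul_left ha (hχ.smooth.mono (subset_univ _))).mul_left ha
        (smoothOver_coord (Ioo 0 a) i)).integrable
      simpa only [mul_comm] using this
    have e2 : ∀ z, dirDeriv (0, EuclideanSpace.single i 1)
        (fun z => (χ : ℝ × Sph n → ℝ) z * (f : ℝ × Sph n → ℝ) z) z =
        (χ : ℝ × Sph n → ℝ) z * dirDeriv (0, EuclideanSpace.single i 1) (f : ℝ × Sph n → ℝ) z +
        dirDeriv (0, EuclideanSpace.single i 1) (χ : ℝ × Sph n → ℝ) z * (f : ℝ × Sph n → ℝ) z :=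
      fun z => by
        rw [dirDeriv_mul isOpen_univ hχ.smooth hf.smooth _ (mem_univ z.1)]; ring
    simp only [e2] at h3
    rw [integral_add i2 i1] at h3
    calc _ = k * (∫ z, (χ : ℝ × Sph n → ℝ) z * (f : ℝ × Sph n → ℝ) z * (z.2 : Euc n) i
          ∂(sliceMeasure n a)) - ∫ z, (χ : ℝ × Sph n → ℝ) z *
        dirDeriv (0, EuclideanSpace.single i 1) (f : ℝ × Sph n → ℝ) z ∂(sliceMeasure n a) := by
          linarith
      _ = _ := by
          rw [← integral_const_mul, ← integral_sub (i3.const_mul k) i2]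
          congr 1; ext z
          simp only [mkTest, Pi.add_apply, Pi.smul_apply, smul_eq_mul]
          ring

/-- Division of test functions by `x`. -/
def divTest (ha : 0 < a) : sliceTests n ha →ₗ[ℝ] sliceTests n ha where
  toFun χ := mkTest ha ((isSliceTest_coe χ).mul_left ha (smoothOver_div_fst 1 a))
  map_add' χ χ' := by
    ext z
    exact mul_add _ _ _
  map_smul' c χ := by
    ext z
    exact mul_left_comm _ _ _

lemma divTest_apply {ha : 0 < a} (χ : sliceTests n ha) (z : ℝ × Sph n) :
    (divTest ha χ : ℝ × Sph n → ℝ) z = 1 / z.1 * (χ : ℝ × Sph n → ℝ) z := rfl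

/-- The integrand equals `(1/(2x)) ∂_x(χ²) + α (χ/x)²`, and the first term integrates to zero
against `x dx dθ`. -/
lemma inner_twistOf_divTest {ha : 0 < a} (χ : sliceTests n ha) :
    inner ℝ (twistOf (testH10 n α ha χ)) (testL2 (divTest ha χ)) =
      α * ‖testL2 (divTest ha χ)‖ ^ 2 := by
  have hχ := isSliceTest_coe χ
  have hg := isSliceTest_coe (divTest ha χ)
  have h1 := (hχ.mul_left ha (hχ.smooth.mono (subset_univ _))).integral_dirDeriv_div ha
  rw [← real_inner_self_eq_norm_sq, inner_testL2,
    inner_eq_integral (twistOf_testH10_ae χ) (testL2_ae _), twisted_eq α hχ.smooth,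
    ← integral_const_mul]
  have i1 : Integrable (fun z => α * ((divTest ha χ : ℝ × Sph n → ℝ) z *
      (divTest ha χ : ℝ × Sph n → ℝ) z)) (sliceMeasure n a) :=
    (hg.mul_left ha (hg.smooth.mono (subset_univ _))).integrable.const_mul α
  have i2 : Integrable (fun z => 1 / 2 * (1 / z.1 * dirDeriv ((1 : ℝ), 0)
      (fun z => (χ : ℝ × Sph n → ℝ) z * (χ : ℝ × Sph n → ℝ) z) z)) (sliceMeasure n a) :=
    (((hχ.mul_left ha (hχ.smooth.mono (subset_univ _))).dirDeriv ha _).mul_left ha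
      (smoothOver_div_fst 1 a)).integrable.const_mul _
  rw [← zero_add (∫ z, α * _ ∂(sliceMeasure n a)), ← mul_zero (1 / 2 : ℝ), ← h1,
    ← integral_const_mul, ← integral_add i2 i1]
  congr 1
  ext z
  rw [dirDeriv_mul isOpen_univ hχ.smooth hχ.smooth _ (mem_univ z.1)]
  simp only [divTest_apply]
  ring

end AAdS

namespace AAdS

open scoped InnerProduct

variable {n : ℕ} {a α : ℝ}

/-! ### The operators on `𝐇¹₀` -/

/-- The inclusion of `𝐇¹₀` in `𝐋²`. -/
def fnL (n : ℕ) (α a : ℝ) : H10 n α a →L[ℝ] L2 n a :=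
  (WithLp.fstL 2 ℝ (L2 n a) (WithLp 2 (L2 n a × L2vec n a))).comp (H10 n α a).subtypeL

/-- The twisted derivative as an operator. -/
def twistL (n : ℕ) (α a : ℝ) : H10 n α a →L[ℝ] L2 n a :=
  (WithLp.fstL 2 ℝ (L2 n a) (L2vec n a)).comp
    ((WithLp.sndL 2 ℝ (L2 n a) (WithLp 2 (L2 n a × L2vec n a))).comp (H10 n α a).subtypeL)

@[simp]
lemma fnL_apply (v : H10 n α a) : fnL n α a v = fnOf v := rfl

@[simp]
lemma twistL_apply (v : H10 n α a) : twistL n α a v = twistOf v := rfl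

lemma norm_sq_H10 (v : H10 n α a) :
    ‖v‖ ^ 2 = ‖fnOf v‖ ^ 2 + (‖twistOf v‖ ^ 2 + ‖angularOf v‖ ^ 2) := by
  have h1 := WithLp.prod_norm_sq_eq_of_L2 (v : Triple n a)
  have h2 := WithLp.prod_norm_sq_eq_of_L2 (v : Triple n a).snd
  rw [h2] at h1
  exact h1

lemma norm_twistOf_le (v : H10 n α a) : ‖twistOf v‖ ≤ ‖v‖ :=
  abs_le_of_sq_le_sq' (by
    nlinarith [norm_sq_H10 v, sq_nonneg (‖fnOf v‖), sq_nonneg (‖angularOf v‖)]) (norm_nonneg v) |>.2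

lemma norm_angularOf_le (v : H10 n α a) : ‖angularOf v‖ ≤ ‖v‖ :=
  abs_le_of_sq_le_sq' (by
    nlinarith [norm_sq_H10 v, sq_nonneg (‖fnOf v‖), sq_nonneg (‖twistOf v‖)]) (norm_nonneg v) |>.2

lemma norm_le_sum_H10 (v : H10 n α a) :
    ‖v‖ ≤ ‖fnOf v‖ + ‖twistOf v‖ + ‖angularOf v‖ :=
  abs_le_of_sq_le_sq' (by
    have h1 := norm_nonneg (fnOf v)
    have h2 := norm_nonneg (twistOf v)
    have h3 := norm_nonneg (angularOf v)
    nlinarith [norm_sq_H10 v, mul_nonneg h1 h2, mul_nonneg h1 h3, mul_nonneg h2 h3])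
    (by positivity) |>.2

lemma sum_norm_sq_angComp (v : H10 n α a) :
    ∑ i, ‖angComp i v‖ ^ 2 = ‖angularOf v‖ ^ 2 := by
  have h1 : ∀ i, ‖angComp i v‖ ^ 2 = ∫ z, angularOf v z i * angularOf v z i
      ∂(sliceMeasure n a) := fun i => by
    rw [← real_inner_self_eq_norm_sq, inner_eq_integral (angComp_ae i v) (angComp_ae i v)]
  have h2 : ∀ i, Integrable (fun z => angularOf v z i * angularOf v z i) (sliceMeasure n a) :=
    fun i => by
      have h3 : MemLp (fun z => angularOf v z i) 2 (sliceMeasure n a) :=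
        (memLp_congr_ae (angComp_ae i v)).1 (Lp.memLp _)
      exact h3.integrable_mul h3
  simp only [h1]
  rw [← integral_finsetSum _ fun i _ => h2 i, ← real_inner_self_eq_norm_sq, L2.inner_def]
  congr 1

lemma continuous_fnOf : Continuous (fnOf : H10 n α a → L2 n a) := (fnL n α a).continuous

lemma continuous_twistOf : Continuous (twistOf : H10 n α a → L2 n a) := (twistL n α a).continuous

/-- Cauchy–Schwarz in the preceding identity. This bound lets division by `x` extend from test
functions to `𝐇¹₀`. -/
lemma norm_testL2_divTest_le (hα : 0 < α) {ha : 0 < a} (χ : sliceTests n ha) :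
    ‖testL2 (divTest ha χ)‖ ≤ α⁻¹ * ‖testH10 n α ha χ‖ := by
  have h1 := inner_twistOf_divTest (α := α) χ
  have h2 := abs_real_inner_le_norm (twistOf (testH10 n α ha χ)) (testL2 (divTest ha χ))
  rw [h1, abs_of_nonneg (by positivity)] at h2
  have h3 := norm_twistOf_le (testH10 n α ha χ)
  rw [inv_mul_eq_div, le_div_iff₀ hα]
  by_contra hne
  rw [not_le] at hne
  have h4 : 0 < ‖testL2 (divTest ha χ)‖ := by
    by_contra h5
    have : ‖testL2 (divTest ha χ)‖ = 0 := le_antisymm (not_lt.1 h5) (norm_nonneg _)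
    rw [this, zero_mul] at hne
    exact absurd hne (not_lt.2 (norm_nonneg _))
  nlinarith [mul_le_mul_of_nonneg_right h3 h4.le, mul_lt_mul_of_pos_right hne h4]

/-- Division by `x` as an operator from `𝐇¹₀` to `𝐋²`. -/
def divL (n : ℕ) (α : ℝ) {a : ℝ} (ha : 0 < a) : H10 n α a →L[ℝ] L2 n a :=
  LinearMap.extendOfNorm
    ((fnL n α a).toLinearMap ∘ₗ testH10 n α ha ∘ₗ divTest ha) (testH10 n α ha)

lemma divL_testH10 (hα : 0 < α) {ha : 0 < a} (χ : sliceTests n ha) :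
    divL n α ha (testH10 n α ha χ) = testL2 (divTest ha χ) :=
  LinearMap.extendOfNorm_eq (denseRange_testH10 n α ha)
    ⟨α⁻¹, fun χ => norm_testL2_divTest_le hα χ⟩ χ

/-- The key identity, extended by density. It yields the Hardy inequality and also the exact form of
the flat energy. -/
lemma inner_twistOf_divL (hα : 0 < α) (ha : 0 < a) (v : H10 n α a) :
    inner ℝ (twistOf v) (divL n α ha v) = α * ‖divL n α ha v‖ ^ 2 := by
  refine (denseRange_testH10 n α ha).induction_on v ?_ fun χ => ?_
  · exact isClosed_eq (continuous_twistOf.inner (divL n α ha).continuous) (by fun_prop)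
  · rw [divL_testH10 hα, inner_twistOf_divTest]

/-- The Hardy inequality. -/
lemma norm_divL_le (hα : 0 < α) (ha : 0 < a) (v : H10 n α a) :
    ‖divL n α ha v‖ ≤ α⁻¹ * ‖twistOf v‖ := by
  have h2 := abs_real_inner_le_norm (twistOf v) (divL n α ha v)
  rw [inner_twistOf_divL hα, abs_of_nonneg (by positivity)] at h2
  rw [inv_mul_eq_div, le_div_iff₀ hα]
  rcases (norm_nonneg (divL n α ha v)).eq_or_lt' with h | h
  · rw [h, zero_mul]; exact norm_nonneg _
  · nlinarith

lemma memLp_fst (n : ℕ) (a : ℝ) :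
    MemLp (fun z : ℝ × Sph n => z.1) ∞ (sliceMeasure n a) := by
  refine memLp_top_of_bound (by fun_prop) a ?_
  filter_upwards [ae_slice_mem] with z hz
  rw [Real.norm_eq_abs, abs_of_pos hz.1]
  exact hz.2.le

/-- The operator `divL` is defined by extension, so its pointwise meaning has to be recovered.
Multiplying back by the bounded function `x` gives an identity that is continuous in `v`. -/
lemma mulOp_fst_divL (hα : 0 < α) (ha : 0 < a) (v : H10 n α a) :
    mulOp (sliceMeasure n a) (fun z => z.1) (divL n α ha v) = fnOf v := by
  refine (denseRange_testH10 n α ha).induction_on v ?_ fun χ => ?_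
  · exact isClosed_eq (by fun_prop) continuous_fnOf
  · rw [divL_testH10 hα, fnOf_testH10]
    refine Lp.ext ?_
    filter_upwards [mulOp_ae (memLp_fst n a) (testL2 (divTest ha χ)), testL2_ae χ,
      testL2_ae (divTest ha χ), ae_slice_mem] with z h1 h2 h3 h4
    have := h4.1.ne'
    rw [h1, h2, h3, divTest_apply]
    field_simp

lemma divL_ae (hα : 0 < α) (ha : 0 < a) (v : H10 n α a) :
    divL n α ha v =ᵐ[sliceMeasure n a] fun z => 1 / z.1 * fnOf v z := by
  have h := mulOp_ae (memLp_fst n a) (divL n α ha v)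
  rw [mulOp_fst_divL hα ha v] at h
  filter_upwards [h, ae_slice_mem] with z h1 h2
  have := h2.1.ne'
  rw [h1]
  field_simp

/-- Since `v = x (v / x)` and `x < a`, the Hardy inequality gains a factor `a`. This is what the
weight `1 / a` in the norm of `𝐇¹_a` requires. -/
lemma norm_fnOf_le_twistOf (hα : 0 < α) (ha : 0 < a) (v : H10 n α a) :
    ‖fnOf v‖ ≤ a * (α⁻¹ * ‖twistOf v‖) := by
  rw [← mulOp_fst_divL hα ha v]
  refine (ContinuousLinearMap.le_opNorm _ _).trans ?_
  refine mul_le_mul ?_ (norm_divL_le hα ha v) (norm_nonneg _) ha.le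
  refine norm_mulOp_le ha.le ?_
  filter_upwards [ae_slice_mem] with z hz
  rw [abs_of_pos hz.1]
  exact hz.2.le

/-- Test functions are dense in `𝐋²`. -/
theorem denseRange_testL2 (n : ℕ) (ha : 0 < a) :
    DenseRange (testL2 : sliceTests n ha → L2 n a) := by
  -- A function orthogonal to all test functions is extended by zero from the closed cylinder to `ℝ
  -- × ℝ^(n-1)` and tested against smooth functions there, for the push-forward of the slice
  -- measure. Their restrictions to the cylinder are test functions.
  let Φ : ℝ × Sph n → ℝ × Euc n := Prod.map id Subtype.val
  have hΦ : IsClosedEmbedding Φ :=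
    IsClosedEmbedding.id.prodMap Metric.isClosed_sphere.isClosedEmbedding_subtypeVal
  have hΦm : MeasurableEmbedding Φ := hΦ.measurableEmbedding
  let R : Submodule ℝ (L2 n a) :=
    LinearMap.range ((fnL n 0 a).toLinearMap ∘ₗ testH10 n 0 ha)
  have hR : R.topologicalClosure = ⊤ := by
    rw [Submodule.topologicalClosure_eq_top_iff, Submodule.eq_bot_iff]
    intro f hf
    have hfi : Integrable f (sliceMeasure n a) := (Lp.memLp f).integrable (by norm_num)
    let F : ℝ × Euc n → ℝ := Function.extend Φ f 0
    have hF : F ∘ Φ = f := funext fun z => hΦ.injective.extend_apply _ _ z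
    have hFi : Integrable F ((sliceMeasure n a).map Φ) := by
      rw [hΦm.integrable_map_iff, hF]; exact hfi
    have hU : IsOpen (Ioo 0 a ×ˢ (univ : Set (Euc n))) := isOpen_Ioo.prod isOpen_univ
    have h0 := hU.ae_eq_zero_of_integral_contDiff_smul_eq_zero
      (hFi.locallyIntegrable.locallyIntegrableOn _) fun g hg hgc hgs => by
        rw [hΦm.integral_map]
        have ht : IsSliceTest a (g ∘ Φ) := by
          refine ⟨smoothOver_of_contDiffOn hg.contDiffOn, hgc.comp_isClosedEmbedding hΦ, ?_⟩
          refine (tsupport_comp_subset_preimage g hΦ.continuous).trans fun z hz => ?_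
          have := hgs hz
          exact ⟨this.1, mem_univ _⟩
        have h1 : inner ℝ (testL2 (mkTest ha ht)) f = 0 := hf _ ⟨mkTest ha ht, rfl⟩
        rw [inner_eq_integral (testL2_ae _) (.refl _ _)] at h1
        rw [← h1]
        congr 1
        ext z
        rw [show F (Φ z) = f z from congrFun hF z]
        rfl
    have h1 := (hΦm.ae_map_iff).1 h0
    refine (Lp.eq_zero_iff_ae_eq_zero).2 ?_
    filter_upwards [h1, ae_slice_mem] with z h1 h2
    have h3 := h1 ⟨h2, mem_univ _⟩
    rwa [show F (Φ z) = f z from congrFun hF z] at h3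
  have h3 := congrArg (fun W : Submodule ℝ (L2 n a) => (W : Set (L2 n a))) hR
  have h4 : closure (range (testL2 : sliceTests n ha → L2 n a)) = univ := h3
  exact dense_iff_closure_eq.2 h4

lemma denseRange_fnL (n : ℕ) (α : ℝ) (ha : 0 < a) : DenseRange (fnL n α a) := by
  refine (denseRange_testL2 n ha).mono ?_
  rintro _ ⟨χ, rfl⟩
  exact ⟨testH10 n α ha χ, rfl⟩

/-- The components of `x^(-β) dφ` for `φ = x^β v`, without the time derivative. -/
def gradL (n : ℕ) (α β : ℝ) {a : ℝ} (ha : 0 < a) : Idx n → H10 n α a →L[ℝ] L2 n a :=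
  Sum.elim ![0, twistL n α a + (β - α) • divL n α ha] angComp

/-- The derivative is moved to the test function, so the pairing depends continuously on `v` in `𝐋²`
alone. This is the input for identifying the initial velocity. -/
lemma exists_inner_gradL (hα : 0 < α) (β : ℝ) (ha : 0 < a) (i : Idx n) (f : sliceTests n ha) :
    ∃ C, ∀ v : H10 n α a, |inner ℝ (gradL n α β ha i v) (testL2 f)| ≤ C * ‖fnOf v‖ := by
  have key : ∀ {J : H10 n α a → L2 n a}, (∃ f' : sliceTests n ha, ∀ v : H10 n α a,
      inner ℝ (J v) (testL2 f) = inner ℝ (fnOf v) (testL2 f')) →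
      ∃ C, ∀ v : H10 n α a, |inner ℝ (J v) (testL2 f)| ≤ C * ‖fnOf v‖ := fun {J} ⟨f', h⟩ =>
    ⟨‖testL2 f'‖, fun v => by
      rw [h, mul_comm]; exact abs_real_inner_le_norm _ _⟩
  rcases i with i | i
  · fin_cases i
    · exact ⟨0, fun v => by simp [gradL]⟩
    · obtain ⟨C, hC⟩ := key (exists_inner_twistOf (α := α) ha f)
      refine ⟨C + |β - α| * ‖testL2 (divTest ha f)‖, fun v => ?_⟩
      have h1 : inner ℝ (divL n α ha v) (testL2 f) = inner ℝ (fnOf v) (testL2 (divTest ha f)) := by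
        rw [inner_eq_integral (divL_ae hα ha v) (testL2_ae f),
          inner_eq_integral (.refl _ (fnOf v : _ → ℝ)) (testL2_ae (divTest ha f))]
        congr 1
        ext z
        rw [divTest_apply]
        ring
      have h2 : gradL n α β ha (Sum.inl ((fun i => i) ⟨1, by norm_num⟩)) v =
          twistOf v + (β - α) • divL n α ha v := rfl
      rw [h2, inner_add_left, inner_smul_left, h1, RCLike.conj_to_real, add_mul]
      refine (abs_add_le _ _).trans (add_le_add (hC v) ?_)
      rw [abs_mul, mul_assoc]
      refine mul_le_mul_of_nonneg_left ?_ (abs_nonneg _)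
      rw [mul_comm]
      exact abs_real_inner_le_norm _ _
  · exact key (exists_inner_angComp (α := α) ha i f)

end AAdS

namespace AAdS

open scoped InnerProduct

/-! ### Functions of slowly varying curves -/

lemma exists_fderiv_bounds {E F : Type*} [NormedAddCommGroup E] [NormedSpace ℝ E]
    [NormedAddCommGroup F] [NormedSpace ℝ F] {Φ : E → F} {k₀ : E} (h : ContDiffAt ℝ 2 Φ k₀) :
    ∃ r > 0, ∃ C > 0, (∀ k ∈ Metric.ball k₀ r, DifferentiableAt ℝ Φ k ∧ ‖fderiv ℝ Φ k‖ ≤ C) ∧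
      ∀ k ∈ Metric.ball k₀ r, ∀ l ∈ Metric.ball k₀ r,
        ‖fderiv ℝ Φ k - fderiv ℝ Φ l‖ ≤ C * ‖k - l‖ := by
  have h1 : ContDiffAt ℝ 1 (fderiv ℝ Φ) k₀ := h.fderiv_right (by norm_num)
  obtain ⟨K, t, ht, hK⟩ := h1.exists_lipschitzOnWith
  have h2 : ∀ᶠ k in 𝓝 k₀, DifferentiableAt ℝ Φ k :=
    ((h.of_le (by norm_num : (1 : WithTop ℕ∞) ≤ 2)).eventually (by simp)).mono fun k hk =>
      hk.differentiableAt (by simp)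
  obtain ⟨r, hr, hrt⟩ := Metric.eventually_nhds_iff_ball.1 (h2.and (eventually_mem_set.2 ht))
  have h0 : k₀ ∈ Metric.ball k₀ r := Metric.mem_ball_self hr
  have hlip : ∀ k ∈ Metric.ball k₀ r, ∀ l ∈ Metric.ball k₀ r,
      ‖fderiv ℝ Φ k - fderiv ℝ Φ l‖ ≤ K * ‖k - l‖ := fun k hk l hl =>
    hK.norm_sub_le (hrt k hk).2 (hrt l hl).2
  refine ⟨r, hr, K + (‖fderiv ℝ Φ k₀‖ + K * r) + 1, by positivity,
    fun k hk => ⟨(hrt k hk).1, ?_⟩, fun k hk l hl => (hlip k hk l hl).trans ?_⟩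
  · have h3 := hlip k hk k₀ h0
    have h4 : ‖k - k₀‖ ≤ r := by rw [← dist_eq_norm]; exact (Metric.mem_ball.1 hk).le
    have h5 := norm_le_norm_add_norm_sub' (fderiv ℝ Φ k) (fderiv ℝ Φ k₀)
    have h6 : (K : ℝ) * ‖k - k₀‖ ≤ K * r := by gcongr
    have h7 : (0 : ℝ) ≤ K := K.2
    linarith
  · gcongr
    have : 0 ≤ ‖fderiv ℝ Φ k₀‖ + K * r := by positivity
    linarith

/-- Functions of curves that stay, with two derivatives, close to a point. -/
lemma curve_bounds {E F : Type*} [NormedAddCommGroup E] [NormedSpace ℝ E]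
    [NormedAddCommGroup F] [NormedSpace ℝ F] {Φ : E → F} {k₀ : E} {r C c : ℝ} (hC : 0 < C)
    (h1 : ∀ k ∈ Metric.ball k₀ r, DifferentiableAt ℝ Φ k ∧ ‖fderiv ℝ Φ k‖ ≤ C)
    (h2 : ∀ k ∈ Metric.ball k₀ r, ∀ l ∈ Metric.ball k₀ r,
        ‖fderiv ℝ Φ k - fderiv ℝ Φ l‖ ≤ C * ‖k - l‖)
    {κ κ' κ'' : ℝ → E} (hκ : ∀ t, HasDerivAt κ (κ' t) t) (hκ' : ∀ t, HasDerivAt κ' (κ'' t) t)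
    (hc : c < r) (b0 : ∀ t, ‖κ t - k₀‖ ≤ c) (b1 : ∀ t, ‖κ' t‖ ≤ c) (b2 : ∀ t, ‖κ'' t‖ ≤ c) :
    ∀ t, ‖Φ (κ t) - Φ k₀‖ ≤ C * c ∧
      HasDerivAt (fun t => Φ (κ t)) (fderiv ℝ Φ (κ t) (κ' t)) t ∧
      ‖fderiv ℝ Φ (κ t) (κ' t)‖ ≤ C * c ∧
      ∀ s, ‖fderiv ℝ Φ (κ t) (κ' t) - fderiv ℝ Φ (κ s) (κ' s)‖ ≤ (C * c * c + C * c) * |t - s| := by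
  have hc0 : 0 ≤ c := (norm_nonneg _).trans (b0 0)
  have hm : ∀ t, κ t ∈ Metric.ball k₀ r := fun t => by
    rw [Metric.mem_ball, dist_eq_norm]; exact (b0 t).trans_lt hc
  have hk0 : k₀ ∈ Metric.ball k₀ r := Metric.mem_ball_self (hc0.trans_lt hc)
  have hmv : ∀ {f f' : ℝ → E}, (∀ t, HasDerivAt f (f' t) t) → (∀ t, ‖f' t‖ ≤ c) → ∀ t s,
      ‖f t - f s‖ ≤ c * |t - s| := fun {f f'} hf hf' t s => by
    simpa using! Convex.norm_image_sub_le_of_norm_hasDerivWithin_le (s := univ)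
      (fun x _ => (hf x).hasDerivWithinAt) (fun x _ => hf' x) convex_univ (mem_univ s) (mem_univ t)
  intro t
  refine ⟨?_, (h1 _ (hm t)).1.hasFDerivAt.comp_hasDerivAt t (hκ t), ?_, fun s => ?_⟩
  · refine ((convex_ball k₀ r).norm_image_sub_le_of_norm_fderiv_le (fun k hk => (h1 k hk).1)
      (fun k hk => (h1 k hk).2) hk0 (hm t)).trans ?_
    gcongr
    exact b0 t
  · refine (ContinuousLinearMap.le_opNorm _ _).trans ?_
    exact mul_le_mul (h1 _ (hm t)).2 (b1 t) (norm_nonneg _) hC.le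
  · have e : fderiv ℝ Φ (κ t) (κ' t) - fderiv ℝ Φ (κ s) (κ' s) =
        (fderiv ℝ Φ (κ t) - fderiv ℝ Φ (κ s)) (κ' t) + fderiv ℝ Φ (κ s) (κ' t - κ' s) := by
      rw [_root_.sub_apply, map_sub]; abel
    rw [e]
    refine (norm_add_le _ _).trans ?_
    have h3 := (ContinuousLinearMap.le_opNorm (fderiv ℝ Φ (κ t) - fderiv ℝ Φ (κ s)) (κ' t))
    have h4 := (ContinuousLinearMap.le_opNorm (fderiv ℝ Φ (κ s)) (κ' t - κ' s))
    have h5 := h2 _ (hm t) _ (hm s)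
    have h6 := hmv hκ b1 t s
    have h7 := hmv hκ' b2 t s
    have h8 : ‖fderiv ℝ Φ (κ t) - fderiv ℝ Φ (κ s)‖ * ‖κ' t‖ ≤ C * (c * |t - s|) * c :=
      mul_le_mul (h5.trans (by gcongr)) (b1 t) (norm_nonneg _) (by positivity)
    have h9 : ‖fderiv ℝ Φ (κ s)‖ * ‖κ' t - κ' s‖ ≤ C * (c * |t - s|) :=
      mul_le_mul (h1 _ (hm s)).2 h7 (norm_nonneg _) hC.le
    nlinarith

/-! ### The coefficients of the equation -/

variable {n : ℕ}

/-- The unit vector normal to the sphere. -/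
def normalVec (θ : Sph n) : Idx n → ℝ := Sum.elim 0 fun i => (θ : Euc n) i

/-- The rescaled metric `x² g`, completed in the direction normal to the sphere. -/
def scaledMetric (g : TensorField n) (p : Pt n) (i j : Idx n) : ℝ :=
  p.1.2 ^ 2 * g p i j + normalVec p.2 i * normalVec p.2 j

/-- The limit of the rescaled metric at `x = 0`. -/
def flatMetric (n : ℕ) (i j : Idx n) : ℝ := if i = j then (if i = iT n then -1 else 1) else 0

/-- The functions `√|det k| (k⁻¹)_ij` and `√|det k|` of a matrix `k`. -/
def coefFun (k : Idx n → Idx n → ℝ) : Option (Idx n × Idx n) → ℝ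
  | none => √|(Matrix.of k).det|
  | some ij => √|(Matrix.of k).det| * (Matrix.of k)⁻¹ ij.1 ij.2

/-- The coefficients of the equation. -/
def coef (g : TensorField n) (c : Option (Idx n × Idx n)) (p : Pt n) : ℝ :=
  coefFun (scaledMetric g p) c

lemma contDiff_det {ι : Type*} [Fintype ι] [DecidableEq ι] {E : Type*} [NormedAddCommGroup E]
    [NormedSpace ℝ E] {f : E → Matrix ι ι ℝ} (hf : ∀ i j, ContDiff ℝ ∞ fun x => f x i j) :
    ContDiff ℝ ∞ fun x => (f x).det := by
  simp only [Matrix.det_apply']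
  exact ContDiff.sum fun σ _ => contDiff_const.mul (contDiff_prod fun i _ => hf _ _)

lemma contDiff_entry (i j : Idx n) : ContDiff ℝ ∞ fun k : Idx n → Idx n → ℝ => k i j := by fun_prop

/-- The determinant is polynomial and the inverse is given by the adjugate; the absolute value and
the root are smooth because the determinant does not vanish. -/
lemma contDiffAt_coefFun {k : Idx n → Idx n → ℝ} (hk : (Matrix.of k).det ≠ 0) :
    ContDiffAt ℝ ∞ coefFun k := by
  have h1 : ContDiff ℝ ∞ fun k : Idx n → Idx n → ℝ => (Matrix.of k).det :=
    contDiff_det contDiff_entry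
  have h2 : ContDiffAt ℝ ∞ (fun k : Idx n → Idx n → ℝ => √|(Matrix.of k).det|) k :=
    (h1.contDiffAt.abs hk).sqrt (abs_ne_zero.2 hk)
  refine contDiffAt_pi.2 fun c => ?_
  rcases c with - | ⟨i, j⟩
  · exact h2
  · have h3 : ContDiff ℝ ∞ fun k : Idx n → Idx n → ℝ => (Matrix.of k).adjugate i j := by
      simp only [Matrix.adjugate_apply]
      refine contDiff_det fun r s => ?_
      by_cases hr : r = j
      · subst hr
        simp only [Matrix.updateRow_self]
        exact contDiff_const
      · simp only [Matrix.updateRow_ne hr]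
        exact contDiff_entry r s
    have h4 : ContDiffAt ℝ ∞ (fun k : Idx n → Idx n → ℝ => (Matrix.of k)⁻¹ i j) k := by
      have h5 : (fun k : Idx n → Idx n → ℝ => (Matrix.of k)⁻¹ i j) = fun k =>
          ((Matrix.of k).det)⁻¹ * (Matrix.of k).adjugate i j := by
        funext l
        rw [Matrix.inv_def, Ring.inverse_eq_inv', Matrix.smul_apply, smul_eq_mul]
      rw [h5]
      exact (h1.contDiffAt.inv hk).mul h3.contDiffAt
    exact h2.mul h4

lemma flatMetric_eq (n : ℕ) : Matrix.of (flatMetric n) =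
    Matrix.diagonal fun i => if i = iT n then (-1 : ℝ) else 1 := by
  ext i j
  by_cases h : i = j
  · subst h; simp [flatMetric]
  · simp [flatMetric, h]

lemma det_flatMetric (n : ℕ) : (Matrix.of (flatMetric n)).det = -1 := by
  rw [flatMetric_eq, Matrix.det_diagonal, Fintype.prod_sum_type]
  simp

lemma coefFun_flatMetric (n : ℕ) : coefFun (flatMetric n) = fun c => c.elim 1 fun ij =>
    flatMetric n ij.1 ij.2 := by
  have h0 := det_flatMetric n
  have h1 : (Matrix.of (flatMetric n))⁻¹ = Matrix.of (flatMetric n) := by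
    refine Matrix.inv_eq_right_inv ?_
    rw [flatMetric_eq, Matrix.diagonal_mul_diagonal, ← Matrix.diagonal_one]
    congr 1
    ext i
    split_ifs <;> simp
  ext c
  rcases c with - | ⟨i, j⟩
  · simp [coefFun, h0]
  · simp [coefFun, h0, h1]

end AAdS

namespace AAdS

open scoped InnerProduct

/-! ### Asymptotics of the coefficients -/

variable {n : ℕ}

/-- All asymptotic conditions take one form after multiplication by `x²`. In the spherical block the
normal part `θ_i θ_j` completes `δ_ij - θ_i θ_j` to the identity. The constant `e` is `-1` for the
`tt` and `xx` components and `0` otherwise. -/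
lemma IsAAdSPatch.exists_remainder {A : ℝ} {g : TensorField n} (hg : IsAAdSPatch n A g)
    (i j : Idx n) : ∃ (e : ℝ) (m : ℕ) (Q : Pt n → ℝ), |e| ≤ 1 ∧ 1 ≤ m ∧ IsOx m Q ∧
      ∀ p : Pt n, p.1.2 ∈ Ioo 0 A →
        scaledMetric g p i j = flatMetric n i j + p.1.2 ^ 2 * (e + Q p) := by
  rcases i with i | i <;> rcases j with j | j
  · fin_cases i <;> fin_cases j
    · refine ⟨-1, 2, _, by norm_num, by norm_num, hg.asymp_tt, fun p hp => ?_⟩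
      have : p.1.2 ≠ 0 := hp.1.ne'
      simp [scaledMetric, flatMetric, normalVec]
      field_simp
      ring
    · refine ⟨0, 1, _, by norm_num, le_rfl, hg.asymp_tx, fun p hp => ?_⟩
      simp [scaledMetric, flatMetric, normalVec]
    · refine ⟨0, 1, _, by norm_num, le_rfl, hg.asymp_tx, fun p hp => ?_⟩
      simp [scaledMetric, flatMetric, normalVec, (hg.symm p hp).apply]
    · refine ⟨-1, 1, _, by norm_num, le_rfl, hg.asymp_xx, fun p hp => ?_⟩
      have : p.1.2 ≠ 0 := hp.1.ne'
      simp [scaledMetric, flatMetric, normalVec]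
      field_simp
      ring
  · fin_cases i
    · refine ⟨0, 1, _, by norm_num, le_rfl, hg.asymp_tsphere j, fun p hp => ?_⟩
      simp [scaledMetric, flatMetric, normalVec]
    · refine ⟨0, 2, _, by norm_num, by norm_num, hg.asymp_xsphere j, fun p hp => ?_⟩
      simp [scaledMetric, flatMetric, normalVec]
  · fin_cases j
    · refine ⟨0, 1, _, by norm_num, le_rfl, hg.asymp_tsphere i, fun p hp => ?_⟩
      simp [scaledMetric, flatMetric, normalVec, (hg.symm p hp).apply (iT n)]
    · refine ⟨0, 2, _, by norm_num, by norm_num, hg.asymp_xsphere i, fun p hp => ?_⟩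
      simp [scaledMetric, flatMetric, normalVec, (hg.symm p hp).apply (iX n)]
  · refine ⟨0, 1, _, by norm_num, le_rfl, hg.asymp_sphere i j, fun p hp => ?_⟩
    have : p.1.2 ≠ 0 := hp.1.ne'
    simp [scaledMetric, flatMetric, normalVec]
    field_simp
    ring

lemma isOpen_strip (A : ℝ) : IsOpen {y : ℝ × ℝ | y.2 ∈ Ioo 0 A} :=
  isOpen_Ioo.preimage continuous_snd

lemma SmoothOver.hasDerivAt_time {A : ℝ} {K : Pt n → ℝ}
    (h : SmoothOver {y : ℝ × ℝ | y.2 ∈ Ioo 0 A} K) (t : ℝ) {x : ℝ} (hx : x ∈ Ioo 0 A) (θ : Sph n) :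
    HasDerivAt (fun s => K ((s, x), θ)) (AAdS.dirDeriv (((1 : ℝ), (0 : ℝ)), 0) K ((t, x), θ)) t :=
  h.hasDerivAt_comp (c := fun s => (s, x)) (isOpen_strip A)
    ((hasDerivAt_id t).prodMk (hasDerivAt_const t x)) hx θ

lemma SmoothOver.dT_eq {A : ℝ} {K : Pt n → ℝ} (h : SmoothOver {y : ℝ × ℝ | y.2 ∈ Ioo 0 A} K)
    {p : Pt n} (hp : p.1.2 ∈ Ioo 0 A) : AAdS.dT K p = AAdS.dirDeriv (((1 : ℝ), (0 : ℝ)), 0) K p :=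
  (h.hasDerivAt_time p.1.1 hp p.2).deriv

lemma SmoothOver.dT {A : ℝ} {K : Pt n → ℝ} (h : SmoothOver {y : ℝ × ℝ | y.2 ∈ Ioo 0 A} K) :
    SmoothOver {y : ℝ × ℝ | y.2 ∈ Ioo 0 A} (AAdS.dT K) :=
  (h.dirDeriv (isOpen_strip A) _).congr fun _ hp => h.dT_eq hp

lemma SmoothOver.hasDerivAt_dT {A : ℝ} {K : Pt n → ℝ}
    (h : SmoothOver {y : ℝ × ℝ | y.2 ∈ Ioo 0 A} K) (t : ℝ) {x : ℝ} (hx : x ∈ Ioo 0 A) (θ : Sph n) :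
    HasDerivAt (fun s => K ((s, x), θ)) (AAdS.dT K ((t, x), θ)) t := by
  rw [h.dT_eq (p := ((t, x), θ)) hx]
  exact h.hasDerivAt_time t hx θ

lemma IsAAdSPatch.smooth_scaledMetric {A : ℝ} {g : TensorField n} (hg : IsAAdSPatch n A g)
    (i j : Idx n) : SmoothOver {y : ℝ × ℝ | y.2 ∈ Ioo 0 A} fun p => scaledMetric g p i j := by
  have hν : ∀ i : Idx n, SmoothOver {y : ℝ × ℝ | y.2 ∈ Ioo 0 A}
      fun p : Pt n => normalVec p.2 i := fun i => by
    rcases i with i | i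
    · exact smoothOver_fst (f := fun _ => (0 : ℝ)) contDiffOn_const
    · exact smoothOver_coord _ i
  exact ((smoothOver_fst (f := fun y : ℝ × ℝ => y.2 ^ 2) (by fun_prop)).mul (hg.smooth i j)).add
    ((hν i).mul (hν j))

lemma dT_of_eq_add {A e c : ℝ} {K Q : Pt n → ℝ}
    (h : ∀ p : Pt n, p.1.2 ∈ Ioo 0 A → K p = c + p.1.2 ^ 2 * (e + Q p)) (p : Pt n)
    (hp : p.1.2 ∈ Ioo 0 A) : dT K p = p.1.2 ^ 2 * dT Q p := by
  simp only [dT]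
  have : (fun s => K ((s, p.1.2), p.2)) = fun s => c + p.1.2 ^ 2 * (e + Q ((s, p.1.2), p.2)) :=
    funext fun s => h ((s, p.1.2), p.2) hp
  rw [this, deriv_const_add, deriv_const_mul_field, deriv_const_add]

/-- Only undifferentiated bounds and time derivatives are used, and these do not lower the power of
`x`. The factor `x²` is estimated by `x`, which suffices. -/
lemma IsAAdSPatch.eventually_scaledMetric {A : ℝ} (hA : 0 < A) {g : TensorField n}
    (hg : IsAAdSPatch n A g) (i j : Idx n) :
    ∃ C : ℝ, ∀ᶠ x in 𝓝[>] (0 : ℝ), ∀ (t : ℝ) (θ : Sph n),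
      |scaledMetric g ((t, x), θ) i j - flatMetric n i j| ≤ C * x ∧
      |dT (fun p => scaledMetric g p i j) ((t, x), θ)| ≤ C * x ∧
      |dT (dT fun p => scaledMetric g p i j) ((t, x), θ)| ≤ C * x := by
  obtain ⟨e, m, Q, he, hm, hQ, hK⟩ := hg.exists_remainder i j
  obtain ⟨C0, h0⟩ := hQ 0 0 []
  obtain ⟨C1, h1⟩ := hQ 1 0 []
  obtain ⟨C2, h2⟩ := hQ 2 0 []
  have hdK := dT_of_eq_add hK
  have hddK : ∀ p : Pt n, p.1.2 ∈ Ioo 0 A → dT (dT fun p => scaledMetric g p i j) p =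
      p.1.2 ^ 2 * dT (dT Q) p := dT_of_eq_add (c := 0) (e := 0) fun p hp => by
    rw [hdK p hp, zero_add, zero_add]
  have hx : ∀ᶠ x in 𝓝[>] (0 : ℝ), x ∈ Ioo 0 (min 1 A) :=
    Ioo_mem_nhdsGT (by positivity)
  refine ⟨1 + |C0| + |C1| + |C2|, ?_⟩
  filter_upwards [h0, h1, h2, hx] with x h0 h1 h2 hx t θ
  have hx1 : x < 1 := hx.2.trans_le (min_le_left _ _)
  have hxA : x ∈ Ioo 0 A := ⟨hx.1, hx.2.trans_le (min_le_right _ _)⟩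
  have hz : x ^ ((m : ℤ) - ((0 : ℕ) : ℤ)) ≤ 1 := by
    rw [Nat.cast_zero, sub_zero, zpow_natCast]
    exact pow_le_one₀ hx.1.le hx1.le
  have hz0 : 0 ≤ x ^ ((m : ℤ) - ((0 : ℕ) : ℤ)) := (zpow_pos hx.1 _).le
  have hb : ∀ {C q : ℝ}, |q| ≤ C * x ^ ((m : ℤ) - ((0 : ℕ) : ℤ)) → |q| ≤ |C| := fun {C q} h =>
    h.trans ((mul_le_mul_of_nonneg_right (le_abs_self C) hz0).trans
      (mul_le_of_le_one_right (abs_nonneg _) hz))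
  have b0 := hb (h0 t θ)
  have b1 := hb (h1 t θ)
  have b2 := hb (h2 t θ)
  simp only [Function.iterate_zero, Function.iterate_succ, id, Function.comp,
    List.foldr_nil] at b0 b1 b2
  have a0 := abs_nonneg C0
  have a1 := abs_nonneg C1
  have a2 := abs_nonneg C2
  have hxx : x ^ 2 ≤ x := by nlinarith [hx.1]
  have fin : ∀ {q : ℝ}, |q| ≤ 1 + |C0| + |C1| + |C2| →
      |x ^ 2 * q| ≤ (1 + |C0| + |C1| + |C2|) * x := fun {q} hq => by
    rw [abs_mul, abs_of_nonneg (sq_nonneg x), mul_comm]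
    exact mul_le_mul hq hxx (sq_nonneg x) (by positivity)
  refine ⟨?_, ?_, ?_⟩
  · rw [hK ((t, x), θ) hxA, add_sub_cancel_left]
    exact fin ((abs_add_le _ _).trans (by linarith))
  · rw [hdK ((t, x), θ) hxA]
    exact fin (by linarith)
  · rw [hddK ((t, x), θ) hxA]
    exact fin (by linarith)

/-- Estimates for the coefficients of the equation, for `0 < x < b`. -/
structure CoefBounds (g : TensorField n) (b C : ℝ) : Prop where
  pos : 0 < b
  const_pos : 0 < C
  det_ne : ∀ p : Pt n, p.1.2 ∈ Ioo 0 b → (Matrix.of (scaledMetric g p)).det ≠ 0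
  smooth : ∀ c, SmoothOver {y : ℝ × ℝ | y.2 ∈ Ioo 0 b} (coef g c)
  dist_le : ∀ c (t x : ℝ) (θ : Sph n), x ∈ Ioo 0 b →
    |coef g c ((t, x), θ) - coefFun (flatMetric n) c| ≤ C * x
  deriv_le : ∀ c (t x : ℝ) (θ : Sph n), x ∈ Ioo 0 b → |dT (coef g c) ((t, x), θ)| ≤ C * x
  lipschitz : ∀ c (t s x : ℝ) (θ : Sph n), x ∈ Ioo 0 b →
    |dT (coef g c) ((t, x), θ) - dT (coef g c) ((s, x), θ)| ≤ C * |t - s|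

lemma smoothOver_coef {b : ℝ} {g : TensorField n}
    (hs : ∀ i j, SmoothOver {y : ℝ × ℝ | y.2 ∈ Ioo 0 b} fun p => scaledMetric g p i j)
    (hd : ∀ p : Pt n, p.1.2 ∈ Ioo 0 b → (Matrix.of (scaledMetric g p)).det ≠ 0)
    (c : Option (Idx n × Idx n)) : SmoothOver {y : ℝ × ℝ | y.2 ∈ Ioo 0 b} (coef g c) := by
  have h : ContDiff ℝ ∞ fun l : Idx n × Idx n → ℝ => fun i j => l (i, j) := by fun_prop
  exact SmoothOver.comp_pi (Q := fun (ij : Idx n × Idx n) p => scaledMetric g p ij.1 ij.2)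
    (Φ := fun l => coefFun (fun i j => l (i, j)) c) (fun ij => hs ij.1 ij.2) fun p hp =>
    contDiffAt_pi.1 (ContDiffAt.comp (g := coefFun)
      (fun ij : Idx n × Idx n => scaledMetric g p ij.1 ij.2)
      (contDiffAt_coefFun (hd p hp)) h.contDiffAt) c

/-- Near the nondegenerate flat matrix the coefficients are smooth functions of the rescaled metric,
so the bounds for the metric and two time derivatives are transported by the chain rule
(`curve_bounds`). -/
lemma IsAAdSPatch.exists_coefBounds {A : ℝ} (hA : 0 < A) {g : TensorField n}
    (hg : IsAAdSPatch n A g) : ∃ b C, b ≤ A ∧ b ≤ 1 ∧ CoefBounds g b C := by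
  have hd0 : (Matrix.of (flatMetric n)).det ≠ 0 := by rw [det_flatMetric]; norm_num
  obtain ⟨r, hr, C, hC, hC1, hC2⟩ :=
    exists_fderiv_bounds (mod_cast contDiffAt_infty.1 (contDiffAt_coefFun hd0) 2)
  have hdc : Continuous fun k : Idx n → Idx n → ℝ => (Matrix.of k).det :=
    (contDiff_det contDiff_entry).continuous
  obtain ⟨r', hr', hr'd⟩ := Metric.eventually_nhds_iff_ball.1 (hdc.continuousAt.eventually_ne hd0)
  choose D hD using hg.eventually_scaledMetric hA
  set D' : ℝ := ∑ i, ∑ j, |D i j| with hD'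
  have hD'0 : 0 ≤ D' := Finset.sum_nonneg fun i _ => Finset.sum_nonneg fun j _ => abs_nonneg _
  have hDle : ∀ i j, D i j ≤ D' := fun i j => (le_abs_self _).trans
    ((Finset.single_le_sum (f := fun j => |D i j|) (fun _ _ => abs_nonneg _)
      (Finset.mem_univ j)).trans
    (Finset.single_le_sum (f := fun i => ∑ j, |D i j|)
      (fun _ _ => Finset.sum_nonneg fun _ _ => abs_nonneg _) (Finset.mem_univ i)))
  have hev := eventually_all.2 fun i => eventually_all.2 fun j => hD i j
  obtain ⟨b, hb, hbev⟩ := mem_nhdsGT_iff_exists_Ioo_subset.1 hev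
  have hb : 0 < b := hb
  -- For `x < b'` the metric stays in the balls where `coefFun` has controlled derivatives (radius
  -- `r`) and where the determinant is nonzero (radius `r'`). The bound `1` allows powers of `x` to
  -- be dropped.
  set b' : ℝ := min (min b (min A 1)) (min r r' / (D' + 1)) with hb'
  have hb'0 : 0 < b' := by positivity
  have hb'b : b' ≤ b := (min_le_left _ _).trans (min_le_left _ _)
  have hb'A : b' ≤ A := (min_le_left _ _).trans ((min_le_right _ _).trans (min_le_left _ _))
  have hb'1 : b' ≤ 1 := (min_le_left _ _).trans ((min_le_right _ _).trans (min_le_right _ _))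
  have hb'r : (D' + 1) * b' ≤ min r r' := by
    have := min_le_right (min b (min A 1)) (min r r' / (D' + 1))
    rw [mul_comm]
    exact (le_div_iff₀ (by positivity)).1 this
  have hs : ∀ i j, SmoothOver {y : ℝ × ℝ | y.2 ∈ Ioo 0 b'} fun p => scaledMetric g p i j :=
    fun i j => (hg.smooth_scaledMetric i j).mono fun y hy => ⟨hy.1, hy.2.trans_le hb'A⟩
  have hlt : ∀ x ∈ Ioo 0 b', D' * x < min r r' := fun x hx => by
    have : D' * x ≤ D' * b' := mul_le_mul_of_nonneg_left hx.2.le hD'0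
    linarith
  have hpi : ∀ {x : ℝ}, x ∈ Ioo 0 b' → ∀ {m : Idx n → Idx n → ℝ}, (∀ i j, |m i j| ≤ D i j * x) →
      ‖m‖ ≤ D' * x := fun {x} hx {m} hm => by
    have h0 : 0 ≤ D' * x := mul_nonneg hD'0 hx.1.le
    refine (pi_norm_le_iff_of_nonneg h0).2 fun i => (pi_norm_le_iff_of_nonneg h0).2 fun j => ?_
    exact (hm i j).trans (mul_le_mul_of_nonneg_right (hDle i j) hx.1.le)
  have e0 : ∀ {x : ℝ}, x ∈ Ioo 0 b' → ∀ t θ,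
      ‖scaledMetric g ((t, x), θ) - flatMetric n‖ ≤ D' * x := fun {x} hx t θ =>
    hpi hx fun i j => (hbev ⟨hx.1, hx.2.trans_le hb'b⟩ i j t θ).1
  have hdet : ∀ p : Pt n, p.1.2 ∈ Ioo 0 b' → (Matrix.of (scaledMetric g p)).det ≠ 0 :=
    fun p hp => hr'd _ (by
      rw [Metric.mem_ball, dist_eq_norm]
      exact (e0 hp p.1.1 p.2).trans_lt ((hlt _ hp).trans_le (min_le_right _ _)))
  have main : ∀ (x : ℝ) (θ : Sph n), x ∈ Ioo 0 b' → ∀ t,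
      ‖coefFun (scaledMetric g ((t, x), θ)) - coefFun (flatMetric n)‖ ≤ C * (D' * x) ∧
      ∃ f : ℝ → Option (Idx n × Idx n) → ℝ,
        (∀ t, HasDerivAt (fun s => coefFun (scaledMetric g ((s, x), θ))) (f t) t) ∧
        ‖f t‖ ≤ C * (D' * x) ∧
        ∀ s, ‖f t - f s‖ ≤ (C * (D' * x) * (D' * x) + C * (D' * x)) * |t - s| := by
    intro x θ hx t
    have key := curve_bounds (Φ := coefFun) (k₀ := flatMetric n) hC hC1 hC2
      (κ := fun t => scaledMetric g ((t, x), θ))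
      (κ' := fun t i j => dT (fun p => scaledMetric g p i j) ((t, x), θ))
      (κ'' := fun t i j => dT (dT fun p => scaledMetric g p i j) ((t, x), θ))
      (c := D' * x)
      (fun t => hasDerivAt_pi.2 fun i => hasDerivAt_pi.2 fun j => (hs i j).hasDerivAt_dT t hx θ)
      (fun t => hasDerivAt_pi.2 fun i => hasDerivAt_pi.2 fun j =>
        (hs i j).dT.hasDerivAt_dT t hx θ)
      ((hlt x hx).trans_le (min_le_left _ _)) (fun t => e0 hx t θ)
      (fun t => hpi hx fun i j => (hbev ⟨hx.1, hx.2.trans_le hb'b⟩ i j t θ).2.1)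
      (fun t => hpi hx fun i j => (hbev ⟨hx.1, hx.2.trans_le hb'b⟩ i j t θ).2.2)
    exact ⟨(key t).1, _, fun t => (key t).2.1, (key t).2.2.1, (key t).2.2.2⟩
  have hdT : ∀ (c) (x : ℝ) (θ : Sph n) (f : ℝ → Option (Idx n × Idx n) → ℝ),
      (∀ t, HasDerivAt (fun s => coefFun (scaledMetric g ((s, x), θ))) (f t) t) →
      ∀ t, dT (coef g c) ((t, x), θ) = f t c := fun c x θ f hf t =>
    (hasDerivAt_pi.1 (hf t) c).deriv
  have hCD : C * D' ≤ C * D' * D' + C * D' + 1 := by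
    have : 0 ≤ C * D' * D' := by positivity
    linarith
  have hle : ∀ x ∈ Ioo 0 b', C * (D' * x) ≤ (C * D' * D' + C * D' + 1) * x := fun x hx => by
    rw [← mul_assoc]
    exact mul_le_mul_of_nonneg_right hCD hx.1.le
  refine ⟨b', C * D' * D' + C * D' + 1, hb'A, hb'1, hb'0, by positivity, hdet,
    smoothOver_coef hs hdet, fun c t x θ hx => ?_, fun c t x θ hx => ?_, fun c t s x θ hx => ?_⟩
  · exact (norm_le_pi_norm (coefFun (scaledMetric g ((t, x), θ)) - coefFun (flatMetric n)) c).trans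
      ((main x θ hx t).1.trans (hle x hx))
  · obtain ⟨f, hf, h1, -⟩ := (main x θ hx t).2
    rw [hdT c x θ f hf]
    exact (norm_le_pi_norm (f t) c).trans (h1.trans (hle x hx))
  · obtain ⟨f, hf, -, h2⟩ := (main x θ hx t).2
    rw [hdT c x θ f hf, hdT c x θ f hf]
    refine (norm_le_pi_norm (f t - f s) c).trans ((h2 s).trans ?_)
    refine mul_le_mul_of_nonneg_right ?_ (abs_nonneg _)
    have hx1 : x ≤ 1 := hx.2.le.trans hb'1
    have h3 : D' * x ≤ D' := mul_le_of_le_one_right hD'0 hx1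
    have h4 : 0 ≤ D' * x := mul_nonneg hD'0 hx.1.le
    have h5 : C * (D' * x) ≤ C * D' := mul_le_mul_of_nonneg_left h3 hC.le
    have h6 : C * (D' * x) * (D' * x) ≤ C * D' * D' :=
      mul_le_mul h5 h3 h4 (by positivity)
    linarith

end AAdS

namespace AAdS

open scoped InnerProduct

/-! ### The inverse metric and the volume in terms of the coefficients -/

section Rescale

variable {m : Type*} [Fintype m] [DecidableEq m] {G : Matrix m m ℝ} {ν : m → ℝ}

lemma vecMulVec_self_mul_self {m : Type*} [Fintype m] {ν : m → ℝ} (hν : ν ⬝ᵥ ν = 1) :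
    vecMulVec ν ν * vecMulVec ν ν = vecMulVec ν ν := by
  rw [vecMulVec_mul_vecMulVec, hν, one_smul]

/-- With `R = ν νᵀ`, the rescaled matrix factors as `(G + R) · x² (1 + (x⁻² - 1) R)`. The normal
direction is not rescaled, so the determinant picks up `N` factors `x²` and not `N + 1`. -/
lemma det_rescale (hν : ν ⬝ᵥ ν = 1) (hG : G *ᵥ ν = 0) {x : ℝ} (hx : x ≠ 0) {N : ℕ}
    (hN : Fintype.card m = N + 1) :
    (x ^ 2 • G + vecMulVec ν ν).det = (x ^ N) ^ 2 * (G + vecMulVec ν ν).det := by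
  have hGR : G * vecMulVec ν ν = 0 := by rw [mul_vecMulVec, hG, zero_vecMulVec]
  have e : x ^ 2 • G + vecMulVec ν ν =
      (G + vecMulVec ν ν) * (x ^ 2 • (1 + vecMulVec (((x ^ 2)⁻¹ - 1) • ν) ν)) := by
    rw [smul_vecMulVec, Matrix.mul_smul, mul_add, mul_one, Matrix.mul_smul, add_mul, hGR,
      vecMulVec_self_mul_self hν, zero_add, smul_add, smul_add, smul_smul, add_assoc, ← add_smul]
    have : x ^ 2 + x ^ 2 * ((x ^ 2)⁻¹ - 1) = 1 := by field_simp; ring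
    rw [this, one_smul]
  rw [e, det_mul, det_smul, vecMulVec_eq Unit (((x ^ 2)⁻¹ - 1) • ν), det_one_add_replicateCol_mul_replicateRow,
    dotProduct_smul, hν, hN]
  simp only [smul_eq_mul, mul_one]
  have : x ^ 2 * (1 + ((x ^ 2)⁻¹ - 1)) = 1 := by field_simp; ring
  calc (G + vecMulVec ν ν).det * ((x ^ 2) ^ (N + 1) * (1 + ((x ^ 2)⁻¹ - 1)))
      = (G + vecMulVec ν ν).det * (x ^ 2) ^ N * (x ^ 2 * (1 + ((x ^ 2)⁻¹ - 1))) := by ring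
    _ = _ := by rw [this]; ring

/-- The two inverses differ, apart from the factor `x²`, only by a multiple of the normal
projection, which annihilates tangential covectors. -/
lemma inv_rescale (hν : ν ⬝ᵥ ν = 1) (hG : G *ᵥ ν = 0) (hsymm : G.IsSymm) {x : ℝ}
    (hd : (x ^ 2 • G + vecMulVec ν ν).det ≠ 0) :
    (G + vecMulVec ν ν)⁻¹ =
      x ^ 2 • (x ^ 2 • G + vecMulVec ν ν)⁻¹ - (x ^ 2 - 1) • vecMulVec ν ν := by
  have hGR : G * vecMulVec ν ν = 0 := by rw [mul_vecMulVec, hG, zero_vecMulVec]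
  have hRG : vecMulVec ν ν * G = 0 := by
    rw [vecMulVec_mul, ← mulVec_transpose, hsymm.eq, hG, vecMulVec_zero]
  have hRR := vecMulVec_self_mul_self hν
  set R := vecMulVec ν ν
  set K := x ^ 2 • G + R with hK
  have hu : IsUnit K.det := isUnit_iff_ne_zero.2 hd
  have hRK : R * K⁻¹ = R := by
    have : R * K = R := by rw [hK, mul_add, Matrix.mul_smul, hRG, hRR, smul_zero, zero_add]
    calc R * K⁻¹ = R * K * K⁻¹ := by rw [this]
      _ = R := by rw [mul_assoc, Matrix.mul_nonsing_inv _ hu, mul_one]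
  have hF : (G + R) * R = R := by rw [add_mul, hGR, hRR, zero_add]
  have hxF : x ^ 2 • (G + R) = K + (x ^ 2 - 1) • R := by
    rw [hK, smul_add, sub_smul, one_smul]; abel
  refine Matrix.inv_eq_right_inv ?_
  rw [mul_sub, Matrix.mul_smul, Matrix.mul_smul, hF, ← Matrix.smul_mul, hxF, add_mul,
    Matrix.smul_mul, hRK, Matrix.mul_nonsing_inv _ hu]
  abel

end Rescale

variable {n : ℕ}

lemma normalVec_dotProduct_self (θ : Sph n) : normalVec θ ⬝ᵥ normalVec θ = 1 := by
  have h := norm_eq_of_mem_sphere θ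
  have h2 := EuclideanSpace.real_norm_sq_eq (θ : Euc n)
  rw [h] at h2
  simp only [dotProduct, normalVec, Fintype.sum_sum_type, Sum.elim_inl, Sum.elim_inr,
    Pi.zero_apply, mul_zero, Finset.sum_const_zero, zero_add]
  refine Eq.trans ?_ (h2.symm.trans (one_pow 2))
  exact Finset.sum_congr rfl fun i _ => (sq _).symm

lemma of_scaledMetric (g : TensorField n) (p : Pt n) :
    Matrix.of (scaledMetric g p) =
      p.1.2 ^ 2 • g p + vecMulVec (normalVec p.2) (normalVec p.2) := by
  ext i j
  simp [scaledMetric, vecMulVec_apply]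

lemma fullMetric_eq (g : TensorField n) (p : Pt n) :
    fullMetric g p = g p + vecMulVec (normalVec p.2) (normalVec p.2) := rfl

variable {A : ℝ} {g : TensorField n}

lemma IsAAdSPatch.mulVec_normalVec (hg : IsAAdSPatch n A g) {p : Pt n} (hp : p.1.2 ∈ Ioo 0 A) :
    g p *ᵥ normalVec p.2 = 0 := by
  funext i
  have := hg.tangential p hp i
  simp only [mulVec, dotProduct, normalVec, Fintype.sum_sum_type, Sum.elim_inl, Sum.elim_inr,
    Pi.zero_apply, mul_zero, Finset.sum_const_zero, zero_add]
  exact this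

/-- The index set has `n + 1` elements, one more than the dimension of space-time, because of the
normal direction. -/
lemma IsAAdSPatch.volDensity_eq (hg : IsAAdSPatch n A g) (hn : 2 ≤ n) {p : Pt n} (hp : p.1.2 ∈ Ioo 0 A) :
    volDensity g p = coef g none p / p.1.2 ^ n := by
  have hx : 0 < p.1.2 := hp.1
  have hN : Fintype.card (Idx n) = n + 1 := by
    simp only [Idx, Fintype.card_sum, Fintype.card_fin]; omega
  have h1 := det_rescale (normalVec_dotProduct_self p.2) (hg.mulVec_normalVec hp) hx.ne' hN
  rw [volDensity, fullMetric_eq, coef, coefFun, of_scaledMetric, h1, abs_mul,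
    abs_of_nonneg (sq_nonneg (p.1.2 ^ n)), Real.sqrt_mul (sq_nonneg _), Real.sqrt_sq (by positivity)]
  field_simp

lemma IsAAdSPatch.coef_symm (hg : IsAAdSPatch n A g) {p : Pt n} (hp : p.1.2 ∈ Ioo 0 A) (i j : Idx n) :
    coef g (some (i, j)) p = coef g (some (j, i)) p := by
  have h1 : (Matrix.of (scaledMetric g p))ᵀ = Matrix.of (scaledMetric g p) := by
    ext i j
    simp only [transpose_apply, of_apply, scaledMetric, (hg.symm p hp).apply i j]
    ring
  have h2 := congrFun (congrFun (transpose_nonsing_inv (Matrix.of (scaledMetric g p))) i) j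
  rw [h1, transpose_apply] at h2
  simp only [coef, coefFun, h2]

/-- Only one of the two covectors has to be tangential, since this already removes the normal term
of `inv_rescale`. In the application it is the differential of the test function. -/
lemma IsAAdSPatch.invMetric_mul_volDensity (hg : IsAAdSPatch n A g) (hn : 2 ≤ n) {p : Pt n}
    (hp : p.1.2 ∈ Ioo 0 A)
    (hd : (Matrix.of (scaledMetric g p)).det ≠ 0) (ξ : Idx n → ℝ) {η : Idx n → ℝ}
    (hη : normalVec p.2 ⬝ᵥ η = 0) :
    invMetric g p ξ η * volDensity g p =
      p.1.2 ^ 2 / p.1.2 ^ n * ∑ i, ∑ j, coef g (some (i, j)) p * ξ i * η j := by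
  have hx : 0 < p.1.2 := hp.1
  have hinv := inv_rescale (normalVec_dotProduct_self p.2) (hg.mulVec_normalVec hp) (hg.symm p hp)
    (by rwa [of_scaledMetric] at hd)
  have hR : vecMulVec (normalVec p.2) (normalVec p.2) *ᵥ η = 0 := by
    rw [vecMulVec_mulVec, hη]; simp
  rw [invMetric, fullMetric_eq, hinv, sub_mulVec, smul_mulVec, smul_mulVec, hR, smul_zero, sub_zero,
    ← of_scaledMetric, hg.volDensity_eq hn hp, dotProduct_smul]
  simp only [dotProduct, mulVec, smul_eq_mul, coef, coefFun, Finset.mul_sum, Finset.sum_mul]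
  refine Finset.sum_congr rfl fun i _ => ?_
  refine Finset.sum_congr rfl fun j _ => ?_
  ring

lemma IsAAdSPatch.invTT_mul_volDensity (hg : IsAAdSPatch n A g) (hn : 2 ≤ n) {p : Pt n}
    (hp : p.1.2 ∈ Ioo 0 A)
    (hd : (Matrix.of (scaledMetric g p)).det ≠ 0) :
    invTT g p * volDensity g p = p.1.2 ^ 2 / p.1.2 ^ n * coef g (some (iT n, iT n)) p := by
  have h := hg.invMetric_mul_volDensity hn hp hd (Pi.single (iT n) 1) (η := Pi.single (iT n) 1)
    (by simp [normalVec])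
  have e : invMetric g p (Pi.single (iT n) 1) (Pi.single (iT n) 1) = invTT g p := by
    simp [invMetric, invTT]
  rw [e] at h
  rw [h]
  simp [Pi.single_apply]

end AAdS

namespace AAdS

open scoped InnerProduct

/-! ### Forms on the Sobolev space -/

lemma hasDerivAt_const_comp_comp_const {𝕜 E F G K : Type*} [NontriviallyNormedField 𝕜]
    [NormedAddCommGroup E] [NormedSpace 𝕜 E] [NormedAddCommGroup F] [NormedSpace 𝕜 F]
    [NormedAddCommGroup G] [NormedSpace 𝕜 G] [NormedAddCommGroup K] [NormedSpace 𝕜 K]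
    {X : 𝕜 → F →L[𝕜] G} {X' : F →L[𝕜] G} {t : 𝕜} (h : HasDerivAt X X' t) (P : G →L[𝕜] K)
    (Q : E →L[𝕜] F) : HasDerivAt (fun s => P ∘L X s ∘L Q) (P ∘L X' ∘L Q) t := by
  have := (hasDerivAt_const t P).clm_comp (h.clm_comp (hasDerivAt_const t Q))
  simpa using this

section Forms

variable {ι V H : Type*} [Fintype ι] [NormedAddCommGroup V] [InnerProductSpace ℝ V]
    [NormedAddCommGroup H] [InnerProductSpace ℝ H]

/-- The operator of a first order form with the coefficients `-X`. -/
def rowOp (J : ι → V →L[ℝ] H) (i : ι) (X : Option (ι × ι) → H →L[ℝ] H) : V →L[ℝ] H :=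
  -∑ j : ι, X (some (i, j)) ∘L J j

lemma inner_rowOp (J : ι → V →L[ℝ] H) (i : ι) (X : Option (ι × ι) → H →L[ℝ] H)
    (v : V) (f : H) : inner ℝ (rowOp J i X v) f = -∑ j, inner ℝ (X (some (i, j)) (J j v)) f := by
  simp only [rowOp, _root_.neg_apply, _root_.sum_apply, ContinuousLinearMap.comp_apply, sum_inner,
    inner_neg_left]

lemma norm_rowOp_le {J : ι → V →L[ℝ] H} (i : ι) {X : Option (ι × ι) → H →L[ℝ] H} {R G : ℝ}
    (hX : ∀ c, ‖X c‖ ≤ R) (hJ : ∀ i, ‖J i‖ ≤ G) :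
    ‖rowOp J i X‖ ≤ Fintype.card ι * (R * G) := by
  rw [rowOp, norm_neg]
  refine (norm_sum_le _ _).trans ((Finset.sum_le_sum fun j _ =>
    (ContinuousLinearMap.opNorm_comp_le _ _).trans
      (mul_le_mul (hX _) (hJ j) (norm_nonneg _) ((norm_nonneg _).trans (hX none)))).trans ?_)
  simp

lemma hasDerivAt_rowOp (J : ι → V →L[ℝ] H) (i : ι)
    {X : ℝ → Option (ι × ι) → H →L[ℝ] H} {X' : Option (ι × ι) → H →L[ℝ] H} {t : ℝ}
    (h : ∀ c, HasDerivAt (fun s => X s c) (X' c) t) :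
    HasDerivAt (fun s => rowOp J i (X s)) (rowOp J i X') t :=
  HasDerivAt.fun_neg (HasDerivAt.fun_sum fun j _ =>
    hasDerivAt_const_comp_comp_const (h (some (i, j))) (ContinuousLinearMap.id ℝ H) (J j))

lemma continuous_rowOp (J : ι → V →L[ℝ] H) (i : ι)
    {X : ℝ → Option (ι × ι) → H →L[ℝ] H} (h : ∀ c, Continuous fun s => X s c) :
    Continuous fun s => rowOp J i (X s) :=
  Continuous.neg (continuous_finsetSum _ fun j _ => (h (some (i, j))).clm_comp continuous_const)

variable [CompleteSpace V] [CompleteSpace H]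

/-- The operator of a second order form with the coefficients `X`. -/
def formOp (J : ι → V →L[ℝ] H) (P : V →L[ℝ] H) (μ : ℝ) (X : Option (ι × ι) → H →L[ℝ] H) :
    V →L[ℝ] V :=
  (∑ ij : ι × ι, ((J ij.1)†) ∘L X (some ij) ∘L J ij.2) + μ • ((P†) ∘L X none ∘L P)

lemma inner_formOp (J : ι → V →L[ℝ] H) (P : V →L[ℝ] H) (μ : ℝ) (X : Option (ι × ι) → H →L[ℝ] H)
    (v w : V) : inner ℝ (formOp J P μ X v) w =
      (∑ i, ∑ j, inner ℝ (X (some (i, j)) (J j v)) (J i w)) + μ * inner ℝ (X none (P v)) (P w) := by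
  simp only [formOp, _root_.add_apply, _root_.sum_apply, ContinuousLinearMap.comp_apply,
    inner_add_left, sum_inner, ContinuousLinearMap.adjoint_inner_left, _root_.smul_apply,
    real_inner_smul_left, Fintype.sum_prod_type]

lemma norm_formOp_le {J : ι → V →L[ℝ] H} {P : V →L[ℝ] H} (μ : ℝ) {X : Option (ι × ι) → H →L[ℝ] H}
    {R G K : ℝ} (hX : ∀ c, ‖X c‖ ≤ R) (hJ : ∀ i, ‖J i‖ ≤ G) (hG : 0 ≤ G) (hP : ‖P‖ ≤ K) :
    ‖formOp J P μ X‖ ≤ (Fintype.card (ι × ι) * (G * G) + |μ| * (K * K)) * R := by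
  have hR : 0 ≤ R := (norm_nonneg _).trans (hX none)
  have hK : 0 ≤ K := (norm_nonneg _).trans hP
  have h3 : ∀ {Y Z : V →L[ℝ] H} {c L : ℝ}, ‖Y‖ ≤ L → ‖Z‖ ≤ L → 0 ≤ L → ∀ d,
      ‖(Y†) ∘L X d ∘L Z‖ ≤ L * (R * L) := fun {Y Z c L} hY hZ hL d =>
    (ContinuousLinearMap.opNorm_comp_le _ _).trans (mul_le_mul
      (by rw [LinearIsometryEquiv.norm_map]; exact hY)
      ((ContinuousLinearMap.opNorm_comp_le _ _).trans
        (mul_le_mul (hX _) hZ (norm_nonneg _) hR)) (norm_nonneg _) hL)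
  have h1 : ‖∑ ij : ι × ι, ((J ij.1)†) ∘L X (some ij) ∘L J ij.2‖ ≤
      Fintype.card (ι × ι) * (G * (R * G)) := by
    refine (norm_sum_le _ _).trans ((Finset.sum_le_sum fun ij _ =>
      h3 (c := 0) (hJ ij.1) (hJ ij.2) hG (some ij)).trans ?_)
    simp
  have h2 : ‖μ • ((P†) ∘L X none ∘L P)‖ ≤ |μ| * (K * (R * K)) := by
    rw [norm_smul, Real.norm_eq_abs]
    exact mul_le_mul_of_nonneg_left (h3 (c := 0) hP hP hK none) (abs_nonneg _)
  refine (norm_add_le _ _).trans ((add_le_add h1 h2).trans (le_of_eq ?_))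
  ring

lemma hasDerivAt_formOp (J : ι → V →L[ℝ] H) (P : V →L[ℝ] H) (μ : ℝ)
    {X : ℝ → Option (ι × ι) → H →L[ℝ] H} {X' : Option (ι × ι) → H →L[ℝ] H} {t : ℝ}
    (h : ∀ c, HasDerivAt (fun s => X s c) (X' c) t) :
    HasDerivAt (fun s => formOp J P μ (X s)) (formOp J P μ X') t :=
  HasDerivAt.fun_add (HasDerivAt.fun_sum fun ij _ =>
    hasDerivAt_const_comp_comp_const (h (some ij)) ((J ij.1)†) (J ij.2))
    ((hasDerivAt_const_comp_comp_const (h none) (P†) P).fun_const_smul μ)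

lemma continuous_formOp (J : ι → V →L[ℝ] H) (P : V →L[ℝ] H) (μ : ℝ)
    {X : ℝ → Option (ι × ι) → H →L[ℝ] H} (h : ∀ c, Continuous fun s => X s c) :
    Continuous fun s => formOp J P μ (X s) :=
  Continuous.add (continuous_finsetSum _ fun ij _ => continuous_const.clm_comp
    ((h (some ij)).clm_comp continuous_const))
      ((continuous_const.clm_comp ((h none).clm_comp continuous_const)).const_smul μ)

lemma inner_formOp_sub (J : ι → V →L[ℝ] H) (P : V →L[ℝ] H) (μ : ℝ)
    (X Y : Option (ι × ι) → H →L[ℝ] H) (v w : V) :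
    inner ℝ (formOp J P μ (fun c => X c - Y c) v) w =
      inner ℝ (formOp J P μ X v) w - inner ℝ (formOp J P μ Y v) w := by
  simp only [inner_formOp, _root_.sub_apply, inner_sub_left, Finset.sum_sub_distrib]
  ring

/-- Constant coefficients. -/
def constCoef (H : Type*) [NormedAddCommGroup H] [InnerProductSpace ℝ H] {κ : Type*} (k : κ → ℝ)
    (c : κ) : H →L[ℝ] H := k c • ContinuousLinearMap.id ℝ H

lemma inner_formOp_constCoef (J : ι → V →L[ℝ] H) (P : V →L[ℝ] H) (μ : ℝ)
    (k : Option (ι × ι) → ℝ) (v : V) :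
    inner ℝ (formOp J P μ (constCoef H k) v) v =
      (∑ i, ∑ j, k (some (i, j)) * inner ℝ (J j v) (J i v)) + μ * (k none * ‖P v‖ ^ 2) := by
  simp only [inner_formOp, constCoef, _root_.smul_apply, ContinuousLinearMap.id_apply,
    real_inner_smul_left, real_inner_self_eq_norm_sq]

/-- A bound for the operators of forms. -/
def formConst (ι : Type*) [Fintype ι] (μ G K : ℝ) : ℝ :=
  1 + (Fintype.card (ι × ι) * (G * G) + |μ| * (K * K)) + Fintype.card ι * G

lemma formConst_ge (ι : Type*) [Fintype ι] (μ : ℝ) {G K : ℝ} (hG : 0 ≤ G) (hK : 0 ≤ K) :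
    1 ≤ formConst ι μ G K ∧
      Fintype.card (ι × ι) * (G * G) + |μ| * (K * K) ≤ formConst ι μ G K ∧
      Fintype.card ι * G ≤ formConst ι μ G K := by
  have h1 : 0 ≤ Fintype.card (ι × ι) * (G * G) + |μ| * (K * K) := by positivity
  have h2 : 0 ≤ Fintype.card ι * G := by positivity
  unfold formConst
  refine ⟨?_, ?_, ?_⟩ <;> linarith

/-- The data of a wave equation whose coefficients are close to constant ones. -/
structure FormData (ι V H : Type*) [Fintype ι] [NormedAddCommGroup V] [InnerProductSpace ℝ V]
    [NormedAddCommGroup H] [InnerProductSpace ℝ H] where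
  /-- The map from `V` to `H`. -/
  emb : V →L[ℝ] H
  /-- The gradient. -/
  J : ι → V →L[ℝ] H
  /-- The singular multiple of the embedding. -/
  P : V →L[ℝ] H
  /-- The mass parameter. -/
  μ : ℝ
  /-- The index of time. -/
  time : ι
  /-- The coefficients. -/
  X : ℝ → Option (ι × ι) → H →L[ℝ] H
  /-- Their time derivatives. -/
  X' : ℝ → Option (ι × ι) → H →L[ℝ] H
  /-- The constant coefficients. -/
  k : Option (ι × ι) → ℝ
  /-- The bound for the gradient. -/
  G : ℝ
  /-- The bound for the singular multiple of the embedding. -/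
  K : ℝ
  /-- The lower bound for the energy. -/
  L : ℝ
  /-- The size of the perturbation. -/
  ε : ℝ
  dense : DenseRange emb
  hasDerivAt : ∀ c t, HasDerivAt (fun s => X s c) (X' t c) t
  continuous : ∀ c, Continuous fun s => X' s c
  symm : ∀ t c x y, inner ℝ (X t c x) y = inner ℝ x (X t c y)
  swap : ∀ t i j, X t (some (i, j)) = X t (some (j, i))
  norm_J : ∀ i, ‖J i‖ ≤ G
  norm_P : ‖P‖ ≤ K
  nonneg_G : 0 ≤ G
  k_time : k (some (time, time)) = -1
  abs_k : ∀ c, |k c| ≤ 1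
  norm_sub : ∀ t c, ‖X t c - constCoef H k c‖ ≤ ε
  norm_deriv : ∀ t c, ‖X' t c‖ ≤ ε
  L_pos : 0 < L
  L_le : L ≤ 1 / 2
  small : formConst ι μ G K * ε ≤ L
  coercive : ∀ v, 2 * L * ‖v‖ ^ 2 ≤
    (∑ i, ∑ j, k (some (i, j)) * inner ℝ (J j v) (J i v)) + μ * (k none * ‖P v‖ ^ 2)

namespace FormData

variable (D : FormData ι V H)

lemma nonneg_K : 0 ≤ D.K := (norm_nonneg _).trans D.norm_P

lemma nonneg_eps : 0 ≤ D.ε := (norm_nonneg _).trans (D.norm_deriv 0 none)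

lemma const_ge : 1 ≤ formConst ι D.μ D.G D.K ∧
    Fintype.card (ι × ι) * (D.G * D.G) + |D.μ| * (D.K * D.K) ≤ formConst ι D.μ D.G D.K ∧
    Fintype.card ι * D.G ≤ formConst ι D.μ D.G D.K :=
  formConst_ge ι D.μ D.nonneg_G D.nonneg_K

lemma eps_le : D.ε ≤ 1 / 2 :=
  (le_mul_of_one_le_left D.nonneg_eps D.const_ge.1).trans (D.small.trans D.L_le)

lemma norm_X_le (t : ℝ) (c : Option (ι × ι)) : ‖D.X t c‖ ≤ 2 := by
  have h1 := norm_add_le (constCoef H D.k c) (D.X t c - constCoef H D.k c)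
  have h2 : ‖constCoef H D.k c‖ ≤ 1 := by
    rw [constCoef, norm_smul, Real.norm_eq_abs]
    exact mul_le_one₀ (D.abs_k c) (norm_nonneg _) ContinuousLinearMap.norm_id_le
  rw [add_sub_cancel] at h1
  linarith [D.norm_sub t c, D.eps_le]

/-- The flat mass is the identity, and the perturbation is at most `1/2`. -/
lemma lower_time (t : ℝ) (x : H) :
    D.L * ‖x‖ ^ 2 ≤ inner ℝ ((-D.X t (some (D.time, D.time))) x) x := by
  have h1 := abs_inner_clm_le _ (D.norm_sub t (some (D.time, D.time))) x x
  have h2 : inner ℝ (constCoef H D.k (some (D.time, D.time)) x) x = -‖x‖ ^ 2 := by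
    rw [constCoef, D.k_time, _root_.smul_apply, ContinuousLinearMap.id_apply,
      real_inner_smul_left, real_inner_self_eq_norm_sq]
    ring
  rw [_root_.sub_apply, inner_sub_left, h2] at h1
  rw [_root_.neg_apply, inner_neg_left]
  have h3 := (abs_le.1 h1).2
  have h4 := mul_le_mul_of_nonneg_right D.eps_le (sq_nonneg ‖x‖)
  have h5 := mul_le_mul_of_nonneg_right D.L_le (sq_nonneg ‖x‖)
  nlinarith

/-- The flat form has the lower bound `2 L`, of which the smallness condition lets the perturbation
consume at most `L`. -/
lemma lower_form (t : ℝ) (v : V) :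
    D.L * ‖v‖ ^ 2 ≤ inner ℝ (formOp D.J D.P D.μ (D.X t) v) v := by
  have h1 := abs_inner_clm_le _ (norm_formOp_le D.μ (D.norm_sub t) D.norm_J D.nonneg_G D.norm_P) v v
  rw [inner_formOp_sub, inner_formOp_constCoef] at h1
  have h2 := D.coercive v
  have h3 := (abs_le.1 h1).1
  have h4 := (mul_le_mul_of_nonneg_right D.const_ge.2.1 D.nonneg_eps).trans D.small
  have h5 := mul_le_mul_of_nonneg_right h4 (sq_nonneg ‖v‖)
  nlinarith

/-- The abstract wave equation with the given coefficients. -/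
def waveSystem : WaveSystem V H where
  ι := D.emb
  M t := -D.X t (some (D.time, D.time))
  M' t := -D.X' t (some (D.time, D.time))
  B t := rowOp D.J D.time (D.X t)
  B' t := rowOp D.J D.time (D.X' t)
  A t := formOp D.J D.P D.μ (D.X t)
  A' t := formOp D.J D.P D.μ (D.X' t)
  lower := D.L
  upper := 2 * formConst ι D.μ D.G D.K
  rate := formConst ι D.μ D.G D.K * D.ε
  dense := D.dense
  hasDerivAt_M t := (D.hasDerivAt _ t).fun_neg
  hasDerivAt_B t := hasDerivAt_rowOp _ _ fun c => D.hasDerivAt c t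
  hasDerivAt_A t := hasDerivAt_formOp _ _ _ fun c => D.hasDerivAt c t
  continuous_M' := (D.continuous _).neg
  continuous_B' := continuous_rowOp _ _ D.continuous
  continuous_A' := continuous_formOp _ _ _ D.continuous
  symm_M t x y := by
    rw [_root_.neg_apply, _root_.neg_apply, inner_neg_left, inner_neg_right, D.symm]
  symm_A t x y := by
    rw [real_inner_comm (formOp D.J D.P D.μ (D.X t) y) x, inner_formOp, inner_formOp,
      Finset.sum_comm]
    congr 1
    · refine Finset.sum_congr rfl fun i _ => Finset.sum_congr rfl fun j _ => ?_
      rw [D.swap t j i, real_inner_comm, D.symm]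
    · rw [real_inner_comm, D.symm]
  lower_pos := D.L_pos
  upper_nonneg := by linarith [D.const_ge.1]
  rate_nonneg := mul_nonneg (by linarith [D.const_ge.1]) D.nonneg_eps
  lower_M := D.lower_time
  lower_A := D.lower_form
  upper_M t := by
    rw [norm_neg]
    linarith [D.norm_X_le t (some (D.time, D.time)), D.const_ge.1]
  upper_A t := by
    refine (norm_formOp_le D.μ (D.norm_X_le t) D.norm_J D.nonneg_G D.norm_P).trans ?_
    linarith [D.const_ge.2.1]
  rate_M t := by
    rw [norm_neg]
    exact (D.norm_deriv t _).trans (le_mul_of_one_le_left D.nonneg_eps D.const_ge.1)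
  rate_B t := by
    refine (norm_rowOp_le _ (D.norm_deriv t) D.norm_J).trans ?_
    rw [mul_comm D.ε, ← mul_assoc]
    exact mul_le_mul_of_nonneg_right D.const_ge.2.2 D.nonneg_eps
  rate_A t := (norm_formOp_le D.μ (D.norm_deriv t) D.norm_J D.nonneg_G D.norm_P).trans
    (mul_le_mul_of_nonneg_right D.const_ge.2.1 D.nonneg_eps)

end FormData

end Forms

/-! ### Bounds for the operators and coercivity of the flat energy on `𝐇¹₀` -/

variable {n : ℕ} {α β a : ℝ}

instance : CompleteSpace (H10 n α a) :=
  (Submodule.isClosed_topologicalClosure _).completeSpace_coe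

lemma norm_gradL_le (hα : 0 < α) (ha : 0 < a) (i : Idx n) :
    ‖gradL n α β ha i‖ ≤ 1 + |β - α| * α⁻¹ := by
  refine ContinuousLinearMap.opNorm_le_bound _ (by positivity) fun v => ?_
  have h1 := norm_twistOf_le v
  have h2 := norm_divL_le (n := n) hα ha v
  have h3 := norm_angularOf_le v
  have hp : 0 ≤ |β - α| * α⁻¹ * ‖v‖ := by positivity
  rcases i with i | i
  · fin_cases i
    · simp only [gradL, Sum.elim_inl, Fin.zero_eta, Matrix.cons_val_zero, _root_.zero_apply,
        norm_zero]
      positivity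
    · have e : gradL n α β ha (Sum.inl 1) v = twistOf v + (β - α) • divL n α ha v := rfl
      show ‖gradL n α β ha (Sum.inl 1) v‖ ≤ _
      rw [e]
      refine (norm_add_le _ _).trans ?_
      rw [norm_smul, Real.norm_eq_abs]
      have h4 : |β - α| * ‖divL n α ha v‖ ≤ |β - α| * (α⁻¹ * ‖v‖) := by
        gcongr
        exact h2.trans (by gcongr)
      linarith
  · have e : ‖gradL n α β ha (Sum.inr i) v‖ ^ 2 ≤ ‖angularOf v‖ ^ 2 := by
      rw [← sum_norm_sq_angComp]
      exact Finset.single_le_sum (f := fun i => ‖angComp i v‖ ^ 2) (fun _ _ => sq_nonneg _)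
        (Finset.mem_univ i)
    have := abs_le_of_sq_le_sq' e (norm_nonneg _)
    linarith [this.2]

lemma norm_divL (hα : 0 < α) (ha : 0 < a) : ‖divL n α ha‖ ≤ α⁻¹ :=
  ContinuousLinearMap.opNorm_le_bound _ (by positivity) fun v =>
    (norm_divL_le hα ha v).trans (by gcongr; exact norm_twistOf_le v)

lemma abs_coefFun_flatMetric_le (c : Option (Idx n × Idx n)) :
    |coefFun (flatMetric n) c| ≤ 1 := by
  rw [coefFun_flatMetric]
  rcases c with - | ⟨i, j⟩
  · simp
  · simp only [Option.elim_some, flatMetric]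
    split_ifs <;> simp

/-- Expanding `‖𝐃_x v + (β-α) v/x‖²` with `⟨𝐃_x v, v/x⟩ = α ‖v/x‖²` produces `(β² - α²) ‖v/x‖²`,
which cancels the mass term `μ ‖v/x‖²` exactly. The possibly negative mass thus leaves no trace. -/
lemma form_flatMetric (hα : 0 < α) {μ : ℝ} (hμ : α ^ 2 = β ^ 2 + μ) (ha : 0 < a)
    (v : H10 n α a) : (∑ i, ∑ j, coefFun (flatMetric n) (some (i, j)) *
        inner ℝ (gradL n α β ha j v) (gradL n α β ha i v)) +
      μ * (coefFun (flatMetric n) none * ‖divL n α ha v‖ ^ 2) =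
      ‖twistOf v‖ ^ 2 + ‖angularOf v‖ ^ 2 := by
  have hdiag : ∀ i : Idx n, ∑ j, coefFun (flatMetric n) (some (i, j)) *
      inner ℝ (gradL n α β ha j v) (gradL n α β ha i v) =
      flatMetric n i i * ‖gradL n α β ha i v‖ ^ 2 := fun i => by
    rw [Finset.sum_eq_single i]
    · rw [coefFun_flatMetric, real_inner_self_eq_norm_sq]
      rfl
    · intro j _ hj
      simp [coefFun_flatMetric, flatMetric, hj.symm]
    · simp
  have e0 : gradL n α β ha (Sum.inl 0) v = 0 := rfl
  have e1 : gradL n α β ha (Sum.inl 1) v = twistOf v + (β - α) • divL n α ha v := rfl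
  have e2 : ∀ i, gradL n α β ha (Sum.inr i) v = angComp i v := fun i => rfl
  have h3 := inner_twistOf_divL hα ha v
  have h4 : coefFun (flatMetric n) none = 1 := by rw [coefFun_flatMetric]; rfl
  rw [Finset.sum_congr rfl fun i _ => hdiag i, Fintype.sum_sum_type,
    Fin.sum_univ_two, e0, e1, h4, norm_add_sq_real, inner_smul_right, h3, norm_smul,
    Real.norm_eq_abs, mul_pow, sq_abs, ← sum_norm_sq_angComp]
  simp only [e2, flatMetric]
  simp
  linear_combination (-‖divL n α ha v‖ ^ 2) * hμ

/-- The missing term `‖v‖²` is controlled by the Hardy inequality; for `a ≤ 1` the constant is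
independent of `a`. -/
lemma norm_sq_le_energy (hα : 0 < α) (ha : 0 < a) (ha1 : a ≤ 1) (v : H10 n α a) :
    (1 + (α⁻¹) ^ 2)⁻¹ * ‖v‖ ^ 2 ≤ ‖twistOf v‖ ^ 2 + ‖angularOf v‖ ^ 2 := by
  rw [inv_mul_le_iff₀ (by positivity), norm_sq_H10]
  have h1 : ‖fnOf v‖ ≤ α⁻¹ * ‖twistOf v‖ := (norm_fnOf_le_twistOf hα ha v).trans
    (mul_le_of_le_one_left (by positivity) ha1)
  have h2 : ‖fnOf v‖ ^ 2 ≤ (α⁻¹ * ‖twistOf v‖) ^ 2 := pow_le_pow_left₀ (norm_nonneg _) h1 2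
  have h3 : 0 ≤ (α⁻¹) ^ 2 * ‖angularOf v‖ ^ 2 := by positivity
  linarith

end AAdS

namespace AAdS

open scoped InnerProduct

/-! ### The wave equation as an abstract system -/

variable {n : ℕ} {α β a b C : ℝ} {g : TensorField n}

lemma aestronglyMeasurable_slice {K : Pt n → ℝ} (hab : a ≤ b)
    (hK : SmoothOver {y : ℝ × ℝ | y.2 ∈ Ioo 0 b} K) (t : ℝ) :
    AEStronglyMeasurable (fun z : ℝ × Sph n => K ((t, z.1), z.2)) (sliceMeasure n a) := by
  have h1 : ContinuousOn (fun z : ℝ × Sph n => K ((t, z.1), z.2)) (Ioo 0 a ×ˢ univ) := by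
    refine hK.continuousOn.comp (f := fun z : ℝ × Sph n => ((t, z.1), z.2)) (by fun_prop)
      fun z hz => ⟨⟨hz.1.1, hz.1.2.trans_le hab⟩, mem_univ _⟩
  have h2 := h1.aestronglyMeasurable (μ := sliceMeasure n a)
    (measurableSet_Ioo.prod MeasurableSet.univ)
  rwa [Measure.restrict_eq_self_of_ae_mem] at h2
  filter_upwards [ae_slice_mem] with z hz
  exact ⟨hz, mem_univ _⟩

/-- The restriction of a coefficient to a time slice. -/
def sliceCoef (g : TensorField n) (c : Option (Idx n × Idx n)) (t : ℝ) (z : ℝ × Sph n) : ℝ :=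
  coef g c ((t, z.1), z.2)

/-- The time derivative of a coefficient on a time slice. -/
def sliceCoefDeriv (g : TensorField n) (c : Option (Idx n × Idx n)) (t : ℝ) (z : ℝ × Sph n) : ℝ :=
  dT (coef g c) ((t, z.1), z.2)

/-- Multiplication by a coefficient. -/
def coefOp (g : TensorField n) (a t : ℝ) (c : Option (Idx n × Idx n)) : L2 n a →L[ℝ] L2 n a :=
  mulOp (sliceMeasure n a) (sliceCoef g c t)

/-- Multiplication by the time derivative of a coefficient. -/
def coefOpDeriv (g : TensorField n) (a t : ℝ) (c : Option (Idx n × Idx n)) :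
    L2 n a →L[ℝ] L2 n a :=
  mulOp (sliceMeasure n a) (sliceCoefDeriv g c t)

lemma CoefBounds.ae_dist_le (hb : CoefBounds g b C) (hab : a ≤ b) (c : Option (Idx n × Idx n))
    (t : ℝ) : ∀ᵐ z ∂(sliceMeasure n a),
      |sliceCoef g c t z - coefFun (flatMetric n) c| ≤ C * a := by
  filter_upwards [ae_slice_mem] with z hz
  exact (hb.dist_le c t z.1 z.2 ⟨hz.1, hz.2.trans_le hab⟩).trans
    (mul_le_mul_of_nonneg_left hz.2.le hb.const_pos.le)

lemma CoefBounds.ae_deriv_le (hb : CoefBounds g b C) (hab : a ≤ b) (c : Option (Idx n × Idx n))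
    (t : ℝ) : ∀ᵐ z ∂(sliceMeasure n a), |sliceCoefDeriv g c t z| ≤ C * a := by
  filter_upwards [ae_slice_mem] with z hz
  exact (hb.deriv_le c t z.1 z.2 ⟨hz.1, hz.2.trans_le hab⟩).trans
    (mul_le_mul_of_nonneg_left hz.2.le hb.const_pos.le)

lemma CoefBounds.memLp (hb : CoefBounds g b C) (hab : a ≤ b) (c : Option (Idx n × Idx n))
    (t : ℝ) : MemLp (sliceCoef g c t) ∞ (sliceMeasure n a) := by
  refine memLp_top_of_bound (aestronglyMeasurable_slice hab (hb.smooth c) t) (C * a + 1) ?_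
  filter_upwards [hb.ae_dist_le hab c t] with z hz
  have h1 := abs_coefFun_flatMetric_le c
  have h2 := abs_add_le (sliceCoef g c t z - coefFun (flatMetric n) c) (coefFun (flatMetric n) c)
  rw [sub_add_cancel] at h2
  rw [Real.norm_eq_abs]
  linarith

lemma CoefBounds.memLp_deriv (hb : CoefBounds g b C) (hab : a ≤ b) (c : Option (Idx n × Idx n))
    (t : ℝ) : MemLp (sliceCoefDeriv g c t) ∞ (sliceMeasure n a) :=
  memLp_top_of_bound (aestronglyMeasurable_slice hab (hb.smooth c).dT t) (C * a)
    (hb.ae_deriv_le hab c t)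

lemma CoefBounds.hasDerivAt_coefOp (hb : CoefBounds g b C) (hab : a ≤ b)
    (c : Option (Idx n × Idx n)) (t : ℝ) :
    HasDerivAt (fun s => coefOp g a s c) (coefOpDeriv g a t c) t :=
  hasDerivAt_mulOp (k := sliceCoef g c) (k' := sliceCoefDeriv g c) (s := {z | z.1 ∈ Ioo 0 a})
    ae_slice_mem (hb.memLp hab c) (hb.memLp_deriv hab c)
    (fun z hz t => (hb.smooth c).hasDerivAt_dT t (x := z.1) ⟨hz.1, hz.2.trans_le hab⟩ z.2)
    hb.const_pos.le
    (fun z hz t r => hb.lipschitz c t r z.1 z.2 ⟨hz.1, hz.2.trans_le hab⟩) t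

lemma CoefBounds.continuous_coefOpDeriv (hb : CoefBounds g b C) (hab : a ≤ b)
    (c : Option (Idx n × Idx n)) : Continuous fun t => coefOpDeriv g a t c :=
  continuous_mulOp (k := sliceCoefDeriv g c) (s := {z | z.1 ∈ Ioo 0 a}) ae_slice_mem (hb.memLp_deriv hab c) hb.const_pos.le
    fun z hz t r => hb.lipschitz c t r z.1 z.2 ⟨hz.1, hz.2.trans_le hab⟩

lemma mulOp_const {Ω : Type*} [MeasurableSpace Ω] (ν : Measure Ω) [IsFiniteMeasure ν] (k : ℝ) :
    mulOp ν (fun _ => k) = k • ContinuousLinearMap.id ℝ (Lp ℝ 2 ν) := by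
  ext1 f
  refine Lp.ext ?_
  filter_upwards [mulOp_ae (memLp_const k) f, Lp.coeFn_smul k f] with z h1 h2
  rw [h1, _root_.smul_apply, ContinuousLinearMap.id_apply, h2]
  rfl

/-- The lower bound for the energy. -/
def energyLower (α : ℝ) : ℝ := (1 + (α⁻¹) ^ 2)⁻¹ / 2

lemma energyLower_pos (α : ℝ) : 0 < energyLower α := by unfold energyLower; positivity

lemma energyLower_le (α : ℝ) : energyLower α ≤ 1 / 2 := by
  have : (1 + (α⁻¹) ^ 2)⁻¹ ≤ 1 := inv_le_one_of_one_le₀ (by nlinarith [sq_nonneg (α⁻¹)])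
  unfold energyLower
  linarith

lemma CoefBounds.coefOp_symm {A : ℝ} (hg : IsAAdSPatch n A g) (hbA : b ≤ A)
    (hb : CoefBounds g b C) (hab : a ≤ b) (i j : Idx n) (t : ℝ) :
    coefOp g a t (some (i, j)) = coefOp g a t (some (j, i)) := by
  ext1 f
  refine Lp.ext ?_
  filter_upwards [mulOp_ae (hb.memLp hab (some (i, j)) t) f,
    mulOp_ae (hb.memLp hab (some (j, i)) t) f, ae_slice_mem] with z h1 h2 hz
  refine h1.trans (Eq.trans ?_ h2.symm)
  simp only [sliceCoef]
  rw [hg.coef_symm (p := ((t, z.1), z.2)) ⟨hz.1, hz.2.trans_le (hab.trans hbA)⟩]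

/-- A bound for the growth of the energy. -/
def rateConst (n : ℕ) (α β μ : ℝ) : ℝ := formConst (Idx n) μ (1 + |β - α| * α⁻¹) α⁻¹

/-- The wave equation of an asymptotically AdS patch as an abstract system. -/
def waveData {A μ : ℝ} (hg : IsAAdSPatch n A g) (hbA : b ≤ A) (hb : CoefBounds g b C)
    (hα : 0 < α) (hμ : α ^ 2 = β ^ 2 + μ) (ha : 0 < a) (hab : a ≤ b) (ha1 : a ≤ 1)
    (hsmall : rateConst n α β μ * (C * a) ≤ energyLower α) :
    FormData (Idx n) (H10 n α a) (L2 n a) where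
  emb := fnL n α a
  J := gradL n α β ha
  P := divL n α ha
  μ := μ
  time := iT n
  X := coefOp g a
  X' := coefOpDeriv g a
  k := coefFun (flatMetric n)
  G := 1 + |β - α| * α⁻¹
  K := α⁻¹
  L := energyLower α
  ε := C * a
  dense := denseRange_fnL n α ha
  hasDerivAt := hb.hasDerivAt_coefOp hab
  continuous := hb.continuous_coefOpDeriv hab
  symm t c x y := inner_mulOp_comm (hb.memLp hab c t) x y
  swap t i j := hb.coefOp_symm hg hbA hab i j t
  norm_J := norm_gradL_le hα ha
  norm_P := norm_divL hα ha
  nonneg_G := by positivity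
  k_time := by simp [coefFun_flatMetric, flatMetric]
  abs_k := abs_coefFun_flatMetric_le
  norm_sub t c := by
    rw [constCoef, ← mulOp_const, coefOp, ← mulOp_sub (hb.memLp hab c t) (memLp_const _)]
    exact norm_mulOp_le (mul_nonneg hb.const_pos.le ha.le) (hb.ae_dist_le hab c t)
  norm_deriv t c := norm_mulOp_le (mul_nonneg hb.const_pos.le ha.le) (hb.ae_deriv_le hab c t)
  L_pos := energyLower_pos α
  L_le := energyLower_le α
  small := hsmall
  coercive v := by
    rw [form_flatMetric hα hμ]
    have h := norm_sq_le_energy hα ha ha1 v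
    have h5 : (1 + (α⁻¹) ^ 2)⁻¹ = 2 * energyLower α := by unfold energyLower; ring
    rwa [h5] at h

end AAdS

namespace AAdS

open scoped InnerProduct

/-! ### The weak form of the abstract equation -/

namespace FormData

variable {ι V H : Type*} [Fintype ι] [DecidableEq ι] [NormedAddCommGroup V] [InnerProductSpace ℝ V]
    [NormedAddCommGroup H] [InnerProductSpace ℝ H]

/-- The space-time gradient of a curve with value `v` and time derivative `w`. -/
def grad (D : FormData ι V H) (v : V) (w : H) (i : ι) : H := D.J i v + if i = D.time then w else 0

/-- The space-time form of the equation. -/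
def form (D : FormData ι V H) (t : ℝ) (v : V) (w : H) (u : V) (w' : H) : ℝ :=
  -((∑ i, ∑ j, inner ℝ (D.X t (some (i, j)) (D.grad v w i)) (D.grad u w' j)) +
    D.μ * inner ℝ (D.X t none (D.P v)) (D.P u))

variable [CompleteSpace V] [CompleteSpace H]

/-- The double sum is split according to which indices are the time index. The terms paired with the
time derivative of the test function form the momentum and the others the force. The vector `f` is
arbitrary, since the last term removes it from the force. -/
lemma form_eq (D : FormData ι V H) (t : ℝ) (v u u' : V) (w f : H) :
    D.form t v w u (D.emb u') = inner ℝ (D.waveSystem.momentum t v w) u' +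
      inner ℝ (D.waveSystem.force t v w f) u + inner ℝ (D.waveSystem.M t f) (D.waveSystem.ι u) := by
  have e1 : inner ℝ (D.waveSystem.momentum t v w) u' =
      -inner ℝ (D.X t (some (D.time, D.time)) w) (D.emb u') -
        ∑ j, inner ℝ (D.X t (some (D.time, j)) (D.J j v)) (D.emb u') := by
    rw [WaveSystem.momentum, ContinuousLinearMap.adjoint_inner_left, inner_add_left]
    simp only [waveSystem, _root_.neg_apply, inner_neg_left, inner_rowOp]
    ring
  have e2 : inner ℝ (D.waveSystem.force t v w f) u =
      -(∑ j, inner ℝ w (D.X t (some (D.time, j)) (D.J j u))) -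
      ((∑ i, ∑ j, inner ℝ (D.X t (some (i, j)) (D.J j v)) (D.J i u)) +
        D.μ * inner ℝ (D.X t none (D.P v)) (D.P u)) -
      inner ℝ (D.waveSystem.M t f) (D.waveSystem.ι u) := by
    rw [WaveSystem.force, inner_sub_left, inner_sub_left, ContinuousLinearMap.adjoint_inner_left,
      ContinuousLinearMap.adjoint_inner_left]
    have e3 : inner ℝ w (D.waveSystem.B t u) =
        -∑ j, inner ℝ w (D.X t (some (D.time, j)) (D.J j u)) := by
      rw [real_inner_comm]
      simp only [waveSystem, inner_rowOp]
      exact congrArg _ (Finset.sum_congr rfl fun j _ => real_inner_comm _ _)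
    rw [e3]
    simp only [waveSystem, inner_formOp]
  have e4 : (∑ i, ∑ j, inner ℝ (D.X t (some (i, j)) (D.grad v w i)) (D.grad u (D.emb u') j)) =
      (∑ i, ∑ j, inner ℝ (D.X t (some (i, j)) (D.J j v)) (D.J i u)) +
      ∑ j, inner ℝ w (D.X t (some (D.time, j)) (D.J j u)) +
      ∑ j, inner ℝ (D.X t (some (D.time, j)) (D.J j v)) (D.emb u') +
      inner ℝ (D.X t (some (D.time, D.time)) w) (D.emb u') := by
    have h1 : ∀ i j, inner ℝ (D.X t (some (i, j)) (D.grad v w i)) (D.grad u (D.emb u') j) =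
        inner ℝ (D.X t (some (j, i)) (D.J i v)) (D.J j u) +
        (if i = D.time then inner ℝ w (D.X t (some (i, j)) (D.J j u)) else 0) +
        (if j = D.time then inner ℝ (D.X t (some (j, i)) (D.J i v)) (D.emb u') else 0) +
        (if i = D.time then (if j = D.time then
          inner ℝ (D.X t (some (i, j)) w) (D.emb u') else 0) else 0) := fun i j => by
      rw [grad, grad, map_add, inner_add_left, inner_add_right, inner_add_right, D.swap t i j]
      by_cases hi : i = D.time <;> by_cases hj : j = D.time <;>
        simp [hi, hj, D.symm, D.swap t j] <;> ring
    simp only [h1, Finset.sum_add_distrib, Finset.sum_ite_eq', Finset.mem_univ, if_true,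
      Finset.sum_ite_irrel, Finset.sum_const_zero]
    rw [Finset.sum_comm]
  rw [form, e4, e1, e2]
  ring

lemma integral_form_sub (D : FormData ι V H) {T : ℝ} {v : ℝ → V} {w F : ℝ → H}
    (hv : Integrable v (timeMeasure T)) (hw : Integrable w (timeMeasure T))
    (hF : Integrable F (timeMeasure T)) {u u' : ℝ → V} (hu : Continuous u) (hu' : Continuous u') :
    (∫ t in Ioo (-T) T, D.form t (v t) (w t) (u t) (D.emb (u' t))) -
        ∫ t in Ioo (-T) T, inner ℝ (D.waveSystem.M t (F t)) (D.waveSystem.ι (u t)) =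
      ∫ t in Ioo (-T) T, (inner ℝ (D.waveSystem.momentum t (v t) (w t)) (u' t) +
        inner ℝ (D.waveSystem.force t (v t) (w t) (F t)) (u t)) := by
  have hi : ∀ {f : ℝ → V} {p : ℝ → V}, Integrable f (timeMeasure T) → Continuous p →
      Integrable (fun t => inner ℝ (f t) (p t)) (timeMeasure T) := fun {f p} hf hp => by
    have := WaveSystem.integrable_clm hf (U := fun t => innerSL ℝ (p t)) ((innerSL ℝ).continuous.comp hp)
    refine this.congr (.of_forall fun t => ?_)
    simp [real_inner_comm]
  have hm : Integrable (fun t => D.waveSystem.momentum t (v t) (w t)) (timeMeasure T) := by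
    have h1 : Continuous fun t => (D.waveSystem.ι†).comp (D.waveSystem.M t) :=
      continuous_const.clm_comp D.waveSystem.continuous_M
    have h2 : Continuous fun t => (D.waveSystem.ι†).comp (D.waveSystem.B t) :=
      continuous_const.clm_comp D.waveSystem.continuous_B
    refine ((WaveSystem.integrable_clm hw h1).add (WaveSystem.integrable_clm hv h2)).congr (.of_forall fun t => ?_)
    simp [WaveSystem.momentum]
  have hf := D.waveSystem.integrable_force hv hw hF
  have hM : Integrable (fun t => inner ℝ (D.waveSystem.M t (F t)) (D.waveSystem.ι (u t)))
      (timeMeasure T) := by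
    have h1 : Continuous fun t => (D.waveSystem.ι†).comp (D.waveSystem.M t) :=
      continuous_const.clm_comp D.waveSystem.continuous_M
    refine (hi (WaveSystem.integrable_clm hF h1) hu).congr (.of_forall fun t => ?_)
    simp [ContinuousLinearMap.adjoint_inner_left]
  have hR : Integrable (fun t => inner ℝ (D.waveSystem.momentum t (v t) (w t)) (u' t) +
      inner ℝ (D.waveSystem.force t (v t) (w t) (F t)) (u t)) (timeMeasure T) :=
    (hi hm hu').add (hi hf hu)
  have hL : ∫ t in Ioo (-T) T, D.form t (v t) (w t) (u t) (D.emb (u' t)) =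
      ∫ t in Ioo (-T) T, ((inner ℝ (D.waveSystem.momentum t (v t) (w t)) (u' t) +
      inner ℝ (D.waveSystem.force t (v t) (w t) (F t)) (u t)) +
      inner ℝ (D.waveSystem.M t (F t)) (D.waveSystem.ι (u t))) :=
    integral_congr_ae (.of_forall fun t => D.form_eq t (v t) (u t) (u' t) (w t) (F t))
  rw [hL, integral_add hR hM, add_sub_cancel_right]

end FormData

/-! ### Test functions on space-time -/

section Tests

variable {n : ℕ} {a T : ℝ}

lemma isSpacetimeTest_iff {ψ : Pt n → ℝ} : IsSpacetimeTest a T ψ ↔ SmoothOver univ ψ ∧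
    ∃ K : Set (ℝ × ℝ), IsCompact K ∧ K ⊆ Ioo (-T) T ×ˢ Ioo 0 a ∧
      ∀ y, y ∉ K → ∀ θ, ψ (y, θ) = 0 := by
  constructor
  · rintro ⟨h1, h2, h3⟩
    refine ⟨h1, Prod.fst '' tsupport ψ, h2.isCompact.image continuous_fst, ?_,
      fun y hy θ => image_eq_zero_of_notMem_tsupport fun h => hy ⟨_, h, rfl⟩⟩
    rintro _ ⟨z, hz, rfl⟩
    exact (h3 hz).1
  · rintro ⟨h1, K, hK, hKs, h⟩
    have h0 : ∀ z : Pt n, z ∉ K ×ˢ (univ : Set (Sph n)) → ψ z = 0 := fun z hz =>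
      h z.1 (fun hz' => hz ⟨hz', mem_univ _⟩) z.2
    have hc : IsCompact (K ×ˢ (univ : Set (Sph n))) := hK.prod isCompact_univ
    refine ⟨h1, HasCompactSupport.intro hc h0, ?_⟩
    refine (closure_minimal (fun z hz => ?_) hc.isClosed : tsupport ψ ⊆ _).trans
      (prod_mono_left hKs)
    by_contra hz'
    exact hz (h0 z hz')

lemma IsSpacetimeTest.dirDeriv {ψ : Pt n → ℝ} (h : IsSpacetimeTest a T ψ)
    (v : (ℝ × ℝ) × Euc n) : IsSpacetimeTest a T (dirDeriv v ψ) := by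
  rw [isSpacetimeTest_iff] at h ⊢
  obtain ⟨h1, K, hK, hKs, h2⟩ := h
  exact ⟨h1.dirDeriv isOpen_univ v, K, hK, hKs, dirDeriv_eq_zero hK.isClosed h2 v⟩

lemma IsSpacetimeTest.mul_left {ψ Q : Pt n → ℝ} (h : IsSpacetimeTest a T ψ)
    (hQ : SmoothOver {y : ℝ × ℝ | y.2 ∈ Ioo 0 a} Q) : IsSpacetimeTest a T fun z => Q z * ψ z := by
  rw [isSpacetimeTest_iff] at h ⊢
  obtain ⟨h1, K, hK, hKs, h2⟩ := h
  have h0 : ∀ y, y ∉ K → ∀ θ, Q (y, θ) * ψ (y, θ) = 0 := fun x hx θ => by rw [h2 x hx θ, mul_zero]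
  exact ⟨smoothOver_univ_of_supported (isOpen_strip a) hK.isClosed (fun y hy => (hKs hy).2)
    (hQ.mul (h1.mono (subset_univ _))) h0, K, hK, hKs, h0⟩

lemma IsSpacetimeTest.add {ψ ψ' : Pt n → ℝ} (h : IsSpacetimeTest a T ψ)
    (h' : IsSpacetimeTest a T ψ') : IsSpacetimeTest a T fun z => ψ z + ψ' z :=
  ⟨h.smooth.add h'.smooth, h.compact.add h'.compact,
    (tsupport_add ψ ψ').trans (union_subset h.support h'.support)⟩

lemma IsSpacetimeTest.dT_eq {ψ : Pt n → ℝ} (h : IsSpacetimeTest a T ψ) :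
    dT ψ = AAdS.dirDeriv (((1 : ℝ), (0 : ℝ)), 0) ψ := by
  funext p
  exact (h.smooth.hasDerivAt_comp (c := fun s => (s, p.1.2)) isOpen_univ
    ((hasDerivAt_id p.1.1).prodMk (hasDerivAt_const _ p.1.2)) (mem_univ _) p.2).deriv

lemma IsSpacetimeTest.hasDerivAt {ψ : Pt n → ℝ} (h : IsSpacetimeTest a T ψ) (t x : ℝ) (θ : Sph n) :
    HasDerivAt (fun s => ψ ((s, x), θ)) (dT ψ ((t, x), θ)) t := by
  rw [h.dT_eq]
  exact h.smooth.hasDerivAt_comp (c := fun s => (s, x)) isOpen_univ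
    ((hasDerivAt_id t).prodMk (hasDerivAt_const t x)) (mem_univ _) θ

lemma IsSpacetimeTest.dT {ψ : Pt n → ℝ} (h : IsSpacetimeTest a T ψ) :
    IsSpacetimeTest a T (AAdS.dT ψ) := by
  rw [h.dT_eq]
  exact h.dirDeriv _

lemma IsSpacetimeTest.exists_bound {ψ : Pt n → ℝ} (h : IsSpacetimeTest a T ψ) :
    ∃ C, 0 ≤ C ∧ ∀ p, |ψ p| ≤ C := by
  obtain ⟨C, hC⟩ := h.smooth.continuous.bounded_above_of_compact_support h.compact
  exact ⟨|C|, abs_nonneg _, fun p => (hC p).trans (le_abs_self _)⟩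

/-- The restriction of a function to a time slice. -/
def slice (ψ : Pt n → ℝ) (t : ℝ) (z : ℝ × Sph n) : ℝ := ψ ((t, z.1), z.2)

lemma SmoothOver.slice {ψ : Pt n → ℝ} (h : SmoothOver univ ψ) (t : ℝ) :
    SmoothOver univ (slice ψ t) :=
  h.comp_fst (f := fun x => (t, x)) (by fun_prop) (mapsTo_univ _ _)

lemma IsSpacetimeTest.slice (ha : 0 < a) {ψ : Pt n → ℝ} (h : IsSpacetimeTest a T ψ) (t : ℝ) :
    IsSliceTest a (slice ψ t) := by
  rw [isSpacetimeTest_iff] at h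
  obtain ⟨h1, K, hK, hKs, h2⟩ := h
  obtain ⟨p, q, hp, hq, hpq⟩ := exists_Icc_of_isCompact (hK.image continuous_snd) ha (by
    rintro _ ⟨z, hz, rfl⟩; exact (hKs hz).2)
  refine (isSliceTest_iff ha).2 ⟨h1.slice t, p, q, hp, hq, fun x hx θ => h2 _ (fun hk => hx ?_) θ⟩
  exact hpq ⟨_, hk, rfl⟩

lemma IsSpacetimeTest.slice_eq_zero {ψ : Pt n → ℝ} (h : IsSpacetimeTest a T ψ) {t : ℝ}
    (ht : t ∉ Ioo (-T) T) : AAdS.slice ψ t = 0 := by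
  rw [isSpacetimeTest_iff] at h
  obtain ⟨h1, K, hK, hKs, h2⟩ := h
  funext z
  exact h2 _ (fun hk => ht (hKs hk).1) _

lemma dirDeriv_slice {ψ : Pt n → ℝ} (h : SmoothOver univ ψ) (t : ℝ) (v : ℝ × Euc n) :
    dirDeriv v (slice ψ t) = slice (dirDeriv (((0 : ℝ), v.1), v.2) ψ) t := by
  funext z
  have h1 : HasFDerivAt (fun p : ℝ × Euc n => (((t, p.1), p.2) : (ℝ × ℝ) × Euc n))
      (((0 : ℝ × Euc n →L[ℝ] ℝ).prod (ContinuousLinearMap.fst ℝ ℝ (Euc n))).prod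
        (ContinuousLinearMap.snd ℝ ℝ (Euc n))) (z.1, (z.2 : Euc n)) :=
    ((hasFDerivAt_const t _).prodMk hasFDerivAt_fst).prodMk hasFDerivAt_snd
  have h2 := (h.hasFDerivAt isOpen_univ (mem_univ (t, z.1)) (sph_ne_zero z.2)).comp
    (z.1, (z.2 : Euc n)) h1
  have h3 : HasFDerivAt (jointExt (slice ψ t)) _ (z.1, (z.2 : Euc n)) := h2
  rw [dirDeriv, h3.fderiv]
  rfl

lemma twisted_slice (α : ℝ) {ψ : Pt n → ℝ} (h : SmoothOver univ ψ) (t : ℝ) :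
    twisted α (slice ψ t) =
      slice (fun p => dirDeriv (((0 : ℝ), (1 : ℝ)), 0) ψ p + α / p.1.2 * ψ p) t := by
  rw [twisted_eq α (h.slice t), dirDeriv_slice h]
  rfl

lemma gradS_slice {ψ : Pt n → ℝ} (h : SmoothOver univ ψ) (t : ℝ) (i : Fin (n - 1)) :
    (fun z => gradS (slice ψ t) z i) =
      slice (dirDeriv (((0 : ℝ), (0 : ℝ)), EuclideanSpace.single i 1) ψ) t := by
  rw [gradS_apply_eq (h.slice t), dirDeriv_slice h]

lemma IsSpacetimeTest.twist {ψ : Pt n → ℝ} (h : IsSpacetimeTest a T ψ) (α : ℝ) :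
    IsSpacetimeTest a T
      fun p => AAdS.dirDeriv (((0 : ℝ), (1 : ℝ)), 0) ψ p + α / p.1.2 * ψ p :=
  (h.dirDeriv _).add (h.mul_left (smoothOver_fst (f := fun y : ℝ × ℝ => α / y.2)
    (contDiffOn_const.div contDiffOn_snd fun _ hy => hy.1.ne')))

lemma dT_twist (α : ℝ) {ψ : Pt n → ℝ} (h : IsSpacetimeTest a T ψ) :
    dT (fun p => dirDeriv (((0 : ℝ), (1 : ℝ)), 0) ψ p + α / p.1.2 * ψ p) =
      fun p => dirDeriv (((0 : ℝ), (1 : ℝ)), 0) (dT ψ) p + α / p.1.2 * dT ψ p := by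
  funext p
  have h1 := (h.dirDeriv (((0 : ℝ), (1 : ℝ)), 0)).hasDerivAt p.1.1 p.1.2 p.2
  rw [(h.dirDeriv _).dT_eq, dirDeriv_comm isOpen_univ h.smooth _ _ (mem_univ _), ← h.dT_eq] at h1
  exact (h1.add ((h.hasDerivAt p.1.1 p.1.2 p.2).const_mul (α / p.1.2))).deriv

lemma dT_dirDeriv {ψ : Pt n → ℝ} (h : IsSpacetimeTest a T ψ) (v : (ℝ × ℝ) × Euc n) :
    dT (dirDeriv v ψ) = dirDeriv v (dT ψ) := by
  rw [(h.dirDeriv _).dT_eq, h.dT_eq]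
  funext p
  exact dirDeriv_comm isOpen_univ h.smooth _ _ (mem_univ _)

end Tests

end AAdS

namespace AAdS

open scoped InnerProduct

/-! ### Curves of test functions -/

variable {n : ℕ} {α a T : ℝ}

/-- Each slice is the multiplication operator by itself applied to the constant function `1`, so
`hasDerivAt_mulOp` applies. -/
lemma IsSpacetimeTest.hasDerivAt_L2 {R : Pt n → ℝ} (h : IsSpacetimeTest a T R)
    {f : ℝ → L2 n a} {f' : L2 n a} {t : ℝ} (hf : ∀ s, f s =ᵐ[sliceMeasure n a] AAdS.slice R s)
    (hf' : f' =ᵐ[sliceMeasure n a] AAdS.slice (AAdS.dT R) t) : HasDerivAt f f' t := by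
  have hm : ∀ {Q : Pt n → ℝ}, IsSpacetimeTest a T Q → ∀ s,
      MemLp (AAdS.slice Q s) ∞ (sliceMeasure n a) := fun {Q} hQ s => by
    obtain ⟨C, -, hC⟩ := hQ.exists_bound
    exact memLp_top_of_bound (hQ.smooth.slice s).continuous.aestronglyMeasurable C
      (.of_forall fun z => hC _)
  obtain ⟨C, hC0, hC⟩ := h.dT.dT.exists_bound
  have hlip : ∀ z ∈ (univ : Set (ℝ × Sph n)), ∀ s r,
      |AAdS.slice (AAdS.dT R) s z - AAdS.slice (AAdS.dT R) r z| ≤ C * |s - r| := fun z _ s r => by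
    simpa using! Convex.norm_image_sub_le_of_norm_hasDerivWithin_le (s := univ)
      (fun x _ => (h.dT.hasDerivAt x z.1 z.2).hasDerivWithinAt) (fun x _ => hC _) convex_univ
      (mem_univ r) (mem_univ s)
  have key := hasDerivAt_mulOp (ν := sliceMeasure n a) (k := AAdS.slice R) (k' := AAdS.slice (AAdS.dT R))
    (s := univ) (.of_forall fun _ => mem_univ _) (hm h) (hm h.dT)
    (fun z _ s => h.hasDerivAt s z.1 z.2) hC0 hlip t
  have key2 := key.clm_apply (hasDerivAt_const t (memLp_const (1 : ℝ)).toLp)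
  have e : ∀ {Q : Pt n → ℝ}, IsSpacetimeTest a T Q → ∀ (s : ℝ) (u : L2 n a),
      u =ᵐ[sliceMeasure n a] AAdS.slice Q s →
      mulOp (sliceMeasure n a) (AAdS.slice Q s) (memLp_const (1 : ℝ)).toLp = u := fun {Q} hQ s u hu => by
    refine Lp.ext ?_
    filter_upwards [mulOp_ae (hm hQ s) (memLp_const (1 : ℝ)).toLp, hu,
      (memLp_const (p := 2) (μ := sliceMeasure n a) (1 : ℝ)).coeFn_toLp] with z h1 h2 h3
    rw [h1, h2, h3, mul_one]
  rw [map_zero, add_zero, e h.dT t f' hf'] at key2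
  exact key2.congr_of_eventuallyEq (.of_forall fun s => (e h s (f s) (hf s)).symm)

lemma norm_le_sum_components (v : H10 n α a) :
    ‖v‖ ≤ ‖fnOf v‖ + ‖twistOf v‖ + ∑ i, ‖angComp i v‖ := by
  refine (norm_le_sum_H10 v).trans (add_le_add le_rfl ?_)
  refine abs_le_of_sq_le_sq' ?_ (Finset.sum_nonneg fun _ _ => norm_nonneg _) |>.2
  rw [← sum_norm_sq_angComp]
  exact Finset.sum_sq_le_sq_sum_of_nonneg fun _ _ => norm_nonneg _

/-- The norm of `𝐇¹₀` is at most the sum of the norms of the components, so differentiability may be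
checked component by component. -/
lemma hasDerivAt_H10 {Φ : ℝ → H10 n α a} {Φ' : H10 n α a} {t : ℝ}
    (h1 : HasDerivAt (fun s => fnOf (Φ s)) (fnOf Φ') t)
    (h2 : HasDerivAt (fun s => twistOf (Φ s)) (twistOf Φ') t)
    (h3 : ∀ i, HasDerivAt (fun s => angComp i (Φ s)) (angComp i Φ') t) : HasDerivAt Φ Φ' t := by
  rw [hasDerivAt_iff_isLittleO] at h1 h2 ⊢
  have h3' := fun i => hasDerivAt_iff_isLittleO.1 (h3 i)
  have h4 := (h1.norm_left.add h2.norm_left).add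
    (Asymptotics.IsLittleO.sum (s := Finset.univ) fun i _ => (h3' i).norm_left)
  refine Asymptotics.IsBigO.trans_isLittleO (.of_bound 1 (.of_forall fun s => ?_)) h4
  rw [one_mul]
  refine ((norm_le_sum_components _).trans (le_of_eq ?_)).trans (Real.le_norm_self _)
  have e1 : fnOf (Φ s - Φ t - (s - t) • Φ') = fnOf (Φ s) - fnOf (Φ t) - (s - t) • fnOf Φ' := rfl
  have e2 : twistOf (Φ s - Φ t - (s - t) • Φ') =
      twistOf (Φ s) - twistOf (Φ t) - (s - t) • twistOf Φ' := rfl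
  rw [e1, e2]
  simp only [map_sub, map_smul, Finset.sum_apply]

/-- The curve in `𝐇¹₀` of the time slices of a test function on space-time. -/
def testCurve (α : ℝ) (ha : 0 < a) {ψ : Pt n → ℝ} (h : IsSpacetimeTest a T ψ) (t : ℝ) :
    H10 n α a := testH10 n α ha (mkTest ha (h.slice ha t))

lemma fnOf_testCurve_ae (ha : 0 < a) {ψ : Pt n → ℝ} (h : IsSpacetimeTest a T ψ) (t : ℝ) :
    fnOf (testCurve α ha h t) =ᵐ[sliceMeasure n a] slice ψ t := testL2_ae _

lemma twistOf_testCurve_ae (ha : 0 < a) {ψ : Pt n → ℝ} (h : IsSpacetimeTest a T ψ) (t : ℝ) :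
    twistOf (testCurve α ha h t) =ᵐ[sliceMeasure n a] twisted α (slice ψ t) :=
  twistOf_testH10_ae _

lemma angularOf_testCurve_ae (ha : 0 < a) {ψ : Pt n → ℝ} (h : IsSpacetimeTest a T ψ) (t : ℝ) :
    angularOf (testCurve α ha h t) =ᵐ[sliceMeasure n a] gradS (slice ψ t) :=
  angularOf_testH10_ae _

/-- The time derivative commutes with `𝐃_x` and with the angular derivatives, so every component of
the curve is again the slice of a test function on space-time. -/
lemma hasDerivAt_testCurve (ha : 0 < a) {ψ : Pt n → ℝ} (h : IsSpacetimeTest a T ψ) (t : ℝ) :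
    HasDerivAt (testCurve α ha h) (testCurve α ha h.dT t) t := by
  have hang : ∀ {Q : Pt n → ℝ} (hQ : IsSpacetimeTest a T Q) (s : ℝ) (i : Fin (n - 1)),
      angComp i (testCurve α ha hQ s) =ᵐ[sliceMeasure n a]
        slice (dirDeriv (((0 : ℝ), (0 : ℝ)), EuclideanSpace.single i 1) Q) s := fun {Q} hQ s i => by
    rw [← gradS_slice hQ.smooth]
    filter_upwards [angComp_ae i (testCurve α ha hQ s), angularOf_testCurve_ae (α := α) ha hQ s]
      with z h1 h2
    rw [h1, h2]
  refine hasDerivAt_H10 (h.hasDerivAt_L2 (fnOf_testCurve_ae ha h) (fnOf_testCurve_ae ha h.dT t))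
    ((h.twist α).hasDerivAt_L2 (fun s => ?_) ?_) fun i =>
      (h.dirDeriv (((0 : ℝ), (0 : ℝ)), EuclideanSpace.single i 1)).hasDerivAt_L2
        (fun s => hang h s i) ?_
  · rw [← twisted_slice α h.smooth]
    exact twistOf_testCurve_ae ha h s
  · rw [dT_twist α h, ← twisted_slice α h.dT.smooth]
    exact twistOf_testCurve_ae ha h.dT t
  · rw [dT_dirDeriv h]
    exact hang h.dT t i

lemma continuous_testCurve (ha : 0 < a) {ψ : Pt n → ℝ} (h : IsSpacetimeTest a T ψ) :
    Continuous (testCurve α ha h) :=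
  continuous_iff_continuousAt.2 fun t => (hasDerivAt_testCurve ha h t).continuousAt

lemma testCurve_eq_zero (ha : 0 < a) {ψ : Pt n → ℝ} (h : IsSpacetimeTest a T ψ) {t : ℝ}
    (ht : t ∉ Ioo (-T) T) : testCurve α ha h t = 0 := by
  have e : mkTest ha (h.slice ha t) = 0 := Subtype.ext (h.slice_eq_zero ht)
  rw [testCurve, e, map_zero]

/-! ### The wave equation on time slices -/

variable {β b C A μ : ℝ} {g : TensorField n}

lemma grad_ae (hg : IsAAdSPatch n A g) (hbA : b ≤ A) (hb : CoefBounds g b C)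
    (hα : 0 < α) (hμ : α ^ 2 = β ^ 2 + μ) (ha : 0 < a) (hab : a ≤ b) (ha1 : a ≤ 1)
    (hsmall : rateConst n α β μ * (C * a) ≤ energyLower α) (v : H10 n α a) (w : L2 n a)
    (i : Idx n) :
    (waveData hg hbA hb hα hμ ha hab ha1 hsmall).grad v w i =ᵐ[sliceMeasure n a] fun z =>
      covec (w z) (twistOf v z + (β - α) / z.1 * fnOf v z) (angularOf v z) i := by
  rcases i with i | i
  · fin_cases i
    · have e : (waveData hg hbA hb hα hμ ha hab ha1 hsmall).grad v w (Sum.inl 0) = w := by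
        simp only [FormData.grad, waveData, gradL, if_true]
        exact zero_add w
      show (waveData hg hbA hb hα hμ ha hab ha1 hsmall).grad v w (Sum.inl 0) =ᵐ[_] _
      rw [e]
      exact .refl _ _
    · have e : (waveData hg hbA hb hα hμ ha hab ha1 hsmall).grad v w (Sum.inl 1) =
          twistOf v + (β - α) • divL n α ha v := add_zero _
      show (waveData hg hbA hb hα hμ ha hab ha1 hsmall).grad v w (Sum.inl 1) =ᵐ[_] _
      rw [e]
      filter_upwards [Lp.coeFn_add (twistOf v) ((β - α) • divL n α ha v),
        Lp.coeFn_smul (β - α) (divL n α ha v), divL_ae hα ha v] with z h1 h2 h3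
      rw [h1, Pi.add_apply, h2, Pi.smul_apply, h3]
      simp only [covec, smul_eq_mul, Sum.elim_inl]
      show _ = twistOf v z + (β - α) / z.1 * fnOf v z
      ring
  · have e : (waveData hg hbA hb hα hμ ha hab ha1 hsmall).grad v w (Sum.inr i) = angComp i v :=
      add_zero _
    rw [e]
    exact angComp_ae i v

lemma integrable_mulOp_mul {Ω : Type*} [MeasurableSpace Ω] {ν : Measure Ω} {k : Ω → ℝ}
    (hk : MemLp k ∞ ν) {u w : Lp ℝ 2 ν} {f g : Ω → ℝ} (hu : u =ᵐ[ν] f) (hw : w =ᵐ[ν] g) :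
    Integrable (fun z => k z * f z * g z) ν := by
  refine (L2.integrable_inner (𝕜 := ℝ) (mulOp ν k u) w).congr ?_
  filter_upwards [mulOp_ae hk u, hu, hw] with z h1 h2 h3
  rw [h1, h2, h3]
  simp [mul_comm]

/-- The space-time form as an integral. -/
lemma form_eq_integral (hg : IsAAdSPatch n A g) (hbA : b ≤ A) (hb : CoefBounds g b C)
    (hα : 0 < α) (hμ : α ^ 2 = β ^ 2 + μ) (ha : 0 < a) (hab : a ≤ b) (ha1 : a ≤ 1)
    (hsmall : rateConst n α β μ * (C * a) ≤ energyLower α) (t : ℝ) (v u : H10 n α a)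
    (w w' : L2 n a) {ξ η : Idx n → ℝ × Sph n → ℝ} {q r : ℝ × Sph n → ℝ}
    (hξ : ∀ i, (waveData hg hbA hb hα hμ ha hab ha1 hsmall).grad v w i =ᵐ[sliceMeasure n a] ξ i)
    (hη : ∀ i, (waveData hg hbA hb hα hμ ha hab ha1 hsmall).grad u w' i =ᵐ[sliceMeasure n a] η i)
    (hq : divL n α ha v =ᵐ[sliceMeasure n a] q) (hr : divL n α ha u =ᵐ[sliceMeasure n a] r) :
    (waveData hg hbA hb hα hμ ha hab ha1 hsmall).form t v w u w' =
      ∫ z, -((∑ i, ∑ j, sliceCoef g (some (i, j)) t z * ξ i z * η j z) +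
        μ * (sliceCoef g none t z * q z * r z)) ∂(sliceMeasure n a) := by
  have h1 : ∀ i j, inner ℝ (coefOp g a t (some (i, j))
      ((waveData hg hbA hb hα hμ ha hab ha1 hsmall).grad v w i))
      ((waveData hg hbA hb hα hμ ha hab ha1 hsmall).grad u w' j) =
      ∫ z, sliceCoef g (some (i, j)) t z * ξ i z * η j z ∂(sliceMeasure n a) := fun i j =>
    inner_mulOp (hb.memLp hab _ t) (hξ i) (hη j)
  have h2 : inner ℝ (coefOp g a t none (divL n α ha v)) (divL n α ha u) =
      ∫ z, sliceCoef g none t z * q z * r z ∂(sliceMeasure n a) :=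
    inner_mulOp (hb.memLp hab _ t) hq hr
  have i1 : ∀ i j, Integrable (fun z => sliceCoef g (some (i, j)) t z * ξ i z * η j z)
      (sliceMeasure n a) := fun i j => integrable_mulOp_mul (hb.memLp hab _ t) (hξ i) (hη j)
  have i2 : Integrable (fun z => μ * (sliceCoef g none t z * q z * r z)) (sliceMeasure n a) :=
    (integrable_mulOp_mul (hb.memLp hab _ t) hq hr).const_mul μ
  have i3 : ∀ i, Integrable (fun z => ∑ j, sliceCoef g (some (i, j)) t z * ξ i z * η j z)
      (sliceMeasure n a) := fun i => integrable_finsetSum _ fun j _ => i1 i j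
  have i4 : Integrable (fun z => ∑ i, ∑ j, sliceCoef g (some (i, j)) t z * ξ i z * η j z)
      (sliceMeasure n a) := integrable_finsetSum _ fun i _ => i3 i
  rw [integral_neg, integral_add i4 i2, integral_finsetSum _ fun i _ => i3 i, integral_const_mul,
    ← h2, Finset.sum_congr rfl fun i _ => integral_finsetSum _ fun j _ => i1 i j]
  simp only [← h1]
  rfl

end AAdS

namespace AAdS

open scoped InnerProduct

/-! ### Comparison with the weak form of the wave equation -/

variable {n : ℕ} {α β a b C T A μ : ℝ} {g : TensorField n}

/-- Conjugation by `x^β` turns `∂_x` into `∂_x + β/x = 𝐃_x + (β-α)/x`, so the differentials of the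
test function and of the solution have the same shape. -/
lemma dPsi_rpow {Q : Pt n → ℝ} (h : IsSpacetimeTest a T Q) (α β t : ℝ) {z : ℝ × Sph n}
    (hz : 0 < z.1) : dPsi (fun p : Pt n => p.1.2 ^ β * Q p) ((t, z.1), z.2) =
      z.1 ^ β • covec (slice (dT Q) t z)
        (twisted α (slice Q t) z + (β - α) / z.1 * slice Q t z) (gradS (slice Q t) z) := by
  have e0 : dT (fun p : Pt n => p.1.2 ^ β * Q p) ((t, z.1), z.2) = z.1 ^ β * slice (dT Q) t z :=
    ((h.hasDerivAt t z.1 z.2).const_mul (z.1 ^ β)).deriv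
  have e1 : dX (fun p : Pt n => p.1.2 ^ β * Q p) ((t, z.1), z.2) =
      z.1 ^ β * (twisted α (slice Q t) z + (β - α) / z.1 * slice Q t z) := by
    have h1 : HasDerivAt (fun s => slice Q t (s, z.2))
        (dirDeriv ((1 : ℝ), 0) (slice Q t) z) z.1 :=
      (h.smooth.slice t).hasDerivAt_comp isOpen_univ (hasDerivAt_id z.1) (mem_univ _) z.2
    have h2 := (Real.hasDerivAt_rpow_const (p := β) (Or.inl hz.ne')).fun_mul h1
    refine h2.deriv.trans ?_
    rw [twisted_eq α (h.smooth.slice t), Real.rpow_sub_one hz.ne']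
    simp only [Prod.mk.eta]
    field_simp
    ring
  have e2 : gradS (fun p : Pt n => p.1.2 ^ β * Q p) ((t, z.1), z.2) =
      z.1 ^ β • gradS (slice Q t) z :=
    congrFun (gradS_const_smul (z.1 ^ β) (h.smooth.slice t)) z
  funext i
  rw [dPsi, e0, e1, e2]
  rcases i with i | i
  · fin_cases i <;> rfl
  · rfl

lemma normalVec_dotProduct_covec (θ : Sph n) (r s : ℝ) (u : Euc n) :
    normalVec θ ⬝ᵥ covec r s u = inner ℝ u (θ : Euc n) := by
  simp [normalVec, covec, dotProduct, PiLp.inner_apply]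

lemma normalVec_dotProduct_slice {Q : Pt n → ℝ} (h : IsSpacetimeTest a T Q) (t r s : ℝ)
    (z : ℝ × Sph n) : normalVec z.2 ⬝ᵥ covec r s (gradS (slice Q t) z) = 0 := by
  rw [normalVec_dotProduct_covec]
  exact inner_gradS z
    ((h.smooth.slice t).differentiableAt_radialExt isOpen_univ (mem_univ _) (sph_ne_zero _))

lemma rpow_half_mul_self (n : ℕ) {x : ℝ} (hx : 0 < x) :
    x ^ (((n : ℝ) - 1) / 2) * x ^ (((n : ℝ) - 1) / 2) * x = x ^ n := by
  rw [← Real.rpow_add hx, ← Real.rpow_add_one hx.ne', ← Real.rpow_natCast]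
  congr 1
  ring

/-- The powers of `x` cancel: `x² x^(-n)` from the inverse metric and the volume, `x^(n-1)` from the
two factors `x^((n-1)/2)`, and `1/x` from the slice measure multiply to one. The mass term lacks the
factor `x²` and keeps `1/x` on both functions. -/
lemma wave_integrand_eq (hn : 2 ≤ n) (hg : IsAAdSPatch n A g) (hbA : b ≤ A)
    (hb : CoefBounds g b C) (hab : a ≤ b) {Q : Pt n → ℝ} (h : IsSpacetimeTest a T Q)
    (μ t : ℝ) (v : H10 n α a) (w : L2 n a) {z : ℝ × Sph n} (hz : z.1 ∈ Ioo 0 a) :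
    (-invMetric g ((t, z.1), z.2) (dPhi v w z)
        (dPsi (fun p : Pt n => p.1.2 ^ (((n : ℝ) - 1) / 2) * Q p) ((t, z.1), z.2))
      - μ * (z.1 ^ (((n : ℝ) - 1) / 2) * fnOf v z) *
        (z.1 ^ (((n : ℝ) - 1) / 2) * Q ((t, z.1), z.2)))
      * (volDensity g ((t, z.1), z.2) / z.1) =
    -((∑ i, ∑ j, sliceCoef g (some (i, j)) t z *
        covec (w z) (twistOf v z + (((n : ℝ) - 1) / 2 - α) / z.1 * fnOf v z) (angularOf v z) i *
        covec (slice (dT Q) t z) (twisted α (slice Q t) z +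
          (((n : ℝ) - 1) / 2 - α) / z.1 * slice Q t z) (gradS (slice Q t) z) j) +
      μ * (sliceCoef g none t z * (1 / z.1 * fnOf v z) * (1 / z.1 * slice Q t z))) := by
  have hzb : z.1 ∈ Ioo 0 b := ⟨hz.1, hz.2.trans_le hab⟩
  have hzA : z.1 ∈ Ioo 0 A := ⟨hz.1, hz.2.trans_le (hab.trans hbA)⟩
  have hx := hz.1
  have hc := rpow_half_mul_self n hx
  rw [dPsi_rpow h α _ t hx]
  set c := z.1 ^ (((n : ℝ) - 1) / 2) with hcdef
  set ξ := covec (w z) (twistOf v z + (((n : ℝ) - 1) / 2 - α) / z.1 * fnOf v z) (angularOf v z)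
    with hξ
  set η := covec (slice (dT Q) t z) (twisted α (slice Q t) z +
          (((n : ℝ) - 1) / 2 - α) / z.1 * slice Q t z) (gradS (slice Q t) z) with hη
  have h1 := hg.invMetric_mul_volDensity hn (p := ((t, z.1), z.2)) hzA (hb.det_ne _ hzb) (c • ξ)
    (η := c • η) (by
      rw [dotProduct_smul]
      exact (congrArg _ (normalVec_dotProduct_slice h t _ _ z)).trans (smul_zero _))
  have h2 := hg.volDensity_eq hn (p := ((t, z.1), z.2)) hzA
  have e1 : ∑ i, ∑ j, coef g (some (i, j)) ((t, z.1), z.2) * (c • ξ) i * (c • η) j =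
      c * c * ∑ i, ∑ j, sliceCoef g (some (i, j)) t z * ξ i * η j := by
    simp only [Finset.mul_sum, Pi.smul_apply, smul_eq_mul, sliceCoef]
    exact Finset.sum_congr rfl fun i _ => Finset.sum_congr rfl fun j _ => by ring
  rw [e1] at h1
  have h3 : dPhi v w z = c • ξ := rfl
  have h4 : slice Q t z = Q ((t, z.1), z.2) := rfl
  have h5 : sliceCoef g none t z = coef g none ((t, z.1), z.2) := rfl
  rw [h3, sub_mul, neg_mul, mul_div_assoc', h1, h2, h4, h5]
  have hxn : z.1 ^ n ≠ 0 := (pow_pos hx n).ne'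
  -- Writing `x^n` as `c c x` replaces the real powers by the single nonzero quantity `c`, which can
  -- then be cancelled.
  simp only [← hc] at hxn ⊢
  have hc0 : c ≠ 0 := (Real.rpow_pos_of_pos hx _).ne'
  field_simp
  ring

lemma wave_source_eq (hn : 2 ≤ n) (hg : IsAAdSPatch n A g) (hbA : b ≤ A)
    (hb : CoefBounds g b C) (hab : a ≤ b) (Q : Pt n → ℝ) (t : ℝ) (f : L2 n a) {z : ℝ × Sph n}
    (hz : z.1 ∈ Ioo 0 a) :
    (-invTT g ((t, z.1), z.2)) * z.1 ^ (((n : ℝ) - 1) / 2) * f z *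
      (z.1 ^ (((n : ℝ) - 1) / 2) * Q ((t, z.1), z.2)) * (volDensity g ((t, z.1), z.2) / z.1) =
    -(sliceCoef g (some (iT n, iT n)) t z * f z * slice Q t z) := by
  have hzb : z.1 ∈ Ioo 0 b := ⟨hz.1, hz.2.trans_le hab⟩
  have hzA : z.1 ∈ Ioo 0 A := ⟨hz.1, hz.2.trans_le (hab.trans hbA)⟩
  have hx := hz.1
  have hc := rpow_half_mul_self n hx
  have h1 := hg.invTT_mul_volDensity hn (p := ((t, z.1), z.2)) hzA (hb.det_ne _ hzb)
  set c := z.1 ^ (((n : ℝ) - 1) / 2) with hcdef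
  have hxn : z.1 ^ n ≠ 0 := (pow_pos hx n).ne'
  have h4 : slice Q t z = Q ((t, z.1), z.2) := rfl
  have h5 : sliceCoef g (some (iT n, iT n)) t z =
    coef g (some (iT n, iT n)) ((t, z.1), z.2) := rfl
  rw [h4, h5]
  calc _ = -(invTT g ((t, z.1), z.2) * volDensity g ((t, z.1), z.2)) * (c * c) * f z *
        Q ((t, z.1), z.2) / z.1 := by ring
    _ = _ := by
      rw [h1]
      simp only [← hc] at hxn ⊢
      have hc0 : c ≠ 0 := (Real.rpow_pos_of_pos hx _).ne'
      field_simp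

section Slices

variable (hn : 2 ≤ n) (hg : IsAAdSPatch n A g) (hbA : b ≤ A) (hb : CoefBounds g b C)
    (hα : 0 < α) (hμ : α ^ 2 = (((n : ℝ) - 1) / 2) ^ 2 + μ) (ha : 0 < a) (hab : a ≤ b) (ha1 : a ≤ 1)
    (hsmall : rateConst n α (((n : ℝ) - 1) / 2) μ * (C * a) ≤ energyLower α)

lemma integral_wave_slice (hn : 2 ≤ n) {Q : Pt n → ℝ} (h : IsSpacetimeTest a T Q) (t : ℝ)
    (v : H10 n α a) (w : L2 n a) :
    ∫ z, (-invMetric g ((t, z.1), z.2) (dPhi v w z)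
        (dPsi (fun p : Pt n => p.1.2 ^ (((n : ℝ) - 1) / 2) * Q p) ((t, z.1), z.2))
      - μ * (z.1 ^ (((n : ℝ) - 1) / 2) * fnOf v z) *
        (z.1 ^ (((n : ℝ) - 1) / 2) * Q ((t, z.1), z.2)))
      * (volDensity g ((t, z.1), z.2) / z.1) ∂(sliceMeasure n a) =
    (waveData hg hbA hb hα hμ ha hab ha1 hsmall).form t v w (testCurve α ha h t)
      (fnOf (testCurve α ha h.dT t)) := by
  have hη : ∀ i, (waveData hg hbA hb hα hμ ha hab ha1 hsmall).grad (testCurve α ha h t)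
      (fnOf (testCurve α ha h.dT t)) i =ᵐ[sliceMeasure n a] fun z =>
        covec (slice (dT Q) t z) (twisted α (slice Q t) z +
          (((n : ℝ) - 1) / 2 - α) / z.1 * slice Q t z) (gradS (slice Q t) z) i := fun i => by
    filter_upwards [grad_ae hg hbA hb hα hμ ha hab ha1 hsmall (testCurve α ha h t)
      (fnOf (testCurve α ha h.dT t)) i, fnOf_testCurve_ae (α := α) ha h t,
      twistOf_testCurve_ae (α := α) ha h t, angularOf_testCurve_ae (α := α) ha h t,
      fnOf_testCurve_ae (α := α) ha h.dT t] with z h1 h2 h3 h4 h5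
    rw [h1, h2, h3, h4, h5]
  have hr : divL n α ha (testCurve α ha h t) =ᵐ[sliceMeasure n a]
      fun z => 1 / z.1 * slice Q t z := by
    filter_upwards [divL_ae hα ha (testCurve α ha h t), fnOf_testCurve_ae (α := α) ha h t]
      with z h1 h2
    rw [h1, h2]
  rw [form_eq_integral hg hbA hb hα hμ ha hab ha1 hsmall t v _ w _
    (grad_ae hg hbA hb hα hμ ha hab ha1 hsmall v w) hη (divL_ae hα ha v) hr]
  refine integral_congr_ae ?_
  filter_upwards [ae_slice_mem] with z hz
  exact wave_integrand_eq hn hg hbA hb hab h μ t v w hz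

lemma integral_source_slice (hn : 2 ≤ n) {Q : Pt n → ℝ} (h : IsSpacetimeTest a T Q) (t : ℝ)
    (f : L2 n a) :
    ∫ z, (-invTT g ((t, z.1), z.2)) * z.1 ^ (((n : ℝ) - 1) / 2) * f z *
      (z.1 ^ (((n : ℝ) - 1) / 2) * Q ((t, z.1), z.2)) *
      (volDensity g ((t, z.1), z.2) / z.1) ∂(sliceMeasure n a) =
    inner ℝ ((waveData hg hbA hb hα hμ ha hab ha1 hsmall).waveSystem.M t f)
      ((waveData hg hbA hb hα hμ ha hab ha1 hsmall).waveSystem.ι (testCurve α ha h t)) := by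
  have h1 : inner ℝ (coefOp g a t (some (iT n, iT n)) f) (fnOf (testCurve α ha h t)) =
      ∫ z, sliceCoef g (some (iT n, iT n)) t z * f z * slice Q t z ∂(sliceMeasure n a) :=
    inner_mulOp (hb.memLp hab _ t) (.refl _ _) (fnOf_testCurve_ae ha h t)
  have h2 : inner ℝ ((waveData hg hbA hb hα hμ ha hab ha1 hsmall).waveSystem.M t f)
      ((waveData hg hbA hb hα hμ ha hab ha1 hsmall).waveSystem.ι (testCurve α ha h t)) =
      -inner ℝ (coefOp g a t (some (iT n, iT n)) f) (fnOf (testCurve α ha h t)) :=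
    inner_neg_left _ _
  rw [h2, h1, ← integral_neg]
  refine integral_congr_ae ?_
  filter_upwards [ae_slice_mem] with z hz
  exact wave_source_eq hn hg hbA hb hab Q t f hz

/-- Test functions are supported away from `x = 0`, where `x^(-β)` is smooth, so no test function is
lost by conjugation. -/
lemma exists_eq_rpow_mul {ψ : Pt n → ℝ} (h : IsSpacetimeTest a T ψ) (β : ℝ) :
    ∃ Q, IsSpacetimeTest a T Q ∧ ψ = fun p => p.1.2 ^ β * Q p := by
  refine ⟨fun p => p.1.2 ^ (-β) * ψ p, h.mul_left (smoothOver_fst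
    (f := fun y : ℝ × ℝ => y.2 ^ (-β)) fun y hy =>
      ((Real.contDiffAt_rpow_const_of_ne hy.1.ne').comp y contDiffAt_snd).contDiffWithinAt), ?_⟩
  obtain ⟨h1, K, hK, hKs, h2⟩ := isSpacetimeTest_iff.1 h
  funext p
  by_cases hp : p.1 ∈ K
  · have hx : 0 < p.1.2 := (hKs hp).2.1
    rw [← mul_assoc, ← Real.rpow_add hx, add_neg_cancel, Real.rpow_zero, one_mul]
  · have : ψ p = 0 := h2 p.1 hp p.2
    beta_reduce
    rw [this, mul_zero, mul_zero]

lemma IsSpacetimeTest.rpow_mul {Q : Pt n → ℝ} (h : IsSpacetimeTest a T Q) (β : ℝ) :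
    IsSpacetimeTest a T fun p => p.1.2 ^ β * Q p :=
  h.mul_left (smoothOver_fst (f := fun y : ℝ × ℝ => y.2 ^ β) fun y hy =>
    ((Real.contDiffAt_rpow_const_of_ne hy.1.ne').comp y contDiffAt_snd).contDiffWithinAt)

/-- This is the bridge between the geometric weak form and the abstract one: slicewise the two
integrands agree, once every test function is written as `x^((n-1)/2) Q`. -/
lemma satisfiesWave_iff (hn : 2 ≤ n) {v : ℝ → H10 n α a} {w F : ℝ → L2 n a}
    (hv : Integrable v (timeMeasure T)) (hw : Integrable w (timeMeasure T))
    (hF : Integrable F (timeMeasure T)) :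
    SatisfiesWave g μ T v w F ↔ ∀ (Q : Pt n → ℝ) (h : IsSpacetimeTest a T Q),
      ∫ t in Ioo (-T) T,
        (inner ℝ ((waveData hg hbA hb hα hμ ha hab ha1 hsmall).waveSystem.momentum t (v t) (w t))
          (testCurve α ha h.dT t) +
        inner ℝ ((waveData hg hbA hb hα hμ ha hab ha1 hsmall).waveSystem.force t (v t) (w t) (F t))
          (testCurve α ha h t)) = 0 := by
  have key : ∀ (Q : Pt n → ℝ) (h : IsSpacetimeTest a T Q), _ := fun Q h =>
    (waveData hg hbA hb hα hμ ha hab ha1 hsmall).integral_form_sub hv hw hF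
      (continuous_testCurve (α := α) ha h) (continuous_testCurve (α := α) ha h.dT)
  have e1 : ∀ (Q : Pt n → ℝ) (h : IsSpacetimeTest a T Q), _ := fun Q h =>
    integral_congr_ae (μ := timeMeasure T) (.of_forall fun t =>
      integral_wave_slice hg hbA hb hα hμ ha hab ha1 hsmall hn h t (v t) (w t))
  have e2 : ∀ (Q : Pt n → ℝ) (h : IsSpacetimeTest a T Q), _ := fun Q h =>
    integral_congr_ae (μ := timeMeasure T) (.of_forall fun t =>
      integral_source_slice hg hbA hb hα hμ ha hab ha1 hsmall hn h t (F t))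
  constructor
  · intro hs Q h
    have h1 := hs _ (h.rpow_mul (((n : ℝ) - 1) / 2))
    refine (key Q h).symm.trans (sub_eq_zero.2 ?_)
    exact (e1 Q h).symm.trans (h1.trans (e2 Q h))
  · intro hs ψ hψ
    obtain ⟨Q, h, rfl⟩ := exists_eq_rpow_mul hψ (((n : ℝ) - 1) / 2)
    have h1 := sub_eq_zero.1 ((key Q h).trans (hs Q h))
    exact (e1 Q h).trans (h1.trans (e2 Q h).symm)

end Slices

end AAdS

namespace AAdS

open scoped InnerProduct

/-! ### Weak solutions and mild solutions -/

variable {n : ℕ} {α a b C T A μ : ℝ} {g : TensorField n}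

lemma CoefBounds.smooth_slice (hb : CoefBounds g b C) (hab : a ≤ b) (c : Option (Idx n × Idx n))
    (t : ℝ) : SmoothOver (Ioo 0 a) (sliceCoef g c t) :=
  (hb.smooth c).comp_fst (f := fun x => (t, x)) (by fun_prop)
    fun x hx => ⟨hx.1, hx.2.trans_le hab⟩

/-- The coefficients are smooth for `0 < x < b`, so multiplication by them preserves test functions.
Symmetric coefficient operators can therefore be moved to the test side. -/
lemma CoefBounds.exists_coefOp_testL2 (hb : CoefBounds g b C) (ha : 0 < a) (hab : a ≤ b)
    (c : Option (Idx n × Idx n)) (t : ℝ) (χ : sliceTests n ha) :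
    ∃ χ' : sliceTests n ha, coefOp g a t c (testL2 χ) = testL2 χ' := by
  refine ⟨mkTest ha ((isSliceTest_coe χ).mul_left ha (hb.smooth_slice hab c t)), Lp.ext ?_⟩
  filter_upwards [mulOp_ae (hb.memLp hab c t) (testL2 χ), testL2_ae χ,
    testL2_ae (mkTest ha ((isSliceTest_coe χ).mul_left ha (hb.smooth_slice hab c t)))]
    with z h1 h2 h3
  rw [h3]
  refine (h1 : _ = _).trans ?_
  rw [h2]
  rfl

lemma isSpacetimeTest_product (ha : 0 < a) {η : ℝ → ℝ} (h1 : ContDiff ℝ ∞ η)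
    (h2 : HasCompactSupport η) (h3 : tsupport η ⊆ Ioo (-T) T) {χ : ℝ × Sph n → ℝ}
    (h : IsSliceTest a χ) : IsSpacetimeTest a T fun p => η p.1.1 * χ (p.1.2, p.2) := by
  obtain ⟨hs, p, q, hp, hq, h0⟩ := (isSliceTest_iff ha).1 h
  refine isSpacetimeTest_iff.2 ⟨SmoothOver.mul
    (smoothOver_fst (f := fun y : ℝ × ℝ => η y.1) (h1.comp contDiff_fst).contDiffOn)
    (hs.comp_fst (f := fun y : ℝ × ℝ => y.2) (by fun_prop) (mapsTo_univ _ _)),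
    tsupport η ×ˢ Icc p q, h2.isCompact.prod isCompact_Icc,
    prod_mono h3 fun x hx => ⟨hp.trans_le hx.1, hx.2.trans_lt hq⟩, fun y hy θ => ?_⟩
  by_cases hy1 : y.1 ∈ tsupport η
  · have : χ (y.2, θ) = 0 := h0 _ (fun hy2 => hy ⟨hy1, hy2⟩) θ
    simp only [this, mul_zero]
  · have : η y.1 = 0 := image_eq_zero_of_notMem_tsupport hy1
    simp only [this, zero_mul]

lemma testCurve_of_slice (ha : 0 < a) {Q : Pt n → ℝ} (h : IsSpacetimeTest a T Q) {t r : ℝ}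
    {χ : sliceTests n ha} (hQ : slice Q t = r • (χ : ℝ × Sph n → ℝ)) :
    testCurve α ha h t = r • testH10 n α ha χ := by
  rw [← map_smul]
  exact congrArg _ (Subtype.ext hQ)

section Solutions

variable (hg : IsAAdSPatch n A g) (hbA : b ≤ A) (hb : CoefBounds g b C)
    (hα : 0 < α) (hμ : α ^ 2 = (((n : ℝ) - 1) / 2) ^ 2 + μ) (ha : 0 < a) (hab : a ≤ b) (ha1 : a ≤ 1)
    (hsmall : rateConst n α (((n : ℝ) - 1) / 2) μ * (C * a) ≤ energyLower α)

/-- The abstract wave equation of an asymptotically AdS patch. -/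
def adsSystem : WaveSystem (H10 n α a) (L2 n a) :=
  (waveData hg hbA hb hα hμ ha hab ha1 hsmall).waveSystem

lemma exists_inner_adsSystem_B_le (χ : sliceTests n ha) :
    ∃ K, ∀ x, |inner ℝ ((adsSystem hg hbA hb hα hμ ha hab ha1 hsmall).B 0 x)
      ((adsSystem hg hbA hb hα hμ ha hab ha1 hsmall).ι (testH10 n α ha χ))| ≤
      K * ‖(adsSystem hg hbA hb hα hμ ha hab ha1 hsmall).ι x‖ := by
  choose χ' hχ' using fun j : Idx n => hb.exists_coefOp_testL2 ha hab (some (iT n, j)) 0 χ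
  choose K hK using fun j : Idx n =>
    exists_inner_gradL hα (((n : ℝ) - 1) / 2) ha j (χ' j)
  refine ⟨∑ j, K j, fun x => ?_⟩
  have e : inner ℝ ((adsSystem hg hbA hb hα hμ ha hab ha1 hsmall).B 0 x)
      ((adsSystem hg hbA hb hα hμ ha hab ha1 hsmall).ι (testH10 n α ha χ)) =
      -∑ j, inner ℝ (coefOp g a 0 (some (iT n, j)) (gradL n α (((n : ℝ) - 1) / 2) ha j x))
        (testL2 χ) :=
    inner_rowOp (V := H10 n α a) (H := L2 n a) _ _ _ _ _
  rw [e, abs_neg, Finset.sum_mul]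
  refine (Finset.abs_sum_le_sum_abs _ _).trans (Finset.sum_le_sum fun j _ => ?_)
  have e2 : inner ℝ (coefOp g a 0 (some (iT n, j)) (gradL n α (((n : ℝ) - 1) / 2) ha j x))
      (testL2 χ) = inner ℝ (gradL n α (((n : ℝ) - 1) / 2) ha j x) (testL2 (χ' j)) := by
    rw [← hχ']
    exact inner_mulOp_comm (hb.memLp hab _ 0) _ _
  rw [e2]
  exact hK j x

/-- For the converse to hold it is enough to test with products `η(t) χ(x, θ)`; density of the
functions `χ` in `𝐇¹₀` does the rest. -/
lemma IsWeakSolution.isMildSolution (hn : 2 ≤ n) (hT : 0 < T) {v₀ : H10 n α a} {v₁ : L2 n a}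
    {F : ℝ → L2 n a} (hF : Integrable F (timeMeasure T)) {v : ℝ → H10 n α a} {w : ℝ → L2 n a}
    (h : IsWeakSolution g μ T v₀ v₁ F v w) :
    (adsSystem hg hbA hb hα hμ ha hab ha1 hsmall).IsMildSolution T v₀ v₁ F v w := by
  have hvi : Integrable v (timeMeasure T) := h.memLp.integrable (by norm_num)
  have hwi : Integrable w (timeMeasure T) := h.memLp_deriv.integrable (by norm_num)
  refine WaveSystem.isMildSolution_of_weak
    (S := adsSystem hg hbA hb hα hμ ha hab ha1 hsmall) hT hF h.memLp h.memLp_deriv h.initial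
    (denseRange_testH10 n α ha) ?_ ?_ ?_
  · rintro η h1 h2 h3 _ ⟨χ, rfl⟩
    have hQ := isSpacetimeTest_product ha h1 h2 h3 (isSliceTest_coe χ)
    have key := (satisfiesWave_iff hg hbA hb hα hμ ha hab ha1 hsmall hn hvi hwi hF).1 h.equation _ hQ
    refine Eq.trans (integral_congr_ae (.of_forall fun t => ?_)) key
    have e1 : testCurve α ha hQ t = η t • testH10 n α ha χ := testCurve_of_slice ha hQ rfl
    have e2 : testCurve α ha hQ.dT t = deriv η t • testH10 n α ha χ := by
      refine testCurve_of_slice ha hQ.dT (funext fun z => ?_)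
      exact (((h1.differentiable (by simp)) t).hasDerivAt.mul_const
        ((χ : ℝ × Sph n → ℝ) (z.1, z.2))).deriv
    simp only [e1, e2]
    exact (congrArg₂ (· + ·) (real_inner_smul_right _ _ _) (real_inner_smul_right _ _ _)).symm
  · rintro _ ⟨χ, rfl⟩
    exact exists_inner_adsSystem_B_le hg hbA hb hα hμ ha hab ha1 hsmall χ
  · rintro _ ⟨χ, rfl⟩
    -- The mass operator at time zero maps `χ` to minus a test function, so the prescribed initial
    -- velocity can be tested with it.
    obtain ⟨χ', hχ'⟩ := hb.exists_coefOp_testL2 ha hab (some (iT n, iT n)) 0 χ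
    have e : (adsSystem hg hbA hb hα hμ ha hab ha1 hsmall).M 0
        ((adsSystem hg hbA hb hα hμ ha hab ha1 hsmall).ι (testH10 n α ha χ)) = -testL2 χ' :=
      congrArg Neg.neg hχ'
    have h1 := (h.initial_deriv _ (isSliceTest_coe χ')).fun_neg
    rw [e]
    have e2 : ∀ u : L2 n a, inner ℝ u (-testL2 χ') =
        -∫ z, u z * (χ' : ℝ × Sph n → ℝ) z ∂(sliceMeasure n a) := fun u => by
      rw [inner_neg_right, inner_eq_integral (.refl _ _) (testL2_ae χ')]
    rw [e2]
    exact h1.congr_of_eventuallyEq (.of_forall fun t => e2 _)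

lemma isWeakSolution_of_isMildSolution (hn : 2 ≤ n) (hT : 0 < T) {v₀ : H10 n α a} {v₁ : L2 n a}
    {F : ℝ → L2 n a} (hF : Integrable F (timeMeasure T)) {v : ℝ → H10 n α a} {w : ℝ → L2 n a}
    (h : (adsSystem hg hbA hb hα hμ ha hab ha1 hsmall).IsMildSolution T v₀ v₁ F v w) {K : ℝ}
    (hK : ∀ᵐ t ∂(timeMeasure T), ‖w t‖ ≤ K) : IsWeakSolution g μ T v₀ v₁ F v w := by
  have hvi : Integrable v (timeMeasure T) := h.memLp.integrable (by norm_num)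
  have hwi : Integrable w (timeMeasure T) := h.memLp_deriv.integrable (by norm_num)
  refine ⟨h.memLp, h.memLp_deriv, h.position, fun χ hχ => ?_, ?_⟩
  · have h1 := h.hasDerivAt_inner hT hF hK (denseRange_testH10 n α ha)
      (by
        rintro _ ⟨χ, rfl⟩
        exact exists_inner_adsSystem_B_le hg hbA hb hα hμ ha hab ha1 hsmall χ)
      (testL2 (mkTest ha hχ))
    have e2 : ∀ u : L2 n a, inner ℝ u (testL2 (mkTest ha hχ)) =
        ∫ z, u z * χ z ∂(sliceMeasure n a) := fun u =>
      inner_eq_integral (.refl _ _) (testL2_ae (mkTest ha hχ))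
    rw [e2] at h1
    exact h1.congr_of_eventuallyEq (.of_forall fun t => (e2 _).symm)
  · refine (satisfiesWave_iff hg hbA hb hα hμ ha hab ha1 hsmall hn hvi hwi hF).2 fun Q hQ => ?_
    exact h.integral_eq_zero hT hF (fun t => hasDerivAt_testCurve ha hQ t)
      (continuous_testCurve ha hQ.dT) (testCurve_eq_zero ha hQ (by simp))
      (testCurve_eq_zero ha hQ (by simp))

end Solutions

/-! ### Comparison of the norms of `𝐇¹₀` and `𝐇¹_a`, uniformly in `a` -/

lemma norm_le_normA (ha : 0 < a) (ha1 : a ≤ 1) (v : H10 n α a) : ‖v‖ ≤ normA v := by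
  refine (norm_le_sum_H10 v).trans ?_
  rw [normA, norm_smul, Real.norm_of_nonneg ha.le, mul_div_assoc, mul_div_cancel₀ _ ha.ne']
  gcongr
  exact le_div_self (norm_nonneg _) ha ha1

lemma normA_nonneg (ha : 0 < a) (v : H10 n α a) : 0 ≤ normA v := by
  unfold normA
  positivity

/-- The term `‖v‖ / a` is bounded uniformly in `a` because the Hardy inequality supplies the factor
`a`. -/
lemma normA_le (hα : 0 < α) (ha : 0 < a) (v : H10 n α a) : normA v ≤ (α⁻¹ + 2) * ‖v‖ := by
  rw [normA, norm_smul, Real.norm_of_nonneg ha.le]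
  have h1 : ‖fnOf v‖ / a ≤ α⁻¹ * ‖v‖ := by
    rw [div_le_iff₀' ha]
    refine (norm_fnOf_le_twistOf hα ha v).trans ?_
    gcongr
    exact norm_twistOf_le v
  have h2 : a * ‖twistOf v‖ / a = ‖twistOf v‖ := by field_simp
  rw [h2]
  linarith [norm_twistOf_le v, norm_angularOf_le v]

lemma eLpNorm_top_le_of_ae_le {Ω E : Type*} [MeasurableSpace Ω] {ν : Measure Ω}
    [NormedAddCommGroup E] {f : Ω → E} {K : ℝ} (h : ∀ᵐ t ∂ν, ‖f t‖ ≤ K) :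
    eLpNorm f ∞ ν ≤ ENNReal.ofReal K := by
  rw [eLpNorm_exponent_top]
  exact eLpNormEssSup_le_of_ae_bound h

end AAdS

end

/-! ### Choice of the constants and conclusion -/

open AAdS in
theorem theoremP (n : ℕ) (hn : 2 ≤ n) (μ : ℝ) (hμ : -(((n : ℝ) - 1) / 2) ^ 2 < μ)
    (A : ℝ) (hA : 0 < A) (g : TensorField n) (hg : IsAAdSPatch n A g) :
    ∃ a₀ : ℝ, 0 < a₀ ∧ a₀ ≤ A ∧ ∃ c : ℝ, 0 < c ∧
      ∀ a : ℝ, 0 < a → a ≤ a₀ → ∀ T : ℝ, 0 < T →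
        ∀ (v₀ : H10 n (alphaOf n μ) a) (v₁ : L2 n a) (F : ℝ → L2 n a),
          IntegrableOn F (Ioo (-T) T) →
          ∃ (v : ℝ → H10 n (alphaOf n μ) a) (w : ℝ → L2 n a),
            IsWeakSolution g μ T v₀ v₁ F v w ∧
            (∀ (v' : ℝ → H10 n (alphaOf n μ) a) (w' : ℝ → L2 n a),
              IsWeakSolution g μ T v₀ v₁ F v' w' →
                v' =ᵐ[volume.restrict (Ioo (-T) T)] v ∧
                w' =ᵐ[volume.restrict (Ioo (-T) T)] w) ∧
            eLpNorm (fun t => normA (v t)) ∞ (volume.restrict (Ioo (-T) T)) +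
                eLpNorm w ∞ (volume.restrict (Ioo (-T) T)) ≤
              ENNReal.ofReal (c * Real.exp (c * a * T) *
                (normA v₀ + ‖v₁‖ + ∫ t in Ioo (-T) T, ‖F t‖)) := by
  have hpos : 0 < (((n : ℝ) - 1) / 2) ^ 2 + μ := by linarith
  have hα : 0 < alphaOf n μ := Real.sqrt_pos.2 hpos
  have hαμ : alphaOf n μ ^ 2 = (((n : ℝ) - 1) / 2) ^ 2 + μ := Real.sq_sqrt hpos.le
  set α := alphaOf n μ with hαdef
  obtain ⟨b, C, hbA, hb1, hb⟩ := hg.exists_coefBounds hA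
  have hC := hb.const_pos
  set R := rateConst n α (((n : ℝ) - 1) / 2) μ with hR
  have hR1 : 1 ≤ R := (formConst_ge (Idx n) μ (by positivity) (by positivity)).1
  set L := energyLower α with hL
  have hL0 : 0 < L := energyLower_pos α
  set E := WaveSystem.energyConst L (2 * R) with hE
  have hE0 : 0 ≤ E := by rw [hE, WaveSystem.energyConst]; positivity
  have hk0 : 0 ≤ R * C / L := by positivity
  -- The second bound on `a` is the smallness condition `R C a ≤ L`. In the constant `c`, the factor
  -- `α⁻¹ + 3` collects `α⁻¹ + 2` for the norm of `v` and `1` for that of `w`. The summand `R C / L`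
  -- covers the exponent, and the last summand makes `c` positive.
  refine ⟨min b (L / (R * C)), lt_min hb.pos (by positivity), (min_le_left _ _).trans hbA,
    (α⁻¹ + 3) * E + R * C / L + 1, by positivity, ?_⟩
  intro a ha haa T hT v₀ v₁ F hF
  have hab : a ≤ b := haa.trans (min_le_left _ _)
  have ha1 : a ≤ 1 := hab.trans hb1
  have hsmall : R * (C * a) ≤ L := by
    have := haa.trans (min_le_right _ _)
    rw [le_div_iff₀ (by positivity)] at this
    linarith
  obtain ⟨v, w, h, hv, hw⟩ := (adsSystem hg hbA hb hα hαμ ha hab ha1 hsmall).exists_isMildSolution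
    hT v₀ v₁ hF rfl
  have hweak := isWeakSolution_of_isMildSolution hg hbA hb hα hαμ ha hab ha1 hsmall hn hT hF h hw
  refine ⟨v, w, hweak, fun v' w' h' => ?_, ?_⟩
  · exact ((h'.isMildSolution hg hbA hb hα hαμ ha hab ha1 hsmall hn hT hF).unique hT hF h)
  · set I := ∫ t in Ioo (-T) T, ‖F t‖ with hI
    have hI0 : 0 ≤ I := integral_nonneg fun _ => norm_nonneg _
    -- The growth rate is `rate / lower = R (C a) / L`, proportional to `a` because the time
    -- derivatives of the coefficients are of size `C a`. The bounds `L` and `2 R` do not involve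
    -- `a`.
    have eK : WaveSystem.energyConst (adsSystem hg hbA hb hα hαμ ha hab ha1 hsmall).lower
        (adsSystem hg hbA hb hα hαμ ha hab ha1 hsmall).upper *
        Real.exp ((adsSystem hg hbA hb hα hαμ ha hab ha1 hsmall).rate /
          (adsSystem hg hbA hb hα hαμ ha hab ha1 hsmall).lower * T) *
        (‖v₀‖ + ‖v₁‖ + ∫ t, ‖F t‖ ∂(timeMeasure T)) =
        E * Real.exp (R * C / L * a * T) * (‖v₀‖ + ‖v₁‖ + I) := by
      have : R * C / L * a * T = R * (C * a) / L * T := by ring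
      rw [this]
      rfl
    rw [eK] at hv hw
    set K := E * Real.exp (R * C / L * a * T) * (‖v₀‖ + ‖v₁‖ + I) with hKdef
    have hK0 : 0 ≤ K := by positivity
    have b1 : eLpNorm (fun t => normA (v t)) ∞ (timeMeasure T) ≤
        ENNReal.ofReal ((α⁻¹ + 2) * K) := eLpNorm_top_le_of_ae_le (hv.mono fun t ht => by
      rw [Real.norm_of_nonneg (normA_nonneg ha _)]
      exact (normA_le hα ha _).trans (by gcongr))
    have b2 := eLpNorm_top_le_of_ae_le hw
    refine (add_le_add b1 b2).trans ?_
    rw [← ENNReal.ofReal_add (by positivity) hK0]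
    refine ENNReal.ofReal_le_ofReal ?_
    have hα0 : 0 ≤ (α⁻¹ + 3) * E := by positivity
    calc (α⁻¹ + 2) * K + K = ((α⁻¹ + 3) * E) * Real.exp (R * C / L * a * T) *
          (‖v₀‖ + ‖v₁‖ + I) := by rw [hKdef]; ring
      _ ≤ _ := by
        gcongr
        · linarith
        · linarith
        · exact norm_le_normA ha ha1 v₀
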